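/- **Setting.** Let $R$ be a commutative ring with $1$, $A$ a commutative $R$-algebra, and $H$, $Q$ two $A$-modules. An *almost pre-Lie-Rinehart triple* $(A,H,Q)$ consists of alternating $R$-bilinear brackets $[\cdot,\cdot]_H$ on $H$ and $[\cdot,\cdot]_Q$ on $Q$; $A$-linear maps $H\to\mathrm{Der}_R(A)$, $x\mapsto(a\mapsto x(a))$, and $Q\to\mathrm{Der}_R(A)$, $\xi\mapsto(a\mapsto\xi(a))$; $R$-bilinear operations $H\times Q\to Q$, $(x,\xi)\mapsto x\cdot\xi$, and $Q\times H\to H$, $(\xi,x)\mapsto\xi\cdot x$, which are $A$-linear in the first variable; and an alternating $A$-bilinear map $\delta\colon Q\times Q\to H$; such that $[x,ay]_H=x(a)y+a[x,y]_H$, $[\xi,a\eta]_Q=\xi(a)\eta+a[\xi,\eta]_Q$, $x\cdot(a\xi)=x(a)\xi+a(x\cdot\xi)$ and $\xi\cdot(ax)=\xi(a)x+a(\xi\cdot x)$ for all $a\in A$, $x,y\in H$, $\xi,\eta\in Q$. It is a *Lie-Rinehart triple* if $L=H\oplus Q$, with the bracket $$[(x,\xi),(y,\eta)]=\bigl([x,y]_H+\delta(\xi,\eta)-\eta\cdot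 x+\xi\cdot y,\ [\xi,\eta]_Q+x\cdot\eta-y\cdot\xi\bigr)$$ and the action $(x,\xi)(a)=x(a)+\xi(a)$ on $A$, is a Lie-Rinehart algebra, i.e. the bracket satisfies the Jacobi identity and $L$ acts on $A$ as a Lie algebra. It is *orientable* if $Q$ is finitely generated projective of some constant rank $n$ and there is an isomorphism of $A$-modules $\omega\colon\Lambda^n_AQ\to A$ invariant under $H$, i.e. $x(\omega(\xi_1\wedge\dots\wedge\xi_n))=\sum_j\omega(\xi_1\wedge\dots\wedge x\cdot\xi_j\wedge\dots\wedge\xi_n)$. **The bigraded algebra.** Let $\mathcal G=\mathrm{Alt}_A(H,\Lambda_AQ)$, with $\mathcal G^q_p=\mathrm{Alt}^q_A(H,\Lambda^p_AQ)$ (alternating $A$-multilinear $q$-forms on $H$) in bidegree $(q,p)$ and total degree $|f|=p-q$ for $f\in\mathcal G^q_p$, and let $\mathcal A=\mathrm{Alt}_A(H,A)=\mathcal G^*_0$. For $f\in\mathcal G^q_p$, $g\in\mathcal G^{q'}_{p'}$ the product is $$(fg)(x_1,\dots,x_{q+q'})=(-1)^{q(p'-q')}\sum_{\sigma}\mathrm{sign}(\sigma)\,f(x_{\sigma1},\dots,x_{\sigma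 q})\wedge g(x_{\sigma(q+1)},\dots,x_{\sigma(q+q')}),$$ the sum being over the $(q,q')$-shuffles. **The operations.** (1) $d$ is the Lie-Rinehart differential: for $f\in\mathcal G^q_p$, $$(-1)^{|f|+1}(df)(x_0,\dots,x_q)=\sum_{i}(-1)^i\,x_i\bigl(f(x_0,\dots,\widehat{x_i},\dots,x_q)\bigr)+\sum_{j<k}(-1)^{j+k}f([x_j,x_k]_H,x_0,\dots,\widehat{x_j},\dots,\widehat{x_k},\dots,x_q),$$ where $x\in H$ acts on $\Lambda_AQ$ by the derivation that is $a\mapsto x(a)$ on $A$ and $\xi\mapsto x\cdot\xi$ on $Q$. (2) $[\cdot,\cdot]$ is the $R$-bilinear bracket of bidegree $(0,-1)$ on $\mathcal G$ determined by $$[\alpha\beta,\gamma]=\alpha[\beta,\gamma]+(-1)^{|\alpha||\beta|}\beta[\alpha,\gamma],\qquad[\alpha,\beta]=-(-1)^{(|\alpha|-1)(|\beta|-1)}[\beta,\alpha]$$ for homogeneous $\alpha,\beta,\gamma\in\mathcal G$, together with $[\xi,\eta]=[\xi,\eta]_Q$ for $\xi,\eta\in Q$ and $[\xi,\alpha]=\xi(\alpha)$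 for $\xi\in Q$, $\alpha\in\mathrm{Alt}^q_A(H,A)$, where $\xi(\alpha)(x_1,\dots,x_q)=\xi(\alpha(x_1,\dots,x_q))-\sum_j\alpha(x_1,\dots,\xi\cdot x_j,\dots,x_q)$. (3) $\Psi$ is the $R$-linear operator of bidegree $(-1,-2)$ on $\mathcal G$ determined by $$\Psi(\beta\,\xi_1\wedge\dots\wedge\xi_p)=\sum_{1\le j<k\le p}(-1)^{j+k}\langle\xi_j,\xi_k;\beta\rangle\ \xi_1\wedge\dots\widehat{\xi_j}\dots\widehat{\xi_k}\dots\wedge\xi_p\qquad(\beta\in\mathcal A,\ \xi_i\in Q),$$ where $\langle\xi,\eta;\beta\rangle(x_1,\dots,x_{q-1})=\beta(x_1,\dots,x_{q-1},\delta(\xi,\eta))$ for $\beta\in\mathrm{Alt}^q_A(H,A)$, $q\ge1$. **Quasi-Gerstenhaber algebras.** For an $R$-linear operator $D$ on a bigraded commutative algebra $\mathcal G$ and homogeneous $x,y,z,w$ let $$\begin{aligned}\Phi^3_D(x,y,z)={}&D(xyz)-D(xy)z-(-1)^{|x|(|y|+|z|)}D(yz)x-(-1)^{|z|(|x|+|y|)}D(zx)y\\&+D(x)yz+(-1)^{|x|(|y|+|z|)}D(y)zx+(-1)^{|z|(|x|+|y|)}D(z)xy-D(1)xyz,\end{aligned}$$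 $$\Phi^4_D(x,y,z,w)=\Phi^3_D(x,y,zw)-\Phi^3_D(x,y,z)w-(-1)^{|z||w|}\Phi^3_D(x,y,w)z;$$ $D$ is a *differential operator of order $\le3$* if $\Phi^4_D=0$. A *quasi-Gerstenhaber algebra* $(\mathcal G;d,[\cdot,\cdot],\Psi)$ is a bigraded $R$-algebra $\mathcal G=\bigoplus_{q,p\ge0}\mathcal G^q_p$, associative with $1$ and graded commutative for the total degree $p-q$, with an $R$-bilinear bracket of bidegree $(0,-1)$, a differential $d$ ($dd=0$) of bidegree $(1,0)$ with $d(xy)=(dx)y+(-1)^{|x|}x\,dy$, and a $\mathcal G^0_0$-linear differential operator $\Psi$ of order $\le3$ and bidegree $(-1,-2)$ with $\Psi(1)=0$, such that, for all homogeneous elements, (i) $[x,y]=-(-1)^{(|x|-1)(|y|-1)}[y,x]$; (ii) $[x,yz]=[x,y]z+(-1)^{(|x|-1)|y|}y[x,z]$; (iii) $d[x,y]=[dx,y]-(-1)^{|x|}[x,dy]$; (iv) $\displaystyle\sum_{(x,y,z)\text{ cyclic}}(-1)^{(|x|-1)(|z|-1)}[x,[y,z]]=(-1)^{|x||z|+|x|+|y|+|z|}\,\Phi^3_{d\Psi+\Psi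 d}(x,y,z)$; (v) $\Psi\Psi=0$; (vi) for all homogeneous $a_1,a_2,a_3,a_4$, $$\sum_{\sigma}\varepsilon(\mathbf a,\sigma)(-1)^{|a_{\sigma1}|+|a_{\sigma2}|+|a_{\sigma3}|}[\Phi^3_\Psi(a_{\sigma1},a_{\sigma2},a_{\sigma3}),a_{\sigma4}]=\sum_{\tau}\varepsilon(\mathbf a,\tau)(-1)^{|a_{\tau1}|}\Phi^3_\Psi([a_{\tau1},a_{\tau2}],a_{\tau3},a_{\tau4}),$$ where $\sigma$ runs through the $(3,1)$-shuffles, $\tau$ through the $(2,2)$-shuffles, and the sign $\varepsilon(\mathbf a,\sigma)$ is the Eilenberg-Koszul sign, defined by $a_1a_2a_3a_4=\varepsilon(\mathbf a,\sigma)\,a_{\sigma1}a_{\sigma2}a_{\sigma3}a_{\sigma4}$ in the free graded commutative algebra. **Corollary.** Let $(A,H,Q)$ be an orientable Lie-Rinehart triple. Then there are exactly one operator $d$ as in (1), exactly one bracket $[\cdot,\cdot]$ as in (2) and exactly one operator $\Psi$ as in (3) on $\mathcal G=\mathrm{Alt}_A(H,\Lambda_AQ)$, and $(\mathcal G;d,[\cdot,\cdot],\Psi)$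 is a quasi-Gerstenhaber algebra. -/

import Mathlib

noncomputable section

/-! ### Bigraded algebras and quasi-Gerstenhaber algebras -/

/-- The raw data of a bigraded `R`-algebra on an `R`-module `V`: the homogeneous components
`gr q p` (cohomology degree `q`, written as a superscript, and homology degree `p`, written as a
subscript), a bilinear product and a unit. -/
structure BigradedAlgebraData (R V : Type*) [CommRing R] [AddCommGroup V] [Module R V] where
  gr : ℤ → ℤ → Submodule R V
  mul : V →ₗ[R] V →ₗ[R] V
  one : V

namespace BigradedAlgebraData

variable {R V : Type*} [CommRing R] [AddCommGroup V] [Module R V]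

/-- `G` is a bigraded commutative `R`-algebra with `1`, zero in negative degrees; the total degree
of an element of `gr q p` is `p - q`, and commutativity refers to the total degree. -/
structure IsBigradedCommutative (G : BigradedAlgebraData R V) : Prop where
  isInternal : DirectSum.IsInternal (fun i : ℤ × ℤ => G.gr i.1 i.2)
  gr_eq_bot : ∀ q p : ℤ, q < 0 ∨ p < 0 → G.gr q p = ⊥
  one_mem : G.one ∈ G.gr 0 0
  mul_mem : ∀ {q p q' p' : ℤ} {a b : V}, a ∈ G.gr q p → b ∈ G.gr q' p' →
    G.mul a b ∈ G.gr (q + q') (p + p')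
  one_mul : ∀ a, G.mul G.one a = a
  mul_one : ∀ a, G.mul a G.one = a
  mul_assoc : ∀ a b c, G.mul (G.mul a b) c = G.mul a (G.mul b c)
  mul_comm : ∀ {q p q' p' : ℤ} {a b : V}, a ∈ G.gr q p → b ∈ G.gr q' p' →
    G.mul a b = ((p - q) * (p' - q')).negOnePow • G.mul b a

/-- Koszul's form `Φ³` of an endomorphism `D`, evaluated at elements `x`, `y`, `z` of total degrees
`i`, `j`, `k`. -/
def koszulForm₃ (G : BigradedAlgebraData R V) (D : V →ₗ[R] V) (i j k : ℤ) (x y z : V) : V :=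
  D (G.mul (G.mul x y) z)
    - G.mul (D (G.mul x y)) z
    - (i * (j + k)).negOnePow • G.mul (D (G.mul y z)) x
    - (k * (i + j)).negOnePow • G.mul (D (G.mul z x)) y
    + G.mul (G.mul (D x) y) z
    + (i * (j + k)).negOnePow • G.mul (G.mul (D y) z) x
    + (k * (i + j)).negOnePow • G.mul (G.mul (D z) x) y
    - G.mul (G.mul (G.mul (D G.one) x) y) z

/-- Koszul's form `Φ⁴`, obtained from `Φ³` by Koszul's recursion
`Φ⁴(x,y,z,w) = Φ³(x,y,zw) - Φ³(x,y,z)w - (-1)^{|z||w|} Φ³(x,y,w)z`. -/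
def koszulForm₄ (G : BigradedAlgebraData R V) (D : V →ₗ[R] V) (i j k l : ℤ) (x y z w : V) : V :=
  G.koszulForm₃ D i j (k + l) x y (G.mul z w)
    - G.mul (G.koszulForm₃ D i j k x y z) w
    - (k * l).negOnePow • G.mul (G.koszulForm₃ D i j l x y w) z

/-- `D` is a differential operator of order `≤ 3`: the form `Φ⁴` vanishes on homogeneous
elements. -/
def IsDiffOpOrderLEThree (G : BigradedAlgebraData R V) (D : V →ₗ[R] V) : Prop :=
  ∀ {q₁ p₁ q₂ p₂ q₃ p₃ q₄ p₄ : ℤ} {x y z w : V},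
    x ∈ G.gr q₁ p₁ → y ∈ G.gr q₂ p₂ → z ∈ G.gr q₃ p₃ → w ∈ G.gr q₄ p₄ →
    G.koszulForm₄ D (p₁ - q₁) (p₂ - q₂) (p₃ - q₃) (p₄ - q₄) x y z w = 0

/-- The Eilenberg-Koszul sign `ε(a, σ)`, defined by `a₁ ⋯ aₘ = ε(a, σ) a_{σ 1} ⋯ a_{σ m}`, for
elements of total degrees `deg i`. -/
def koszulSign {m : ℕ} (deg : Fin m → ℤ) (σ : Equiv.Perm (Fin m)) : ℤˣ :=
  ∏ ij : Fin m × Fin m with ij.1 < ij.2 ∧ σ ij.2 < σ ij.1,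
    (deg (σ ij.1) * deg (σ ij.2)).negOnePow

/-- `(G; d, [·,·], Ψ)` is a quasi-Gerstenhaber algebra. -/
structure IsQuasiGerstenhaber (G : BigradedAlgebraData R V) (d : V →ₗ[R] V)
    (br : V →ₗ[R] V →ₗ[R] V) (Ψ : V →ₗ[R] V) : Prop extends G.IsBigradedCommutative where
  /-- the bracket has bidegree `(0, -1)` -/
  br_mem : ∀ {q p q' p' : ℤ} {a b : V}, a ∈ G.gr q p → b ∈ G.gr q' p' →
    br a b ∈ G.gr (q + q') (p + p' - 1)
  /-- `d` is a differential of bidegree `(1, 0)` and a derivation of the product -/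
  d_mem : ∀ {q p : ℤ} {a : V}, a ∈ G.gr q p → d a ∈ G.gr (q + 1) p
  d_d : ∀ a, d (d a) = 0
  d_mul : ∀ {q p : ℤ} {a : V} (b : V), a ∈ G.gr q p →
    d (G.mul a b) = G.mul (d a) b + (p - q).negOnePow • G.mul a (d b)
  /-- `Ψ` has bidegree `(-1, -2)`, kills `1`, is linear over the degree `(0, 0)` part and is a
  differential operator of order `≤ 3` -/
  psi_mem : ∀ {q p : ℤ} {a : V}, a ∈ G.gr q p → Ψ a ∈ G.gr (q - 1) (p - 2)
  psi_one : Ψ G.one = 0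
  psi_linear : ∀ {a : V} (b : V), a ∈ G.gr 0 0 → Ψ (G.mul a b) = G.mul a (Ψ b)
  psi_order : G.IsDiffOpOrderLEThree Ψ
  /-- graded skew-symmetry -/
  br_skew : ∀ {q p q' p' : ℤ} {a b : V}, a ∈ G.gr q p → b ∈ G.gr q' p' →
    br a b = -((p - q - 1) * (p' - q' - 1)).negOnePow • br b a
  /-- the bracket is a derivation in the second variable -/
  br_mul : ∀ {q p q' p' : ℤ} {a b : V} (c : V), a ∈ G.gr q p → b ∈ G.gr q' p' →
    br a (G.mul b c) =
      G.mul (br a b) c + ((p - q - 1) * (p' - q')).negOnePow • G.mul b (br a c)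
  /-- `d` is a derivation for the bracket -/
  d_br : ∀ {q p : ℤ} {a : V} (b : V), a ∈ G.gr q p →
    d (br a b) = br (d a) b - (p - q).negOnePow • br a (d b)
  /-- `Ψ` controls the failure of the graded Jacobi identity -/
  jacobi : ∀ {q₁ p₁ q₂ p₂ q₃ p₃ : ℤ} {x y z : V},
    x ∈ G.gr q₁ p₁ → y ∈ G.gr q₂ p₂ → z ∈ G.gr q₃ p₃ →
    ((p₁ - q₁ - 1) * (p₃ - q₃ - 1)).negOnePow • br x (br y z)
      + ((p₂ - q₂ - 1) * (p₁ - q₁ - 1)).negOnePow • br y (br z x)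
      + ((p₃ - q₃ - 1) * (p₂ - q₂ - 1)).negOnePow • br z (br x y)
    = ((p₁ - q₁) * (p₃ - q₃) + (p₁ - q₁) + (p₂ - q₂) + (p₃ - q₃)).negOnePow •
        G.koszulForm₃ (d ∘ₗ Ψ + Ψ ∘ₗ d) (p₁ - q₁) (p₂ - q₂) (p₃ - q₃) x y z
  psi_psi : ∀ a, Ψ (Ψ a) = 0
  /-- compatibility of the bracket with `Ψ`; the sums run over the `(3,1)`-shuffles and the
  `(2,2)`-shuffles -/
  br_psi : ∀ (q p : Fin 4 → ℤ) (a : Fin 4 → V), (∀ i, a i ∈ G.gr (q i) (p i)) →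
    let e : Fin 4 → ℤ := fun i => p i - q i
    ∑ σ : Equiv.Perm (Fin 4) with σ 0 < σ 1 ∧ σ 1 < σ 2,
      (koszulSign e σ * (e (σ 0) + e (σ 1) + e (σ 2)).negOnePow) •
        br (G.koszulForm₃ Ψ (e (σ 0)) (e (σ 1)) (e (σ 2)) (a (σ 0)) (a (σ 1)) (a (σ 2))) (a (σ 3))
    = ∑ τ : Equiv.Perm (Fin 4) with τ 0 < τ 1 ∧ τ 2 < τ 3,
      (koszulSign e τ * (e (τ 0)).negOnePow) •
        G.koszulForm₃ Ψ (e (τ 0) + e (τ 1) - 1) (e (τ 2)) (e (τ 3))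
          (br (a (τ 0)) (a (τ 1))) (a (τ 2)) (a (τ 3))

end BigradedAlgebraData

/-! ### Lie-Rinehart triples -/

/-- An almost pre-Lie-Rinehart triple `(A, H, Q)` over `R`. That `H` and `Q` act on `A` by
`R`-linear derivations, and the `A`-linearity of `anchorH`, `anchorQ`, `actHQ`, `actQH` in the first
variable and of `δ` in both, are part of the types. -/
structure AlmostPreLieRinehartTriple (R A H Q : Type*) [CommRing R] [CommRing A] [Algebra R A]
    [AddCommGroup H] [Module R H] [Module A H] [IsScalarTower R A H]
    [AddCommGroup Q] [Module R Q] [Module A Q] [IsScalarTower R A Q] where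
  /-- the bracket `[·,·]_H` -/
  brH : H →ₗ[R] H →ₗ[R] H
  /-- the bracket `[·,·]_Q` -/
  brQ : Q →ₗ[R] Q →ₗ[R] Q
  /-- the operation `(x, a) ↦ x(a)` -/
  anchorH : H →ₗ[A] Derivation R A A
  /-- the operation `(ξ, a) ↦ ξ(a)` -/
  anchorQ : Q →ₗ[A] Derivation R A A
  /-- the operation `(x, ξ) ↦ x · ξ` -/
  actHQ : H →ₗ[A] Q →ₗ[R] Q
  /-- the operation `(ξ, x) ↦ ξ · x` -/
  actQH : Q →ₗ[A] H →ₗ[R] H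
  /-- the pairing `δ` -/
  δ : Q →ₗ[A] Q →ₗ[A] H
  brH_self : ∀ x, brH x x = 0
  brQ_self : ∀ ξ, brQ ξ ξ = 0
  δ_self : ∀ ξ, δ ξ ξ = 0
  brH_smul : ∀ (x : H) (a : A) (y : H), brH x (a • y) = anchorH x a • y + a • brH x y
  brQ_smul : ∀ (ξ : Q) (a : A) (η : Q), brQ ξ (a • η) = anchorQ ξ a • η + a • brQ ξ η
  actHQ_smul : ∀ (x : H) (a : A) (ξ : Q), actHQ x (a • ξ) = anchorH x a • ξ + a • actHQ x ξ
  actQH_smul : ∀ (ξ : Q) (a : A) (x : H), actQH ξ (a • x) = anchorQ ξ a • x + a • actQH ξ x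

section

variable {R A H Q : Type*} [CommRing R] [CommRing A] [Algebra R A]
    [AddCommGroup H] [Module R H] [Module A H] [IsScalarTower R A H]
    [AddCommGroup Q] [Module R Q] [Module A Q] [IsScalarTower R A Q]

/-- The bracket on `L = H ⊕ Q`. -/
def AlmostPreLieRinehartTriple.brL (T : AlmostPreLieRinehartTriple R A H Q) (u v : H × Q) : H × Q :=
  (T.brH u.1 v.1 + T.δ u.2 v.2 - T.actQH v.2 u.1 + T.actQH u.2 v.1,
    T.brQ u.2 v.2 + T.actHQ u.1 v.2 - T.actHQ v.1 u.2)

/-- The action of `L = H ⊕ Q` on `A`. -/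
def AlmostPreLieRinehartTriple.anchorL (T : AlmostPreLieRinehartTriple R A H Q) (u : H × Q) :
    Derivation R A A :=
  T.anchorH u.1 + T.anchorQ u.2

end

/-- A Lie-Rinehart triple: an almost pre-Lie-Rinehart triple such that the bracket on `L = H ⊕ Q`
and the action of `L` on `A` turn `(A, L)` into a Lie-Rinehart algebra, i.e. the bracket satisfies
the Jacobi identity and `L` acts on `A` as a Lie algebra (skew-symmetry, `A`-linearity of the
action and the Leibniz rule hold already in an almost pre-Lie-Rinehart triple). -/
structure LieRinehartTriple (R A H Q : Type*) [CommRing R] [CommRing A] [Algebra R A]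
    [AddCommGroup H] [Module R H] [Module A H] [IsScalarTower R A H]
    [AddCommGroup Q] [Module R Q] [Module A Q] [IsScalarTower R A Q]
    extends AlmostPreLieRinehartTriple R A H Q where
  jacobi : ∀ u v w : H × Q,
    toAlmostPreLieRinehartTriple.brL u (toAlmostPreLieRinehartTriple.brL v w)
      + toAlmostPreLieRinehartTriple.brL v (toAlmostPreLieRinehartTriple.brL w u)
      + toAlmostPreLieRinehartTriple.brL w (toAlmostPreLieRinehartTriple.brL u v) = 0
  anchor_brL : ∀ (u v : H × Q) (a : A),
    toAlmostPreLieRinehartTriple.anchorL (toAlmostPreLieRinehartTriple.brL u v) a =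
      toAlmostPreLieRinehartTriple.anchorL u (toAlmostPreLieRinehartTriple.anchorL v a)
        - toAlmostPreLieRinehartTriple.anchorL v (toAlmostPreLieRinehartTriple.anchorL u a)

/-! ### Extending a connection to the exterior algebra -/

section ExteriorDerivation

variable {R A : Type*} [CommRing R] [CommRing A] [Algebra R A]

/-- The dual numbers over the exterior algebra; they carry the `A`-algebra structure
`a ↦ a + D(a) ε`. -/
def TwistedDual (_D : Derivation R A A) (Q : Type*) [AddCommGroup Q] [Module A Q] : Type _ :=
  DualNumber (ExteriorAlgebra A Q)

variable {Q : Type*} [AddCommGroup Q] [Module A Q]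

instance (D : Derivation R A A) : Ring (TwistedDual D Q) :=
  inferInstanceAs (Ring (DualNumber (ExteriorAlgebra A Q)))

/-- The ring homomorphism `a ↦ a + D(a) ε`. -/
def twistedScalar (D : Derivation R A A) (Q : Type*) [AddCommGroup Q] [Module A Q] :
    A →+* TwistedDual D Q where
  toFun a := ((algebraMap A _ a, algebraMap A _ (D a)) : DualNumber (ExteriorAlgebra A Q))
  map_one' := TrivSqZeroExt.ext (map_one (algebraMap A (ExteriorAlgebra A Q)))
    ((congrArg _ D.map_one_eq_zero).trans (map_zero (algebraMap A (ExteriorAlgebra A Q))))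
  map_zero' := TrivSqZeroExt.ext (map_zero (algebraMap A (ExteriorAlgebra A Q)))
    ((congrArg _ (map_zero D)).trans (map_zero (algebraMap A (ExteriorAlgebra A Q))))
  map_add' a b := TrivSqZeroExt.ext (map_add _ _ _)
    ((congrArg _ (map_add D a b)).trans (map_add _ _ _))
  map_mul' a b := by
    refine TrivSqZeroExt.ext (map_mul _ _ _) ?_
    change algebraMap A (ExteriorAlgebra A Q) (D (a * b)) =
      algebraMap A (ExteriorAlgebra A Q) a * algebraMap A (ExteriorAlgebra A Q) (D b) +
        algebraMap A (ExteriorAlgebra A Q) (D a) * algebraMap A (ExteriorAlgebra A Q) b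
    rw [Derivation.leibniz, smul_eq_mul, smul_eq_mul, map_add, map_mul, map_mul,
      Algebra.commutes b]

instance (D : Derivation R A A) : Algebra A (TwistedDual D Q) :=
  RingHom.toAlgebra' (twistedScalar D Q) fun a z => by
    obtain ⟨u, v⟩ : DualNumber (ExteriorAlgebra A Q) := z
    refine TrivSqZeroExt.ext (Algebra.commutes a u) ?_
    change algebraMap A _ a * v + algebraMap A _ (D a) * u =
      u * algebraMap A _ (D a) + v * algebraMap A _ a
    rw [Algebra.commutes a v, Algebra.commutes (D a) u, add_comm]

theorem TwistedDual.smul_def (D : Derivation R A A) (a : A) (u v : ExteriorAlgebra A Q) :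
    a • (show TwistedDual D Q from ((u, v) : DualNumber (ExteriorAlgebra A Q))) =
      ((a • u, a • v + D a • u) : DualNumber (ExteriorAlgebra A Q)) := by
  refine TrivSqZeroExt.ext (Algebra.smul_def a u).symm ?_
  change algebraMap A _ a * v + algebraMap A _ (D a) * u = a • v + D a • u
  rw [Algebra.smul_def, Algebra.smul_def]

/-- The coefficient of `1`. -/
def TwistedDual.fst {D : Derivation R A A} (z : TwistedDual D Q) : ExteriorAlgebra A Q :=
  TrivSqZeroExt.fst (R := ExteriorAlgebra A Q) (M := ExteriorAlgebra A Q) z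

/-- The coefficient of `ε`. -/
def TwistedDual.snd {D : Derivation R A A} (z : TwistedDual D Q) : ExteriorAlgebra A Q :=
  TrivSqZeroExt.snd (R := ExteriorAlgebra A Q) (M := ExteriorAlgebra A Q) z

variable [Module R Q]

/-- The `A`-linear map `ξ ↦ ξ + φ(ξ) ε`. -/
def twistedIota (D : Derivation R A A) (φ : Q →ₗ[R] Q)
    (h : ∀ (a : A) (ξ : Q), φ (a • ξ) = D a • ξ + a • φ ξ) : Q →ₗ[A] TwistedDual D Q where
  toFun ξ := ((ExteriorAlgebra.ι A ξ, ExteriorAlgebra.ι A (φ ξ)) :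
    DualNumber (ExteriorAlgebra A Q))
  map_add' ξ η := TrivSqZeroExt.ext (map_add _ _ _)
    ((congrArg _ (map_add φ ξ η)).trans (map_add _ _ _))
  map_smul' a ξ := by
    rw [RingHom.id_apply, TwistedDual.smul_def]
    refine TrivSqZeroExt.ext (map_smul _ _ _) ?_
    change ExteriorAlgebra.ι A (φ (a • ξ)) = _
    rw [h, map_add, map_smul, map_smul, add_comm]
    rfl

/-- The algebra homomorphism `u ↦ u + D(u) ε` on the exterior algebra. -/
def twistedHom (D : Derivation R A A) (φ : Q →ₗ[R] Q)
    (h : ∀ (a : A) (ξ : Q), φ (a • ξ) = D a • ξ + a • φ ξ) :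
    ExteriorAlgebra A Q →ₐ[A] TwistedDual D Q :=
  ExteriorAlgebra.lift A ⟨twistedIota D φ h, fun ξ => by
    refine TrivSqZeroExt.ext (ExteriorAlgebra.ι_sq_zero ξ) ?_
    exact ExteriorAlgebra.ι_add_mul_swap ξ (φ ξ)⟩

theorem twistedHom_ι (D : Derivation R A A) (φ : Q →ₗ[R] Q)
    (h : ∀ (a : A) (ξ : Q), φ (a • ξ) = D a • ξ + a • φ ξ) (ξ : Q) :
    twistedHom D φ h (ExteriorAlgebra.ι A ξ) = twistedIota D φ h ξ :=
  ExteriorAlgebra.lift_ι_apply A _ _ ξ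

theorem twistedHom_fst (D : Derivation R A A) (φ : Q →ₗ[R] Q)
    (h : ∀ (a : A) (ξ : Q), φ (a • ξ) = D a • ξ + a • φ ξ) (u : ExteriorAlgebra A Q) :
    (twistedHom D φ h u).fst = u := by
  induction u using ExteriorAlgebra.induction with
  | algebraMap a => rw [AlgHom.commutes]; rfl
  | ι ξ => rw [twistedHom_ι]; rfl
  | mul u v hu hv =>
    rw [map_mul]
    exact congrArg₂ (fun s t : ExteriorAlgebra A Q => s * t) hu hv
  | add u v hu hv =>
    rw [map_add]
    exact congrArg₂ (fun s t : ExteriorAlgebra A Q => s + t) hu hv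

/-- The unique derivation of the exterior algebra that extends a derivation `D` of `A` and an
operator `φ` on `Q` which behaves over `D` like a covariant derivative. -/
def extDerivation (D : Derivation R A A) (φ : Q →ₗ[R] Q)
    (h : ∀ (a : A) (ξ : Q), φ (a • ξ) = D a • ξ + a • φ ξ) (u : ExteriorAlgebra A Q) :
    ExteriorAlgebra A Q :=
  (twistedHom D φ h u).snd

theorem extDerivation_algebraMap (D : Derivation R A A) (φ : Q →ₗ[R] Q)
    (h : ∀ (a : A) (ξ : Q), φ (a • ξ) = D a • ξ + a • φ ξ) (a : A) :
    extDerivation D φ h (algebraMap A _ a) = algebraMap A _ (D a) := by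
  rw [extDerivation, AlgHom.commutes]; rfl

theorem extDerivation_ι (D : Derivation R A A) (φ : Q →ₗ[R] Q)
    (h : ∀ (a : A) (ξ : Q), φ (a • ξ) = D a • ξ + a • φ ξ) (ξ : Q) :
    extDerivation D φ h (ExteriorAlgebra.ι A ξ) = ExteriorAlgebra.ι A (φ ξ) := by
  rw [extDerivation, twistedHom_ι]; rfl

theorem extDerivation_add (D : Derivation R A A) (φ : Q →ₗ[R] Q)
    (h : ∀ (a : A) (ξ : Q), φ (a • ξ) = D a • ξ + a • φ ξ) (u v : ExteriorAlgebra A Q) :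
    extDerivation D φ h (u + v) = extDerivation D φ h u + extDerivation D φ h v := by
  rw [extDerivation, map_add]; rfl

theorem extDerivation_mul (D : Derivation R A A) (φ : Q →ₗ[R] Q)
    (h : ∀ (a : A) (ξ : Q), φ (a • ξ) = D a • ξ + a • φ ξ) (u v : ExteriorAlgebra A Q) :
    extDerivation D φ h (u * v) = extDerivation D φ h u * v + u * extDerivation D φ h v := by
  have key : (twistedHom D φ h u * twistedHom D φ h v).snd =
      (twistedHom D φ h u).fst * (twistedHom D φ h v).snd +
        (twistedHom D φ h u).snd * (twistedHom D φ h v).fst := rfl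
  rw [twistedHom_fst, twistedHom_fst] at key
  rw [extDerivation, map_mul, key, add_comm]
  rfl

end ExteriorDerivation

/-! ### The bigraded algebra of alternating forms on `H` with values in the exterior algebra on
`Q` -/

section Forms

open scoped DirectSum TensorProduct

/-- The module of alternating `A`-multilinear forms on `H` with values in the exterior algebra
on `Q`. -/
abbrev ExtForms (A H Q : Type*) [CommRing A] [AddCommGroup H] [Module A H]
    [AddCommGroup Q] [Module A Q] : Type _ :=
  ⨁ q : ℕ, H [⋀^Fin q]→ₗ[A] ExteriorAlgebra A Q

section

variable {A H Q : Type*} [CommRing A] [AddCommGroup H] [Module A H] [AddCommGroup Q] [Module A Q]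

/-- A `q`-form, as an element of the module of all forms. -/
def toForm {q : ℕ} (f : H [⋀^Fin q]→ₗ[A] ExteriorAlgebra A Q) : ExtForms A H Q :=
  DirectSum.lof A ℕ (fun q => H [⋀^Fin q]→ₗ[A] ExteriorAlgebra A Q) q f

variable (H) in
/-- An element of the exterior algebra on `Q`, as a form of degree zero. -/
def ofExt (u : ExteriorAlgebra A Q) : ExtForms A H Q :=
  toForm (AlternatingMap.constOfIsEmpty A H (Fin 0) u)

variable (Q) in
/-- An `A`-valued form, as a form with values in the exterior algebra. -/
def ofScalarForm {q : ℕ} (β : H [⋀^Fin q]→ₗ[A] A) : ExtForms A H Q :=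
  toForm ((Algebra.linearMap A (ExteriorAlgebra A Q)).compAlternatingMap β)

/-- The product of two homogeneous forms, with the Eilenberg-Koszul sign for moving the arguments
`x₁, …, x_q` of the first form past the second form: for `g` with values in the `p'`-th exterior
power,
`(f g)(x₁, …) = (-1)^{q (p' - q')} ∑ sign(σ) f(x_{σ 1}, …, x_{σ q}) ∧ g(x_{σ (q+1)}, …)`,
the sum being over the `(q, q')`-shuffles `σ`. -/
def formMul {q q' : ℕ} (f : H [⋀^Fin q]→ₗ[A] ExteriorAlgebra A Q)
    (g : H [⋀^Fin q']→ₗ[A] ExteriorAlgebra A Q) :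
    H [⋀^Fin (q + q')]→ₗ[A] ExteriorAlgebra A Q :=
  (-1 : ℤˣ) ^ (q * q') • AlternatingMap.domDomCongr finSumFinEquiv
    ((LinearMap.mul' A (ExteriorAlgebra A Q)).compAlternatingMap
      (AlternatingMap.domCoprod f
        (((CliffordAlgebra.involute : ExteriorAlgebra A Q →ₐ[A] ExteriorAlgebra A Q).toLinearMap ^
          q).compAlternatingMap g)))

theorem formMul_eq {q q' : ℕ} (f : H [⋀^Fin q]→ₗ[A] ExteriorAlgebra A Q)
    (g : H [⋀^Fin q']→ₗ[A] ExteriorAlgebra A Q) :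
    formMul f g = (-1 : ℤˣ) ^ (q * q') • AlternatingMap.domDomCongr finSumFinEquiv
      ((LinearMap.mul' A (ExteriorAlgebra A Q)).compAlternatingMap
        (AlternatingMap.domCoprod' (f ⊗ₜ[A]
          (((CliffordAlgebra.involute : ExteriorAlgebra A Q →ₐ[A]
            ExteriorAlgebra A Q).toLinearMap ^ q).compAlternatingMap g)))) :=
  rfl

theorem formMul_add_left {q q' : ℕ} (f f' : H [⋀^Fin q]→ₗ[A] ExteriorAlgebra A Q)
    (g : H [⋀^Fin q']→ₗ[A] ExteriorAlgebra A Q) :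
    formMul (f + f') g = formMul f g + formMul f' g := by
  simp only [formMul_eq, TensorProduct.add_tmul, map_add]
  ext v
  simp

theorem formMul_smul_left {q q' : ℕ} (c : A) (f : H [⋀^Fin q]→ₗ[A] ExteriorAlgebra A Q)
    (g : H [⋀^Fin q']→ₗ[A] ExteriorAlgebra A Q) :
    formMul (c • f) g = c • formMul f g := by
  simp only [formMul_eq, ← TensorProduct.smul_tmul', map_smul]
  ext v
  simp [smul_comm c]

theorem formMul_add_right {q q' : ℕ} (f : H [⋀^Fin q]→ₗ[A] ExteriorAlgebra A Q)
    (g g' : H [⋀^Fin q']→ₗ[A] ExteriorAlgebra A Q) :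
    formMul f (g + g') = formMul f g + formMul f g' := by
  simp only [formMul_eq, LinearMap.compAlternatingMap_add, TensorProduct.tmul_add, map_add]
  ext v
  simp

theorem formMul_smul_right {q q' : ℕ} (c : A) (f : H [⋀^Fin q]→ₗ[A] ExteriorAlgebra A Q)
    (g : H [⋀^Fin q']→ₗ[A] ExteriorAlgebra A Q) :
    formMul f (c • g) = c • formMul f g := by
  simp only [formMul_eq, LinearMap.compAlternatingMap_smul, TensorProduct.tmul_smul, map_smul]
  ext v
  simp [smul_comm c]

/-- The product on all forms. -/
def formMulₗ (A H Q : Type*) [CommRing A] [AddCommGroup H] [Module A H]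
    [AddCommGroup Q] [Module A Q] :
    ExtForms A H Q →ₗ[A] ExtForms A H Q →ₗ[A] ExtForms A H Q :=
  DirectSum.toModule A ℕ _ fun q => LinearMap.flip <| DirectSum.toModule A ℕ _ fun q' =>
    LinearMap.flip <| LinearMap.mk₂ A (fun f g => toForm (formMul f g))
      (fun f f' g => by rw [formMul_add_left]; exact map_add _ _ _)
      (fun c f g => by rw [formMul_smul_left]; exact map_smul _ _ _)
      (fun f g g' => by rw [formMul_add_right]; exact map_add _ _ _)
      (fun c f g => by rw [formMul_smul_right]; exact map_smul _ _ _)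

theorem formMulₗ_toForm {q q' : ℕ} (f : H [⋀^Fin q]→ₗ[A] ExteriorAlgebra A Q)
    (g : H [⋀^Fin q']→ₗ[A] ExteriorAlgebra A Q) :
    formMulₗ A H Q (toForm f) (toForm g) = toForm (formMul f g) := by
  simp [formMulₗ, toForm]

/-- The `p`-th exterior power, zero for negative `p`. -/
def extPower (A Q : Type*) [CommRing A] [AddCommGroup Q] [Module A Q] :
    ℤ → Submodule A (ExteriorAlgebra A Q)
  | Int.ofNat p => ⋀[A]^p Q
  | Int.negSucc _ => ⊥

/-- Contraction of a form with `y`, inserted as the last argument: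
`(β ⌞ y)(x₁, …, x_q) = β(x₁, …, x_q, y)`. -/
def contractLast {q : ℕ} (y : H) (β : H [⋀^Fin (q + 1)]→ₗ[A] A) : H [⋀^Fin q]→ₗ[A] A :=
  (-1 : ℤˣ) ^ q • β.curryLeft y

theorem contractLast_apply {q : ℕ} (y : H) (β : H [⋀^Fin (q + 1)]→ₗ[A] A) (x : Fin q → H) :
    contractLast y β x = β (Fin.snoc (α := fun _ => H) x y) := by
  rw [Fin.snoc_eq_cons_rotate]
  have h := β.map_perm (Fin.cons (α := fun _ => H) y x) (finRotate (q + 1))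
  rw [sign_finRotate, Nat.add_sub_cancel] at h
  exact h.symm

end

instance (R A H Q : Type*) [CommRing R] [CommRing A] [Algebra R A]
    [AddCommGroup H] [Module A H]
    [AddCommGroup Q] [Module R Q] [Module A Q] [IsScalarTower R A Q] :
    IsScalarTower R A (ExtForms A H Q) :=
  ⟨fun r a w => by
    refine DFinsupp.ext fun q => AlternatingMap.ext fun v => ?_
    exact smul_assoc r a (w q v)⟩

/-- The bigraded algebra `Alt_A(H, Λ_A Q)`, with `Alt^q_A(H, Λ^p_A Q)` in bidegree `(q, p)`. -/
def formsAlgebra (R A H Q : Type*) [CommRing R] [CommRing A] [Algebra R A]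
    [AddCommGroup H] [Module A H]
    [AddCommGroup Q] [Module R Q] [Module A Q] [IsScalarTower R A Q] :
    BigradedAlgebraData R (ExtForms A H Q) where
  gr q p :=
    { carrier := {w | (∀ m : ℕ, (m : ℤ) ≠ q → w m = 0) ∧
        ∀ (m : ℕ) (v : Fin m → H), w m v ∈ extPower A Q p}
      zero_mem' := ⟨fun _ _ => rfl, fun _ _ => zero_mem _⟩
      add_mem' := fun {w w'} hw hw' =>
        ⟨fun m hm => by rw [DirectSum.add_apply, hw.1 m hm, hw'.1 m hm, add_zero],
          fun m v => by
            rw [DirectSum.add_apply]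
            exact add_mem (hw.2 m v) (hw'.2 m v)⟩
      smul_mem' := fun c w hw =>
        ⟨fun m hm => by rw [DirectSum.smul_apply, hw.1 m hm, smul_zero],
          fun m v => by
            rw [DirectSum.smul_apply, AlternatingMap.smul_apply, ← algebraMap_smul A c]
            exact Submodule.smul_mem _ _ (hw.2 m v)⟩ }
  mul := (formMulₗ A H Q).restrictScalars₁₂ R R
  one := ofExt H 1

end Forms

/-! ### The operations determined by a Lie-Rinehart triple -/

namespace AlmostPreLieRinehartTriple

variable {R A H Q : Type*} [CommRing R] [CommRing A] [Algebra R A]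
    [AddCommGroup H] [Module R H] [Module A H] [IsScalarTower R A H]
    [AddCommGroup Q] [Module R Q] [Module A Q] [IsScalarTower R A Q]
    (T : AlmostPreLieRinehartTriple R A H Q)

/-- The action of `x ∈ H` on the exterior algebra: the derivation that is `a ↦ x(a)` on `A` and
`ξ ↦ x · ξ` on `Q`. -/
def actExt (x : H) (u : ExteriorAlgebra A Q) : ExteriorAlgebra A Q :=
  extDerivation (T.anchorH x) (T.actHQ x) (T.actHQ_smul x) u

/-- The second sum in the Cartan-Chevalley-Eilenberg formula,
`∑_{j<k} (-1)^{j+k} f([x_j, x_k]_H, x₁, …, x̂_j, …, x̂_k, …)`. -/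
def bracketSum : ∀ {q : ℕ} (_ : H [⋀^Fin q]→ₗ[A] ExteriorAlgebra A Q) (_ : Fin (q + 1) → H),
    ExteriorAlgebra A Q
  | 0, _, _ => 0
  | q + 1, f, x => ∑ jk : Fin (q + 1) × Fin (q + 2) with jk.1.castSucc < jk.2,
      (-1 : ℤˣ) ^ ((jk.1 : ℕ) + (jk.2 : ℕ)) •
        f (Fin.cons (α := fun _ => H) (T.brH (x jk.1.castSucc) (x jk.2))
          fun i => x (jk.2.succAbove (jk.1.succAbove i)))

/-- `d` is the Lie-Rinehart differential, given on a `q`-form `f` with values in the `p`-th exterior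
power by the Cartan-Chevalley-Eilenberg formula with the sign `(-1)^{|f|+1}`, `|f| = p - q`. -/
structure IsLieRinehartDifferential (d : ExtForms A H Q →ₗ[R] ExtForms A H Q) : Prop where
  apply_eq : ∀ {q p : ℕ} (f : H [⋀^Fin q]→ₗ[A] ExteriorAlgebra A Q), (∀ v, f v ∈ ⋀[A]^p Q) →
    ∀ x : Fin (q + 1) → H,
      ((p : ℤ) - q + 1).negOnePow • d (toForm f) (q + 1) x =
        ∑ i : Fin (q + 1), (-1 : ℤˣ) ^ (i : ℕ) • T.actExt (x i) (f (i.removeNth x))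
          + T.bracketSum f x
  apply_ne : ∀ {q : ℕ} (f : H [⋀^Fin q]→ₗ[A] ExteriorAlgebra A Q) (m : ℕ), m ≠ q + 1 →
    d (toForm f) m = 0

/-- `br` is the bigraded bracket on `Alt_A(H, Λ_A Q)`: the extension of the bracket of `Q` and of
the action `(ξ(α))(x₁, …) = ξ(α(x₁, …)) - ∑ α(x₁, …, ξ · x_j, …)` of `Q` on `A`-valued forms that is
graded skew-symmetric and a derivation in each variable. -/
structure IsFormBracket (br : ExtForms A H Q →ₗ[R] ExtForms A H Q →ₗ[R] ExtForms A H Q) :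
    Prop where
  mem : ∀ {q p q' p' : ℤ} {a b : ExtForms A H Q},
    a ∈ (formsAlgebra R A H Q).gr q p → b ∈ (formsAlgebra R A H Q).gr q' p' →
      br a b ∈ (formsAlgebra R A H Q).gr (q + q') (p + p' - 1)
  mul_left : ∀ {q p q' p' : ℤ} {a b : ExtForms A H Q} (c : ExtForms A H Q),
    a ∈ (formsAlgebra R A H Q).gr q p → b ∈ (formsAlgebra R A H Q).gr q' p' →
      br ((formsAlgebra R A H Q).mul a b) c = (formsAlgebra R A H Q).mul a (br b c)
        + ((p - q) * (p' - q')).negOnePow • (formsAlgebra R A H Q).mul b (br a c)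
  skew : ∀ {q p q' p' : ℤ} {a b : ExtForms A H Q},
    a ∈ (formsAlgebra R A H Q).gr q p → b ∈ (formsAlgebra R A H Q).gr q' p' →
      br a b = -((p - q - 1) * (p' - q' - 1)).negOnePow • br b a
  scalar : ∀ (ξ : Q) {q : ℕ} (α : H [⋀^Fin q]→ₗ[A] A) (x : Fin q → H),
    br (ofExt H (ExteriorAlgebra.ι A ξ)) (ofScalarForm Q α) q x =
      algebraMap A (ExteriorAlgebra A Q)
        (T.anchorQ ξ (α x) - ∑ j, α (Function.update x j (T.actQH ξ (x j))))
  ext : ∀ ξ η : Q, br (ofExt H (ExteriorAlgebra.ι A ξ)) (ofExt H (ExteriorAlgebra.ι A η)) =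
    ofExt H (ExteriorAlgebra.ι A (T.brQ ξ η))

/-- `Ψ` is the Jacobiator of the triple, the operator of bidegree `(-1, -2)` with
`Ψ(β ξ₁ ∧ … ∧ ξ_p) =
  ∑_{j<k} (-1)^{j+k} ⟨ξ_j, ξ_k; β⟩ ξ₁ ∧ … ξ̂_j … ξ̂_k … ∧ ξ_p`, where `⟨ξ, η; β⟩` is the
contraction of `β` with `δ(ξ, η)`. -/
structure IsJacobiator (Ψ : ExtForms A H Q →ₗ[R] ExtForms A H Q) : Prop where
  mem : ∀ {q p : ℤ} {a : ExtForms A H Q}, a ∈ (formsAlgebra R A H Q).gr q p →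
    Ψ a ∈ (formsAlgebra R A H Q).gr (q - 1) (p - 2)
  apply_eq : ∀ {q p : ℕ} (β : H [⋀^Fin (q + 1)]→ₗ[A] A) (ξ : Fin (p + 2) → Q),
    Ψ ((formsAlgebra R A H Q).mul (ofScalarForm Q β)
        (ofExt H (ExteriorAlgebra.ιMulti A (p + 2) ξ))) =
      ∑ jk : Fin (p + 1) × Fin (p + 2) with jk.1.castSucc < jk.2,
        (-1 : ℤˣ) ^ ((jk.1 : ℕ) + (jk.2 : ℕ)) • (formsAlgebra R A H Q).mul
          (ofScalarForm Q (contractLast (T.δ (ξ jk.1.castSucc) (ξ jk.2)) β))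
          (ofExt H (ExteriorAlgebra.ιMulti A p
            fun i => ξ (jk.2.succAbove (jk.1.succAbove i))))

/-- `ω` is an orientation form: an `A`-module isomorphism `Λ^n_A Q ≅ A` that is invariant under the
action of `H`. -/
def IsOrientationForm {n : ℕ} (ω : ⋀[A]^n Q ≃ₗ[A] A) : Prop :=
  ∀ (x : H) (ξ : Fin n → Q), T.anchorH x (ω (exteriorPower.ιMulti A n ξ)) =
    ∑ j, ω (exteriorPower.ιMulti A n (Function.update ξ j (T.actHQ x (ξ j))))

/-- The triple is orientable: `Q` is finitely generated projective of some constant rank `n`, and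
there is an orientation form. -/
def IsOrientable : Prop :=
  ∃ n : ℕ, Module.Finite A Q ∧ Module.Projective A Q ∧
    (∀ 𝔭 : PrimeSpectrum A, Module.rankAtStalk (R := A) Q 𝔭 = n) ∧
    ∃ ω : ⋀[A]^n Q ≃ₗ[A] A, T.IsOrientationForm ω

end AlmostPreLieRinehartTriple

end

/-!
A form on `H` is determined by its constant term and its contractions with the elements of `H`. More
generally, a family of forms all of whose constant terms vanish, and whose contractions are sums of
members of the family, is zero (`eq_zero_of_insertFirst_mem`). As the operators on forms are described
by commutation rules with contractions, most identities between them are proved in this way, without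
shuffles and explicit formulas in several variables.

Orientability is used only to know that `Q` is finitely generated projective, so that it has a dual
basis `e i`, `θ i`. Then the forms are spanned by the products of an `A`-valued form and elements of
`Q`; in other words, the algebra is generated by `A`-valued forms and `Q`
(`isGeneratedBy_isFormGenerator`), which gives the uniqueness of the three operations. The operations
themselves are explicit:
* `dOp` is defined by Cartan's recursion `i_x C = L_x - C i_x` on contractions, up to a sign;
* `brOp` is the sum over `i` of `(∂_i a) (L_i b)`, up to a sign, minus `(∇_i a) (∂_i b)`, where `∂_i` is
  the contraction with `θ i`, and `L_i` and `∇_i` are derivations along `e i`, the second one given by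
  the flat connection on `Q` of the dual basis;
* `psiOp` is a sum of composites of three contractions, two with some `θ i` and one with an element
  `δ (e i) (e j)`.

The identities of a quasi-Gerstenhaber algebra are reduced to generators by an argument about graded
commutative rings. The Jacobiator `Ψ` has order at most `3`, as a composite of three derivations, so
that the form `Φ³` of `Ψ` is a derivation in every variable. Together with the Leibniz rule for the
bracket and the differential, this makes both sides of the identities (or rather their differences)
derivations in every variable: this is `IsSkewBracket.isDer_bracket` for the compatibility of the
differential and the bracket, `IsSkewBracket.jacobi` for the Jacobi identity up to the homotopy `Ψ`,
and `bracketKoszul_eq_zero` for the identity in four variables, whose sums over shuffles are written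
out in `sum_shuffles_eq_of_bracketKoszul`.

On generators, most of the cases are void because a bidegree would be negative, and the rest are the
components of the Jacobi identity of the Lie-Rinehart algebra `H ⊕ Q`, transported to forms by means
of `[ξ, ·] = L_ξ` (`brOp_ι`) and of the equality of `Φ³ (ξ, η, ·)` with the contraction with `δ ξ η`
(`koszulThree_psiOp_ι_ι`). The formulas for the actions on brackets, `actQH_brH` and `actHQ_brQ`,
correspond to the compatibility of the differential and the bracket, the identities `brQ_brQ` and
`brH_δ` to the Jacobi identity, and `δ_brQ` to the identity in four variables.
-/

open scoped DirectSum TensorProduct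

/-! ### Cosets of the subgroup of block permutations and products of alternating maps -/

section Cosets

open Equiv

/-- A permutation lies in the subgroup `Perm m × Perm n` of `Perm (m ⊕ n)` if and only if it
preserves the first summand. -/
theorem mem_sumCongrHom_range_iff {m n : Type*} [Finite m] [Finite n] (σ : Perm (m ⊕ n)) :
    σ ∈ (Perm.sumCongrHom m n).range ↔ ∀ i, (σ (Sum.inl i)).isLeft := by
  constructor
  · rintro ⟨⟨s, t⟩, rfl⟩ i
    simp
  · intro h
    refine Perm.mem_sumCongrHom_range_of_perm_mapsTo_inl ?_
    rintro _ ⟨i, rfl⟩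
    obtain ⟨j, hj⟩ := Sum.isLeft_iff.1 (h i)
    exact ⟨j, hj.symm⟩

theorem isRight_of_mem_sumCongrHom_range {m n : Type*} {σ : Perm (m ⊕ n)}
    (h : σ ∈ (Perm.sumCongrHom m n).range) (j : n) : (σ (Sum.inr j)).isRight := by
  obtain ⟨⟨s, t⟩, rfl⟩ := h
  simp

/-- The extension of a permutation by a fixed point. -/
def permAddFixedPoint {ι₀ ι : Type*} (e : Option ι₀ ≃ ι) : Perm ι₀ →* Perm ι where
  toFun τ := e.permCongr τ.optionCongr
  map_one' := by ext; simp [optionCongr_one]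
  map_mul' σ τ := by
    ext i
    obtain ⟨i, rfl⟩ := e.surjective i
    cases i <;> simp [Equiv.permCongr_apply]

variable {ι₀ ι : Type*} (e : Option ι₀ ≃ ι)

@[simp]
theorem permAddFixedPoint_none (τ : Perm ι₀) : permAddFixedPoint e τ (e none) = e none := by
  simp [permAddFixedPoint, Equiv.permCongr_apply]

@[simp]
theorem permAddFixedPoint_some (τ : Perm ι₀) (i : ι₀) :
    permAddFixedPoint e τ (e (some i)) = e (some (τ i)) := by
  simp [permAddFixedPoint, Equiv.permCongr_apply]

theorem sign_permAddFixedPoint [DecidableEq ι₀] [Fintype ι₀] [DecidableEq ι] [Fintype ι]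
    (τ : Perm ι₀) : Perm.sign (permAddFixedPoint e τ) = Perm.sign τ := by
  simp [permAddFixedPoint, Perm.sign_permCongr, optionCongr_sign]

theorem exists_permAddFixedPoint_eq {σ : Perm ι} (h : σ (e none) = e none) :
    ∃ τ, permAddFixedPoint e τ = σ := by
  classical
  refine ⟨removeNone (e.symm.permCongr σ), ?_⟩
  have h' : (e.symm.permCongr σ) none = none := by simp [Equiv.permCongr_apply, h]
  have := map_equiv_removeNone (e.symm.permCongr σ)
  rw [h', swap_self] at this
  ext i
  have h2 : (removeNone (e.symm.permCongr σ)).optionCongr = e.symm.permCongr σ := by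
    rw [this]; rfl
  simp [permAddFixedPoint, h2, Equiv.permCongr_apply]

variable (q q' : ℕ)

/-- `Fin (q + 1) ⊕ β` as `Fin q ⊕ β` with the point `inl 0` added. -/
def optionSumLeft (q : ℕ) (β : Type*) : Option (Fin q ⊕ β) ≃ Fin (q + 1) ⊕ β where
  toFun
    | none => Sum.inl 0
    | some (Sum.inl i) => Sum.inl i.succ
    | some (Sum.inr j) => Sum.inr j
  invFun
    | Sum.inl i => Fin.cases none (fun i => some (Sum.inl i)) i
    | Sum.inr j => some (Sum.inr j)
  left_inv := by rintro (_ | _ | _) <;> simp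
  right_inv := by
    rintro (i | _)
    · cases i using Fin.cases <;> simp
    · simp

/-- `α ⊕ Fin (q' + 1)` as `α ⊕ Fin q'` with the point `inr 0` added. -/
def optionSumRight (α : Type*) (q' : ℕ) : Option (α ⊕ Fin q') ≃ α ⊕ Fin (q' + 1) where
  toFun
    | none => Sum.inr 0
    | some (Sum.inl i) => Sum.inl i
    | some (Sum.inr j) => Sum.inr j.succ
  invFun
    | Sum.inr i => Fin.cases none (fun i => some (Sum.inr i)) i
    | Sum.inl j => some (Sum.inl j)
  left_inv := by rintro (_ | _ | _) <;> simp
  right_inv := by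
    rintro (_ | i)
    · simp
    · cases i using Fin.cases <;> simp

/-- Permutations that fix `inl 0`. -/
abbrev extLeft (q : ℕ) (β : Type*) : Perm (Fin q ⊕ β) →* Perm (Fin (q + 1) ⊕ β) :=
  permAddFixedPoint (optionSumLeft q β)

/-- Permutations that fix `inr 0`. -/
abbrev extRight (α : Type*) (q' : ℕ) : Perm (α ⊕ Fin q') →* Perm (α ⊕ Fin (q' + 1)) :=
  permAddFixedPoint (optionSumRight α q')

theorem extLeft_inl_zero {β : Type*} (τ : Perm (Fin q ⊕ β)) :
    extLeft q β τ (Sum.inl 0) = Sum.inl 0 :=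
  permAddFixedPoint_none (optionSumLeft q β) τ

theorem extLeft_inl_succ {β : Type*} (τ : Perm (Fin q ⊕ β)) (i : Fin q) :
    extLeft q β τ (Sum.inl i.succ) = optionSumLeft q β (some (τ (Sum.inl i))) :=
  permAddFixedPoint_some (optionSumLeft q β) τ (Sum.inl i)

theorem extRight_inr_zero {α : Type*} (τ : Perm (α ⊕ Fin q')) :
    extRight α q' τ (Sum.inr 0) = Sum.inr 0 :=
  permAddFixedPoint_none (optionSumRight α q') τ

theorem extRight_inr_succ {α : Type*} (τ : Perm (α ⊕ Fin q')) (i : Fin q') :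
    extRight α q' τ (Sum.inr i.succ) = optionSumRight α q' (some (τ (Sum.inr i))) :=
  permAddFixedPoint_some (optionSumRight α q') τ (Sum.inr i)

theorem extRight_inl {α : Type*} (τ : Perm (α ⊕ Fin q')) (j : α) :
    extRight α q' τ (Sum.inl j) = optionSumRight α q' (some (τ (Sum.inl j))) :=
  permAddFixedPoint_some (optionSumRight α q') τ (Sum.inl j)

theorem extLeft_mem_iff {β : Type*} [Finite β] (τ : Perm (Fin q ⊕ β)) :
    extLeft q β τ ∈ (Perm.sumCongrHom (Fin (q + 1)) β).range ↔
      τ ∈ (Perm.sumCongrHom (Fin q) β).range := by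
  have key : ∀ z : Fin q ⊕ β, (optionSumLeft q β (some z)).isLeft = z.isLeft := by
    rintro (_ | _) <;> rfl
  simp only [mem_sumCongrHom_range_iff, Fin.forall_fin_succ, extLeft_inl_zero, extLeft_inl_succ,
    key, Sum.isLeft_inl, true_and]

theorem extRight_mem_iff {α : Type*} [Finite α] (τ : Perm (α ⊕ Fin q')) :
    extRight α q' τ ∈ (Perm.sumCongrHom α (Fin (q' + 1))).range ↔
      τ ∈ (Perm.sumCongrHom α (Fin q')).range := by
  have key : ∀ z : α ⊕ Fin q', (optionSumRight α q' (some z)).isLeft = z.isLeft := by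
    rintro (_ | _) <;> rfl
  simp only [mem_sumCongrHom_range_iff, extRight_inl, key]

/-- The cosets of shuffles of `q + 1` and `q' + 1` letters, sorted by the block that receives the
letter `inl 0`. -/
def splitCosets : Perm.ModSumCongr (Fin q) (Fin (q' + 1)) ⊕ Perm.ModSumCongr (Fin (q + 1)) (Fin q') →
    Perm.ModSumCongr (Fin (q + 1)) (Fin (q' + 1)) :=
  Sum.elim
    (Quotient.map' (extLeft q (Fin (q' + 1))) fun σ τ h => by
      rw [QuotientGroup.leftRel_apply] at h ⊢
      rwa [← map_inv, ← map_mul, extLeft_mem_iff])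
    (Quotient.map' (fun τ => swap (Sum.inl 0) (Sum.inr 0) * extRight (Fin (q + 1)) q' τ)
      fun σ τ h => by
        rw [QuotientGroup.leftRel_apply] at h ⊢
        rwa [mul_inv_rev, mul_assoc, inv_mul_cancel_left, ← map_inv, ← map_mul, extRight_mem_iff])

/-- A shuffle puts the letter `inl 0` first in one of the two blocks, and is then a shuffle of the
remaining letters. -/
theorem splitCosets_bijective : Function.Bijective (splitCosets q q') := by
  constructor
  · have cross : ∀ (σ : Perm (Fin q ⊕ Fin (q' + 1))) (τ : Perm (Fin (q + 1) ⊕ Fin q')),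
        (extLeft q (Fin (q' + 1)) σ)⁻¹ *
          (swap (Sum.inl 0) (Sum.inr 0) * extRight (Fin (q + 1)) q' τ) ∉
          (Perm.sumCongrHom (Fin (q + 1)) (Fin (q' + 1))).range := by
      intro σ τ h
      have h1 := isRight_of_mem_sumCongrHom_range h 0
      have h2 : (extLeft q (Fin (q' + 1)) σ)⁻¹ (Sum.inl 0) = Sum.inl 0 := by
        rw [← map_inv, extLeft_inl_zero]
      rw [Perm.mul_apply, Perm.mul_apply, extRight_inr_zero, swap_apply_right, h2] at h1
      simp at h1
    rintro (σ | σ) (τ | τ) h <;> induction σ using Quotient.inductionOn' with | _ σ <;>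
      induction τ using Quotient.inductionOn' with | _ τ
    · have h' := QuotientGroup.leftRel_apply.1 (Quotient.exact' h)
      rw [← map_inv, ← map_mul, extLeft_mem_iff] at h'
      exact congrArg _ (Quotient.sound' (QuotientGroup.leftRel_apply.2 h'))
    · exact absurd (QuotientGroup.leftRel_apply.1 (Quotient.exact' h)) (cross σ τ)
    · exact absurd (QuotientGroup.leftRel_apply.1 (Quotient.exact' h.symm)) (cross τ σ)
    · have h' := QuotientGroup.leftRel_apply.1 (Quotient.exact' h)
      rw [mul_inv_rev, mul_assoc, inv_mul_cancel_left, ← map_inv, ← map_mul,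
        extRight_mem_iff] at h'
      exact congrArg _ (Quotient.sound' (QuotientGroup.leftRel_apply.2 h'))
  · intro σ
    induction σ using Quotient.inductionOn' with | _ σ
    -- changing `σ` inside its coset, the preimage of `inl 0` can be taken to be `inl 0` or `inr 0`
    obtain ⟨k, hk⟩ : ∃ k, σ k = Sum.inl 0 := σ.surjective _
    rcases k with k | k
    · have h1 : (σ * swap (Sum.inl 0) (Sum.inl k) : Perm (Fin (q + 1) ⊕ Fin (q' + 1)))
          (optionSumLeft q (Fin (q' + 1)) none) =
          optionSumLeft q (Fin (q' + 1)) none := by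
        change (σ * swap (Sum.inl 0) (Sum.inl k) : Perm (Fin (q + 1) ⊕ Fin (q' + 1)))
          (Sum.inl 0) = Sum.inl 0
        rw [Perm.mul_apply, swap_apply_left, hk]
      obtain ⟨τ, hτ⟩ := exists_permAddFixedPoint_eq _ h1
      refine ⟨Sum.inl (Quotient.mk'' τ), Quotient.sound' (QuotientGroup.leftRel_apply.2 ?_)⟩
      change (permAddFixedPoint _ τ)⁻¹ * σ ∈ _
      rw [hτ, mul_inv_rev, swap_inv, mul_assoc, inv_mul_cancel, mul_one,
        mem_sumCongrHom_range_iff]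
      intro i
      rw [swap_apply_def]
      split_ifs <;> rfl
    · have h1 : (swap (Sum.inl 0) (Sum.inr 0) * (σ * swap (Sum.inr 0) (Sum.inr k)) :
          Perm (Fin (q + 1) ⊕ Fin (q' + 1))) (optionSumRight (Fin (q + 1)) q' none) =
          optionSumRight (Fin (q + 1)) q' none := by
        change (swap (Sum.inl 0) (Sum.inr 0) * (σ * swap (Sum.inr 0) (Sum.inr k)) :
          Perm (Fin (q + 1) ⊕ Fin (q' + 1))) (Sum.inr 0) = Sum.inr 0
        rw [Perm.mul_apply, Perm.mul_apply, swap_apply_left, hk, swap_apply_left]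
      obtain ⟨τ, hτ⟩ := exists_permAddFixedPoint_eq _ h1
      refine ⟨Sum.inr (Quotient.mk'' τ), Quotient.sound' (QuotientGroup.leftRel_apply.2 ?_)⟩
      change (swap _ _ * permAddFixedPoint _ τ)⁻¹ * σ ∈ _
      rw [hτ, ← mul_assoc, swap_mul_self, one_mul, mul_inv_rev, swap_inv, mul_assoc,
        inv_mul_cancel, mul_one, mem_sumCongrHom_range_iff]
      intro i
      rw [swap_apply_of_ne_of_ne (by simp) (by simp)]
      rfl

end Cosets

section DomCoprod

open Equiv TensorProduct

variable {A M N₁ N₂ : Type*} [CommRing A] [AddCommGroup M] [Module A M]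
  [AddCommGroup N₁] [Module A N₁] [AddCommGroup N₂] [Module A N₂]

/-- Expansion of the shuffle product of two alternating maps with respect to its first argument. -/
theorem domCoprod_expand {q q' : ℕ} (a : M [⋀^Fin (q + 1)]→ₗ[A] N₁)
    (b : M [⋀^Fin (q' + 1)]→ₗ[A] N₂) (v : Fin (q + 1) ⊕ Fin (q' + 1) → M) :
    a.domCoprod b v =
      (a.curryLeft (v (Sum.inl 0))).domCoprod b
          (fun i => v (optionSumLeft q (Fin (q' + 1)) (some i)))
        - a.domCoprod (b.curryLeft (v (Sum.inl 0)))
          (fun i => v (swap (Sum.inl 0) (Sum.inr 0)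
            (optionSumRight (Fin (q + 1)) q' (some i)))) := by
  rw [AlternatingMap.domCoprod_apply, AlternatingMap.domCoprod_apply,
    AlternatingMap.domCoprod_apply, _root_.sum_apply, _root_.sum_apply,
    _root_.sum_apply,
    ← Fintype.sum_equiv (Equiv.ofBijective _ (splitCosets_bijective q q')) _ _ (fun _ => rfl),
    Fintype.sum_sum_type, sub_eq_add_neg, ← Finset.sum_neg_distrib]
  congr 1
  · refine Finset.sum_congr rfl fun τ _ => ?_
    induction τ using Quotient.inductionOn' with | _ τ
    change AlternatingMap.domCoprod.summand a b (Quotient.mk'' (extLeft q (Fin (q' + 1)) τ)) v = _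
    rw [AlternatingMap.domCoprod.summand_mk'', AlternatingMap.domCoprod.summand_mk'',
      sign_permAddFixedPoint]
    simp only [_root_.smul_apply, MultilinearMap.domDomCongr_apply,
      MultilinearMap.domCoprod_apply, AlternatingMap.coe_multilinearMap]
    congr 2
    rw [AlternatingMap.curryLeft_apply_apply]
    congr 1
    funext i
    cases i using Fin.cases with
    | zero => rw [extLeft_inl_zero]; rfl
    | succ i => rw [extLeft_inl_succ]; rfl
  · refine Finset.sum_congr rfl fun τ _ => ?_
    induction τ using Quotient.inductionOn' with | _ τ
    change AlternatingMap.domCoprod.summand a b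
      (Quotient.mk'' (swap (Sum.inl 0) (Sum.inr 0) * extRight (Fin (q + 1)) q' τ)) v = _
    rw [AlternatingMap.domCoprod.summand_mk'', AlternatingMap.domCoprod.summand_mk'',
      Perm.sign_mul, sign_permAddFixedPoint, Perm.sign_swap (by simp)]
    simp only [_root_.smul_apply, _root_.neg_apply, MultilinearMap.domDomCongr_apply,
      MultilinearMap.domCoprod_apply, AlternatingMap.coe_multilinearMap, neg_mul, one_mul,
      Units.neg_smul]
    congr 3
    rw [AlternatingMap.curryLeft_apply_apply]
    congr 1
    funext i
    cases i using Fin.cases with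
    | zero => rw [Perm.mul_apply, extRight_inr_zero, swap_apply_right]; rfl
    | succ i => rw [Perm.mul_apply, extRight_inr_succ]; rfl

theorem domCoprod_isEmpty_left {α β : Type*} [IsEmpty α] [Fintype α] [DecidableEq α] [Fintype β]
    [DecidableEq β] (a : M [⋀^α]→ₗ[A] N₁) (b : M [⋀^β]→ₗ[A] N₂) (v : α ⊕ β → M) :
    a.domCoprod b v = a (fun i => v (Sum.inl i)) ⊗ₜ b (fun j => v (Sum.inr j)) := by
  have : ∀ σ : Perm.ModSumCongr α β, σ = Quotient.mk'' 1 := fun σ => by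
    induction σ using Quotient.inductionOn' with | _ σ
    refine Quotient.sound' (QuotientGroup.leftRel_apply.2 ?_)
    rw [mem_sumCongrHom_range_iff]
    exact isEmptyElim
  rw [AlternatingMap.domCoprod_apply, _root_.sum_apply]
  refine (Finset.sum_eq_single_of_mem (Quotient.mk'' 1) (Finset.mem_univ _)
    fun σ _ h => absurd (this σ) h).trans ?_
  rw [AlternatingMap.domCoprod.summand_mk'']
  simp

theorem domCoprod_isEmpty_right {α β : Type*} [IsEmpty β] [Fintype α] [DecidableEq α] [Fintype β]
    [DecidableEq β] (a : M [⋀^α]→ₗ[A] N₁) (b : M [⋀^β]→ₗ[A] N₂) (v : α ⊕ β → M) :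
    a.domCoprod b v = a (fun i => v (Sum.inl i)) ⊗ₜ b (fun j => v (Sum.inr j)) := by
  have : ∀ σ : Perm.ModSumCongr α β, σ = Quotient.mk'' 1 := fun σ => by
    induction σ using Quotient.inductionOn' with | _ σ
    refine Quotient.sound' (QuotientGroup.leftRel_apply.2 ?_)
    rw [mem_sumCongrHom_range_iff]
    intro i
    generalize (σ⁻¹ * 1 : Perm (α ⊕ β)) (Sum.inl i) = z
    rcases z with z | z
    · rfl
    · exact isEmptyElim z
  rw [AlternatingMap.domCoprod_apply, _root_.sum_apply]
  refine (Finset.sum_eq_single_of_mem (Quotient.mk'' 1) (Finset.mem_univ _)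
    fun σ _ h => absurd (this σ) h).trans ?_
  rw [AlternatingMap.domCoprod.summand_mk'']
  simp

end DomCoprod

/-! ### Contractions of forms -/

section FormCalculus

variable {A H Q : Type*} [CommRing A] [AddCommGroup H] [Module A H] [AddCommGroup Q] [Module A Q]

theorem forms_ext {w w' : ExtForms A H Q} (h : ∀ q v, w q v = w' q v) : w = w' :=
  DFinsupp.ext fun q => AlternatingMap.ext fun v => h q v

theorem toForm_apply_self {q : ℕ} (f : H [⋀^Fin q]→ₗ[A] ExteriorAlgebra A Q) : toForm f q = f :=
  DirectSum.lof_apply (M := fun q : ℕ => H [⋀^Fin q]→ₗ[A] ExteriorAlgebra A Q) A q f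

theorem toForm_apply_ne {q m : ℕ} (h : q ≠ m) (f : H [⋀^Fin q]→ₗ[A] ExteriorAlgebra A Q) :
    toForm f m = 0 :=
  DirectSum.of_eq_of_ne (β := fun q : ℕ => H [⋀^Fin q]→ₗ[A] ExteriorAlgebra A Q) q m f h.symm

theorem toForm_add {q : ℕ} (f g : H [⋀^Fin q]→ₗ[A] ExteriorAlgebra A Q) :
    toForm (f + g) = toForm f + toForm g :=
  map_add _ _ _

theorem toForm_neg {q : ℕ} (f : H [⋀^Fin q]→ₗ[A] ExteriorAlgebra A Q) :
    toForm (-f) = -toForm f :=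
  map_neg _ _

@[elab_as_elim]
theorem forms_induction {P : ExtForms A H Q → Prop} (w : ExtForms A H Q) (zero : P 0)
    (form : ∀ (q : ℕ) (f : H [⋀^Fin q]→ₗ[A] ExteriorAlgebra A Q), P (toForm f))
    (add : ∀ w w', P w → P w' → P (w + w')) : P w :=
  DirectSum.induction_on w zero form add

theorem toForm_eq_toForm {m n : ℕ} (h : m = n) {f : H [⋀^Fin m]→ₗ[A] ExteriorAlgebra A Q}
    {g : H [⋀^Fin n]→ₗ[A] ExteriorAlgebra A Q}
    (hfg : ∀ v : Fin n → H, f (fun i => v (Fin.cast h i)) = g v) : toForm f = toForm g := by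
  subst h
  exact congrArg toForm (AlternatingMap.ext hfg)

/-- The value of the component of degree `0` of a form. -/
def constTerm : ExtForms A H Q →ₗ[A] ExteriorAlgebra A Q where
  toFun w := w 0 ![]
  map_add' _ _ := rfl
  map_smul' _ _ := rfl

theorem constTerm_apply (w : ExtForms A H Q) (v : Fin 0 → H) : constTerm w = w 0 v :=
  congrArg (w 0) (Subsingleton.elim _ _)

/-- Insertion of `x` as the first argument of a form. -/
def insertFirst (x : H) : ExtForms A H Q →ₗ[A] ExtForms A H Q where
  toFun w := DFinsupp.mapRange (fun (q : ℕ) (f : H [⋀^Fin (q + 1)]→ₗ[A] ExteriorAlgebra A Q) =>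
    f.curryLeft x) (fun _ => rfl) (DFinsupp.comapDomain' Nat.succ Nat.pred_succ w)
  map_add' _ _ := forms_ext fun _ _ => rfl
  map_smul' _ _ := forms_ext fun _ _ => rfl

theorem insertFirst_apply (x : H) (w : ExtForms A H Q) (q : ℕ) (v : Fin q → H) :
    insertFirst x w q v = w (q + 1) (Fin.cons (α := fun _ => H) x v) :=
  rfl

theorem insertFirst_toForm_succ (x : H) {q : ℕ}
    (f : H [⋀^Fin (q + 1)]→ₗ[A] ExteriorAlgebra A Q) :
    insertFirst x (toForm f) = toForm (f.curryLeft x) := by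
  refine forms_ext fun m v => ?_
  rw [insertFirst_apply]
  by_cases h : q = m
  · subst h
    rw [toForm_apply_self, toForm_apply_self]
    rfl
  · rw [toForm_apply_ne h, toForm_apply_ne (by omega)]
    rfl

theorem insertFirst_toForm_zero (x : H) (f : H [⋀^Fin 0]→ₗ[A] ExteriorAlgebra A Q) :
    insertFirst x (toForm f) = 0 := by
  refine forms_ext fun m v => ?_
  rw [insertFirst_apply, toForm_apply_ne (by omega)]
  rfl

theorem insertFirst_add (x y : H) (w : ExtForms A H Q) :
    insertFirst (x + y) w = insertFirst x w + insertFirst y w :=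
  forms_ext fun q v => congrArg (fun g : H [⋀^Fin q]→ₗ[A] ExteriorAlgebra A Q => g v)
    (map_add (w (q + 1)).curryLeft x y)

theorem insertFirst_smul (a : A) (x : H) (w : ExtForms A H Q) :
    insertFirst (a • x) w = a • insertFirst x w :=
  forms_ext fun q v => congrArg (fun g : H [⋀^Fin q]→ₗ[A] ExteriorAlgebra A Q => g v)
    (map_smul (w (q + 1)).curryLeft a x)

theorem insertFirst_self (x : H) (w : ExtForms A H Q) : insertFirst x (insertFirst x w) = 0 :=
  forms_ext fun q v => congrArg (fun g : H [⋀^Fin q]→ₗ[A] ExteriorAlgebra A Q => g v)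
    ((w (q + 2)).curryLeft_same x)

/-- Forms are detected by their contractions: a family of forms without constant terms vanishes if
every contraction of a member is a combination of members. -/
theorem eq_zero_of_insertFirst_mem {ι : Sort*} (T : ι → ExtForms A H Q)
    (h₀ : ∀ i, constTerm (T i) = 0)
    (h₁ : ∀ i x, insertFirst x (T i) ∈ AddSubgroup.closure (Set.range T)) (i : ι) : T i = 0 := by
  have h₀' : ∀ w ∈ AddSubgroup.closure (Set.range T), constTerm w = 0 := fun w hw => by
    induction hw using AddSubgroup.closure_induction with
    | mem w hw => obtain ⟨i, rfl⟩ := hw; exact h₀ i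
    | zero => exact map_zero _
    | add w w' _ _ hw hw' => rw [map_add, hw, hw', add_zero]
    | neg w _ hw => rw [map_neg, hw, neg_zero]
  have h₁' : ∀ w ∈ AddSubgroup.closure (Set.range T), ∀ x,
      insertFirst x w ∈ AddSubgroup.closure (Set.range T) := fun w hw x => by
    induction hw using AddSubgroup.closure_induction with
    | mem w hw => obtain ⟨i, rfl⟩ := hw; exact h₁ i x
    | zero => rw [map_zero]; exact zero_mem _
    | add w w' _ _ hw hw' => rw [map_add]; exact add_mem hw hw'
    | neg w _ hw => rw [map_neg]; exact neg_mem hw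
  have key : ∀ (q : ℕ) (v : Fin q → H), ∀ w ∈ AddSubgroup.closure (Set.range T), w q v = 0 := by
    intro q
    induction q with
    | zero => exact fun v w hw => (constTerm_apply w v).symm.trans (h₀' w hw)
    | succ q ih =>
      intro v w hw
      have := ih (Fin.tail v) _ (h₁' w hw (v 0))
      rwa [insertFirst_apply, Fin.cons_self_tail] at this
  exact forms_ext fun q v => key q v _ (AddSubgroup.subset_closure ⟨i, rfl⟩)

theorem eq_zero_of_insertFirst {w : ExtForms A H Q} (h₀ : constTerm w = 0)
    (h₁ : ∀ x, insertFirst x w = 0) : w = 0 :=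
  eq_zero_of_insertFirst_mem (fun _ : Unit => w) (fun _ => h₀)
    (fun _ x => by rw [h₁ x]; exact zero_mem _) ()

/-- The operator on forms that applies a linear map to the values. -/
def mapValues (N : ExteriorAlgebra A Q →ₗ[A] ExteriorAlgebra A Q) :
    ExtForms A H Q →ₗ[A] ExtForms A H Q where
  toFun w := DFinsupp.mapRange (fun (q : ℕ) (f : H [⋀^Fin q]→ₗ[A] ExteriorAlgebra A Q) =>
    N.compAlternatingMap f) (fun _ => AlternatingMap.ext fun _ => map_zero N) w
  map_add' _ _ := forms_ext fun _ _ => map_add N _ _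
  map_smul' _ _ := forms_ext fun _ _ => map_smul N _ _

theorem mapValues_apply (N : ExteriorAlgebra A Q →ₗ[A] ExteriorAlgebra A Q) (w : ExtForms A H Q)
    (q : ℕ) (v : Fin q → H) : mapValues N w q v = N (w q v) :=
  rfl

theorem constTerm_mapValues (N : ExteriorAlgebra A Q →ₗ[A] ExteriorAlgebra A Q)
    (w : ExtForms A H Q) : constTerm (mapValues N w) = N (constTerm w) :=
  rfl

theorem insertFirst_mapValues (x : H) (N : ExteriorAlgebra A Q →ₗ[A] ExteriorAlgebra A Q)
    (w : ExtForms A H Q) : insertFirst x (mapValues N w) = mapValues N (insertFirst x w) :=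
  forms_ext fun _ _ => rfl

/-- The main involution, which multiplies a homogeneous form by the parity of its total degree. -/
def parity : ExtForms A H Q →ₗ[A] ExtForms A H Q where
  toFun w := DFinsupp.mapRange (fun (q : ℕ) (f : H [⋀^Fin q]→ₗ[A] ExteriorAlgebra A Q) =>
    (-1 : ℤˣ) ^ q • CliffordAlgebra.involute.toLinearMap.compAlternatingMap f)
    (fun q => AlternatingMap.ext fun v => by simp) w
  map_add' w w' := forms_ext fun q v => by
    change (-1 : ℤˣ) ^ q • CliffordAlgebra.involute (w q v + w' q v) =
      (-1 : ℤˣ) ^ q • CliffordAlgebra.involute (w q v) +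
        (-1 : ℤˣ) ^ q • CliffordAlgebra.involute (w' q v)
    rw [map_add, smul_add]
  map_smul' a w := forms_ext fun q v => by
    change (-1 : ℤˣ) ^ q • CliffordAlgebra.involute (a • w q v) =
      a • (-1 : ℤˣ) ^ q • CliffordAlgebra.involute (w q v)
    rw [map_smul, smul_comm]

theorem parity_apply (w : ExtForms A H Q) (q : ℕ) (v : Fin q → H) :
    parity w q v = (-1 : ℤˣ) ^ q • CliffordAlgebra.involute (w q v) :=
  rfl

theorem constTerm_parity (w : ExtForms A H Q) :
    constTerm (parity w) = CliffordAlgebra.involute (constTerm w) :=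
  one_smul ℤˣ _

theorem insertFirst_parity (x : H) (w : ExtForms A H Q) :
    insertFirst x (parity w) = -parity (insertFirst x w) :=
  forms_ext fun q v => by
    rw [insertFirst_apply, parity_apply, pow_succ, mul_neg_one, Units.neg_smul]
    rfl

theorem parity_parity (w : ExtForms A H Q) : parity (parity w) = w :=
  forms_ext fun q v => by
    rw [parity_apply, parity_apply, ← AlgHom.toLinearMap_apply, LinearMap.map_smul_of_tower,
      AlgHom.toLinearMap_apply, smul_smul, ← mul_pow,
      CliffordAlgebra.involute_involute]
    simp

theorem parity_toForm {q : ℕ} (f : H [⋀^Fin q]→ₗ[A] ExteriorAlgebra A Q) :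
    parity (toForm f) =
      toForm ((-1 : ℤˣ) ^ q • CliffordAlgebra.involute.toLinearMap.compAlternatingMap f) :=
  forms_ext fun m v => by
    rw [parity_apply]
    by_cases h : q = m
    · subst h
      rw [toForm_apply_self, toForm_apply_self]
      rfl
    · rw [toForm_apply_ne h, toForm_apply_ne h]
      simp

end FormCalculus

/-! ### Contractions of a product of forms -/

section Product

variable {A H Q : Type*} [CommRing A] [AddCommGroup H] [Module A H] [AddCommGroup Q] [Module A Q]

theorem formMul_apply {q q' : ℕ} (f : H [⋀^Fin q]→ₗ[A] ExteriorAlgebra A Q)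
    (g : H [⋀^Fin q']→ₗ[A] ExteriorAlgebra A Q) (v : Fin (q + q') → H) :
    formMul f g v = (-1 : ℤˣ) ^ (q * q') • LinearMap.mul' A (ExteriorAlgebra A Q)
      (AlternatingMap.domCoprod f
        (((CliffordAlgebra.involute : ExteriorAlgebra A Q →ₐ[A] ExteriorAlgebra A Q).toLinearMap ^
          q).compAlternatingMap g) (fun i => v (finSumFinEquiv i))) :=
  rfl

theorem formMul_units_smul_right {q q' : ℕ} (u : ℤˣ) (f : H [⋀^Fin q]→ₗ[A] ExteriorAlgebra A Q)
    (g : H [⋀^Fin q']→ₗ[A] ExteriorAlgebra A Q) : formMul f (u • g) = u • formMul f g := by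
  have h : formMul f (-g) = -formMul f g :=
    map_neg (AddMonoidHom.mk' (formMul f) (formMul_add_right f)) g
  rcases Int.units_eq_one_or u with rfl | rfl
  · rw [one_smul, one_smul]
  · rw [Units.neg_smul, Units.neg_smul, one_smul, one_smul, h]

/-- The product of two forms of positive degree, with its first argument split off. -/
theorem formMul_apply_cons {q q' : ℕ} (f : H [⋀^Fin (q + 1)]→ₗ[A] ExteriorAlgebra A Q)
    (g : H [⋀^Fin (q' + 1)]→ₗ[A] ExteriorAlgebra A Q) (x : H) (v : Fin (q + 1 + q') → H)
    (w : Fin (q + 1 + (q' + 1)) → H) (hx : w ⟨0, by omega⟩ = x)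
    (hv : ∀ (i : ℕ) (hi : i < q + 1 + q'), w ⟨i + 1, by omega⟩ = v ⟨i, hi⟩) :
    formMul f g w =
      formMul (f.curryLeft x)
          ((-1 : ℤˣ) ^ (q' + 1) • CliffordAlgebra.involute.toLinearMap.compAlternatingMap g)
          (fun i => v (Fin.cast (by omega) i))
        + formMul f (g.curryLeft x) v := by
  have hx' : w (finSumFinEquiv (Sum.inl 0)) = x := hx
  rw [formMul_units_smul_right, AlternatingMap.smul_apply, formMul_apply, formMul_apply,
    formMul_apply, domCoprod_expand, map_sub, smul_sub, sub_eq_add_neg, smul_smul, hx']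
  congr 1
  · congr 1
    · rw [← pow_add]
      congr 1
      ring
    · congr 1
      have h : ∀ i : Fin q ⊕ Fin (q' + 1),
          w (finSumFinEquiv (optionSumLeft q (Fin (q' + 1)) (some i))) =
          v (Fin.cast (by omega) (finSumFinEquiv i)) := by
        rintro (i | j)
        · exact hv i (by omega)
        · refine Eq.trans (congrArg w (Fin.ext ?_)) (hv (q + j) (by omega))
          change q + 1 + (j : ℕ) = q + j + 1
          omega
      simp only [h]
      rfl
  · have h : ∀ i : Fin (q + 1) ⊕ Fin q', w (finSumFinEquiv (Equiv.swap (Sum.inl 0) (Sum.inr 0)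
            (optionSumRight (Fin (q + 1)) q' (some i)))) =
          v (finSumFinEquiv (Equiv.Perm.sumCongr (finRotate (q + 1))⁻¹ 1 i)) := by
      rintro (i | j)
      · cases i using Fin.cases with
        | zero =>
          have h1 : (finRotate (q + 1))⁻¹ 0 = Fin.last q := by
            rw [Equiv.Perm.inv_eq_iff_eq, finRotate_last]
          rw [Equiv.Perm.sumCongr_apply, Sum.map_inl, h1]
          exact hv q (by omega)
        | succ i =>
          have h1 : (finRotate (q + 1))⁻¹ i.succ = i.castSucc := by
            rw [Equiv.Perm.inv_eq_iff_eq, finRotate_apply, Fin.coeSucc_eq_succ]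
          rw [Equiv.Perm.sumCongr_apply, Sum.map_inl, h1]
          change w (finSumFinEquiv (Equiv.swap (Sum.inl 0) (Sum.inr 0) (Sum.inl i.succ))) = _
          rw [Equiv.swap_apply_of_ne_of_ne (by simp) (by simp)]
          exact hv i (by omega)
      · change w (finSumFinEquiv (Equiv.swap (Sum.inl 0) (Sum.inr 0) (Sum.inr j.succ))) = _
        rw [Equiv.swap_apply_of_ne_of_ne (by simp) (by simp)]
        exact hv (q + 1 + j) (by omega)
    simp only [h]
    have h2 := AlternatingMap.map_perm (f.domCoprod
      ((((CliffordAlgebra.involute : ExteriorAlgebra A Q →ₐ[A] ExteriorAlgebra A Q).toLinearMap ^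
          (q + 1)).compAlternatingMap (g.curryLeft x)))) (fun i => v (finSumFinEquiv i))
      (Equiv.Perm.sumCongr (finRotate (q + 1))⁻¹ 1)
    rw [Equiv.Perm.sign_sumCongr, Equiv.Perm.sign_inv, sign_finRotate, Nat.add_sub_cancel,
      map_one, mul_one] at h2
    refine (congrArg (fun z => -((-1 : ℤˣ) ^ ((q + 1) * (q' + 1)) •
      LinearMap.mul' A (ExteriorAlgebra A Q) z)) h2).trans ?_
    rw [LinearMap.map_smul_of_tower, smul_smul, ← Units.neg_smul, ← pow_add]
    congr 1
    have : (q + 1) * (q' + 1) + q = (q + 1) * q' + 2 * q + 1 := by ring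
    rw [this, pow_succ, pow_add, pow_mul]
    simp

theorem insertFirst_toForm_eq (x : H) {n m : ℕ} (h : n = m + 1)
    {F : H [⋀^Fin n]→ₗ[A] ExteriorAlgebra A Q} {G : H [⋀^Fin m]→ₗ[A] ExteriorAlgebra A Q}
    (hFG : ∀ (w : Fin n → H) (v : Fin m → H), w ⟨0, by omega⟩ = x →
      (∀ (i : ℕ) (hi : i < m), w ⟨i + 1, by omega⟩ = v ⟨i, hi⟩) → F w = G v) :
    insertFirst x (toForm F) = toForm G := by
  subst h
  rw [insertFirst_toForm_succ]
  congr 1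
  ext v
  exact hFG _ v rfl fun i hi => rfl

theorem insertFirst_formMul_zero_left (x : H) {q' : ℕ} (f : H [⋀^Fin 0]→ₗ[A] ExteriorAlgebra A Q)
    (g : H [⋀^Fin (q' + 1)]→ₗ[A] ExteriorAlgebra A Q) :
    insertFirst x (toForm (formMul f g)) = toForm (formMul f (g.curryLeft x)) := by
  refine insertFirst_toForm_eq x (by omega) fun w v hx hv => ?_
  rw [formMul_apply, formMul_apply, domCoprod_isEmpty_left, domCoprod_isEmpty_left,
    Nat.zero_mul, Nat.zero_mul]
  congr 3
  · exact congrArg f (Subsingleton.elim _ _)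
  · change g _ = g _
    congr 1
    funext i
    cases i using Fin.cases with
    | zero => exact hx
    | succ i =>
      refine Eq.trans (congrArg w (Fin.ext ?_)) (hv (0 + i) (by omega))
      simp

theorem insertFirst_formMul_zero_right (x : H) {q : ℕ}
    (f : H [⋀^Fin (q + 1)]→ₗ[A] ExteriorAlgebra A Q) (g : H [⋀^Fin 0]→ₗ[A] ExteriorAlgebra A Q) :
    insertFirst x (toForm (formMul f g)) = toForm (formMul (f.curryLeft x)
      (CliffordAlgebra.involute.toLinearMap.compAlternatingMap g)) := by
  refine insertFirst_toForm_eq x rfl fun w v hx hv => ?_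
  rw [formMul_apply, formMul_apply, domCoprod_isEmpty_right, domCoprod_isEmpty_right,
    Nat.mul_zero, Nat.mul_zero]
  congr 3
  · change f _ = f _
    congr 1
    funext i
    cases i using Fin.cases with
    | zero => exact hx
    | succ i => exact hv i (by omega)
  · rw [pow_succ]
    refine congrArg (fun z => ((CliffordAlgebra.involute :
      ExteriorAlgebra A Q →ₐ[A] ExteriorAlgebra A Q).toLinearMap ^ q)
        (CliffordAlgebra.involute (g z))) (Subsingleton.elim _ _)

theorem insertFirst_formMulₗ (x : H) (a b : ExtForms A H Q) :
    insertFirst x (formMulₗ A H Q a b) =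
      formMulₗ A H Q (insertFirst x a) (parity b) + formMulₗ A H Q a (insertFirst x b) := by
  induction a using forms_induction with
  | zero => simp
  | add a a' ha ha' => simp only [map_add, LinearMap.add_apply, ha, ha']; abel
  | form q f =>
    induction b using forms_induction with
    | zero => simp
    | add b b' hb hb' => simp only [map_add, hb, hb']; abel
    | form q' g =>
      rw [parity_toForm, formMulₗ_toForm]
      rcases q with _ | q <;> rcases q' with _ | q'
      · rw [insertFirst_toForm_zero x f, insertFirst_toForm_zero x g, map_zero, map_zero,
          LinearMap.zero_apply]
        exact (insertFirst_toForm_zero x (formMul f g)).trans (add_zero 0).symm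
      · rw [insertFirst_toForm_zero x f, insertFirst_toForm_succ x g, map_zero,
          LinearMap.zero_apply, formMulₗ_toForm]
        exact (insertFirst_formMul_zero_left x f g).trans (zero_add _).symm
      · rw [insertFirst_toForm_zero x g, insertFirst_toForm_succ x f, map_zero,
          formMulₗ_toForm, pow_zero, one_smul]
        exact (insertFirst_formMul_zero_right x f g).trans (add_zero _).symm
      · rw [insertFirst_toForm_succ x f, insertFirst_toForm_succ x g, formMulₗ_toForm,
          formMulₗ_toForm]
        rw [toForm_eq_toForm (show q + (q' + 1) = q + 1 + q' by omega)
          (g := ((formMul (f.curryLeft x) ((-1 : ℤˣ) ^ (q' + 1) •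
            CliffordAlgebra.involute.toLinearMap.compAlternatingMap g)).domDomCongr
              (finCongr (by omega)))) (fun v => rfl), ← toForm_add]
        exact insertFirst_toForm_eq x rfl fun w v hx hv => formMul_apply_cons f g x v w hx hv

theorem constTerm_formMulₗ (a b : ExtForms A H Q) :
    constTerm (formMulₗ A H Q a b) = constTerm a * constTerm b := by
  induction a using forms_induction with
  | zero => simp
  | add a a' ha ha' => simp only [map_add, LinearMap.add_apply, ha, ha', add_mul]
  | form q f =>
    induction b using forms_induction with
    | zero => simp
    | add b b' hb hb' => simp only [map_add, hb, hb', mul_add]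
    | form q' g =>
      rw [formMulₗ_toForm]
      rcases q with _ | q
      · rcases q' with _ | q'
        · have h : toForm (formMul f g) 0 = formMul f g := toForm_apply_self (q := 0) (formMul f g)
          change toForm (formMul f g) 0 ![] = toForm f 0 ![] * toForm g 0 ![]
          rw [h, toForm_apply_self, toForm_apply_self, formMul_apply, domCoprod_isEmpty_left]
          simp
          congr 2
        · change toForm (formMul f g) 0 ![] = toForm f 0 ![] * toForm g 0 ![]
          rw [toForm_apply_ne (by omega), toForm_apply_ne (show q' + 1 ≠ 0 by omega)]
          simp
      · change toForm (formMul f g) 0 ![] = toForm f 0 ![] * toForm g 0 ![]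
        rw [toForm_apply_ne (by omega), toForm_apply_ne (show q + 1 ≠ 0 by omega)]
        simp

end Product

/-! ### The ring of forms and its bigrading -/

section ExteriorGrading

variable {A Q : Type*} [CommRing A] [AddCommGroup Q] [Module A Q]

theorem ι_mul_eq_involute_mul (ξ : Q) (u : ExteriorAlgebra A Q) :
    ExteriorAlgebra.ι A ξ * u = CliffordAlgebra.involute u * ExteriorAlgebra.ι A ξ := by
  induction u using ExteriorAlgebra.induction with
  | algebraMap a => rw [AlgHom.commutes, Algebra.commutes]
  | ι η =>
    have h : CliffordAlgebra.involute (ExteriorAlgebra.ι A η) = -ExteriorAlgebra.ι A η :=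
      CliffordAlgebra.involute_ι η
    rw [h, neg_mul]
    exact eq_neg_of_add_eq_zero_left (ExteriorAlgebra.ι_add_mul_swap ξ η)
  | mul u v hu hv => rw [map_mul, ← mul_assoc, hu, mul_assoc, hv, mul_assoc]
  | add u v hu hv => rw [map_add, mul_add, hu, hv, add_mul]

theorem extPower_neg (p : ℤ) (h : p < 0) : extPower A Q p = ⊥ := by
  obtain ⟨n, rfl⟩ := Int.eq_negSucc_of_lt_zero h
  rfl

theorem extPower_natCast (p : ℕ) : extPower A Q (p : ℤ) = ⋀[A]^p Q :=
  rfl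

theorem extPower_induction {P : (p : ℤ) → ExteriorAlgebra A Q → Prop}
    (zero : ∀ p, P p 0) (add : ∀ p u v, P p u → P p v → P p (u + v))
    (scalar : ∀ a, P 0 (algebraMap A _ a))
    (mul : ∀ p ξ u, 0 ≤ p → u ∈ extPower A Q p → P p u → P (p + 1) (ExteriorAlgebra.ι A ξ * u))
    {p : ℤ} {u : ExteriorAlgebra A Q} (hu : u ∈ extPower A Q p) : P p u := by
  rcases lt_or_ge p 0 with hp | hp
  · rw [extPower_neg p hp, Submodule.mem_bot] at hu
    rw [hu]
    exact zero p
  · lift p to ℕ using hp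
    rw [extPower_natCast] at hu
    induction hu using Submodule.pow_induction_on_left' with
    | algebraMap a => exact scalar a
    | add u v p _ _ hu hv => exact add _ _ _ hu hv
    | mem_mul m hm p u hu ih =>
      obtain ⟨ξ, rfl⟩ := hm
      rw [Nat.succ_eq_add_one, Nat.cast_add, Nat.cast_one]
      exact mul _ ξ u (by omega) hu ih

theorem algebraMap_mem_extPower (a : A) : algebraMap A (ExteriorAlgebra A Q) a ∈ extPower A Q 0 := by
  change algebraMap A (ExteriorAlgebra A Q) a ∈ ⋀[A]^0 Q
  exact Submodule.algebraMap_mem a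

theorem ι_mem_extPower (ξ : Q) : ExteriorAlgebra.ι A ξ ∈ extPower A Q 1 := by
  change ExteriorAlgebra.ι A ξ ∈ LinearMap.range (ExteriorAlgebra.ι A) ^ 1
  rw [pow_one]
  exact ⟨ξ, rfl⟩

theorem mul_mem_extPower {p p' : ℤ} {u v : ExteriorAlgebra A Q} (hu : u ∈ extPower A Q p)
    (hv : v ∈ extPower A Q p') : u * v ∈ extPower A Q (p + p') := by
  rcases lt_or_ge p 0 with hp | hp
  · rw [extPower_neg p hp, Submodule.mem_bot] at hu
    rw [hu, zero_mul]
    exact zero_mem _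
  rcases lt_or_ge p' 0 with hp' | hp'
  · rw [extPower_neg p' hp', Submodule.mem_bot] at hv
    rw [hv, mul_zero]
    exact zero_mem _
  lift p to ℕ using hp
  lift p' to ℕ using hp'
  exact SetLike.mul_mem_graded (A := fun n : ℕ => ⋀[A]^n Q) hu hv

theorem involute_of_mem_extPower {p : ℤ} {u : ExteriorAlgebra A Q} (hu : u ∈ extPower A Q p) :
    CliffordAlgebra.involute u = p.negOnePow • u := by
  refine extPower_induction (P := fun p u => CliffordAlgebra.involute u = p.negOnePow • u)
    ?_ ?_ ?_ ?_ hu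
  · intro p
    simp
  · intro p u v hu hv
    rw [map_add, hu, hv, smul_add]
  · intro a
    rw [AlgHom.commutes, Int.negOnePow_zero, one_smul]
  · intro p ξ u _ _ hu
    have h : CliffordAlgebra.involute (ExteriorAlgebra.ι A ξ) = -ExteriorAlgebra.ι A ξ :=
      CliffordAlgebra.involute_ι ξ
    rw [map_mul, hu, h, Int.negOnePow_succ, neg_mul, mul_smul_comm, Units.neg_smul]

theorem mul_comm_of_mem_extPower {p p' : ℤ} {u v : ExteriorAlgebra A Q} (hu : u ∈ extPower A Q p)
    (hv : v ∈ extPower A Q p') : u * v = (p * p').negOnePow • (v * u) := by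
  refine extPower_induction (P := fun p u => u * v = (p * p').negOnePow • (v * u))
    ?_ ?_ ?_ ?_ hu
  · intro p
    simp
  · intro p u u' hu hu'
    rw [add_mul, hu, hu', mul_add, smul_add]
  · intro a
    rw [zero_mul, Int.negOnePow_zero, one_smul, Algebra.commutes]
  · intro p ξ u _ _ hu
    rw [mul_assoc, hu, mul_smul_comm, ← mul_assoc, ι_mul_eq_involute_mul,
      involute_of_mem_extPower hv, smul_mul_assoc, smul_mul_assoc, smul_smul,
      ← Int.negOnePow_add, mul_assoc]
    congr 2
    ring

end ExteriorGrading

section FormRing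

variable {A H Q : Type*} [CommRing A] [AddCommGroup H] [Module A H] [AddCommGroup Q] [Module A Q]

theorem toForm_apply_constTerm (u : ExteriorAlgebra A Q) : constTerm (ofExt H u) = u := by
  change toForm (AlternatingMap.constOfIsEmpty A H (Fin 0) u) 0 ![] = u
  rw [toForm_apply_self]
  rfl

theorem insertFirst_ofExt (x : H) (u : ExteriorAlgebra A Q) : insertFirst x (ofExt H u) = 0 :=
  insertFirst_toForm_zero x _

theorem ofExt_eq {w : ExtForms A H Q} {u : ExteriorAlgebra A Q} (h₀ : constTerm w = u)
    (h₁ : ∀ x, insertFirst x w = 0) : w = ofExt H u :=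
  sub_eq_zero.1 (eq_zero_of_insertFirst (by rw [map_sub, h₀, toForm_apply_constTerm, sub_self])
    fun x => by rw [map_sub, h₁, insertFirst_ofExt, sub_self])

theorem parity_ofExt (u : ExteriorAlgebra A Q) :
    parity (ofExt H u) = ofExt H (CliffordAlgebra.involute u) :=
  ofExt_eq (by rw [constTerm_parity, toForm_apply_constTerm])
    fun x => by rw [insertFirst_parity, insertFirst_ofExt, map_zero, neg_zero]

theorem formMulₗ_neg_left (a b : ExtForms A H Q) :
    formMulₗ A H Q (-a) b = -formMulₗ A H Q a b :=
  map_neg (AddMonoidHom.mk' (fun a => formMulₗ A H Q a b)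
    fun a a' => LinearMap.map_add₂ (formMulₗ A H Q) a a' b) a

theorem parity_formMulₗ (a b : ExtForms A H Q) :
    parity (formMulₗ A H Q a b) = formMulₗ A H Q (parity a) (parity b) := by
  refine sub_eq_zero.1 (eq_zero_of_insertFirst_mem (fun ab : ExtForms A H Q × ExtForms A H Q =>
    parity (formMulₗ A H Q ab.1 ab.2) - formMulₗ A H Q (parity ab.1) (parity ab.2)) ?_ ?_ (a, b))
  · rintro ⟨a, b⟩
    simp only [map_sub, constTerm_parity, constTerm_formMulₗ, map_mul, sub_self]
  · rintro ⟨a, b⟩ x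
    have : insertFirst x (parity (formMulₗ A H Q a b) - formMulₗ A H Q (parity a) (parity b)) =
        -(parity (formMulₗ A H Q (insertFirst x a) (parity b)) -
          formMulₗ A H Q (parity (insertFirst x a)) (parity (parity b))) -
        (parity (formMulₗ A H Q a (insertFirst x b)) -
          formMulₗ A H Q (parity a) (parity (insertFirst x b))) := by
      simp only [map_sub, insertFirst_parity, insertFirst_formMulₗ, map_add, map_neg,
        formMulₗ_neg_left]
      abel
    rw [this]
    exact sub_mem (neg_mem (AddSubgroup.subset_closure ⟨(_, _), rfl⟩))
      (AddSubgroup.subset_closure ⟨(_, _), rfl⟩)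

theorem formMulₗ_assoc (a b c : ExtForms A H Q) :
    formMulₗ A H Q (formMulₗ A H Q a b) c = formMulₗ A H Q a (formMulₗ A H Q b c) := by
  refine sub_eq_zero.1 (eq_zero_of_insertFirst_mem
    (fun t : ExtForms A H Q × ExtForms A H Q × ExtForms A H Q =>
    formMulₗ A H Q (formMulₗ A H Q t.1 t.2.1) t.2.2 -
      formMulₗ A H Q t.1 (formMulₗ A H Q t.2.1 t.2.2)) ?_ ?_ (a, b, c))
  · rintro ⟨a, b, c⟩
    simp only [map_sub, constTerm_formMulₗ, mul_assoc, sub_self]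
  · rintro ⟨a, b, c⟩ x
    have : insertFirst x (formMulₗ A H Q (formMulₗ A H Q a b) c -
        formMulₗ A H Q a (formMulₗ A H Q b c)) =
        (formMulₗ A H Q (formMulₗ A H Q (insertFirst x a) (parity b)) (parity c) -
          formMulₗ A H Q (insertFirst x a) (formMulₗ A H Q (parity b) (parity c))) +
        (formMulₗ A H Q (formMulₗ A H Q a (insertFirst x b)) (parity c) -
          formMulₗ A H Q a (formMulₗ A H Q (insertFirst x b) (parity c))) +
        (formMulₗ A H Q (formMulₗ A H Q a b) (insertFirst x c) -
          formMulₗ A H Q a (formMulₗ A H Q b (insertFirst x c))) := by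
      simp only [map_sub, insertFirst_formMulₗ, map_add, parity_formMulₗ, LinearMap.add_apply]
      abel
    rw [this]
    exact add_mem (add_mem (AddSubgroup.subset_closure ⟨(_, _, _), rfl⟩)
      (AddSubgroup.subset_closure ⟨(_, _, _), rfl⟩)) (AddSubgroup.subset_closure ⟨(_, _, _), rfl⟩)

theorem formMulₗ_ofExt_one_left (a : ExtForms A H Q) : formMulₗ A H Q (ofExt H 1) a = a := by
  refine sub_eq_zero.1 (eq_zero_of_insertFirst_mem (fun a : ExtForms A H Q =>
    formMulₗ A H Q (ofExt H 1) a - a) ?_ ?_ a)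
  · intro a
    rw [map_sub, constTerm_formMulₗ, toForm_apply_constTerm, one_mul, sub_self]
  · intro a x
    refine AddSubgroup.subset_closure ⟨insertFirst x a, ?_⟩
    simp only [map_sub, insertFirst_formMulₗ, insertFirst_ofExt, map_zero, LinearMap.zero_apply,
      zero_add]

theorem formMulₗ_ofExt_one_right (a : ExtForms A H Q) : formMulₗ A H Q a (ofExt H 1) = a := by
  refine sub_eq_zero.1 (eq_zero_of_insertFirst_mem (fun a : ExtForms A H Q =>
    formMulₗ A H Q a (ofExt H 1) - a) ?_ ?_ a)
  · intro a
    rw [map_sub, constTerm_formMulₗ, toForm_apply_constTerm, mul_one, sub_self]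
  · intro a x
    refine AddSubgroup.subset_closure ⟨insertFirst x a, ?_⟩
    simp only [map_sub, insertFirst_formMulₗ, insertFirst_ofExt, parity_ofExt, map_one, map_zero,
      add_zero]

/-- The ring structure on `Alt_A(H, Λ_A Q)`. -/
abbrev formRing (A H Q : Type*) [CommRing A] [AddCommGroup H] [Module A H] [AddCommGroup Q]
    [Module A Q] : Ring (ExtForms A H Q) :=
  { (inferInstance : AddCommGroup (ExtForms A H Q)) with
    mul := fun a b => formMulₗ A H Q a b
    one := ofExt H 1
    mul_assoc := formMulₗ_assoc
    one_mul := formMulₗ_ofExt_one_left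
    mul_one := formMulₗ_ofExt_one_right
    left_distrib := fun a b c => map_add (formMulₗ A H Q a) b c
    right_distrib := fun a b c => LinearMap.map_add₂ (formMulₗ A H Q) a b c
    zero_mul := fun a => LinearMap.map_zero₂ (formMulₗ A H Q) a
    mul_zero := fun a => map_zero (formMulₗ A H Q a) }

attribute [local instance] formRing

theorem formMulₗ_eq_mul (a b : ExtForms A H Q) : formMulₗ A H Q a b = a * b :=
  rfl

theorem smul_formMul (c : A) (a b : ExtForms A H Q) : c • a * b = c • (a * b) :=
  LinearMap.map_smul₂ (formMulₗ A H Q) c a b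

theorem formMul_smul (c : A) (a b : ExtForms A H Q) : a * c • b = c • (a * b) :=
  map_smul (formMulₗ A H Q a) c b

theorem insertFirst_mul (x : H) (a b : ExtForms A H Q) :
    insertFirst x (a * b) = insertFirst x a * parity b + a * insertFirst x b :=
  insertFirst_formMulₗ x a b

theorem constTerm_mul (a b : ExtForms A H Q) : constTerm (a * b) = constTerm a * constTerm b :=
  constTerm_formMulₗ a b

theorem parity_mul (a b : ExtForms A H Q) : parity (a * b) = parity a * parity b :=
  parity_formMulₗ a b

theorem ofExt_mul (u v : ExteriorAlgebra A Q) : ofExt H (u * v) = ofExt H u * ofExt H v :=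
  (ofExt_eq (by rw [constTerm_mul, toForm_apply_constTerm, toForm_apply_constTerm])
    fun x => by simp only [insertFirst_mul, insertFirst_ofExt, zero_mul, mul_zero, add_zero]).symm

end FormRing

section FormGrading

variable {R A H Q : Type*} [CommRing R] [CommRing A] [Algebra R A] [AddCommGroup H] [Module A H]
  [AddCommGroup Q] [Module R Q] [Module A Q] [IsScalarTower R A Q]

theorem mem_gr_iff {q p : ℤ} {w : ExtForms A H Q} : w ∈ (formsAlgebra R A H Q).gr q p ↔
    ∀ (m : ℕ) (v : Fin m → H), w m v ∈ extPower A Q p ∧ ((m : ℤ) ≠ q → w m v = 0) := by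
  constructor
  · exact fun h m v => ⟨h.2 m v, fun hm => by rw [h.1 m hm]; rfl⟩
  · exact fun h => ⟨fun m hm => AlternatingMap.ext fun v => (h m v).2 hm, fun m v => (h m v).1⟩

/-- Bidegrees can be checked on constant terms and contractions: a family of forms has the expected
bidegrees if the contractions of its members are combinations of members, and of forms that are
already known to be homogeneous, of the bidegree lowered by `(1, 0)`. -/
theorem mem_gr_of_insertFirst {ι : Sort*} (T : ι → ExtForms A H Q) (q p : ι → ℤ)
    (h₀ : ∀ i, constTerm (T i) ∈ extPower A Q (p i) ∧ (q i ≠ 0 → constTerm (T i) = 0))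
    (h₁ : ∀ i x, insertFirst x (T i) ∈ AddSubgroup.closure
      ({w | ∃ j, w = T j ∧ q j = q i - 1 ∧ p j = p i} ∪
        {w | w ∈ (formsAlgebra R A H Q).gr (q i - 1) (p i)})) (i : ι) :
    T i ∈ (formsAlgebra R A H Q).gr (q i) (p i) := by
  have key : ∀ (m : ℕ) (i : ι) (v : Fin m → H),
      T i m v ∈ extPower A Q (p i) ∧ ((m : ℤ) ≠ q i → T i m v = 0) := by
    intro m
    induction m with
    | zero =>
      intro i v
      rw [← constTerm_apply]
      exact ⟨(h₀ i).1, fun h => (h₀ i).2 (by simpa using h.symm)⟩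
    | succ m ih =>
      intro i v
      have h := h₁ i (v 0)
      have h2 : T i (m + 1) v = insertFirst (v 0) (T i) m (Fin.tail v) := by
        rw [insertFirst_apply, Fin.cons_self_tail]
      rw [h2]
      generalize insertFirst (v 0) (T i) = w at h
      induction h using AddSubgroup.closure_induction with
      | mem w hw =>
        rcases hw with ⟨j, rfl, hq, hp⟩ | hw
        · rw [← hp]
          exact ⟨(ih j _).1, fun hm => (ih j _).2 (by push_cast at hm; omega)⟩
        · exact ⟨((mem_gr_iff (R := R)).1 hw m _).1,
            fun hm => ((mem_gr_iff (R := R)).1 hw m _).2 (by push_cast at hm; omega)⟩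
      | zero => exact ⟨zero_mem _, fun _ => rfl⟩
      | add w w' _ _ hw hw' =>
        exact ⟨add_mem hw.1 hw'.1, fun hm => by
          rw [DirectSum.add_apply, AlternatingMap.add_apply, hw.2 hm, hw'.2 hm, add_zero]⟩
      | neg w _ hw =>
        exact ⟨neg_mem hw.1, fun hm => (congrArg Neg.neg (hw.2 hm)).trans neg_zero⟩
  exact mem_gr_iff.2 fun m v => key m i v

theorem insertFirst_mem {q p : ℤ} {w : ExtForms A H Q} (h : w ∈ (formsAlgebra R A H Q).gr q p)
    (x : H) : insertFirst x w ∈ (formsAlgebra R A H Q).gr (q - 1) p := by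
  rw [mem_gr_iff] at h ⊢
  intro m v
  rw [insertFirst_apply]
  exact ⟨(h _ _).1, fun hm => (h _ _).2 (by push_cast; omega)⟩

theorem parity_of_mem {q p : ℤ} {w : ExtForms A H Q} (h : w ∈ (formsAlgebra R A H Q).gr q p) :
    parity w = (p - q).negOnePow • w := by
  rw [mem_gr_iff] at h
  refine forms_ext fun m v => ?_
  change _ = (p - q).negOnePow • w m v
  rw [parity_apply]
  by_cases hm : (m : ℤ) = q
  · rw [involute_of_mem_extPower (h m v).1, smul_smul, ← hm, Int.negOnePow_sub,
      mul_comm]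
    rfl
  · rw [(h m v).2 hm, map_zero, smul_zero, smul_zero]

theorem neg_mem_gr {q p : ℤ} {w : ExtForms A H Q} (h : w ∈ (formsAlgebra R A H Q).gr q p) :
    -w ∈ (formsAlgebra R A H Q).gr q p := by
  rw [mem_gr_iff] at h ⊢
  exact fun m v => ⟨neg_mem (h m v).1, fun hm => (congrArg Neg.neg ((h m v).2 hm)).trans neg_zero⟩

theorem sub_mem_gr {q p : ℤ} {w w' : ExtForms A H Q} (h : w ∈ (formsAlgebra R A H Q).gr q p)
    (h' : w' ∈ (formsAlgebra R A H Q).gr q p) : w - w' ∈ (formsAlgebra R A H Q).gr q p := by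
  rw [sub_eq_add_neg]
  exact add_mem h (neg_mem_gr h')

theorem units_smul_mem {q p : ℤ} {w : ExtForms A H Q} (h : w ∈ (formsAlgebra R A H Q).gr q p)
    (u : ℤˣ) : u • w ∈ (formsAlgebra R A H Q).gr q p := by
  rcases Int.units_eq_one_or u with rfl | rfl
  · rwa [one_smul]
  · rw [Units.neg_smul, one_smul]
    exact neg_mem_gr h

theorem parity_mem {q p : ℤ} {w : ExtForms A H Q} (h : w ∈ (formsAlgebra R A H Q).gr q p) :
    parity w ∈ (formsAlgebra R A H Q).gr q p := by
  rw [parity_of_mem h]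
  exact units_smul_mem h _

theorem constTerm_of_mem {q p : ℤ} {w : ExtForms A H Q} (h : w ∈ (formsAlgebra R A H Q).gr q p) :
    constTerm w ∈ extPower A Q p ∧ (q ≠ 0 → constTerm w = 0) :=
  ⟨(mem_gr_iff.1 h 0 ![]).1, fun hq => (mem_gr_iff.1 h 0 ![]).2 (by simpa using hq.symm)⟩

theorem toForm_mem {q : ℕ} {p : ℤ} {f : H [⋀^Fin q]→ₗ[A] ExteriorAlgebra A Q}
    (h : ∀ v, f v ∈ extPower A Q p) : toForm f ∈ (formsAlgebra R A H Q).gr q p := by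
  refine mem_gr_iff.2 fun m v => ?_
  by_cases hm : q = m
  · subst hm
    rw [toForm_apply_self]
    exact ⟨h v, fun hq => absurd rfl hq⟩
  · rw [toForm_apply_ne hm]
    exact ⟨zero_mem _, fun _ => rfl⟩

theorem ofExt_mem {p : ℤ} {u : ExteriorAlgebra A Q} (h : u ∈ extPower A Q p) :
    ofExt H u ∈ (formsAlgebra R A H Q).gr 0 p :=
  toForm_mem (q := 0) fun _ => h

theorem ofScalarForm_mem {q : ℕ} (α : H [⋀^Fin q]→ₗ[A] A) :
    ofScalarForm Q α ∈ (formsAlgebra R A H Q).gr q 0 :=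
  toForm_mem fun _ => algebraMap_mem_extPower _

theorem gr_eq_zero {q p : ℤ} (h : q < 0 ∨ p < 0) {w : ExtForms A H Q}
    (hw : w ∈ (formsAlgebra R A H Q).gr q p) : w = 0 := by
  rw [mem_gr_iff] at hw
  refine forms_ext fun m v => ?_
  rcases h with h | h
  · exact (hw m v).2 (by omega)
  · have := (hw m v).1
    rwa [extPower_neg p h, Submodule.mem_bot] at this

attribute [local instance] formRing

theorem formsAlgebra_mul (a b : ExtForms A H Q) : (formsAlgebra R A H Q).mul a b = a * b :=
  rfl

theorem one_mem_gr : (1 : ExtForms A H Q) ∈ (formsAlgebra R A H Q).gr 0 0 :=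
  ofExt_mem (by simpa using algebraMap_mem_extPower (Q := Q) (1 : A))

theorem mul_mem_gr {q p q' p' : ℤ} {a b : ExtForms A H Q} (ha : a ∈ (formsAlgebra R A H Q).gr q p)
    (hb : b ∈ (formsAlgebra R A H Q).gr q' p') :
    a * b ∈ (formsAlgebra R A H Q).gr (q + q') (p + p') := by
  refine mem_gr_of_insertFirst (R := R) (ι := {t : (ℤ × ℤ) × ExtForms A H Q × ExtForms A H Q //
    t.2.1 ∈ (formsAlgebra R A H Q).gr t.1.1 p ∧ t.2.2 ∈ (formsAlgebra R A H Q).gr t.1.2 p'})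
    (fun t => t.1.2.1 * t.1.2.2) (fun t => t.1.1.1 + t.1.1.2) (fun _ => p + p') ?_ ?_
    ⟨((q, q'), a, b), ha, hb⟩
  · rintro ⟨⟨⟨q, q'⟩, a, b⟩, ha, hb⟩
    dsimp only at ha hb ⊢
    rw [constTerm_mul]
    refine ⟨mul_mem_extPower (constTerm_of_mem ha).1 (constTerm_of_mem hb).1, fun h => ?_⟩
    by_cases hq : q = 0
    · rw [(constTerm_of_mem hb).2 (by omega), mul_zero]
    · rw [(constTerm_of_mem ha).2 hq, zero_mul]
  · rintro ⟨⟨⟨q, q'⟩, a, b⟩, ha, hb⟩ x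
    dsimp only at ha hb ⊢
    rw [insertFirst_mul]
    refine add_mem (AddSubgroup.subset_closure (Or.inl
      ⟨⟨((q - 1, q'), _, _), insertFirst_mem ha x, parity_mem hb⟩, rfl, ?_, rfl⟩))
      (AddSubgroup.subset_closure (Or.inl
        ⟨⟨((q, q' - 1), _, _), ha, insertFirst_mem hb x⟩, rfl, ?_, rfl⟩)) <;>
    · dsimp only
      omega

theorem mul_comm_gr {q p q' p' : ℤ} {a b : ExtForms A H Q}
    (ha : a ∈ (formsAlgebra R A H Q).gr q p) (hb : b ∈ (formsAlgebra R A H Q).gr q' p') :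
    a * b = ((p - q) * (p' - q')).negOnePow • (b * a) := by
  refine sub_eq_zero.1 (eq_zero_of_insertFirst_mem
    (ι := {t : (ℤ × ℤ) × ExtForms A H Q × ExtForms A H Q //
    t.2.1 ∈ (formsAlgebra R A H Q).gr t.1.1 p ∧ t.2.2 ∈ (formsAlgebra R A H Q).gr t.1.2 p'})
    (fun t => t.1.2.1 * t.1.2.2 - ((p - t.1.1.1) * (p' - t.1.1.2)).negOnePow •
      (t.1.2.2 * t.1.2.1)) ?_ ?_ ⟨((q, q'), a, b), ha, hb⟩)
  · rintro ⟨⟨⟨q, q'⟩, a, b⟩, ha, hb⟩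
    dsimp only at ha hb ⊢
    rw [map_sub, LinearMap.map_smul_of_tower, constTerm_mul, constTerm_mul, sub_eq_zero]
    by_cases hq : q = 0
    · by_cases hq' : q' = 0
      · rw [hq, hq', sub_zero, sub_zero]
        exact mul_comm_of_mem_extPower (constTerm_of_mem ha).1 (constTerm_of_mem hb).1
      · rw [(constTerm_of_mem hb).2 hq', mul_zero, zero_mul, smul_zero]
    · rw [(constTerm_of_mem ha).2 hq, mul_zero, zero_mul, smul_zero]
  · rintro ⟨⟨⟨q, q'⟩, a, b⟩, ha, hb⟩ x
    dsimp only at ha hb ⊢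
    -- the contraction of a graded commutator is a combination of graded commutators
    have : insertFirst x (a * b - ((p - q) * (p' - q')).negOnePow • (b * a)) =
        (p' - q').negOnePow • (insertFirst x a * b -
          ((p - (q - 1)) * (p' - q')).negOnePow • (b * insertFirst x a)) +
        (a * insertFirst x b - ((p - q) * (p' - (q' - 1))).negOnePow • (insertFirst x b * a)) := by
      rw [map_sub, LinearMap.map_smul_of_tower, insertFirst_mul, insertFirst_mul,
        parity_of_mem ha, parity_of_mem hb, smul_sub, smul_smul, ← Int.negOnePow_add,
        mul_smul_comm, mul_smul_comm, smul_add, smul_smul, ← Int.negOnePow_add,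
        show (p' - q') + (p - (q - 1)) * (p' - q') = (p - q) * (p' - q') + 2 * (p' - q') by ring,
        show (p - q) * (p' - (q' - 1)) = (p - q) * (p' - q') + (p - q) by ring,
        Int.negOnePow_add _ (2 * (p' - q')), Int.negOnePow_two_mul, mul_one]
      abel
    rw [this]
    have h1 : insertFirst x a * b -
          ((p - (q - 1)) * (p' - q')).negOnePow • (b * insertFirst x a) ∈
          AddSubgroup.closure (Set.range fun t : {t : (ℤ × ℤ) × ExtForms A H Q × ExtForms A H Q //
            t.2.1 ∈ (formsAlgebra R A H Q).gr t.1.1 p ∧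
              t.2.2 ∈ (formsAlgebra R A H Q).gr t.1.2 p'} => t.1.2.1 * t.1.2.2 -
            ((p - t.1.1.1) * (p' - t.1.1.2)).negOnePow • (t.1.2.2 * t.1.2.1)) :=
      AddSubgroup.subset_closure ⟨⟨((q - 1, q'), _, _), insertFirst_mem ha x, hb⟩, rfl⟩
    refine add_mem ?_
      (AddSubgroup.subset_closure ⟨⟨((q, q' - 1), _, _), ha, insertFirst_mem hb x⟩, rfl⟩)
    rcases Int.units_eq_one_or (p' - q').negOnePow with h | h <;> rw [h]
    · rwa [one_smul]
    · rw [Units.neg_smul, one_smul]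
      exact neg_mem h1

end FormGrading

/-! ### Derivations of graded commutative rings -/

section GradedDerivations

variable {V : Type*} [Ring V]

/-- Reduces sign computations to the parities of the degrees. -/
theorem negOnePow_smul_eq_ite (n : ℤ) (x : V) :
    n.negOnePow • x = if Even n then x else -x := by
  split_ifs with h
  · rw [Int.negOnePow_even n h, one_smul]
  · rw [Int.negOnePow_odd n (Int.not_even_iff_odd.1 h), Units.neg_smul, one_smul]

/-- A family of additive subgroups of a ring `V` is a graded commutative grading, except that `V`
need not be their direct sum, only their sum. -/
structure IsGradedComm (𝒱 : ℤ → AddSubgroup V) : Prop where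
  one_mem : 1 ∈ 𝒱 0
  mul_mem : ∀ {i j : ℤ} {a b : V}, a ∈ 𝒱 i → b ∈ 𝒱 j → a * b ∈ 𝒱 (i + j)
  mul_comm : ∀ {i j : ℤ} {a b : V}, a ∈ 𝒱 i → b ∈ 𝒱 j → a * b = (i * j).negOnePow • (b * a)
  mem_closure : ∀ a : V, a ∈ AddSubgroup.closure {b | ∃ i, b ∈ 𝒱 i}

/-- `X` is a derivation of degree `n`. -/
structure IsDer (𝒱 : ℤ → AddSubgroup V) (n : ℤ) (X : V → V) : Prop where
  map_add : ∀ a b, X (a + b) = X a + X b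
  mem : ∀ {i : ℤ} {a : V}, a ∈ 𝒱 i → X a ∈ 𝒱 (n + i)
  leibniz : ∀ {i : ℤ} {a : V} (b : V), a ∈ 𝒱 i →
    X (a * b) = X a * b + (n * i).negOnePow • (a * X b)

variable {𝒱 : ℤ → AddSubgroup V}

theorem units_smul_mem_addSubgroup {S : AddSubgroup V} {a : V} (u : ℤˣ) (h : a ∈ S) :
    u • a ∈ S := by
  rcases Int.units_eq_one_or u with rfl | rfl
  · rwa [one_smul]
  · rw [Units.neg_smul, one_smul]
    exact neg_mem h

namespace IsDer

variable {n m : ℤ} {X Y : V → V}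

theorem map_zero (hX : IsDer 𝒱 n X) : X 0 = 0 :=
  _root_.map_zero (AddMonoidHom.mk' X hX.map_add)

theorem map_neg (hX : IsDer 𝒱 n X) (a : V) : X (-a) = -X a :=
  _root_.map_neg (AddMonoidHom.mk' X hX.map_add) a

theorem map_sub (hX : IsDer 𝒱 n X) (a b : V) : X (a - b) = X a - X b :=
  _root_.map_sub (AddMonoidHom.mk' X hX.map_add) a b

theorem map_units_smul (hX : IsDer 𝒱 n X) (u : ℤˣ) (a : V) : X (u • a) = u • X a := by
  rcases Int.units_eq_one_or u with rfl | rfl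
  · rw [one_smul, one_smul]
  · rw [Units.neg_smul, one_smul, hX.map_neg, Units.neg_smul, one_smul]

theorem map_one (hX : IsDer 𝒱 n X) (h : IsGradedComm 𝒱) : X 1 = 0 := by
  have := hX.leibniz 1 h.one_mem
  rw [one_mul, mul_one, one_mul, mul_zero, Int.negOnePow_zero, one_smul] at this
  exact left_eq_add.1 this

theorem congr (hX : IsDer 𝒱 n X) (hn : n = m) (h : ∀ a, Y a = X a) : IsDer 𝒱 m Y := by
  obtain rfl : Y = X := funext h
  exact hn ▸ hX

theorem zero : IsDer 𝒱 n fun _ => 0 where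
  map_add _ _ := (add_zero 0).symm
  mem _ := zero_mem _
  leibniz _ _ := by rw [zero_mul, mul_zero, smul_zero, add_zero]

theorem add (hX : IsDer 𝒱 n X) (hY : IsDer 𝒱 n Y) : IsDer 𝒱 n fun a => X a + Y a where
  map_add a b := by rw [hX.map_add, hY.map_add]; abel
  mem h := add_mem (hX.mem h) (hY.mem h)
  leibniz b h := by rw [hX.leibniz b h, hY.leibniz b h, add_mul, mul_add, smul_add]; abel

theorem neg (hX : IsDer 𝒱 n X) : IsDer 𝒱 n fun a => -X a where
  map_add a b := by rw [hX.map_add]; abel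
  mem h := neg_mem (hX.mem h)
  leibniz b h := by rw [hX.leibniz b h, neg_mul, mul_neg, smul_neg]; abel

theorem sub (hX : IsDer 𝒱 n X) (hY : IsDer 𝒱 n Y) : IsDer 𝒱 n fun a => X a - Y a :=
  (hX.add hY.neg).congr rfl fun _ => sub_eq_add_neg _ _

theorem units_smul (u : ℤˣ) (hX : IsDer 𝒱 n X) : IsDer 𝒱 n fun a => u • X a := by
  rcases Int.units_eq_one_or u with rfl | rfl
  · exact hX.congr rfl fun _ => one_smul _ _
  · exact hX.neg.congr rfl fun _ => by rw [Units.neg_smul, one_smul]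

theorem sum {ι : Type*} (s : Finset ι) {X : ι → V → V} (h : ∀ i, IsDer 𝒱 n (X i)) :
    IsDer 𝒱 n fun a => ∑ i ∈ s, X i a := by
  classical
  induction s using Finset.induction_on with
  | empty => exact zero.congr rfl fun _ => Finset.sum_empty
  | insert i s hi ih => exact ((h i).add ih).congr rfl fun _ => Finset.sum_insert hi

theorem mul_left (h : IsGradedComm 𝒱) {c : V} (hc : c ∈ 𝒱 m) (hX : IsDer 𝒱 n X) :
    IsDer 𝒱 (m + n) fun a => c * X a where
  map_add a b := by rw [hX.map_add, mul_add]
  mem ha := by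
    rw [add_assoc]
    exact h.mul_mem hc (hX.mem ha)
  leibniz {i a} b ha := by
    rw [hX.leibniz b ha, mul_add, mul_smul_comm, ← mul_assoc, ← mul_assoc, h.mul_comm hc ha,
      smul_mul_assoc, smul_smul, ← Int.negOnePow_add, mul_assoc a]
    congr 3
    ring

theorem of_homogeneous (h : IsGradedComm 𝒱) (hadd : ∀ a b, X (a + b) = X a + X b)
    (hmem : ∀ {i : ℤ} {a : V}, a ∈ 𝒱 i → X a ∈ 𝒱 (n + i))
    (hmul : ∀ {i j : ℤ} {a b : V}, a ∈ 𝒱 i → b ∈ 𝒱 j →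
      X (a * b) = X a * b + (n * i).negOnePow • (a * X b)) : IsDer 𝒱 n X where
  map_add := hadd
  mem := hmem
  leibniz {i a} b ha := by
    have hneg : ∀ c, X (-c) = -X c := _root_.map_neg (AddMonoidHom.mk' X hadd)
    have h0 : X 0 = 0 := _root_.map_zero (AddMonoidHom.mk' X hadd)
    induction h.mem_closure b using AddSubgroup.closure_induction with
    | mem b hb => exact hmul ha hb.choose_spec
    | zero => rw [mul_zero, h0, mul_zero, mul_zero, smul_zero, add_zero]
    | add b c _ _ hb hc => rw [mul_add, hadd, hb, hc, hadd, mul_add, mul_add, smul_add]; abel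
    | neg b _ hb => rw [mul_neg, hneg, hb, hneg, mul_neg, mul_neg, smul_neg]; abel

/-- A derivation that vanishes on homogeneous generators is zero. -/
theorem eq_zero_of_generators (hX : IsDer 𝒱 n X) (h : IsGradedComm 𝒱) {S : Set V}
    (hS : ∀ a ∈ S, ∃ i, a ∈ 𝒱 i)
    (hgen : ∀ a : V, a ∈ AddSubgroup.closure (Submonoid.closure S : Set V))
    (h₀ : ∀ a ∈ S, X a = 0) (a : V) : X a = 0 := by
  induction hgen a using AddSubgroup.closure_induction with
  | mem b hb =>
    induction hb using Submonoid.closure_induction_left with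
    | one => exact hX.map_one h
    | mul_left a ha b _ hb =>
      obtain ⟨i, hi⟩ := hS a ha
      rw [hX.leibniz b hi, h₀ a ha, hb, zero_mul, mul_zero, smul_zero, add_zero]
  | zero => exact hX.map_zero
  | add b c _ _ hb hc => rw [hX.map_add, hb, hc, add_zero]
  | neg b _ hb => rw [hX.map_neg, hb, neg_zero]

theorem comm (hX : IsDer 𝒱 n X) (hY : IsDer 𝒱 m Y) :
    IsDer 𝒱 (n + m) fun a => X (Y a) - (n * m).negOnePow • Y (X a) where
  map_add a b := by
    rw [hY.map_add, hX.map_add, hX.map_add, hY.map_add, smul_add]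
    abel
  mem {i a} h := by
    refine sub_mem ?_ (units_smul_mem_addSubgroup _ ?_)
    · rw [add_assoc]
      exact hX.mem (hY.mem h)
    · rw [add_comm n, add_assoc]
      exact hY.mem (hX.mem h)
  leibniz {i a} b h := by
    rw [hY.leibniz b h, hX.leibniz b h, hX.map_add, hY.map_add, hX.map_units_smul,
      hY.map_units_smul, hX.leibniz b (hY.mem h), hX.leibniz _ h, hY.leibniz b (hX.mem h),
      hY.leibniz _ h]
    by_cases h1 : Even n <;> by_cases h2 : Even m <;> by_cases h3 : Even i <;>
    · simp only [negOnePow_smul_eq_ite, Int.even_add, Int.even_mul, h1, h2, h3, if_true, if_false,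
        or_true, or_false, iff_true, iff_false, not_true_eq_false, sub_mul, mul_sub, add_mul, neg_mul, mul_neg, neg_neg, smul_sub, smul_neg, smul_add]
      abel

end IsDer

end GradedDerivations

/-! ### Differential operators on graded commutative rings -/

section DifferentialOperators

variable {V : Type*} [Ring V] {𝒱 : ℤ → AddSubgroup V}

/-- The graded commutator of an operator `T` of degree `n` with the left multiplication by an
element `a` of degree `i`. -/
def commMul (n : ℤ) (T : V → V) (i : ℤ) (a b : V) : V :=
  T (a * b) - (n * i).negOnePow • (a * T b)

/-- `T` is a differential operator of degree `n` and of order less than `k`, in the recursive sense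
of Grothendieck. -/
def IsDiffOp (𝒱 : ℤ → AddSubgroup V) : ℕ → ℤ → (V → V) → Prop
  | 0, _, T => ∀ b, T b = 0
  | k + 1, n, T => (∀ a b, T (a + b) = T a + T b) ∧ (∀ {i : ℤ} {a : V}, a ∈ 𝒱 i → T a ∈ 𝒱 (n + i)) ∧
      ∀ {i : ℤ} {a : V}, a ∈ 𝒱 i → IsDiffOp 𝒱 k (n + i) (commMul n T i a)

namespace IsDiffOp

variable {k l : ℕ} {n m : ℤ} {T S : V → V}

theorem congr (hT : IsDiffOp 𝒱 k n T) (hn : n = m) (h : ∀ a, S a = T a) : IsDiffOp 𝒱 k m S := by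
  obtain rfl : S = T := funext h
  exact hn ▸ hT

theorem map_add (hT : IsDiffOp 𝒱 k n T) (a b : V) : T (a + b) = T a + T b := by
  cases k with
  | zero => rw [hT, hT, hT, add_zero]
  | succ k => exact hT.1 a b

theorem map_zero (hT : IsDiffOp 𝒱 k n T) : T 0 = 0 :=
  _root_.map_zero (AddMonoidHom.mk' T hT.map_add)

theorem map_neg (hT : IsDiffOp 𝒱 k n T) (a : V) : T (-a) = -T a :=
  _root_.map_neg (AddMonoidHom.mk' T hT.map_add) a

theorem map_sub (hT : IsDiffOp 𝒱 k n T) (a b : V) : T (a - b) = T a - T b :=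
  _root_.map_sub (AddMonoidHom.mk' T hT.map_add) a b

theorem map_units_smul (hT : IsDiffOp 𝒱 k n T) (u : ℤˣ) (a : V) : T (u • a) = u • T a := by
  rcases Int.units_eq_one_or u with rfl | rfl
  · rw [one_smul, one_smul]
  · rw [Units.neg_smul, one_smul, hT.map_neg, Units.neg_smul, one_smul]

theorem mem (hT : IsDiffOp 𝒱 k n T) {i : ℤ} {a : V} (ha : a ∈ 𝒱 i) : T a ∈ 𝒱 (n + i) := by
  cases k with
  | zero => rw [hT]; exact zero_mem _
  | succ k => exact hT.2.1 ha

theorem zero : IsDiffOp 𝒱 k n fun _ => 0 := by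
  induction k generalizing n with
  | zero => exact fun _ => rfl
  | succ k ih =>
    exact ⟨fun _ _ => (add_zero 0).symm, fun _ => zero_mem _, fun _ => ih.congr rfl fun b => by
      rw [commMul, mul_zero, smul_zero, sub_zero]⟩

theorem add (hT : IsDiffOp 𝒱 k n T) (hS : IsDiffOp 𝒱 k n S) :
    IsDiffOp 𝒱 k n fun a => T a + S a := by
  induction k generalizing n T S with
  | zero => exact fun b => by beta_reduce; rw [hT, hS, add_zero]
  | succ k ih =>
    refine ⟨fun a b => ?_, fun h => add_mem (hT.mem h) (hS.mem h), fun h => ?_⟩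
    · beta_reduce
      rw [hT.map_add, hS.map_add]
      abel
    · refine (ih (hT.2.2 h) (hS.2.2 h)).congr rfl fun b => ?_
      simp only [commMul, mul_add, smul_add]
      abel

theorem units_smul (u : ℤˣ) (hT : IsDiffOp 𝒱 k n T) : IsDiffOp 𝒱 k n fun a => u • T a := by
  induction k generalizing n T with
  | zero => exact fun b => by beta_reduce; rw [hT, smul_zero]
  | succ k ih =>
    refine ⟨fun a b => ?_, fun h => units_smul_mem_addSubgroup _ (hT.mem h), fun h => ?_⟩
    · beta_reduce
      rw [hT.map_add, smul_add]
    · refine (ih (hT.2.2 h)).congr rfl fun b => ?_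
      simp only [commMul, mul_smul_comm, smul_sub, smul_smul, mul_comm u]

theorem sub (hT : IsDiffOp 𝒱 k n T) (hS : IsDiffOp 𝒱 k n S) :
    IsDiffOp 𝒱 k n fun a => T a - S a :=
  (hT.add (hS.units_smul (-1))).congr rfl fun a => by
    rw [Units.neg_smul, one_smul, sub_eq_add_neg]

theorem sum {ι : Type*} (s : Finset ι) {T : ι → V → V} (h : ∀ i, IsDiffOp 𝒱 k n (T i)) :
    IsDiffOp 𝒱 k n fun a => ∑ i ∈ s, T i a := by
  classical
  induction s using Finset.induction_on with
  | empty => exact zero.congr rfl fun _ => Finset.sum_empty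
  | insert i s hi ih => exact ((h i).add ih).congr rfl fun _ => Finset.sum_insert hi

theorem mono_succ (hT : IsDiffOp 𝒱 k n T) : IsDiffOp 𝒱 (k + 1) n T := by
  induction k generalizing n T with
  | zero => exact zero.congr rfl hT
  | succ k ih => exact ⟨hT.map_add, hT.mem, fun h => ih (hT.2.2 h)⟩

/-- Orders of differential operators add up under composition. -/
theorem comp (hT : IsDiffOp 𝒱 (k + 1) n T) (hS : IsDiffOp 𝒱 (l + 1) m S) :
    IsDiffOp 𝒱 (k + l + 1) (n + m) fun a => T (S a) := by
  obtain ⟨N, hN⟩ : ∃ N, k + l = N := ⟨_, rfl⟩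
  induction N generalizing k l n m T S with
  | zero =>
    obtain rfl : k = 0 := by omega
    obtain rfl : l = 0 := by omega
    refine ⟨fun a b => by beta_reduce; rw [hS.map_add, hT.map_add],
      fun h => by rw [add_assoc]; exact hT.mem (hS.mem h), fun {i a} h b => ?_⟩
    have h1 : S (a * b) = (m * i).negOnePow • (a * S b) := sub_eq_zero.1 (hS.2.2 h b)
    have h2 : T (a * S b) = (n * i).negOnePow • (a * T (S b)) := sub_eq_zero.1 (hT.2.2 h (S b))
    rw [commMul, h1, hT.map_units_smul, h2, smul_smul, ← Int.negOnePow_add, ← add_mul,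
      add_comm m, sub_self]
  | succ N ih =>
    refine ⟨fun a b => by beta_reduce; rw [hS.map_add, hT.map_add],
      fun h => by rw [add_assoc]; exact hT.mem (hS.mem h), fun {i a} h => ?_⟩
    -- `[TS, a] = T [S, a] ± [T, a] S`
    have h1 : IsDiffOp 𝒱 (k + l) (n + m + i) fun b => T (commMul m S i a b) := by
      cases l with
      | zero => exact zero.congr rfl fun b => by rw [hS.2.2 h b, hT.map_zero]
      | succ l => exact (ih hT (hS.2.2 h) (by omega)).congr (by ring) fun _ => rfl
    have h2 : IsDiffOp 𝒱 (k + l) (n + m + i) fun b => commMul n T i a (S b) := by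
      cases k with
      | zero => exact zero.congr rfl fun b => hT.2.2 h (S b)
      | succ k =>
        have := ih (hT.2.2 h) hS (by omega)
        rw [show k + 1 + l = k + l + 1 by omega]
        exact this.congr (by ring) fun _ => rfl
    refine (h1.add (h2.units_smul (m * i).negOnePow)).congr rfl fun b => ?_
    simp only [commMul]
    rw [hT.map_sub, hT.map_units_smul, smul_sub, smul_smul, ← Int.negOnePow_add, ← add_mul,
      add_comm m, sub_add_sub_cancel]

end IsDiffOp

theorem IsDer.isDiffOp (h : IsGradedComm 𝒱) {n : ℤ} {X : V → V} (hX : IsDer 𝒱 n X) :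
    IsDiffOp 𝒱 2 n X :=
  ⟨hX.map_add, hX.mem, fun {i a} ha =>
    ⟨fun b c => by simp only [commMul, mul_add, hX.map_add, smul_add]; abel,
    fun {j b} hb => by
      rw [commMul, hX.leibniz b ha, add_sub_cancel_right]
      exact h.mul_mem (hX.mem ha) hb,
    fun {j b} hb c => by
      simp only [commMul]
      rw [hX.leibniz _ ha, hX.leibniz c ha, add_sub_cancel_right, add_sub_cancel_right, ← mul_assoc,
        h.mul_comm (hX.mem ha) hb, smul_mul_assoc, mul_assoc, sub_self]⟩⟩

theorem isDiffOp_mul_left (h : IsGradedComm 𝒱) {n : ℤ} {c : V} (hc : c ∈ 𝒱 n) :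
    IsDiffOp 𝒱 1 n fun a => c * a :=
  ⟨fun a b => mul_add c a b, fun ha => h.mul_mem hc ha, fun ha b => by
    rw [commMul, ← mul_assoc, h.mul_comm hc ha, smul_mul_assoc, mul_assoc, sub_self]⟩

/-- A differential operator of order at most one that kills `1` is a derivation. -/
theorem IsDiffOp.isDer (h : IsGradedComm 𝒱) {n : ℤ} {T : V → V} (hT : IsDiffOp 𝒱 2 n T)
    (h1 : T 1 = 0) : IsDer 𝒱 n T :=
  IsDer.of_homogeneous h hT.map_add hT.mem fun {i j a b} ha hb => by
    have h2 : commMul n T i a (b * 1) = ((n + i) * j).negOnePow • (b * commMul n T i a 1) :=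
      sub_eq_zero.1 ((hT.2.2 ha).2.2 hb 1)
    rw [commMul, commMul, mul_one, mul_one, h1, mul_zero, smul_zero, sub_zero,
      h.mul_comm hb (hT.mem ha), smul_smul, ← Int.negOnePow_add] at h2
    rw [sub_eq_iff_eq_add.1 h2, Int.negOnePow_even _ ⟨j * (n + i), by ring⟩, one_smul]

end DifferentialOperators

/-! ### Koszul's form `Φ³` -/

section KoszulForms

variable {V : Type*} [Ring V] {𝒱 : ℤ → AddSubgroup V}

/-- Koszul's form `Φ³` of an operator on a graded ring, see
`BigradedAlgebraData.koszulForm₃`. -/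
def koszulThree (D : V → V) (i j k : ℤ) (x y z : V) : V :=
  D (x * y * z) - D (x * y) * z - (i * (j + k)).negOnePow • (D (y * z) * x)
    - (k * (i + j)).negOnePow • (D (z * x) * y) + D x * y * z
    + (i * (j + k)).negOnePow • (D y * z * x) + (k * (i + j)).negOnePow • (D z * x * y)
    - D 1 * x * y * z

/-- The operator `z ↦ Φ³_D(x, y, z)`, written without reference to the degree of `z`. -/
def koszulOp (D : V → V) (n i j : ℤ) (x y z : V) : V :=
  commMul (n + i) (commMul n D i x) j y z - commMul (n + i) (commMul n D i x) j y 1 * z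

variable {n i j k l : ℤ} {D : V → V} {x y z w : V}

/-- Koszul's form as an iterated graded commutator with multiplications, corrected at `1`. -/
theorem koszulThree_eq_koszulOp (h : IsGradedComm 𝒱) {m : ℕ} (hD : IsDiffOp 𝒱 m n D)
    (hx : x ∈ 𝒱 i) (hy : y ∈ 𝒱 j) (hz : z ∈ 𝒱 k) (h1 : D 1 = 0) :
    koszulThree D i j k x y z = koszulOp D n i j x y z := by
  simp only [koszulThree, koszulOp, commMul, mul_one, h1, mul_zero, zero_mul, smul_zero, sub_zero]
  rw [h.mul_comm hz hx, hD.map_units_smul, h.mul_comm (hD.mem (h.mul_mem hy hz)) hx,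
    smul_mul_assoc, h.mul_comm (hD.mem (h.mul_mem hx hz)) hy, mul_assoc x y z,
    mul_assoc _ z x, h.mul_comm (hD.mem hy) (h.mul_mem hz hx), h.mul_comm hz hx,
    mul_assoc _ x y, h.mul_comm (hD.mem hz) (h.mul_mem hx hy)]
  simp only [sub_mul, smul_mul_assoc, mul_sub, mul_smul_comm, smul_sub]
  have e1 : x * z * D y = (k * (n + j)).negOnePow • (x * D y * z) := by
    rw [mul_assoc, h.mul_comm hz (hD.mem hy), mul_smul_comm, mul_assoc]
  have e2 : y * D x * z = (j * (n + i)).negOnePow • (D x * y * z) := by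
    rw [h.mul_comm hy (hD.mem hx), smul_mul_assoc]
  have e3 : y * (x * D z) = (j * i).negOnePow • (x * y * D z) := by
    rw [← mul_assoc, h.mul_comm hy hx, smul_mul_assoc]
  rw [e1, e2, e3]
  simp only [smul_smul, ← Int.negOnePow_add]
  by_cases h0 : Even n <;> by_cases h1 : Even i <;> by_cases h2 : Even j <;> by_cases h3 : Even k <;>
  · simp only [negOnePow_smul_eq_ite, Int.even_add, Int.even_mul, h0, h1, h2, h3, if_true, if_false,
      or_true, or_false, iff_true, iff_false, not_true_eq_false]
    abel

/-- Koszul's form is graded symmetric, here for cyclic permutations. -/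
theorem koszulThree_cyclic (h : IsGradedComm 𝒱) {m : ℕ} (hD : IsDiffOp 𝒱 m n D)
    (hx : x ∈ 𝒱 i) (hy : y ∈ 𝒱 j) (hz : z ∈ 𝒱 k) (h1 : D 1 = 0) :
    koszulThree D j k i y z x = (i * (j + k)).negOnePow • koszulThree D i j k x y z := by
  simp only [koszulThree, h1, zero_mul, sub_zero]
  rw [h.mul_comm (h.mul_mem hy hz) hx, hD.map_units_smul, ← mul_assoc]
  simp only [smul_sub, smul_add, smul_smul, ← Int.negOnePow_add]
  by_cases h1 : Even i <;> by_cases h2 : Even j <;> by_cases h3 : Even k <;>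
  · simp only [negOnePow_smul_eq_ite, Int.even_add, Int.even_mul, h1, h2, h3, if_true, if_false,
      or_true, or_false, iff_true, iff_false, not_true_eq_false]
    abel

theorem IsDiffOp.koszulOp (h : IsGradedComm 𝒱) (hD : IsDiffOp 𝒱 4 n D)
    (hx : x ∈ 𝒱 i) (hy : y ∈ 𝒱 j) : IsDer 𝒱 (n + i + j) (koszulOp D n i j x y) := by
  have h2 : IsDiffOp 𝒱 2 (n + i + j) (commMul (n + i) (commMul n D i x) j y) :=
    (hD.2.2 hx).2.2 hy
  have h3 := h2.mem h.one_mem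
  rw [add_zero] at h3
  exact (h2.sub (isDiffOp_mul_left h h3).mono_succ).isDer h (by simp)

theorem koszulThree_mem (h : IsGradedComm 𝒱) (hD : IsDiffOp 𝒱 4 n D)
    (hx : x ∈ 𝒱 i) (hy : y ∈ 𝒱 j) (hz : z ∈ 𝒱 k) (h1 : D 1 = 0) :
    koszulThree D i j k x y z ∈ 𝒱 (n + i + j + k) := by
  rw [koszulThree_eq_koszulOp h hD hx hy hz h1]
  exact (hD.koszulOp h hx hy).mem hz

/-- The form `Φ⁴` of a differential operator of order at most three vanishes. -/
theorem koszulThree_mul (h : IsGradedComm 𝒱) (hD : IsDiffOp 𝒱 4 n D)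
    (hx : x ∈ 𝒱 i) (hy : y ∈ 𝒱 j) (hz : z ∈ 𝒱 k) (hw : w ∈ 𝒱 l) (h1 : D 1 = 0) :
    koszulThree D i j (k + l) x y (z * w) - koszulThree D i j k x y z * w
      - (k * l).negOnePow • (koszulThree D i j l x y w * z) = 0 := by
  rw [koszulThree_eq_koszulOp h hD hx hy (h.mul_mem hz hw) h1,
    koszulThree_eq_koszulOp h hD hx hy hz h1, koszulThree_eq_koszulOp h hD hx hy hw h1,
    (hD.koszulOp h hx hy).leibniz w hz,
    h.mul_comm hz ((hD.koszulOp h hx hy).mem hw), add_sub_cancel_left, smul_smul,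
    ← Int.negOnePow_add, sub_eq_zero]
  rw [(Int.negOnePow_eq_iff _ (k * l)).2 ⟨(n + i + j) * k, by ring⟩]

/-- The form `Φ³` of the graded commutator of an operator with an odd derivation. -/
theorem koszulThree_commutator (h : IsGradedComm 𝒱) {m : ℕ} (hD : IsDiffOp 𝒱 m (-1) D) {d : V → V}
    (hd : IsDer 𝒱 (-1) d)
    (hx : x ∈ 𝒱 i) (hy : y ∈ 𝒱 j) (hz : z ∈ 𝒱 k) (h1 : D 1 = 0) :
    koszulThree (fun a => d (D a) + D (d a)) i j k x y z =
      d (koszulThree D i j k x y z) + koszulThree D (-1 + i) j k (d x) y z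
        + i.negOnePow • koszulThree D i (-1 + j) k x (d y) z
        + (i + j).negOnePow • koszulThree D i j (-1 + k) x y (d z) := by
  simp only [koszulThree, h1, hd.map_one h, hD.map_zero, hd.map_zero, zero_mul, sub_zero, add_zero]
  simp only [hd.map_add, hd.map_sub, hd.map_units_smul, mul_assoc]
  rw [hd.leibniz _ hx, hd.leibniz _ hy, hd.leibniz _ hx, hd.leibniz _ hz,
    hd.leibniz _ (hD.mem (h.mul_mem hx hy)), hd.leibniz _ (hD.mem (h.mul_mem hy hz)),
    hd.leibniz _ (hD.mem (h.mul_mem hz hx)), hd.leibniz _ (hD.mem hx), hd.leibniz _ (hD.mem hy),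
    hd.leibniz _ (hD.mem hz), hd.leibniz _ hy, hd.leibniz _ hz, hd.leibniz _ hx]
  simp only [hD.map_add, hD.map_units_smul, mul_add, add_mul, smul_mul_assoc,
    mul_smul_comm, smul_add, smul_sub, smul_smul]
  by_cases h1 : Even i <;> by_cases h2 : Even j <;> by_cases h3 : Even k <;>
  · simp only [negOnePow_smul_eq_ite, ← Int.negOnePow_add, Int.even_add, Int.even_mul, h1, h2, h3,
      if_true, if_false, even_neg, Int.not_even_one,
      or_true, or_false, iff_true, iff_false, not_true_eq_false]
    abel

end KoszulForms

/-! ### Identities that can be checked on generators: skew-symmetry and the derivation property -/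

section GeneratorCriteria

variable {V : Type*} [Ring V] {𝒱 : ℤ → AddSubgroup V}

theorem koszulThree_swap (h : IsGradedComm 𝒱) {m : ℕ} {n i j k : ℤ} {D : V → V} {x y z : V}
    (hD : IsDiffOp 𝒱 m n D) (hx : x ∈ 𝒱 i) (hy : y ∈ 𝒱 j) (hz : z ∈ 𝒱 k) (h1 : D 1 = 0) :
    koszulThree D j i k y x z = (i * j).negOnePow • koszulThree D i j k x y z := by
  simp only [koszulThree, h1, zero_mul, sub_zero, mul_assoc]
  have e1 : y * (x * z) = (i * j).negOnePow • (x * (y * z)) := by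
    rw [← mul_assoc, h.mul_comm hy hx, smul_mul_assoc, mul_assoc, mul_comm j]
  rw [e1, h.mul_comm hy hx, h.mul_comm hx hz, h.mul_comm hz hy]
  simp only [hD.map_units_smul, smul_mul_assoc, mul_smul_comm, smul_sub, smul_add, smul_smul,
    ← Int.negOnePow_add]
  by_cases h1 : Even i <;> by_cases h2 : Even j <;> by_cases h3 : Even k <;>
  · simp only [negOnePow_smul_eq_ite, Int.even_add, Int.even_mul, h1, h2, h3, if_true, if_false,
      or_true, or_false, iff_true, iff_false, not_true_eq_false]
    abel

theorem koszulThree_swap_right (h : IsGradedComm 𝒱) {m : ℕ} {n i j k : ℤ} {D : V → V} {x y z : V}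
    (hD : IsDiffOp 𝒱 m n D) (hx : x ∈ 𝒱 i) (hy : y ∈ 𝒱 j) (hz : z ∈ 𝒱 k) (h1 : D 1 = 0) :
    koszulThree D i k j x z y = (j * k).negOnePow • koszulThree D i j k x y z := by
  rw [koszulThree_cyclic h hD hy hx hz h1, koszulThree_swap h hD hx hy hz h1, smul_smul,
    ← Int.negOnePow_add, (Int.negOnePow_eq_iff _ (j * k)).2 ⟨i * j, by ring⟩]

/-- `br` is a bracket of degree `-1` that is a derivation in each variable. -/
structure IsBiderivation (𝒱 : ℤ → AddSubgroup V) (br : V → V → V) : Prop where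
  der : ∀ {i : ℤ} {a : V}, a ∈ 𝒱 i → IsDer 𝒱 (i - 1) (br a)
  add_left : ∀ a b c, br (a + b) c = br a c + br b c
  mul_left : ∀ {i j : ℤ} {a b : V} (c : V), a ∈ 𝒱 i → b ∈ 𝒱 j →
    br (a * b) c = a * br b c + (i * j).negOnePow • (b * br a c)

/-- A predicate on pairs of a degree and an element singles out homogeneous generators of `V`. -/
structure IsGeneratedBy (𝒱 : ℤ → AddSubgroup V) (Gen : ℤ → V → Prop) : Prop where
  mem : ∀ {i : ℤ} {a : V}, Gen i a → a ∈ 𝒱 i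
  generates : ∀ a : V, a ∈ AddSubgroup.closure (Submonoid.closure {b | ∃ i, Gen i b} : Set V)

variable {Gen : ℤ → V → Prop} {br : V → V → V}

theorem IsDer.eq_zero_of_isGeneratedBy (h : IsGradedComm 𝒱) (hG : IsGeneratedBy 𝒱 Gen) {n : ℤ}
    {X : V → V} (hX : IsDer 𝒱 n X) (h₀ : ∀ i a, Gen i a → X a = 0) (a : V) : X a = 0 :=
  hX.eq_zero_of_generators h (fun _ ha => ha.imp fun _ ha => hG.mem ha) hG.generates
    (fun a ha => h₀ _ a ha.choose_spec) a

/-- A biderivation that is graded skew-symmetric on generators is graded skew-symmetric. -/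
theorem IsBiderivation.skew (h : IsGradedComm 𝒱) (hG : IsGeneratedBy 𝒱 Gen)
    (hbr : IsBiderivation 𝒱 br) {σ : V → V} (hσ_add : ∀ a b, σ (a + b) = σ a + σ b)
    (hσ : ∀ {i : ℤ} {a : V}, a ∈ 𝒱 i → σ a = i.negOnePow • a)
    (h₀ : ∀ i j a b, Gen i a → Gen j b → br a b = -((i - 1) * (j - 1)).negOnePow • br b a)
    {i j : ℤ} {a b : V} (ha : a ∈ 𝒱 i) (hb : b ∈ 𝒱 j) :
    br a b = -((i - 1) * (j - 1)).negOnePow • br b a := by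
  have hneg : ∀ a b, br (-a) b = -br a b := fun a b =>
    map_neg (AddMonoidHom.mk' (fun a => br a b) fun a a' => hbr.add_left a a' b) a
  have hsmul : ∀ (u : ℤˣ) a b, br (u • a) b = u • br a b := fun u a b => by
    rcases Int.units_eq_one_or u with rfl | rfl
    · rw [one_smul, one_smul]
    · rw [Units.neg_smul, one_smul, hneg, Units.neg_smul, one_smul]
  -- for fixed `a`, the other side of the identity is a derivation in `b` as well; to say so, its sign
  -- has to be written without reference to the degree of `b`, by means of the involution `σ`
  have hYeq : ∀ {i : ℤ} {a : V}, ∀ {j : ℤ} {b : V}, b ∈ 𝒱 j →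
      (if Even i then -br (σ b) a else br b a) = ((i - 1) * (j - 1)).negOnePow • br b a := by
    intro i a j b hb
    rw [hσ hb, hsmul]
    by_cases h1 : Even i <;> by_cases h2 : Even j <;>
    · simp only [negOnePow_smul_eq_ite, Int.even_sub, Int.even_mul, h1, h2, Int.not_even_one,
        if_true, if_false, or_true, or_false, iff_false, not_true_eq_false, neg_neg,
        or_self]
  have hY : ∀ {i : ℤ} {a : V}, a ∈ 𝒱 i → IsDer 𝒱 (i - 1) fun b =>
      if Even i then -br (σ b) a else br b a := fun {i a} ha => by
    refine IsDer.of_homogeneous h (fun b c => ?_) (fun {j b} hb => ?_) (fun {j k b c} hb hc => ?_)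
    · split_ifs
      · rw [hσ_add, hbr.add_left]
        abel
      · exact hbr.add_left _ _ _
    · rw [hYeq hb]
      have := units_smul_mem_addSubgroup ((i - 1) * (j - 1)).negOnePow ((hbr.der hb).mem ha)
      rwa [show j - 1 + i = i - 1 + j by ring] at this
    · rw [hYeq hb, hYeq hc, hYeq (h.mul_mem hb hc), hbr.mul_left a hb hc,
        h.mul_comm hc ((hbr.der hb).mem ha), smul_mul_assoc, mul_smul_comm]
      by_cases h1 : Even i <;> by_cases h2 : Even j <;> by_cases h3 : Even k <;>
      · simp only [negOnePow_smul_eq_ite, Int.even_add, Int.even_sub, Int.even_mul, h1, h2, h3,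
          Int.not_even_one, if_true, if_false, or_true, or_false, iff_true, iff_false,
          not_true_eq_false, neg_neg, or_self]
        abel
  have step : ∀ {i : ℤ} {a : V}, a ∈ 𝒱 i →
      (∀ j b, Gen j b → br a b = -((i - 1) * (j - 1)).negOnePow • br b a) →
      ∀ {j : ℤ} {b : V}, b ∈ 𝒱 j → br a b = -((i - 1) * (j - 1)).negOnePow • br b a := by
    intro i a ha h₁ j b hb
    have := ((hbr.der ha).add (hY ha)).eq_zero_of_isGeneratedBy h hG (fun j b hb => by
      rw [hYeq (hG.mem hb), h₁ j b hb, Units.neg_smul, neg_add_cancel]) b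
    rw [hYeq hb] at this
    rw [Units.neg_smul]
    exact eq_neg_of_add_eq_zero_left this
  refine step ha (fun j b hb => ?_) hb
  rw [step (hG.mem hb) (fun i a ha => h₀ _ _ _ _ hb ha) ha, smul_smul, neg_mul_neg,
    ← Int.negOnePow_add, Int.negOnePow_even _ ⟨(i - 1) * (j - 1), by ring⟩, one_smul]

/-- A graded skew-symmetric bracket of degree `-1` that is a derivation in the second variable. -/
structure IsSkewBracket (𝒱 : ℤ → AddSubgroup V) (br : V → V → V) : Prop where
  der : ∀ {i : ℤ} {a : V}, a ∈ 𝒱 i → IsDer 𝒱 (i - 1) (br a)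
  skew : ∀ {i j : ℤ} {a b : V}, a ∈ 𝒱 i → b ∈ 𝒱 j →
    br a b = -((i - 1) * (j - 1)).negOnePow • br b a

theorem IsSkewBracket.mem (hbr : IsSkewBracket 𝒱 br) {i j : ℤ} {a b : V} (ha : a ∈ 𝒱 i)
    (hb : b ∈ 𝒱 j) : br a b ∈ 𝒱 (i + j - 1) := by
  have := (hbr.der ha).mem hb
  rwa [show i - 1 + j = i + j - 1 by ring] at this

/-- A derivation of the product is a derivation of the bracket if it is one on generators. -/
theorem IsSkewBracket.isDer_bracket (h : IsGradedComm 𝒱) (hG : IsGeneratedBy 𝒱 Gen)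
    (hbr : IsSkewBracket 𝒱 br) {d : V → V} (hd : IsDer 𝒱 (-1) d)
    (h₀ : ∀ i j a b, Gen i a → Gen j b → d (br a b) = br (d a) b - i.negOnePow • br a (d b))
    {i : ℤ} {a : V} (ha : a ∈ 𝒱 i) (b : V) :
    d (br a b) = br (d a) b - i.negOnePow • br a (d b) := by
  have step : ∀ {i : ℤ} {a : V}, a ∈ 𝒱 i →
      (∀ j b, Gen j b → d (br a b) = br (d a) b - i.negOnePow • br a (d b)) →
      ∀ b, d (br a b) = br (d a) b - i.negOnePow • br a (d b) := by
    intro i a ha h₁ b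
    -- the identity says that the graded commutator of `d` and `[a, ·]` is `[da, ·]`
    have e : ∀ b, d (br a b) - (-1 * (i - 1)).negOnePow • br a (d b) - br (d a) b =
        d (br a b) - (br (d a) b - i.negOnePow • br a (d b)) := fun b => by
      rw [show -1 * (i - 1) = -i + 1 by ring, Int.negOnePow_succ, Int.negOnePow_neg, Units.neg_smul]
      abel
    have := ((hd.comm (hbr.der ha)).sub ((hbr.der (hd.mem ha)).congr
      (m := -1 + (i - 1)) (by ring) fun _ => rfl)).eq_zero_of_isGeneratedBy h hG
      (fun j b hb => (e b).trans (sub_eq_zero.2 (h₁ j b hb))) b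
    exact sub_eq_zero.1 ((e b).symm.trans this)
  refine step ha (fun j b hb => ?_) b
  have hb' := hG.mem hb
  have := step hb' (fun i a ha => h₀ _ _ _ _ hb ha) a
  rw [hbr.skew ha hb', hd.map_units_smul, this, hbr.skew (hd.mem ha) hb',
    hbr.skew ha (hd.mem hb')]
  by_cases h1 : Even i <;> by_cases h2 : Even j <;>
  · simp only [negOnePow_smul_eq_ite, Units.neg_smul, Int.even_add, Int.even_sub, Int.even_mul,
      h1, h2, Int.not_even_one, even_neg,
      if_true, if_false, or_true, or_false, iff_true, iff_false, not_true_eq_false, neg_neg,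
      or_self]
    abel

end GeneratorCriteria

/-! ### Identities that can be checked on generators: the Jacobi identity -/

section JacobiCriteria

variable {V : Type*} [Ring V] {𝒱 : ℤ → AddSubgroup V} {Gen : ℤ → V → Prop} {br : V → V → V}

/-- The graded Jacobi identity up to Koszul's form of an operator `Δ` holds if it holds on
generators, when `Δ` is the graded commutator of an odd derivation and a differential operator of
order at most three: both sides are cyclically symmetric, and derivations in the last variable. -/
theorem IsSkewBracket.jacobi (h : IsGradedComm 𝒱) (hG : IsGeneratedBy 𝒱 Gen)
    (hbr : IsSkewBracket 𝒱 br) {d Ψ : V → V} (hd : IsDer 𝒱 (-1) d) (hΨ : IsDiffOp 𝒱 4 (-1) Ψ)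
    (hΨ1 : Ψ 1 = 0)
    (h₀ : ∀ i j k x y z, Gen i x → Gen j y → Gen k z →
      ((i - 1) * (k - 1)).negOnePow • br x (br y z) + ((j - 1) * (i - 1)).negOnePow • br y (br z x)
        + ((k - 1) * (j - 1)).negOnePow • br z (br x y) = (i * k + i + j + k).negOnePow •
        koszulThree (fun a => d (Ψ a) + Ψ (d a)) i j k x y z)
    {i j k : ℤ} {x y z : V} (hx : x ∈ 𝒱 i) (hy : y ∈ 𝒱 j) (hz : z ∈ 𝒱 k) :
    ((i - 1) * (k - 1)).negOnePow • br x (br y z) + ((j - 1) * (i - 1)).negOnePow • br y (br z x)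
        + ((k - 1) * (j - 1)).negOnePow • br z (br x y) = (i * k + i + j + k).negOnePow •
        koszulThree (fun a => d (Ψ a) + Ψ (d a)) i j k x y z := by
  have hΔ : IsDiffOp 𝒱 5 (-1 + -1) fun a => d (Ψ a) + Ψ (d a) :=
    ((hd.isDiffOp h).comp hΨ).add (hΨ.comp (hd.isDiffOp h))
  have hΔ1 : d (Ψ 1) + Ψ (d 1) = 0 := by
    rw [hΨ1, hd.map_one h, hd.map_zero, hΨ.map_zero, add_zero]
  have hcyc : ∀ {i j k : ℤ} {x y z : V}, x ∈ 𝒱 i → y ∈ 𝒱 j → z ∈ 𝒱 k →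
      ((k - 1) * (j - 1)).negOnePow • br z (br x y)
        + ((i - 1) * (k - 1)).negOnePow • br x (br y z)
        + ((j - 1) * (i - 1)).negOnePow • br y (br z x) = (k * j + k + i + j).negOnePow •
        koszulThree (fun a => d (Ψ a) + Ψ (d a)) k i j z x y →
      ((i - 1) * (k - 1)).negOnePow • br x (br y z) + ((j - 1) * (i - 1)).negOnePow • br y (br z x)
        + ((k - 1) * (j - 1)).negOnePow • br z (br x y) = (i * k + i + j + k).negOnePow •
        koszulThree (fun a => d (Ψ a) + Ψ (d a)) i j k x y z := by
    intro i j k x y z hx hy hz h'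
    rw [koszulThree_cyclic h hΔ hz hx hy hΔ1, smul_smul, ← Int.negOnePow_add,
      ← (Int.negOnePow_eq_iff (k * j + k + i + j) (i * k + i + j + k + k * (i + j))).2
        ⟨- (i * k), by ring⟩, ← h']
    abel
  have step : ∀ {i j : ℤ} {x y : V}, x ∈ 𝒱 i → y ∈ 𝒱 j →
      (∀ k z, Gen k z → ((i - 1) * (k - 1)).negOnePow • br x (br y z)
        + ((j - 1) * (i - 1)).negOnePow • br y (br z x)
        + ((k - 1) * (j - 1)).negOnePow • br z (br x y) = (i * k + i + j + k).negOnePow •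
        koszulThree (fun a => d (Ψ a) + Ψ (d a)) i j k x y z) →
      ∀ {k : ℤ} {z : V}, z ∈ 𝒱 k → ((i - 1) * (k - 1)).negOnePow • br x (br y z)
        + ((j - 1) * (i - 1)).negOnePow • br y (br z x)
        + ((k - 1) * (j - 1)).negOnePow • br z (br x y) = (i * k + i + j + k).negOnePow •
        koszulThree (fun a => d (Ψ a) + Ψ (d a)) i j k x y z := by
    intro i j x y hx hy h₁ k z hz
    have hB := hΨ.koszulOp h hx hy
    -- the difference of both sides, up to the sign `(-1)^{(|x| - 1)(|z| - 1)}`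
    have hF := (((hbr.der hx).comm (hbr.der hy)).sub ((hbr.der (hbr.mem hx hy)).congr
        (m := i - 1 + (j - 1)) (by ring) fun _ => rfl)).add (((((hd.comm hB).congr
        (m := i - 1 + (j - 1)) (by ring) fun _ => rfl).add
          ((hΨ.koszulOp h (hd.mem hx) hy).congr (m := i - 1 + (j - 1)) (by ring)
            fun _ => rfl)).add (((hΨ.koszulOp h hx (hd.mem hy)).units_smul i.negOnePow).congr
              (m := i - 1 + (j - 1)) (by ring) fun _ => rfl)).units_smul j.negOnePow)
    have key : ∀ {k : ℤ} {z : V}, z ∈ 𝒱 k →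
        (((i - 1) * (k - 1)).negOnePow • br x (br y z)
          + ((j - 1) * (i - 1)).negOnePow • br y (br z x)
          + ((k - 1) * (j - 1)).negOnePow • br z (br x y)) - (i * k + i + j + k).negOnePow •
          koszulThree (fun a => d (Ψ a) + Ψ (d a)) i j k x y z =
        ((i - 1) * (k - 1)).negOnePow • (br x (br y z) - ((i - 1) * (j - 1)).negOnePow •
          br y (br x z) - br (br x y) z + j.negOnePow • (d (koszulOp Ψ (-1) i j x y z)
            - (-1 * (-1 + i + j)).negOnePow • koszulOp Ψ (-1) i j x y (d z)
            + koszulOp Ψ (-1) (-1 + i) j (d x) y z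
            + i.negOnePow • koszulOp Ψ (-1) i (-1 + j) x (d y) z)) := by
      intro k z hz
      rw [koszulThree_commutator h hΨ hd hx hy hz hΨ1, koszulThree_eq_koszulOp h hΨ hx hy hz hΨ1,
        koszulThree_eq_koszulOp h hΨ (hd.mem hx) hy hz hΨ1,
        koszulThree_eq_koszulOp h hΨ hx (hd.mem hy) hz hΨ1,
        koszulThree_eq_koszulOp h hΨ hx hy (hd.mem hz) hΨ1, hbr.skew hz hx,
        hbr.skew hz (hbr.mem hx hy), (hbr.der hy).map_units_smul]
      by_cases h1 : Even i <;> by_cases h2 : Even j <;> by_cases h3 : Even k <;>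
      · simp only [negOnePow_smul_eq_ite, Units.neg_smul, Int.even_add, Int.even_sub, Int.even_mul,
          h1, h2, h3, Int.not_even_one, even_neg,
          if_true, if_false, or_true, or_false, iff_true, iff_false, not_true_eq_false, neg_neg,
          or_self]
        abel
    have h₂ := hF.eq_zero_of_isGeneratedBy h hG (fun k z hz => by
      have := key (hG.mem hz)
      rw [h₁ k z hz, sub_self] at this
      exact (smul_eq_zero_iff_eq _).1 this.symm) z
    have := key hz
    beta_reduce at h₂
    rw [h₂, smul_zero] at this
    exact sub_eq_zero.1 this
  -- `step` and rotations replace the generators by arbitrary elements, one argument at a time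
  refine step hx hy (fun k z hz => ?_) hz
  refine hcyc hx hy (hG.mem hz) (step (hG.mem hz) hx (fun j y hy => ?_) hy)
  refine hcyc (hG.mem hz) hx (hG.mem hy) ?_
  exact step (hG.mem hy) (hG.mem hz) (fun i x hx => h₀ _ _ _ _ _ _ hy hz hx) hx

end JacobiCriteria

/-! ### Identities that can be checked on generators: the four-term identity -/

section FourTermIdentity

variable {V : Type*} [Ring V] {𝒱 : ℤ → AddSubgroup V} {Gen : ℤ → V → Prop}

/-- The difference of the two sides of the compatibility of a bracket with an operator `Ψ`, with the
shuffles written out. -/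
def bracketKoszul (br : V → V → V) (Ψ : V → V) (i j k l : ℤ) (x y z w : V) : V :=
  (i + j + k).negOnePow • br (koszulThree Ψ i j k x y z) w
    + (k * l + (i + j + l)).negOnePow • br (koszulThree Ψ i j l x y w) z
    + (j * k + j * l + (i + k + l)).negOnePow • br (koszulThree Ψ i k l x z w) y
    + (i * (j + k + l) + (j + k + l)).negOnePow • br (koszulThree Ψ j k l y z w) x
    - (i.negOnePow • koszulThree Ψ (i + j - 1) k l (br x y) z w
      + (j * k + i).negOnePow • koszulThree Ψ (i + k - 1) j l (br x z) y w
      + (j * l + k * l + i).negOnePow • koszulThree Ψ (i + l - 1) j k (br x w) y z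
      + (i * j + i * k + j).negOnePow • koszulThree Ψ (j + k - 1) i l (br y z) x w
      + (i * j + i * l + k * l + j).negOnePow • koszulThree Ψ (j + l - 1) i k (br y w) x z
      + ((i + j) * (k + l) + k).negOnePow • koszulThree Ψ (k + l - 1) i j (br z w) x y)

variable {br : V → V → V} {Ψ : V → V}

theorem koszulThree_units_smul {D : V → V} (hadd : ∀ a b, D (a + b) = D a + D b) (u : ℤˣ)
    (i j k : ℤ) (x y z : V) :
    koszulThree D i j k (u • x) y z = u • koszulThree D i j k x y z := by
  have hneg : ∀ a, D (-a) = -D a := map_neg (AddMonoidHom.mk' D hadd)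
  rcases Int.units_eq_one_or u with rfl | rfl
  · rw [one_smul, one_smul]
  · simp only [Units.neg_smul, one_smul, koszulThree, neg_mul, mul_neg, hneg, smul_neg]
    abel

/-- The four-term identity is invariant under cyclic permutations of its arguments. -/
theorem bracketKoszul_rotate (h : IsGradedComm 𝒱) (hbr : IsSkewBracket 𝒱 br)
    (hΨ : IsDiffOp 𝒱 4 (-1) Ψ) (hΨ1 : Ψ 1 = 0) {i j k l : ℤ} {x y z w : V}
    (hx : x ∈ 𝒱 i) (hy : y ∈ 𝒱 j) (hz : z ∈ 𝒱 k) (hw : w ∈ 𝒱 l)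
    (hbr_smul : ∀ (u : ℤˣ) a b, br (u • a) b = u • br a b) :
    bracketKoszul br Ψ j k l i y z w x =
      (i * (j + k + l)).negOnePow • bracketKoszul br Ψ i j k l x y z w := by
  have e : ∀ {i j k l : ℤ} {x y z w : V}, x ∈ 𝒱 i → y ∈ 𝒱 j →
      koszulThree Ψ (j + i - 1) k l (br y x) z w =
        -((j - 1) * (i - 1)).negOnePow • koszulThree Ψ (i + j - 1) k l (br x y) z w :=
    fun {i j k l x y z w} hx hy => by
      rw [hbr.skew hy hx, koszulThree_units_smul hΨ.map_add, add_comm j i]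
  simp only [bracketKoszul]
  rw [koszulThree_cyclic h hΨ hx hy hz hΨ1, koszulThree_cyclic h hΨ hx hy hw hΨ1,
    koszulThree_cyclic h hΨ hx hz hw hΨ1, koszulThree_swap_right h hΨ (hbr.mem hy hz) hx hw hΨ1,
    koszulThree_swap_right h hΨ (hbr.mem hy hw) hx hz hΨ1,
    koszulThree_swap_right h hΨ (hbr.mem hz hw) hx hy hΨ1, e hx hy, e hx hz, e hx hw]
  simp only [hbr_smul]
  by_cases h1 : Even i <;> by_cases h2 : Even j <;> by_cases h3 : Even k <;> by_cases h4 : Even l <;>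
  · simp only [negOnePow_smul_eq_ite, Units.neg_smul, Int.even_add, Int.even_sub, Int.even_mul,
      h1, h2, h3, h4, Int.not_even_one,
      if_true, if_false, or_true, or_false, iff_true, iff_false, not_true_eq_false, neg_neg,
      or_self]
    abel

/-- The two sides of the four-term identity differ by a combination of `[Φ³(x, y, z), ·]`, graded
commutators of brackets with operators `Φ³(·, ·, -)`, and operators `Φ³([·, ·], ·, -)`. All of them
are derivations in the last variable. -/
theorem bracketKoszul_eq (h : IsGradedComm 𝒱) (hbr : IsSkewBracket 𝒱 br)
    (hΨ : IsDiffOp 𝒱 4 (-1) Ψ) (hΨ1 : Ψ 1 = 0) {i j k l : ℤ} {x y z w : V}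
    (hx : x ∈ 𝒱 i) (hy : y ∈ 𝒱 j) (hz : z ∈ 𝒱 k) (hw : w ∈ 𝒱 l) :
    bracketKoszul br Ψ i j k l x y z w =
      (i + j + k).negOnePow • br (koszulThree Ψ i j k x y z) w
      - (i * k + j * k).negOnePow • (br z (koszulOp Ψ (-1) i j x y w)
        - ((k - 1) * (-1 + i + j)).negOnePow • koszulOp Ψ (-1) i j x y (br z w))
      - (i * j).negOnePow • (br y (koszulOp Ψ (-1) i k x z w)
        - ((j - 1) * (-1 + i + k)).negOnePow • koszulOp Ψ (-1) i k x z (br y w))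
      - (br x (koszulOp Ψ (-1) j k y z w)
        - ((i - 1) * (-1 + j + k)).negOnePow • koszulOp Ψ (-1) j k y z (br x w))
      - i.negOnePow • koszulOp Ψ (-1) (i + j - 1) k (br x y) z w
      - (j * k + i).negOnePow • koszulOp Ψ (-1) (i + k - 1) j (br x z) y w
      - (i * j + i * k + j).negOnePow • koszulOp Ψ (-1) (j + k - 1) i (br y z) x w := by
  simp only [bracketKoszul]
  rw [← koszulThree_eq_koszulOp h hΨ hx hy hw hΨ1, ← koszulThree_eq_koszulOp h hΨ hx hz hw hΨ1,
    ← koszulThree_eq_koszulOp h hΨ hy hz hw hΨ1,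
    ← koszulThree_eq_koszulOp h hΨ hx hy (hbr.mem hz hw) hΨ1,
    ← koszulThree_eq_koszulOp h hΨ hx hz (hbr.mem hy hw) hΨ1,
    ← koszulThree_eq_koszulOp h hΨ hy hz (hbr.mem hx hw) hΨ1,
    ← koszulThree_eq_koszulOp h hΨ (hbr.mem hx hy) hz hw hΨ1,
    ← koszulThree_eq_koszulOp h hΨ (hbr.mem hx hz) hy hw hΨ1,
    ← koszulThree_eq_koszulOp h hΨ (hbr.mem hy hz) hx hw hΨ1,
    koszulThree_cyclic h hΨ (hbr.mem hx hw) hy hz hΨ1,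
    koszulThree_cyclic h hΨ (hbr.mem hy hw) hx hz hΨ1,
    koszulThree_cyclic h hΨ (hbr.mem hz hw) hx hy hΨ1,
    hbr.skew (koszulThree_mem h hΨ hx hy hw hΨ1) hz,
    hbr.skew (koszulThree_mem h hΨ hx hz hw hΨ1) hy,
    hbr.skew (koszulThree_mem h hΨ hy hz hw hΨ1) hx]
  by_cases h1 : Even i <;> by_cases h2 : Even j <;> by_cases h3 : Even k <;> by_cases h4 : Even l <;>
  · simp only [negOnePow_smul_eq_ite, Units.neg_smul, Int.even_add, Int.even_sub, Int.even_mul,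
      h1, h2, h3, h4, Int.not_even_one, even_neg,
      if_true, if_false, or_true, or_false, iff_true, iff_false, not_true_eq_false, neg_neg,
      or_self]
    abel

/-- The compatibility of a bracket with a differential operator of order at most three holds if it
holds on generators. -/
theorem bracketKoszul_eq_zero (h : IsGradedComm 𝒱) (hG : IsGeneratedBy 𝒱 Gen)
    (hbr : IsSkewBracket 𝒱 br) (hΨ : IsDiffOp 𝒱 4 (-1) Ψ) (hΨ1 : Ψ 1 = 0)
    (hbr_smul : ∀ (u : ℤˣ) a b, br (u • a) b = u • br a b)
    (h₀ : ∀ i j k l x y z w, Gen i x → Gen j y → Gen k z → Gen l w →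
      bracketKoszul br Ψ i j k l x y z w = 0)
    {i j k l : ℤ} {x y z w : V} (hx : x ∈ 𝒱 i) (hy : y ∈ 𝒱 j) (hz : z ∈ 𝒱 k) (hw : w ∈ 𝒱 l) :
    bracketKoszul br Ψ i j k l x y z w = 0 := by
  have hrot : ∀ {i j k l : ℤ} {x y z w : V}, x ∈ 𝒱 i → y ∈ 𝒱 j → z ∈ 𝒱 k → w ∈ 𝒱 l →
      bracketKoszul br Ψ j k l i y z w x = 0 → bracketKoszul br Ψ i j k l x y z w = 0 :=
    fun {i j k l x y z w} hx hy hz hw h' => by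
      rw [bracketKoszul_rotate h hbr hΨ hΨ1 hx hy hz hw hbr_smul] at h'
      exact (smul_eq_zero_iff_eq _).1 h'
  have step : ∀ {i j k : ℤ} {x y z : V}, x ∈ 𝒱 i → y ∈ 𝒱 j → z ∈ 𝒱 k →
      (∀ l w, Gen l w → bracketKoszul br Ψ i j k l x y z w = 0) →
      ∀ {l : ℤ} {w : V}, w ∈ 𝒱 l → bracketKoszul br Ψ i j k l x y z w = 0 := by
    intro i j k x y z hx hy hz h₁ l w hw
    rw [bracketKoszul_eq h hbr hΨ hΨ1 hx hy hz hw]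
    have e₁ := (hbr.der (koszulThree_mem h hΨ hx hy hz hΨ1)).congr
      (m := i + j + k - 2) (by ring) fun _ => rfl
    have e₂ := ((hbr.der hz).comm (hΨ.koszulOp h hx hy)).congr
      (m := i + j + k - 2) (by ring) fun _ => rfl
    have e₃ := ((hbr.der hy).comm (hΨ.koszulOp h hx hz)).congr
      (m := i + j + k - 2) (by ring) fun _ => rfl
    have e₄ := ((hbr.der hx).comm (hΨ.koszulOp h hy hz)).congr
      (m := i + j + k - 2) (by ring) fun _ => rfl
    have e₅ := (hΨ.koszulOp h (hbr.mem hx hy) hz).congr (m := i + j + k - 2) (by ring) fun _ => rfl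
    have e₆ := (hΨ.koszulOp h (hbr.mem hx hz) hy).congr (m := i + j + k - 2) (by ring) fun _ => rfl
    have e₇ := (hΨ.koszulOp h (hbr.mem hy hz) hx).congr (m := i + j + k - 2) (by ring) fun _ => rfl
    refine (((((((e₁.units_smul (i + j + k).negOnePow).sub
      (e₂.units_smul (i * k + j * k).negOnePow)).sub (e₃.units_smul (i * j).negOnePow)).sub e₄).sub
      (e₅.units_smul i.negOnePow)).sub (e₆.units_smul (j * k + i).negOnePow)).sub
      (e₇.units_smul (i * j + i * k + j).negOnePow)).eq_zero_of_isGeneratedBy h hG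
      (fun l w hw => ?_) w
    exact (bracketKoszul_eq h hbr hΨ hΨ1 hx hy hz (hG.mem hw)).symm.trans (h₁ l w hw)
  -- `step` and rotations replace the generators by arbitrary elements, one argument at a time
  have step₁ : ∀ {i j k l : ℤ} {x y z w : V}, Gen i x → Gen j y → Gen k z → w ∈ 𝒱 l →
      bracketKoszul br Ψ i j k l x y z w = 0 := fun hx hy hz hw =>
    step (hG.mem hx) (hG.mem hy) (hG.mem hz) (fun l w => h₀ _ _ _ _ _ _ _ _ hx hy hz) hw
  have step₂ : ∀ {i j k l : ℤ} {x y z w : V}, x ∈ 𝒱 i → Gen j y → Gen k z → w ∈ 𝒱 l →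
      bracketKoszul br Ψ i j k l x y z w = 0 := fun hx hy hz hw =>
    step hx (hG.mem hy) (hG.mem hz) (fun l w hw => hrot hx (hG.mem hy) (hG.mem hz) (hG.mem hw)
      (step₁ hy hz hw hx)) hw
  have step₃ : ∀ {i j k l : ℤ} {x y z w : V}, x ∈ 𝒱 i → y ∈ 𝒱 j → Gen k z → w ∈ 𝒱 l →
      bracketKoszul br Ψ i j k l x y z w = 0 := fun hx hy hz hw =>
    step hx hy (hG.mem hz) (fun l w hw => hrot hx hy (hG.mem hz) (hG.mem hw)
      (step₂ hy hz hw hx)) hw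
  exact step hx hy hz (fun l w hw => hrot hx hy hz (hG.mem hw) (step₃ hy hz hw hx)) hw

end FourTermIdentity

/-! ### The shuffles on four letters -/

section Shuffles

open Equiv

theorem koszulSign_eq_prod {e : Fin 4 → ℤ} {σ : Perm (Fin 4)} (l : List (Fin 4 × Fin 4))
    (hl : l.Nodup)
    (h : (Finset.univ.filter fun ij : Fin 4 × Fin 4 => ij.1 < ij.2 ∧ σ ij.2 < σ ij.1) =
      l.toFinset) :
    BigradedAlgebraData.koszulSign e σ =
      (l.map fun ij => (e (σ ij.1) * e (σ ij.2)).negOnePow).prod := by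
  rw [BigradedAlgebraData.koszulSign, h, List.prod_toFinset _ hl]

variable {M : Type*} [AddCommGroup M]

theorem sum_shuffles_three_one (F : Perm (Fin 4) → M) :
    ∑ σ : Perm (Fin 4) with σ 0 < σ 1 ∧ σ 1 < σ 2, F σ =
      F 1 + F (swap 2 3) + F (swap 1 2 * swap 2 3) + F (swap 0 1 * swap 1 2 * swap 2 3) := by
  have h : (Finset.univ.filter fun σ : Perm (Fin 4) => σ 0 < σ 1 ∧ σ 1 < σ 2) =
      {1, swap 2 3, swap 1 2 * swap 2 3, swap 0 1 * swap 1 2 * swap 2 3} := by decide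
  rw [h, Finset.sum_insert (by decide), Finset.sum_insert (by decide),
    Finset.sum_insert (by decide), Finset.sum_singleton]
  abel

theorem sum_shuffles_two_two (F : Perm (Fin 4) → M) :
    ∑ τ : Perm (Fin 4) with τ 0 < τ 1 ∧ τ 2 < τ 3, F τ =
      F 1 + F (swap 1 2) + F (swap 2 3 * swap 1 2) + F (swap 0 1 * swap 1 2)
        + F (swap 0 1 * swap 2 3 * swap 1 2) + F (swap 0 2 * swap 1 3) := by
  have h : (Finset.univ.filter fun τ : Perm (Fin 4) => τ 0 < τ 1 ∧ τ 2 < τ 3) =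
      {1, swap 1 2, swap 2 3 * swap 1 2, swap 0 1 * swap 1 2, swap 0 1 * swap 2 3 * swap 1 2,
        swap 0 2 * swap 1 3} := by decide
  rw [h, Finset.sum_insert (by decide), Finset.sum_insert (by decide),
    Finset.sum_insert (by decide), Finset.sum_insert (by decide),
    Finset.sum_insert (by decide), Finset.sum_singleton]
  abel

variable {V : Type*} [Ring V]

/-- The compatibility of a bracket with an operator, with the sums over the shuffles. -/
theorem sum_shuffles_eq_of_bracketKoszul {br : V → V → V} {Ψ : V → V} (e : Fin 4 → ℤ) (a : Fin 4 → V)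
    (h : bracketKoszul br Ψ (e 0) (e 1) (e 2) (e 3) (a 0) (a 1) (a 2) (a 3) = 0) :
    ∑ σ : Perm (Fin 4) with σ 0 < σ 1 ∧ σ 1 < σ 2,
      (BigradedAlgebraData.koszulSign e σ * (e (σ 0) + e (σ 1) + e (σ 2)).negOnePow) •
        br (koszulThree Ψ (e (σ 0)) (e (σ 1)) (e (σ 2)) (a (σ 0)) (a (σ 1)) (a (σ 2))) (a (σ 3))
    = ∑ τ : Perm (Fin 4) with τ 0 < τ 1 ∧ τ 2 < τ 3,
      (BigradedAlgebraData.koszulSign e τ * (e (τ 0)).negOnePow) •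
        koszulThree Ψ (e (τ 0) + e (τ 1) - 1) (e (τ 2)) (e (τ 3))
          (br (a (τ 0)) (a (τ 1))) (a (τ 2)) (a (τ 3)) := by
  rw [sum_shuffles_three_one, sum_shuffles_two_two,
    koszulSign_eq_prod (σ := 1) [] (by decide)
      (by decide),
    koszulSign_eq_prod (σ := swap 2 3) [(2, 3)] (by decide)
      (by decide),
    koszulSign_eq_prod (σ := swap 1 2 * swap 2 3) [(1, 3), (2, 3)] (by decide)
      (by decide),
    koszulSign_eq_prod (σ := swap 0 1 * swap 1 2 * swap 2 3) [(0, 3), (1, 3), (2, 3)] (by decide)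
      (by decide),
    koszulSign_eq_prod (σ := swap 1 2) [(1, 2)] (by decide)
      (by decide),
    koszulSign_eq_prod (σ := swap 2 3 * swap 1 2) [(1, 2), (1, 3)] (by decide)
      (by decide),
    koszulSign_eq_prod (σ := swap 0 1 * swap 1 2) [(0, 2), (1, 2)] (by decide)
      (by decide),
    koszulSign_eq_prod (σ := swap 0 1 * swap 2 3 * swap 1 2) [(0, 2), (1, 2), (1, 3)] (by decide)
      (by decide),
    koszulSign_eq_prod (σ := swap 0 2 * swap 1 3) [(0, 2), (0, 3), (1, 2), (1, 3)] (by decide)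
      (by decide)]
  rw [← sub_eq_zero, ← h, bracketKoszul]
  have p2 : (swap 2 3 : Perm (Fin 4)) 0 = 0 ∧ (swap 2 3 : Perm (Fin 4)) 1 = 1 ∧
    (swap 2 3 : Perm (Fin 4)) 2 = 3 ∧ (swap 2 3 : Perm (Fin 4)) 3 = 2 := by decide
  have p3 : (swap 1 2 : Perm (Fin 4)) 0 = 0 ∧ (swap 1 2 : Perm (Fin 4)) 1 = 2 ∧
    (swap 1 2 : Perm (Fin 4)) 2 = 1 ∧ (swap 1 2 : Perm (Fin 4)) 3 = 3 := by decide
  have p4 : (swap 0 1 : Perm (Fin 4)) 0 = 1 ∧ (swap 0 1 : Perm (Fin 4)) 1 = 0 ∧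
    (swap 0 1 : Perm (Fin 4)) 2 = 2 ∧ (swap 0 1 : Perm (Fin 4)) 3 = 3 := by decide
  have p5 : (swap 0 2 : Perm (Fin 4)) 0 = 2 ∧ (swap 0 2 : Perm (Fin 4)) 1 = 1 ∧
    (swap 0 2 : Perm (Fin 4)) 2 = 0 ∧ (swap 0 2 : Perm (Fin 4)) 3 = 3 := by decide
  have p6 : (swap 1 3 : Perm (Fin 4)) 0 = 0 ∧ (swap 1 3 : Perm (Fin 4)) 1 = 3 ∧
    (swap 1 3 : Perm (Fin 4)) 2 = 2 ∧ (swap 1 3 : Perm (Fin 4)) 3 = 1 := by decide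
  simp only [List.map_cons, List.map_nil, List.prod_cons, List.prod_nil, mul_one, one_mul,
    ← Int.negOnePow_add]
  simp only [Perm.mul_apply, Perm.one_apply, p2, p3, p4, p5, p6]
  by_cases h1 : Even (e 0) <;> by_cases h2 : Even (e 1) <;> by_cases h3 : Even (e 2) <;>
    by_cases h4 : Even (e 3) <;>
  · simp only [negOnePow_smul_eq_ite, Int.even_add, Int.even_mul, h1, h2, h3, h4,
      if_true, if_false, or_true, or_false, iff_true, iff_false, not_true_eq_false]

end Shuffles

/-! ### Lie operators on forms -/

section ExteriorDerivations

variable {R A Q : Type*} [CommRing R] [CommRing A] [Algebra R A] [AddCommGroup Q] [Module R Q]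
  [Module A Q] (D : Derivation R A A) (ψ : Q →ₗ[R] Q)
  (h : ∀ (a : A) (ξ : Q), ψ (a • ξ) = D a • ξ + a • ψ ξ)

theorem extDerivation_zero : extDerivation D ψ h 0 = 0 :=
  map_zero (AddMonoidHom.mk' _ (extDerivation_add D ψ h))

theorem extDerivation_smul (a : A) (u : ExteriorAlgebra A Q) :
    extDerivation D ψ h (a • u) = D a • u + a • extDerivation D ψ h u := by
  rw [Algebra.smul_def, extDerivation_mul, extDerivation_algebraMap, ← Algebra.smul_def,
    ← Algebra.smul_def]

theorem extDerivation_smul_of_tower [IsScalarTower R A Q] (r : R) (u : ExteriorAlgebra A Q) :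
    extDerivation D ψ h (r • u) = r • extDerivation D ψ h u := by
  rw [← algebraMap_smul A r u, extDerivation_smul, Derivation.map_algebraMap, zero_smul, zero_add,
    algebraMap_smul]

theorem extDerivation_neg (u : ExteriorAlgebra A Q) :
    extDerivation D ψ h (-u) = -extDerivation D ψ h u :=
  map_neg (AddMonoidHom.mk' _ (extDerivation_add D ψ h)) u

theorem involute_extDerivation (u : ExteriorAlgebra A Q) :
    CliffordAlgebra.involute (extDerivation D ψ h u) =
      extDerivation D ψ h (CliffordAlgebra.involute u) := by
  have hι : ∀ ξ : Q, CliffordAlgebra.involute (ExteriorAlgebra.ι A ξ) = -ExteriorAlgebra.ι A ξ :=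
    fun ξ => CliffordAlgebra.involute_ι ξ
  induction u using ExteriorAlgebra.induction with
  | algebraMap a => rw [extDerivation_algebraMap, AlgHom.commutes, AlgHom.commutes,
      extDerivation_algebraMap]
  | ι ξ => rw [extDerivation_ι, hι, hι, extDerivation_neg, extDerivation_ι]
  | mul u v hu hv =>
    rw [extDerivation_mul, map_add, map_mul, map_mul, hu, hv, map_mul, extDerivation_mul]
  | add u v hu hv => rw [extDerivation_add, map_add, hu, hv, map_add, extDerivation_add]

theorem extDerivation_mem {p : ℤ} {u : ExteriorAlgebra A Q} (hu : u ∈ extPower A Q p) :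
    extDerivation D ψ h u ∈ extPower A Q p := by
  refine extPower_induction (P := fun p u => extDerivation D ψ h u ∈ extPower A Q p) ?_ ?_ ?_ ?_ hu
  · intro p
    rw [extDerivation_zero]
    exact zero_mem _
  · intro p u v hu hv
    rw [extDerivation_add]
    exact add_mem hu hv
  · intro a
    rw [extDerivation_algebraMap]
    exact algebraMap_mem_extPower _
  · intro p ξ u _ hu hu'
    rw [extDerivation_mul, extDerivation_ι, add_comm p]
    exact add_mem (mul_mem_extPower (ι_mem_extPower _) hu)
      (mul_mem_extPower (ι_mem_extPower _) hu')

end ExteriorDerivations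

section LieOperators

variable {R A H Q : Type*} [CommRing R] [CommRing A] [Algebra R A]
  [AddCommGroup H] [Module R H] [Module A H] [AddCommGroup Q] [Module R Q] [Module A Q]
  (D : Derivation R A A) (φ : H →ₗ[R] H) (ψ : Q →ₗ[R] Q)
  (hφ : ∀ (a : A) (x : H), φ (a • x) = D a • x + a • φ x)
  (hψ : ∀ (a : A) (ξ : Q), ψ (a • ξ) = D a • ξ + a • ψ ξ)

/-- The Lie derivative of a form along covariant derivatives `φ` and `ψ` of `H` and `Q` over the
same derivation of `A`. -/
def lieForm {q : ℕ} (f : H [⋀^Fin q]→ₗ[A] ExteriorAlgebra A Q) :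
    H [⋀^Fin q]→ₗ[A] ExteriorAlgebra A Q where
  toFun v := extDerivation D ψ hψ (f v) - ∑ j, f (Function.update v j (φ (v j)))
  map_update_add' {_} v i x y := by
    obtain rfl : ‹DecidableEq (Fin q)› = instDecidableEqFin q := Subsingleton.elim _ _
    have : ∑ j, f (Function.update (Function.update v i (x + y)) j
        (φ (Function.update v i (x + y) j))) =
        ∑ j, f (Function.update (Function.update v i x) j (φ (Function.update v i x j))) +
          ∑ j, f (Function.update (Function.update v i y) j (φ (Function.update v i y j))) := by
      rw [← Finset.sum_add_distrib]
      refine Finset.sum_congr rfl fun j _ => ?_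
      by_cases hj : j = i
      · subst hj
        simp only [Function.update_self, Function.update_idem, map_add,
          AlternatingMap.map_update_add]
      · simp only [Function.update_of_ne hj, Function.update_comm (Ne.symm hj),
          AlternatingMap.map_update_add]
    rw [this, AlternatingMap.map_update_add, extDerivation_add]
    abel
  map_update_smul' {_} v i a x := by
    obtain rfl : ‹DecidableEq (Fin q)› = instDecidableEqFin q := Subsingleton.elim _ _
    rw [AlternatingMap.map_update_smul, extDerivation_smul, smul_sub, Finset.smul_sum,
      ← Finset.add_sum_erase _ _ (Finset.mem_univ i),
      ← Finset.add_sum_erase _ (fun j => a • f _) (Finset.mem_univ i)]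
    simp only [Function.update_self, Function.update_idem, hφ, AlternatingMap.map_update_add,
      AlternatingMap.map_update_smul]
    have : ∀ j ∈ Finset.univ.erase i,
        f (Function.update (Function.update v i (a • x)) j
          (φ (Function.update v i (a • x) j))) =
        a • f (Function.update (Function.update v i x) j (φ (Function.update v i x j))) :=
      fun j hj => by
        have hj := Finset.ne_of_mem_erase hj
        simp only [Function.update_of_ne hj, Function.update_comm (Ne.symm hj),
          AlternatingMap.map_update_smul]
    rw [Finset.sum_congr rfl this]
    abel
  map_eq_zero_of_eq' v i j hv hij := by
    rw [f.map_eq_zero_of_eq v hv hij, extDerivation_zero, zero_sub, neg_eq_zero,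
      ← Finset.add_sum_erase _ _ (Finset.mem_univ i),
      ← Finset.add_sum_erase _ _ (Finset.mem_erase.2 ⟨hij.symm, Finset.mem_univ j⟩),
      Finset.sum_eq_zero fun k hk => ?_, add_zero]
    · have h1 := f.map_swap (Function.update v i (φ (v i))) hij
      have h2 : Function.update v i (φ (v i)) ∘ Equiv.swap i j = Function.update v j (φ (v j)) := by
        funext k
        by_cases hki : k = i
        · subst hki
          rw [Function.comp_apply, Equiv.swap_apply_left, Function.update_of_ne hij.symm,
            Function.update_of_ne hij, hv]
        · by_cases hkj : k = j
          · subst hkj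
            rw [Function.comp_apply, Equiv.swap_apply_right, Function.update_self,
              Function.update_self, hv]
          · rw [Function.comp_apply, Equiv.swap_apply_of_ne_of_ne hki hkj,
              Function.update_of_ne hki, Function.update_of_ne hkj]
      rw [← h2, h1, add_neg_cancel]
    · have hkj := Finset.ne_of_mem_erase hk
      have hki := Finset.ne_of_mem_erase (Finset.mem_of_mem_erase hk)
      refine f.map_eq_zero_of_eq _ ?_ hij
      rw [Function.update_of_ne hki.symm, Function.update_of_ne hkj.symm, hv]

theorem lieForm_apply {q : ℕ} (f : H [⋀^Fin q]→ₗ[A] ExteriorAlgebra A Q) (v : Fin q → H) :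
    lieForm D φ ψ hφ hψ f v =
      extDerivation D ψ hψ (f v) - ∑ j, f (Function.update v j (φ (v j))) :=
  rfl

variable [IsScalarTower R A Q]

/-- The Lie derivative along covariant derivatives of `H` and `Q`, on all forms. -/
def lieOp : ExtForms A H Q →ₗ[R] ExtForms A H Q where
  toFun w := DFinsupp.mapRange (fun (q : ℕ) (f : H [⋀^Fin q]→ₗ[A] ExteriorAlgebra A Q) =>
    lieForm D φ ψ hφ hψ f) (fun q => AlternatingMap.ext fun v => by
      rw [lieForm_apply]
      simp [extDerivation_zero]) w
  map_add' w w' := forms_ext fun q v => by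
    change extDerivation D ψ hψ (w q v + w' q v) -
      ∑ j, (w q (Function.update v j (φ (v j))) + w' q (Function.update v j (φ (v j)))) =
      (extDerivation D ψ hψ (w q v) - ∑ j, w q (Function.update v j (φ (v j)))) +
      (extDerivation D ψ hψ (w' q v) - ∑ j, w' q (Function.update v j (φ (v j))))
    rw [extDerivation_add, Finset.sum_add_distrib, add_sub_add_comm]
  map_smul' r w := forms_ext fun q v => by
    change extDerivation D ψ hψ (r • w q v) -
      ∑ j, r • w q (Function.update v j (φ (v j))) =
      r • (extDerivation D ψ hψ (w q v) - ∑ j, w q (Function.update v j (φ (v j))))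
    rw [extDerivation_smul_of_tower, smul_sub, Finset.smul_sum]

theorem lieOp_apply (w : ExtForms A H Q) (q : ℕ) (v : Fin q → H) :
    lieOp D φ ψ hφ hψ w q v =
      extDerivation D ψ hψ (w q v) - ∑ j, w q (Function.update v j (φ (v j))) :=
  rfl

theorem constTerm_lieOp (w : ExtForms A H Q) :
    constTerm (lieOp D φ ψ hφ hψ w) = extDerivation D ψ hψ (constTerm w) := by
  change lieOp D φ ψ hφ hψ w 0 ![] = _
  rw [lieOp_apply, Finset.univ_eq_empty, Finset.sum_empty, sub_zero]
  rfl

theorem insertFirst_lieOp (x : H) (w : ExtForms A H Q) :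
    insertFirst x (lieOp D φ ψ hφ hψ w) =
      lieOp D φ ψ hφ hψ (insertFirst x w) - insertFirst (φ x) w := by
  refine forms_ext fun q v => ?_
  change lieOp D φ ψ hφ hψ w (q + 1) (Fin.cons (α := fun _ => H) x v) =
    lieOp D φ ψ hφ hψ (insertFirst x w) q v - w (q + 1) (Fin.cons (α := fun _ => H) (φ x) v)
  rw [lieOp_apply, lieOp_apply, Fin.sum_univ_succ]
  simp only [Fin.cons_zero, Fin.cons_succ, Fin.update_cons_zero, ← Fin.cons_update,
    insertFirst_apply]
  abel

theorem lieOp_parity (w : ExtForms A H Q) :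
    lieOp D φ ψ hφ hψ (parity w) = parity (lieOp D φ ψ hφ hψ w) := by
  refine forms_ext fun q v => ?_
  have hs : ∀ (u : ℤˣ) (z : ExteriorAlgebra A Q),
      extDerivation D ψ hψ (u • z) = u • extDerivation D ψ hψ z := fun u z => by
    rcases Int.units_eq_one_or u with rfl | rfl
    · rw [one_smul, one_smul]
    · rw [Units.neg_smul, one_smul, extDerivation_neg, Units.neg_smul, one_smul]
  simp only [lieOp_apply, parity_apply]
  rw [hs, map_sub, smul_sub, involute_extDerivation, map_sum, Finset.smul_sum]

theorem lieOp_mem {q p : ℤ} {w : ExtForms A H Q} (hw : w ∈ (formsAlgebra R A H Q).gr q p) :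
    lieOp D φ ψ hφ hψ w ∈ (formsAlgebra R A H Q).gr q p := by
  rw [mem_gr_iff] at hw ⊢
  intro m v
  rw [lieOp_apply]
  refine ⟨sub_mem (extDerivation_mem D ψ hψ (hw m v).1) (sum_mem fun j _ => (hw m _).1),
    fun hm => ?_⟩
  rw [(hw m v).2 hm, extDerivation_zero, Finset.sum_eq_zero fun j _ => (hw m _).2 hm, sub_zero]

attribute [local instance] formRing

theorem lieOp_mul (a b : ExtForms A H Q) : lieOp D φ ψ hφ hψ (a * b) =
    lieOp D φ ψ hφ hψ a * b + a * lieOp D φ ψ hφ hψ b := by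
  refine sub_eq_zero.1 (eq_zero_of_insertFirst_mem (fun ab : ExtForms A H Q × ExtForms A H Q =>
    lieOp D φ ψ hφ hψ (ab.1 * ab.2) -
      (lieOp D φ ψ hφ hψ ab.1 * ab.2 + ab.1 * lieOp D φ ψ hφ hψ ab.2)) ?_ ?_ (a, b))
  · rintro ⟨a, b⟩
    simp only [map_sub, map_add, constTerm_mul, constTerm_lieOp, extDerivation_mul, sub_self]
  · rintro ⟨a, b⟩ x
    have : insertFirst x (lieOp D φ ψ hφ hψ (a * b) -
        (lieOp D φ ψ hφ hψ a * b + a * lieOp D φ ψ hφ hψ b)) =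
        (lieOp D φ ψ hφ hψ (insertFirst x a * parity b) -
          (lieOp D φ ψ hφ hψ (insertFirst x a) * parity b +
            insertFirst x a * lieOp D φ ψ hφ hψ (parity b))) +
        (lieOp D φ ψ hφ hψ (a * insertFirst x b) -
          (lieOp D φ ψ hφ hψ a * insertFirst x b +
            a * lieOp D φ ψ hφ hψ (insertFirst x b))) := by
      simp only [map_sub, map_add, insertFirst_mul, insertFirst_lieOp, lieOp_parity, sub_mul,
        mul_sub]
      abel
    rw [this]
    exact add_mem (AddSubgroup.subset_closure ⟨(_, _), rfl⟩)
      (AddSubgroup.subset_closure ⟨(_, _), rfl⟩)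

end LieOperators

/-! ### Lie operators determined by their action on `H` and on constants -/

section LieRelations

variable {A H Q : Type*} [CommRing A] [AddCommGroup H] [Module A H] [AddCommGroup Q] [Module A Q]

theorem insertFirst_zero_left (w : ExtForms A H Q) : insertFirst (0 : H) w = 0 := by
  rw [← zero_smul A (0 : H), insertFirst_smul, zero_smul]

theorem insertFirst_sub_left (x y : H) (w : ExtForms A H Q) :
    insertFirst (x - y) w = insertFirst x w - insertFirst y w := by
  rw [eq_sub_iff_add_eq, ← insertFirst_add, sub_add_cancel]

/-- `L` is an operator on forms that is given by `E` on constants and commutes with the insertion of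
arguments up to the insertion of `φ`. Such an operator is determined by `φ` and `E`. -/
structure IsLieOp (φ : H → H) (E : ExteriorAlgebra A Q → ExteriorAlgebra A Q)
    (L : ExtForms A H Q → ExtForms A H Q) : Prop where
  map_add : ∀ w w', L (w + w') = L w + L w'
  insert : ∀ x w, insertFirst x (L w) = L (insertFirst x w) - insertFirst (φ x) w
  const : ∀ w, constTerm (L w) = E (constTerm w)

namespace IsLieOp

variable {φ φ' : H → H} {E E' : ExteriorAlgebra A Q → ExteriorAlgebra A Q}
  {L L' : ExtForms A H Q → ExtForms A H Q}

theorem map_sub (hL : IsLieOp φ E L) (w w' : ExtForms A H Q) : L (w - w') = L w - L w' :=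
  _root_.map_sub (AddMonoidHom.mk' L hL.map_add) w w'

theorem add (hL : IsLieOp φ E L) (hL' : IsLieOp φ' E' L') :
    IsLieOp (fun x => φ x + φ' x) (fun u => E u + E' u) (fun w => L w + L' w) where
  map_add w w' := by rw [hL.map_add, hL'.map_add]; abel
  insert x w := by
    rw [_root_.map_add, hL.insert, hL'.insert, insertFirst_add]; abel
  const w := by rw [_root_.map_add, hL.const, hL'.const]

theorem sub (hL : IsLieOp φ E L) (hL' : IsLieOp φ' E' L') :
    IsLieOp (fun x => φ x - φ' x) (fun u => E u - E' u) (fun w => L w - L' w) where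
  map_add w w' := by rw [hL.map_add, hL'.map_add]; abel
  insert x w := by
    rw [_root_.map_sub, hL.insert, hL'.insert, insertFirst_sub_left]; abel
  const w := by rw [_root_.map_sub, hL.const, hL'.const]

theorem smul (a : A) (hL : IsLieOp φ E L) :
    IsLieOp (fun x => a • φ x) (fun u => a • E u) (fun w => a • L w) where
  map_add w w' := by rw [hL.map_add, smul_add]
  insert x w := by
    rw [_root_.map_smul, hL.insert, smul_sub, insertFirst_smul]
  const w := by rw [_root_.map_smul, hL.const]

theorem zero : IsLieOp (fun _ : H => 0) (fun _ : ExteriorAlgebra A Q => 0)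
    (fun _ => 0) where
  map_add w w' := (add_zero 0).symm
  insert x w := by
    rw [_root_.map_zero, insertFirst_zero_left, sub_zero]
  const w := _root_.map_zero _

theorem sum {ι : Type*} (s : Finset ι) {φ : ι → H → H}
    {E : ι → ExteriorAlgebra A Q → ExteriorAlgebra A Q}
    {L : ι → ExtForms A H Q → ExtForms A H Q} (hL : ∀ i, IsLieOp (φ i) (E i) (L i)) :
    IsLieOp (fun x => ∑ i ∈ s, φ i x) (fun u => ∑ i ∈ s, E i u) (fun w => ∑ i ∈ s, L i w) := by
  classical
  induction s using Finset.induction_on with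
  | empty => exact zero
  | insert i s hi ih =>
    simp only [Finset.sum_insert hi]
    exact (hL i).add ih

theorem comm (hL : IsLieOp φ E L) (hL' : IsLieOp φ' E' L') :
    IsLieOp (fun x => φ (φ' x) - φ' (φ x)) (fun u => E (E' u) - E' (E u))
      (fun w => L (L' w) - L' (L w)) where
  map_add w w' := by
    rw [hL'.map_add, hL.map_add, hL.map_add, hL'.map_add]; abel
  insert x w := by
    rw [_root_.map_sub, hL.insert x (L' w), hL'.insert x w, hL'.insert x (L w), hL.insert x w,
      hL.map_sub, hL'.map_sub, hL'.insert (φ x) w, hL.insert (φ' x) w, insertFirst_sub_left]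
    abel
  const w := by
    rw [_root_.map_sub, hL.const, hL'.const, hL'.const, hL.const]

theorem eq_zero (hL : IsLieOp φ E L) (hφ : ∀ x, φ x = 0) {S : Set (ExtForms A H Q)}
    (hS : ∀ w ∈ S, ∀ x, insertFirst x w ∈ S) (hE : ∀ w ∈ S, E (constTerm w) = 0)
    {w : ExtForms A H Q} (hw : w ∈ S) : L w = 0 := by
  refine eq_zero_of_insertFirst_mem (ι := S) (fun w => L w) (fun w => ?_) (fun w x => ?_) ⟨w, hw⟩
  · rw [hL.const, hE w w.2]
  · rw [hL.insert, hφ, insertFirst_zero_left, sub_zero]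
    exact AddSubgroup.subset_closure ⟨⟨_, hS w w.2 x⟩, rfl⟩

end IsLieOp

theorem isLieOp_lieOp {R : Type*} [CommRing R] [Algebra R A] [Module R H] [Module R Q]
    [IsScalarTower R A Q] (D : Derivation R A A) (φ : H →ₗ[R] H) (ψ : Q →ₗ[R] Q)
    (hφ : ∀ (a : A) (x : H), φ (a • x) = D a • x + a • φ x)
    (hψ : ∀ (a : A) (ξ : Q), ψ (a • ξ) = D a • ξ + a • ψ ξ) :
    IsLieOp φ (extDerivation D ψ hψ) (lieOp D φ ψ hφ hψ) :=
  ⟨map_add _, insertFirst_lieOp D φ ψ hφ hψ, constTerm_lieOp D φ ψ hφ hψ⟩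

/-- The forms with values in the ground ring `A`. -/
def scalarForms (A H Q : Type*) [CommRing A] [AddCommGroup H] [Module A H] [AddCommGroup Q]
    [Module A Q] : Set (ExtForms A H Q) :=
  {w | ∀ (q : ℕ) (v : Fin q → H), w q v ∈ Set.range (algebraMap A (ExteriorAlgebra A Q))}

theorem insertFirst_mem_scalarForms {w : ExtForms A H Q} (hw : w ∈ scalarForms A H Q) (x : H) :
    insertFirst x w ∈ scalarForms A H Q :=
  fun _ _ => hw _ _

theorem ofScalarForm_mem_scalarForms {q : ℕ} (α : H [⋀^Fin q]→ₗ[A] A) :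
    ofScalarForm Q α ∈ scalarForms A H Q := by
  intro m v
  by_cases h : q = m
  · subst h
    rw [ofScalarForm, toForm_apply_self]
    exact ⟨α v, rfl⟩
  · rw [ofScalarForm, toForm_apply_ne h]
    exact ⟨0, map_zero _⟩

/-- An operator on scalar-valued forms is determined by its values on constants and its commutation
with the insertion of arguments. -/
theorem IsLieOp.eq_zero_of_scalar {φ : H → H} {E : ExteriorAlgebra A Q → ExteriorAlgebra A Q}
    {L : ExtForms A H Q → ExtForms A H Q} (hL : IsLieOp φ E L) (hφ : ∀ x, φ x = 0)
    (hE : ∀ a, E (algebraMap A _ a) = 0) {w : ExtForms A H Q} (hw : w ∈ scalarForms A H Q) :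
    L w = 0 :=
  hL.eq_zero hφ (fun _ hw x => insertFirst_mem_scalarForms hw x) (fun w hw => by
    obtain ⟨a, ha⟩ := hw 0 ![]
    rw [constTerm_apply w ![], ← ha, hE]) hw

end LieRelations

section OneForms

variable {A H Q : Type*} [CommRing A] [AddCommGroup H] [Module A H] [AddCommGroup Q] [Module A Q]

/-- A linear map on `H`, as a form of degree one. -/
def oneForm (g : H →ₗ[A] ExteriorAlgebra A Q) : ExtForms A H Q :=
  toForm (AlternatingMap.ofSubsingleton A H (ExteriorAlgebra A Q) (0 : Fin 1) g)

theorem insertFirst_oneForm (x : H) (g : H →ₗ[A] ExteriorAlgebra A Q) :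
    insertFirst x (oneForm g) = ofExt H (g x) := by
  rw [oneForm, insertFirst_toForm_succ]
  rfl

theorem constTerm_oneForm (g : H →ₗ[A] ExteriorAlgebra A Q) : constTerm (oneForm g) = 0 := by
  change oneForm g 0 ![] = 0
  rw [oneForm, toForm_apply_ne (by omega)]
  rfl

/-- A linear family of `q`-forms `g x` with `g x (x, …) = 0` is the family of contractions of a
form of degree `q + 1`. -/
theorem exists_insertFirst_eq {q : ℕ} (G : H → ExtForms A H Q)
    (hG : ∀ x, ∃ f : H [⋀^Fin q]→ₗ[A] ExteriorAlgebra A Q, G x = toForm f)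
    (hadd : ∀ x y, G (x + y) = G x + G y) (hsmul : ∀ (a : A) x, G (a • x) = a • G x)
    (hself : ∀ x, insertFirst x (G x) = 0) :
    ∃ F : H [⋀^Fin (q + 1)]→ₗ[A] ExteriorAlgebra A Q, ∀ x, insertFirst x (toForm F) = G x := by
  choose g hg using hG
  have hgq : ∀ x, g x = G x q := fun x => by rw [hg, toForm_apply_self]
  let g' : H →ₗ[A] MultilinearMap A (fun _ : Fin q => H) (ExteriorAlgebra A Q) :=
    { toFun := fun x => (g x).toMultilinearMap
      map_add' := fun x y => by
        ext v
        change g (x + y) v = g x v + g y v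
        rw [hgq, hadd, hgq, hgq]
        rfl
      map_smul' := fun a x => by
        ext v
        change g (a • x) v = a • g x v
        rw [hgq, hsmul, hgq]
        rfl }
  -- If the argument `v 0` is repeated, its second occurrence can be moved to the front of `g (v 0)`,
  -- where `hself` applies.
  have h0 : ∀ (v : Fin (q + 1) → H) (j : Fin q), v 0 = v j.succ → g (v 0) (Fin.tail v) = 0 := by
    intro v j hj
    obtain ⟨q, rfl⟩ : ∃ q', q = q' + 1 := ⟨q - 1, by have := j.2; omega⟩
    have h1 : ∀ u : Fin (q + 1) → H, u 0 = v 0 → g (v 0) u = 0 := fun u hu => by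
      have := congrArg (fun w : ExtForms A H Q => w q (Fin.tail u)) (hself (v 0))
      rw [hg] at this
      dsimp only at this
      rw [insertFirst_apply, toForm_apply_self, ← hu, Fin.cons_self_tail, hu] at this
      exact this
    have h2 := (g (v 0)).map_perm (Fin.tail v) (Equiv.swap 0 j)
    rw [h1 _ (by rw [Function.comp_apply, Equiv.swap_apply_left, hj]; rfl)] at h2
    exact (smul_eq_zero_iff_eq _).1 h2.symm
  let F : H [⋀^Fin (q + 1)]→ₗ[A] ExteriorAlgebra A Q :=
    { LinearMap.uncurryLeft (M := fun _ : Fin (q + 1) => H) g' with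
      map_eq_zero_of_eq' := by
        intro v i j hv hij
        change g (v 0) (Fin.tail v) = 0
        cases i using Fin.cases with
        | zero =>
          cases j using Fin.cases with
          | zero => exact absurd rfl hij
          | succ j => exact h0 v j hv
        | succ i =>
          cases j using Fin.cases with
          | zero => exact h0 v i hv.symm
          | succ j =>
            exact (g (v 0)).map_eq_zero_of_eq (Fin.tail v) hv fun h => hij (congrArg _ h) }
  refine ⟨F, fun x => ?_⟩
  rw [insertFirst_toForm_succ, hg]
  congr 1

end OneForms

/-! ### The Lie derivative along an element of `H` -/

namespace AlmostPreLieRinehartTriple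

variable {R A H Q : Type*} [CommRing R] [CommRing A] [Algebra R A]
  [AddCommGroup H] [Module R H] [Module A H] [IsScalarTower R A H]
  [AddCommGroup Q] [Module R Q] [Module A Q] [IsScalarTower R A Q]
  (T : AlmostPreLieRinehartTriple R A H Q)

/-- The Lie derivative of forms along `x ∈ H`. -/
def lieH (x : H) : ExtForms A H Q →ₗ[R] ExtForms A H Q :=
  lieOp (T.anchorH x) (T.brH x) (T.actHQ x) (T.brH_smul x) (T.actHQ_smul x)

theorem isLieOp_lieH (x : H) : IsLieOp (T.brH x) (T.actExt x) (T.lieH x) :=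
  isLieOp_lieOp _ _ _ _ _

theorem insertFirst_lieH (x y : H) (w : ExtForms A H Q) :
    insertFirst y (T.lieH x w) = T.lieH x (insertFirst y w) - insertFirst (T.brH x y) w :=
  (T.isLieOp_lieH x).insert y w

theorem constTerm_lieH (x : H) (w : ExtForms A H Q) :
    constTerm (T.lieH x w) = T.actExt x (constTerm w) :=
  (T.isLieOp_lieH x).const w

theorem lieH_parity (x : H) (w : ExtForms A H Q) : T.lieH x (parity w) = parity (T.lieH x w) :=
  lieOp_parity _ _ _ _ _ w

theorem lieH_toForm (x : H) {q : ℕ} (f : H [⋀^Fin q]→ₗ[A] ExteriorAlgebra A Q) :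
    T.lieH x (toForm f) = toForm (lieForm (T.anchorH x) (T.brH x) (T.actHQ x) (T.brH_smul x)
      (T.actHQ_smul x) f) := by
  refine forms_ext fun m v => ?_
  rw [lieH, lieOp_apply]
  by_cases h : q = m
  · subst h
    rw [toForm_apply_self, toForm_apply_self]
    rfl
  · rw [toForm_apply_ne h, toForm_apply_ne h]
    simp [extDerivation_zero]

theorem brH_swap (x y : H) : T.brH x y = -T.brH y x := by
  have := T.brH_self (x + y)
  simp only [map_add, LinearMap.add_apply, T.brH_self, zero_add, add_zero] at this
  exact eq_neg_of_add_eq_zero_right this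

theorem brH_smul_left (a : A) (x y : H) :
    T.brH (a • x) y = a • T.brH x y - T.anchorH y a • x := by
  rw [T.brH_swap, T.brH_smul, T.brH_swap x y, smul_neg]
  abel

/-- The linear map `x ↦ x(a)`. -/
def anchorAt (a : A) : H →ₗ[A] A where
  toFun x := T.anchorH x a
  map_add' x y := by rw [map_add]; rfl
  map_smul' b x := by rw [map_smul]; rfl

/-- The differential of `a ∈ A`, the one-form `x ↦ x(a)`. -/
def dScalar (a : A) : ExtForms A H Q :=
  oneForm ((Algebra.linearMap A (ExteriorAlgebra A Q)).comp (T.anchorAt a))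

theorem insertFirst_dScalar (x : H) (a : A) :
    insertFirst x (T.dScalar a) = ofExt H (algebraMap A _ (T.anchorH x a)) :=
  insertFirst_oneForm x _

attribute [local instance] formRing

theorem constTerm_dScalar_mul (a : A) (w : ExtForms A H Q) : constTerm (T.dScalar a * w) = 0 := by
  rw [constTerm_mul, dScalar, constTerm_oneForm, zero_mul]

theorem ofExt_algebraMap_mul (a : A) (w : ExtForms A H Q) :
    ofExt H (algebraMap A (ExteriorAlgebra A Q) a) * w = a • w := by
  have : ofExt H (algebraMap A (ExteriorAlgebra A Q) a) = a • (1 : ExtForms A H Q) := by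
    refine (ofExt_eq ?_ fun x => ?_).symm
    · change constTerm (a • ofExt H (1 : ExteriorAlgebra A Q)) = _
      rw [map_smul, toForm_apply_constTerm, Algebra.algebraMap_eq_smul_one]
    · change insertFirst x (a • ofExt H (1 : ExteriorAlgebra A Q)) = _
      rw [map_smul, insertFirst_ofExt, smul_zero]
  rw [this, smul_formMul, one_mul]

theorem insertFirst_dScalar_mul_parity (x : H) (a : A) (w : ExtForms A H Q) :
    insertFirst x (T.dScalar a * parity w) =
      T.anchorH x a • w - T.dScalar a * parity (insertFirst x w) := by
  rw [insertFirst_mul, insertFirst_dScalar, parity_parity, insertFirst_parity, mul_neg,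
    ofExt_algebraMap_mul, sub_eq_add_neg]

theorem lieH_smul (x : H) (a : A) (w : ExtForms A H Q) :
    T.lieH x (a • w) = T.anchorH x a • w + a • T.lieH x w := by
  rw [← ofExt_algebraMap_mul, lieH, lieOp_mul, ofExt_algebraMap_mul]
  congr 1
  have : lieOp (T.anchorH x) (T.brH x) (T.actHQ x) (T.brH_smul x) (T.actHQ_smul x)
      (ofExt H (algebraMap A (ExteriorAlgebra A Q) a)) =
      ofExt H (algebraMap A (ExteriorAlgebra A Q) (T.anchorH x a)) := by
    refine ofExt_eq ?_ fun y => ?_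
    · rw [constTerm_lieOp, toForm_apply_constTerm, extDerivation_algebraMap]
    · rw [insertFirst_lieOp, insertFirst_ofExt, insertFirst_ofExt, map_zero, sub_zero]
  rw [this, ofExt_algebraMap_mul]

theorem lieH_add (x y : H) (w : ExtForms A H Q) :
    T.lieH (x + y) w = T.lieH x w + T.lieH y w := by
  refine sub_eq_zero.1 (eq_zero_of_insertFirst_mem (fun w =>
    T.lieH (x + y) w - (T.lieH x w + T.lieH y w)) (fun w => ?_) (fun w z => ?_) w)
  · simp only [map_sub, map_add, constTerm_lieH]
    generalize constTerm w = u
    rw [sub_eq_zero]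
    induction u using ExteriorAlgebra.induction with
    | algebraMap a => simp only [actExt, extDerivation_algebraMap, map_add, Derivation.add_apply]
    | ι ξ => simp only [actExt, extDerivation_ι, map_add, LinearMap.add_apply]
    | mul u v hu hv =>
      simp only [actExt, extDerivation_mul] at hu hv ⊢
      rw [hu, hv]
      noncomm_ring
    | add u v hu hv =>
      simp only [actExt, extDerivation_add] at hu hv ⊢
      rw [hu, hv]
      abel
  · refine AddSubgroup.subset_closure ⟨insertFirst z w, ?_⟩
    simp only [map_sub, map_add, insertFirst_lieH, LinearMap.add_apply, insertFirst_add]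
    abel

/-- The Lie derivative is not `A`-linear in the element of `H`; the correction term is what makes the
right-hand side of Cartan's formula `i_x C = L_x - C i_x` linear in `x`. -/
theorem lieH_smul_left (x : H) (a : A) (w : ExtForms A H Q) :
    T.lieH (a • x) w = a • T.lieH x w + T.dScalar a * parity (insertFirst x w) := by
  refine sub_eq_zero.1 (eq_zero_of_insertFirst_mem (fun w =>
    T.lieH (a • x) w - (a • T.lieH x w + T.dScalar a * parity (insertFirst x w)))
    (fun w => ?_) (fun w z => ?_) w)
  · simp only [map_sub, map_add, map_smul, constTerm_lieH, constTerm_dScalar_mul, add_zero]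
    generalize constTerm w = u
    rw [sub_eq_zero]
    induction u using ExteriorAlgebra.induction with
    | algebraMap b =>
      simp only [actExt, extDerivation_algebraMap, map_smul, Derivation.smul_apply, smul_eq_mul,
        map_mul, Algebra.smul_def]
    | ι ξ => simp only [actExt, extDerivation_ι, map_smul, LinearMap.smul_apply]
    | mul u v hu hv =>
      simp only [actExt, extDerivation_mul] at hu hv ⊢
      rw [hu, hv, smul_add, smul_mul_assoc, mul_smul_comm]
    | add u v hu hv =>
      simp only [actExt, extDerivation_add] at hu hv ⊢
      rw [hu, hv, smul_add]
  · refine AddSubgroup.subset_closure ⟨insertFirst z w, ?_⟩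
    have h1 : insertFirst x (insertFirst z w) = -insertFirst z (insertFirst x w) := by
      have := insertFirst_self (x + z) w
      simp only [insertFirst_add, map_add, insertFirst_self, zero_add, add_zero] at this
      exact eq_neg_of_add_eq_zero_right this
    simp only [map_sub, map_add, map_smul, insertFirst_lieH, insertFirst_dScalar_mul_parity,
      T.brH_smul_left, insertFirst_sub_left, insertFirst_smul, h1, map_neg, mul_neg]
    rw [smul_sub]
    abel

end AlmostPreLieRinehartTriple

/-! ### The Cartan-Chevalley-Eilenberg operator -/

namespace AlmostPreLieRinehartTriple

variable {R A H Q : Type*} [CommRing R] [CommRing A] [Algebra R A]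
  [AddCommGroup H] [Module R H] [Module A H] [IsScalarTower R A H]
  [AddCommGroup Q] [Module R Q] [Module A Q] [IsScalarTower R A Q]
  (T : AlmostPreLieRinehartTriple R A H Q)

open Classical in
/-- The Cartan-Chevalley-Eilenberg differential, without the sign `(-1)^{|f|+1}`. It is the operator
determined by Cartan's formula `i_x C f + C i_x f = L_x f`, which serves as the definition. -/
noncomputable def ceForm : ∀ q : ℕ, (H [⋀^Fin q]→ₗ[A] ExteriorAlgebra A Q) →
    H [⋀^Fin (q + 1)]→ₗ[A] ExteriorAlgebra A Q
  | 0, f => if h : ∃ F : H [⋀^Fin 1]→ₗ[A] ExteriorAlgebra A Q,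
      ∀ x, insertFirst x (toForm F) = T.lieH x (toForm f) then h.choose else 0
  | q + 1, f => if h : ∃ F : H [⋀^Fin (q + 2)]→ₗ[A] ExteriorAlgebra A Q,
      ∀ x, insertFirst x (toForm F) = T.lieH x (toForm f) - toForm (ceForm q (f.curryLeft x))
      then h.choose else 0

theorem constTerm_toForm_succ {q : ℕ} (f : H [⋀^Fin (q + 1)]→ₗ[A] ExteriorAlgebra A Q) :
    constTerm (toForm f) = 0 := by
  change toForm f 0 ![] = 0
  rw [toForm_apply_ne (by omega)]
  rfl

attribute [local instance] formRing

/-- The properties of an operator `C` on `q`-forms which ensure that, for a `(q + 1)`-form `f`, the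
values `L_x f - C (i_x f)` prescribed by Cartan's formula are `A`-linear and alternating in `x`, and
hence are the contractions of a form. -/
structure CartanFormula (q : ℕ) (C : (H [⋀^Fin q]→ₗ[A] ExteriorAlgebra A Q) → ExtForms A H Q) :
    Prop where
  add : ∀ f g, C (f + g) = C f + C g
  smul : ∀ (a : A) f, C (a • f) = a • C f + T.dScalar a * parity (toForm f)
  insertFirst : ∀ (f : H [⋀^Fin (q + 1)]→ₗ[A] ExteriorAlgebra A Q) x,
    insertFirst x (C (f.curryLeft x)) = insertFirst x (T.lieH x (toForm f))

theorem toForm_smul {q : ℕ} (a : A) (f : H [⋀^Fin q]→ₗ[A] ExteriorAlgebra A Q) :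
    toForm (a • f) = a • toForm f :=
  map_smul _ _ _

theorem insertFirst_ceForm_zero (f : H [⋀^Fin 0]→ₗ[A] ExteriorAlgebra A Q) (x : H) :
    insertFirst x (toForm (T.ceForm 0 f)) = T.lieH x (toForm f) := by
  have h : ∃ F : H [⋀^Fin 1]→ₗ[A] ExteriorAlgebra A Q,
      ∀ x, insertFirst x (toForm F) = T.lieH x (toForm f) := by
    refine exists_insertFirst_eq _ (fun x => ⟨_, T.lieH_toForm x f⟩)
      (fun x y => T.lieH_add x y _) (fun a x => ?_) (fun x => ?_)
    · rw [T.lieH_smul_left, insertFirst_toForm_zero, map_zero, mul_zero, add_zero]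
    · rw [T.insertFirst_lieH, insertFirst_toForm_zero, insertFirst_toForm_zero, map_zero, sub_zero]
  rw [ceForm, dif_pos h]
  exact h.choose_spec x

theorem lieH_insertFirst_self (x : H) (w : ExtForms A H Q) :
    insertFirst x (T.lieH x w) = T.lieH x (insertFirst x w) := by
  rw [T.insertFirst_lieH, T.brH_self, insertFirst_zero_left, sub_zero]

/-- Cartan's formula in degree `q + 1`. That a form with the prescribed contractions exists follows
from the properties of the operator in degree `q`. -/
theorem insertFirst_ceForm_succ {q : ℕ}
    (hq : T.CartanFormula q fun f => toForm (T.ceForm q f))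
    (f : H [⋀^Fin (q + 1)]→ₗ[A] ExteriorAlgebra A Q) (x : H) :
    insertFirst x (toForm (T.ceForm (q + 1) f)) =
      T.lieH x (toForm f) - toForm (T.ceForm q (f.curryLeft x)) := by
  have h : ∃ F : H [⋀^Fin (q + 2)]→ₗ[A] ExteriorAlgebra A Q, ∀ x, insertFirst x (toForm F) =
      T.lieH x (toForm f) - toForm (T.ceForm q (f.curryLeft x)) := by
    refine exists_insertFirst_eq _ (fun x => ⟨lieForm (T.anchorH x) (T.brH x) (T.actHQ x)
      (T.brH_smul x) (T.actHQ_smul x) f - T.ceForm q (f.curryLeft x), ?_⟩)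
      (fun x y => ?_) (fun a x => ?_) (fun x => ?_)
    · rw [T.lieH_toForm, sub_eq_add_neg, sub_eq_add_neg, toForm_add, toForm_neg]
    · rw [T.lieH_add, map_add, hq.add]
      abel
    · rw [T.lieH_smul_left, map_smul, hq.smul, insertFirst_toForm_succ, smul_sub]
      abel
    · rw [map_sub, hq.insertFirst, sub_self]
  rw [ceForm, dif_pos h]
  exact h.choose_spec x

theorem cartanFormula_ceForm (q : ℕ) : T.CartanFormula q fun f => toForm (T.ceForm q f) := by
  induction q with
  | zero =>
    refine ⟨fun f g => ?_, fun a f => ?_, fun f x => ?_⟩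
    · refine sub_eq_zero.1 (eq_zero_of_insertFirst ?_ fun x => ?_)
      · simp only [map_sub, map_add, constTerm_toForm_succ, add_zero, sub_zero]
      · simp only [map_sub, map_add, T.insertFirst_ceForm_zero, toForm_add, sub_self]
    · refine sub_eq_zero.1 (eq_zero_of_insertFirst ?_ fun x => ?_)
      · simp only [map_sub, map_add, map_smul, constTerm_toForm_succ, T.constTerm_dScalar_mul,
          add_zero, smul_zero, sub_zero]
      · simp only [map_sub, map_add, map_smul, T.insertFirst_ceForm_zero, toForm_smul, T.lieH_smul,
          T.insertFirst_dScalar_mul_parity, insertFirst_toForm_zero, map_zero, mul_zero, sub_zero]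
        abel
    · rw [T.insertFirst_ceForm_zero, T.lieH_insertFirst_self, insertFirst_toForm_succ]
  | succ q ih =>
    have hC := T.insertFirst_ceForm_succ ih
    refine ⟨fun f g => ?_, fun a f => ?_, fun f x => ?_⟩
    · refine sub_eq_zero.1 (eq_zero_of_insertFirst ?_ fun x => ?_)
      · simp only [map_sub, map_add, constTerm_toForm_succ, add_zero, sub_zero]
      · have := ih.add (f.curryLeft x) (g.curryLeft x)
        simp only [map_sub, map_add, hC, toForm_add, AlternatingMap.curryLeft_add,
          LinearMap.add_apply, this]
        abel
    · refine sub_eq_zero.1 (eq_zero_of_insertFirst ?_ fun x => ?_)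
      · simp only [map_sub, map_add, map_smul, constTerm_toForm_succ, T.constTerm_dScalar_mul,
          add_zero, smul_zero, sub_zero]
      · have := ih.smul a (f.curryLeft x)
        simp only [map_sub, map_add, map_smul, hC, toForm_smul, T.lieH_smul,
          T.insertFirst_dScalar_mul_parity, AlternatingMap.curryLeft_smul, LinearMap.smul_apply,
          this, insertFirst_toForm_succ]
        rw [smul_sub]
        abel
    · have h0 : toForm (T.ceForm q ((f.curryLeft x).curryLeft x)) = 0 := by
        rw [AlternatingMap.curryLeft_same]
        have := ih.add 0 0
        rw [add_zero] at this
        exact left_eq_add.1 this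
      rw [hC, h0, sub_zero, T.lieH_insertFirst_self, insertFirst_toForm_succ]

theorem ceForm_toForm_smul_of_tower (q : ℕ) (r : R) (f : H [⋀^Fin q]→ₗ[A] ExteriorAlgebra A Q) :
    toForm (T.ceForm q (r • f)) = r • toForm (T.ceForm q f) := by
  have h1 : r • f = algebraMap R A r • f :=
    AlternatingMap.ext fun v => (algebraMap_smul A r (f v)).symm
  have h2 : T.dScalar (algebraMap R A r) = 0 :=
    eq_zero_of_insertFirst (constTerm_oneForm _) fun x => by
      rw [T.insertFirst_dScalar, Derivation.map_algebraMap, map_zero]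
      exact (ofExt_eq (map_zero _) fun x => map_zero _).symm
  rw [h1, (T.cartanFormula_ceForm q).smul, h2, zero_mul, add_zero, algebraMap_smul]

/-- The Cartan-Chevalley-Eilenberg differential on all forms, as an additive map. -/
noncomputable def ceAddHom : ExtForms A H Q →+ ExtForms A H Q :=
  DirectSum.toAddMonoid fun q =>
    AddMonoidHom.mk' (fun f => toForm (T.ceForm q f)) (T.cartanFormula_ceForm q).add

theorem ceAddHom_toForm {q : ℕ} (f : H [⋀^Fin q]→ₗ[A] ExteriorAlgebra A Q) :
    T.ceAddHom (toForm f) = toForm (T.ceForm q f) :=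
  DirectSum.toAddMonoid_of (β := fun q : ℕ => H [⋀^Fin q]→ₗ[A] ExteriorAlgebra A Q)
    (fun q => AddMonoidHom.mk' (fun f => toForm (T.ceForm q f)) (T.cartanFormula_ceForm q).add) q f

/-- The Cartan-Chevalley-Eilenberg differential on all forms, without the sign `(-1)^{|f|+1}`. -/
noncomputable def ceOp : ExtForms A H Q →ₗ[R] ExtForms A H Q where
  toFun := T.ceAddHom
  map_add' := map_add _
  map_smul' r w := by
    induction w using forms_induction with
    | zero => rw [smul_zero, map_zero, smul_zero]
    | form q f =>
      have h : r • toForm f = toForm (r • f) := by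
        refine forms_ext fun m v => ?_
        change r • toForm f m v = _
        by_cases h : q = m
        · subst h
          rw [toForm_apply_self, toForm_apply_self]
          rfl
        · rw [toForm_apply_ne h, toForm_apply_ne h]
          exact smul_zero r
      rw [h, ceAddHom_toForm, ceAddHom_toForm, ceForm_toForm_smul_of_tower]
      rfl
    | add w w' hw hw' => rw [smul_add, map_add, hw, hw', map_add, smul_add]

theorem ceOp_toForm {q : ℕ} (f : H [⋀^Fin q]→ₗ[A] ExteriorAlgebra A Q) :
    T.ceOp (toForm f) = toForm (T.ceForm q f) :=
  T.ceAddHom_toForm f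

theorem constTerm_ceOp (w : ExtForms A H Q) : constTerm (T.ceOp w) = 0 := by
  induction w using forms_induction with
  | zero => simp only [map_zero]
  | form q f => rw [ceOp_toForm, constTerm_toForm_succ]
  | add w w' hw hw' => rw [map_add, map_add, hw, hw', add_zero]

/-- Cartan's formula. -/
theorem insertFirst_ceOp (x : H) (w : ExtForms A H Q) :
    insertFirst x (T.ceOp w) = T.lieH x w - T.ceOp (insertFirst x w) := by
  induction w using forms_induction with
  | zero => simp only [map_zero, sub_zero]
  | form q f =>
    rw [ceOp_toForm]
    cases q with
    | zero => rw [T.insertFirst_ceForm_zero, insertFirst_toForm_zero, map_zero, sub_zero]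
    | succ q =>
      rw [T.insertFirst_ceForm_succ (T.cartanFormula_ceForm q), insertFirst_toForm_succ,
        ceOp_toForm]
  | add w w' hw hw' =>
    simp only [map_add, hw, hw']
    abel

end AlmostPreLieRinehartTriple

/-! ### The Cartan-Chevalley-Eilenberg formula -/

namespace AlmostPreLieRinehartTriple

variable {R A H Q : Type*} [CommRing R] [CommRing A] [Algebra R A]
  [AddCommGroup H] [Module R H] [Module A H] [IsScalarTower R A H]
  [AddCommGroup Q] [Module R Q] [Module A Q] [IsScalarTower R A Q]
  (T : AlmostPreLieRinehartTriple R A H Q)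

theorem ceForm_apply_cons_zero (f : H [⋀^Fin 0]→ₗ[A] ExteriorAlgebra A Q) (y : H) (v : Fin 0 → H) :
    T.ceForm 0 f (Fin.cons (α := fun _ => H) y v) = T.actExt y (f v) := by
  have := congrArg (fun w : ExtForms A H Q => w 0 v) (T.insertFirst_ceForm_zero f y)
  dsimp only at this
  rw [insertFirst_apply, toForm_apply_self, lieH, lieOp_apply, toForm_apply_self,
    Finset.univ_eq_empty, Finset.sum_empty, sub_zero] at this
  exact this

theorem ceForm_apply_cons_succ {q : ℕ} (f : H [⋀^Fin (q + 1)]→ₗ[A] ExteriorAlgebra A Q) (y : H)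
    (v : Fin (q + 1) → H) : T.ceForm (q + 1) f (Fin.cons (α := fun _ => H) y v) =
      T.actExt y (f v) - ∑ j, f (Function.update v j (T.brH y (v j)))
        - T.ceForm q (f.curryLeft y) v := by
  have := congrArg (fun w : ExtForms A H Q => w (q + 1) v)
    (T.insertFirst_ceForm_succ (T.cartanFormula_ceForm q) f y)
  dsimp only at this
  rw [insertFirst_apply, toForm_apply_self, DirectSum.sub_apply, AlternatingMap.sub_apply, lieH,
    lieOp_apply, toForm_apply_self, toForm_apply_self] at this
  exact this

theorem map_update_eq_map_cons_removeNth {q : ℕ} (f : H [⋀^Fin (q + 1)]→ₗ[A] ExteriorAlgebra A Q)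
    (v : Fin (q + 1) → H) (k : Fin (q + 1)) (z : H) :
    f (Function.update v k z) =
      (-1 : ℤˣ) ^ (k : ℕ) • f (Fin.cons (α := fun _ => H) z (k.removeNth v)) := by
  have h := f.map_insertNth k z (k.removeNth v)
  rw [Fin.insertNth_removeNth] at h
  rw [h, Units.smul_def, Units.val_pow_eq_pow_val, Units.val_neg, Units.val_one]
  rfl

theorem _root_.AlternatingMap.map_cons_cons_swap {q : ℕ}
    (f : H [⋀^Fin (q + 2)]→ₗ[A] ExteriorAlgebra A Q) (y z : H) (v : Fin q → H) :
    f (Fin.cons (α := fun _ => H) y (Fin.cons (α := fun _ => H) z v)) =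
      -f (Fin.cons (α := fun _ => H) z (Fin.cons (α := fun _ => H) y v)) := by
  rw [← f.map_swap _ (Fin.succ_ne_zero 0).symm]
  congr 1
  funext i
  cases i using Fin.cases with
  | zero => simp
  | succ i =>
    cases i using Fin.cases with
    | zero => simp
    | succ i =>
      rw [Function.comp_apply, Equiv.swap_apply_of_ne_of_ne (Fin.succ_ne_zero _)
        (Fin.succ_injective _ |>.ne (Fin.succ_ne_zero i))]
      rfl

theorem bracketSum_succ {q : ℕ} (f : H [⋀^Fin (q + 1)]→ₗ[A] ExteriorAlgebra A Q)
    (x : Fin (q + 2) → H) : T.bracketSum f x =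
      ∑ j : Fin (q + 1), ∑ k : Fin (q + 2), if j.castSucc < k then
        (-1 : ℤˣ) ^ ((j : ℕ) + (k : ℕ)) • f (Fin.cons (α := fun _ => H)
          (T.brH (x j.castSucc) (x k)) fun i => x (k.succAbove (j.succAbove i))) else 0 := by
  rw [bracketSum, Finset.sum_filter, Fintype.sum_prod_type]

/-- The pairs that contain the first argument give the Lie derivative of the arguments of `f` along
it; the other pairs give the same sum for the contracted form. -/
theorem bracketSum_apply_cons {q : ℕ} (f : H [⋀^Fin (q + 1)]→ₗ[A] ExteriorAlgebra A Q) (y : H)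
    (v : Fin (q + 1) → H) : T.bracketSum f (Fin.cons (α := fun _ => H) y v) =
      - ∑ j, f (Function.update v j (T.brH y (v j))) - T.bracketSum (f.curryLeft y) v := by
  have h1 : ∀ k : Fin (q + 1), (-1 : ℤˣ) ^ (((0 : Fin (q + 1)) : ℕ) + (k.succ : ℕ)) •
      f (Fin.cons (α := fun _ => H) (T.brH
        (Fin.cons (α := fun _ => H) y v (Fin.castSucc (0 : Fin (q + 1))))
        (Fin.cons (α := fun _ => H) y v k.succ))
        fun i => Fin.cons (α := fun _ => H) y v (k.succ.succAbove ((0 : Fin (q + 1)).succAbove i))) =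
      -f (Function.update v k (T.brH y (v k))) := fun k => by
    rw [map_update_eq_map_cons_removeNth, Fin.val_zero, zero_add, Fin.val_succ, pow_succ,
      mul_neg_one, Units.neg_smul]
    simp only [Fin.zero_succAbove, Fin.succ_succAbove_succ, Fin.cons_succ, Fin.castSucc_zero,
      Fin.cons_zero]
    rfl
  rw [bracketSum_succ, Fin.sum_univ_succ, Fin.sum_univ_succ]
  rw [if_neg (by simp), zero_add, sub_eq_add_neg]
  congr 1
  · rw [← Finset.sum_neg_distrib]
    refine Finset.sum_congr rfl fun k _ => ?_
    exact (if_pos (Fin.succ_pos k)).trans (h1 k)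
  cases q with
  | zero => exact neg_zero.symm
  | succ q =>
    rw [bracketSum_succ, ← Finset.sum_neg_distrib]
    refine Finset.sum_congr rfl fun j _ => ?_
    rw [Fin.sum_univ_succ, if_neg (by simp), zero_add, ← Finset.sum_neg_distrib]
    refine Finset.sum_congr rfl fun k _ => ?_
    rw [← Fin.succ_castSucc]
    simp only [Fin.succ_lt_succ_iff]
    split_ifs with h
    · have h2 : ((-1 : ℤˣ) ^ ((j.succ : ℕ) + (k.succ : ℕ))) = (-1) ^ ((j : ℕ) + (k : ℕ)) := by
        rw [Fin.val_succ, Fin.val_succ, add_add_add_comm, pow_add, one_add_one_eq_two, neg_one_sq,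
          mul_one]
      have h3 : (fun i => Fin.cons (α := fun _ => H) y v (k.succ.succAbove (j.succ.succAbove i))) =
          Fin.cons (α := fun _ => H) y fun i => v (k.succAbove (j.succAbove i)) := by
        funext i
        cases i using Fin.cases with
        | zero => rfl
        | succ i => rw [Fin.succ_succAbove_succ, Fin.succ_succAbove_succ, Fin.cons_succ,
            Fin.cons_succ]
      rw [h2, h3, Fin.cons_succ, Fin.cons_succ, ← smul_neg]
      congr 1
      exact f.map_cons_cons_swap _ _ _
    · exact neg_zero.symm

/-- The recursion on contractions that defines `ceForm` unfolds to the explicit formula. -/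
theorem ceForm_apply {q : ℕ} (f : H [⋀^Fin q]→ₗ[A] ExteriorAlgebra A Q) (x : Fin (q + 1) → H) :
    T.ceForm q f x = ∑ i : Fin (q + 1), (-1 : ℤˣ) ^ (i : ℕ) • T.actExt (x i) (f (i.removeNth x))
      + T.bracketSum f x := by
  induction q with
  | zero =>
    obtain ⟨y, v, rfl⟩ : ∃ y v, x = Fin.cons (α := fun _ => H) y v :=
      ⟨x 0, Fin.tail x, (Fin.cons_self_tail x).symm⟩
    rw [T.ceForm_apply_cons_zero, Fin.sum_univ_succ, Finset.univ_eq_empty, Finset.sum_empty,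
      bracketSum, add_zero, add_zero, Fin.val_zero, pow_zero, one_smul, Fin.cons_zero,
      Subsingleton.elim (Fin.removeNth 0 _) v]
  | succ q ih =>
    obtain ⟨y, v, rfl⟩ : ∃ y v, x = Fin.cons (α := fun _ => H) y v :=
      ⟨x 0, Fin.tail x, (Fin.cons_self_tail x).symm⟩
    have h1 : ∀ i : Fin (q + 1), (-1 : ℤˣ) ^ (i.succ : ℕ) • T.actExt
        (Fin.cons (α := fun _ => H) y v i.succ)
        (f (i.succ.removeNth (Fin.cons (α := fun _ => H) y v))) =
        -((-1 : ℤˣ) ^ (i : ℕ) • T.actExt (v i) (f.curryLeft y (i.removeNth v))) := fun i => by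
      have h2 : i.succ.removeNth (Fin.cons (α := fun _ => H) y v) =
          Fin.cons (α := fun _ => H) y (i.removeNth v) := by
        funext k
        cases k using Fin.cases with
        | zero => rfl
        | succ k => simp only [Fin.removeNth, Fin.succ_succAbove_succ, Fin.cons_succ]
      rw [Fin.cons_succ, Fin.val_succ, pow_succ, mul_neg_one, Units.neg_smul, h2]
      rfl
    rw [T.ceForm_apply_cons_succ, ih, bracketSum_apply_cons, Fin.sum_univ_succ (n := q + 1)]
    rw [Finset.sum_congr rfl fun i _ => h1 i, Finset.sum_neg_distrib, Fin.cons_zero, Fin.val_zero,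
      pow_zero, one_smul, Fin.removeNth_zero, Fin.tail_cons]
    abel

end AlmostPreLieRinehartTriple

/-! ### The structure equations of a Lie-Rinehart triple and the differential -/

namespace LieRinehartTriple

variable {R A H Q : Type*} [CommRing R] [CommRing A] [Algebra R A]
  [AddCommGroup H] [Module R H] [Module A H] [IsScalarTower R A H]
  [AddCommGroup Q] [Module R Q] [Module A Q] [IsScalarTower R A Q]
  (T : LieRinehartTriple R A H Q)

theorem brH_brH (x y z : H) :
    T.brH x (T.brH y z) + T.brH y (T.brH z x) + T.brH z (T.brH x y) = 0 := by
  simpa [AlmostPreLieRinehartTriple.brL] using congrArg Prod.fst (T.jacobi (x, 0) (y, 0) (z, 0))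

theorem actHQ_brH (x y : H) (ζ : Q) :
    T.actHQ (T.brH x y) ζ = T.actHQ x (T.actHQ y ζ) - T.actHQ y (T.actHQ x ζ) := by
  have h := congrArg Prod.snd (T.jacobi (x, 0) (y, 0) (0, ζ))
  simp [AlmostPreLieRinehartTriple.brL] at h
  rw [← sub_eq_zero, ← neg_eq_zero, ← h]
  abel

theorem actQH_brH (ζ : Q) (x y : H) : T.actQH ζ (T.brH x y) =
    T.brH x (T.actQH ζ y) + T.actQH (T.actHQ y ζ) x - T.brH y (T.actQH ζ x)
      - T.actQH (T.actHQ x ζ) y := by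
  have h := congrArg Prod.fst (T.jacobi (x, 0) (y, 0) (0, ζ))
  simp [AlmostPreLieRinehartTriple.brL] at h
  rw [← sub_eq_zero, ← h]
  abel

theorem actHQ_brQ (x : H) (η ζ : Q) : T.actHQ x (T.brQ η ζ) =
    T.brQ η (T.actHQ x ζ) + T.actHQ (T.actQH ζ x) η - T.brQ ζ (T.actHQ x η)
      - T.actHQ (T.actQH η x) ζ := by
  have h := congrArg Prod.snd (T.jacobi (x, 0) (0, η) (0, ζ))
  simp [AlmostPreLieRinehartTriple.brL] at h
  rw [← sub_eq_zero, ← h]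
  abel

theorem brH_δ (x : H) (η ζ : Q) : T.brH x (T.δ η ζ) =
    T.actQH (T.brQ η ζ) x + T.δ η (T.actHQ x ζ) - T.actQH η (T.actQH ζ x)
      - T.δ ζ (T.actHQ x η) + T.actQH ζ (T.actQH η x) := by
  have h := congrArg Prod.fst (T.jacobi (x, 0) (0, η) (0, ζ))
  simp [AlmostPreLieRinehartTriple.brL] at h
  rw [← sub_eq_zero, ← h]
  abel

theorem brQ_brQ (ξ η ζ : Q) :
    T.brQ ξ (T.brQ η ζ) + T.brQ η (T.brQ ζ ξ) + T.brQ ζ (T.brQ ξ η) =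
      T.actHQ (T.δ η ζ) ξ + T.actHQ (T.δ ζ ξ) η + T.actHQ (T.δ ξ η) ζ := by
  have h := congrArg Prod.snd (T.jacobi (0, ξ) (0, η) (0, ζ))
  simp [AlmostPreLieRinehartTriple.brL] at h
  rw [← sub_eq_zero, ← h]
  abel

theorem δ_brQ (ξ η ζ : Q) :
    T.δ ξ (T.brQ η ζ) + T.δ η (T.brQ ζ ξ) + T.δ ζ (T.brQ ξ η)
      + (T.actQH ξ (T.δ η ζ) + T.actQH η (T.δ ζ ξ) + T.actQH ζ (T.δ ξ η)) = 0 := by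
  have h := congrArg Prod.fst (T.jacobi (0, ξ) (0, η) (0, ζ))
  simp [AlmostPreLieRinehartTriple.brL] at h
  rw [← h]
  abel

theorem anchorH_brH (x y : H) (a : A) : T.anchorH (T.brH x y) a =
    T.anchorH x (T.anchorH y a) - T.anchorH y (T.anchorH x a) := by
  simpa [AlmostPreLieRinehartTriple.brL, AlmostPreLieRinehartTriple.anchorL] using
    T.anchor_brL (x, 0) (y, 0) a

theorem anchorQ_actHQ (x : H) (ξ : Q) (a : A) : T.anchorQ (T.actHQ x ξ) a =
    T.anchorH x (T.anchorQ ξ a) - T.anchorQ ξ (T.anchorH x a) + T.anchorH (T.actQH ξ x) a := by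
  have h := T.anchor_brL (x, 0) (0, ξ) a
  simp [AlmostPreLieRinehartTriple.brL, AlmostPreLieRinehartTriple.anchorL] at h
  rw [← h]
  abel

theorem anchorQ_brQ (ξ η : Q) (a : A) : T.anchorQ (T.brQ ξ η) a =
    T.anchorQ ξ (T.anchorQ η a) - T.anchorQ η (T.anchorQ ξ a) - T.anchorH (T.δ ξ η) a := by
  have h := T.anchor_brL (0, ξ) (0, η) a
  simp [AlmostPreLieRinehartTriple.brL, AlmostPreLieRinehartTriple.anchorL] at h
  rw [← h]
  abel

end LieRinehartTriple

section ExteriorAlgebraDerivation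

variable {A Q : Type*} [CommRing A] [AddCommGroup Q] [Module A Q]

/-- A derivation of the exterior algebra is determined by its values on generators. -/
theorem exteriorAlgebra_derivation_eq_zero {E : ExteriorAlgebra A Q → ExteriorAlgebra A Q}
    (hadd : ∀ u v, E (u + v) = E u + E v) (hmul : ∀ u v, E (u * v) = E u * v + u * E v)
    (h₀ : ∀ a, E (algebraMap A _ a) = 0) (h₁ : ∀ ξ, E (ExteriorAlgebra.ι A ξ) = 0)
    (u : ExteriorAlgebra A Q) : E u = 0 := by
  induction u using ExteriorAlgebra.induction with
  | algebraMap a => exact h₀ a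
  | ι ξ => exact h₁ ξ
  | mul u v hu hv => rw [hmul, hu, hv, zero_mul, mul_zero, add_zero]
  | add u v hu hv => rw [hadd, hu, hv, add_zero]

end ExteriorAlgebraDerivation

namespace AlmostPreLieRinehartTriple

variable {R A H Q : Type*} [CommRing R] [CommRing A] [Algebra R A]
  [AddCommGroup H] [Module R H] [Module A H] [IsScalarTower R A H]
  [AddCommGroup Q] [Module R Q] [Module A Q] [IsScalarTower R A Q]
  (T : AlmostPreLieRinehartTriple R A H Q)

attribute [local instance] formRing

/-- The Lie-Rinehart differential on forms. -/
noncomputable def dOp : ExtForms A H Q →ₗ[R] ExtForms A H Q where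
  toFun w := -T.ceOp (parity w)
  map_add' w w' := by rw [map_add, map_add, neg_add]
  map_smul' r w := by
    rw [RingHom.id_apply, ← algebraMap_smul A r w, map_smul, algebraMap_smul, map_smul, smul_neg]

theorem dOp_apply (w : ExtForms A H Q) : T.dOp w = -T.ceOp (parity w) :=
  rfl

theorem constTerm_dOp (w : ExtForms A H Q) : constTerm (T.dOp w) = 0 := by
  rw [dOp_apply, map_neg, constTerm_ceOp, neg_zero]

/-- Cartan's formula. -/
theorem insertFirst_dOp (x : H) (w : ExtForms A H Q) :
    insertFirst x (T.dOp w) = T.dOp (insertFirst x w) - T.lieH x (parity w) := by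
  rw [dOp_apply, dOp_apply, map_neg, insertFirst_ceOp, insertFirst_parity, map_neg]
  abel

theorem parity_dOp (w : ExtForms A H Q) : parity (T.dOp w) = -T.dOp (parity w) := by
  rw [← add_eq_zero_iff_eq_neg]
  refine eq_zero_of_insertFirst_mem (fun w => parity (T.dOp w) + T.dOp (parity w)) (fun w => ?_)
    (fun w x => ?_) w
  · rw [map_add, constTerm_parity, constTerm_dOp, constTerm_dOp, map_zero, add_zero]
  · have : insertFirst x (parity (T.dOp w) + T.dOp (parity w)) =
        -(parity (T.dOp (insertFirst x w)) + T.dOp (parity (insertFirst x w))) := by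
      simp only [map_add, insertFirst_parity, insertFirst_dOp, parity_parity, map_sub, map_neg,
        lieH_parity]
      abel
    rw [this]
    exact neg_mem (AddSubgroup.subset_closure ⟨_, rfl⟩)

theorem dOp_mul (a b : ExtForms A H Q) :
    T.dOp (a * b) = T.dOp a * b + parity a * T.dOp b := by
  refine sub_eq_zero.1 (eq_zero_of_insertFirst_mem (fun ab : ExtForms A H Q × ExtForms A H Q =>
    T.dOp (ab.1 * ab.2) - (T.dOp ab.1 * ab.2 + parity ab.1 * T.dOp ab.2)) ?_ ?_ (a, b))
  · rintro ⟨a, b⟩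
    simp only [map_sub, map_add, constTerm_mul, constTerm_dOp, zero_mul, mul_zero, add_zero,
      sub_zero]
  · rintro ⟨a, b⟩ x
    have : insertFirst x (T.dOp (a * b) - (T.dOp a * b + parity a * T.dOp b)) =
        (T.dOp (insertFirst x a * parity b) - (T.dOp (insertFirst x a) * parity b +
          parity (insertFirst x a) * T.dOp (parity b))) +
        (T.dOp (a * insertFirst x b) - (T.dOp a * insertFirst x b +
            parity a * T.dOp (insertFirst x b))) := by
      simp only [map_sub, map_add, insertFirst_mul, insertFirst_dOp, insertFirst_parity, parity_mul,
        parity_dOp, sub_mul, mul_sub, neg_mul, mul_neg, neg_neg]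
      rw [show T.lieH x (parity a * parity b) =
        T.lieH x (parity a) * parity b + parity a * T.lieH x (parity b) from
        lieOp_mul _ _ _ _ _ _ _]
      abel
    rw [this]
    exact add_mem (AddSubgroup.subset_closure ⟨(_, _), rfl⟩)
      (AddSubgroup.subset_closure ⟨(_, _), rfl⟩)

theorem lieH_mem (x : H) {q p : ℤ} {w : ExtForms A H Q} (hw : w ∈ (formsAlgebra R A H Q).gr q p) :
    T.lieH x w ∈ (formsAlgebra R A H Q).gr q p :=
  lieOp_mem _ _ _ _ _ hw

theorem dOp_mem {q p : ℤ} {w : ExtForms A H Q} (hw : w ∈ (formsAlgebra R A H Q).gr q p) :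
    T.dOp w ∈ (formsAlgebra R A H Q).gr (q + 1) p := by
  refine mem_gr_of_insertFirst
    (ι := {i : ExtForms A H Q × ℤ // i.1 ∈ (formsAlgebra R A H Q).gr i.2 p})
    (fun i => T.dOp i.1.1) (fun i => i.1.2 + 1) (fun _ => p) (fun i => ?_) (fun i x => ?_)
    ⟨(w, q), hw⟩
  · rw [constTerm_dOp]
    exact ⟨zero_mem _, fun _ => rfl⟩
  · rw [insertFirst_dOp]
    refine sub_mem (AddSubgroup.subset_closure (Or.inl
      ⟨⟨(_, i.1.2 - 1), insertFirst_mem i.2 x⟩, rfl, ?_, rfl⟩))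
      (AddSubgroup.subset_closure (Or.inr ?_))
    · dsimp only
      ring
    · rw [add_sub_cancel_right]
      exact T.lieH_mem x (parity_mem i.2)

theorem isLieRinehartDifferential_dOp : T.IsLieRinehartDifferential T.dOp where
  apply_eq {q p} f hf x := by
    have hf' : toForm f ∈ (formsAlgebra R A H Q).gr q p :=
      toForm_mem fun v => by rw [extPower_natCast]; exact hf v
    rw [← T.ceForm_apply, dOp_apply, parity_of_mem hf', ← toForm_apply_self (T.ceForm q f),
      ← ceOp_toForm, Int.negOnePow_succ]
    rcases Int.units_eq_one_or ((p : ℤ) - q).negOnePow with h | h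
    · rw [h, one_smul, Units.neg_smul, one_smul]
      exact neg_neg _
    · simp only [h, Units.neg_smul, one_smul, map_neg, neg_neg]
  apply_ne {q} f m hm := by
    rw [dOp_apply, parity_toForm]
    rw [ceOp_toForm, ← toForm_neg, toForm_apply_ne hm.symm]

end AlmostPreLieRinehartTriple

namespace LieRinehartTriple

variable {R A H Q : Type*} [CommRing R] [CommRing A] [Algebra R A]
  [AddCommGroup H] [Module R H] [Module A H] [IsScalarTower R A H]
  [AddCommGroup Q] [Module R Q] [Module A Q] [IsScalarTower R A Q]
  (T : LieRinehartTriple R A H Q)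

attribute [local instance] formRing

theorem actExt_brH (x y : H) (u : ExteriorAlgebra A Q) :
    T.actExt x (T.actExt y u) - T.actExt y (T.actExt x u) - T.actExt (T.brH x y) u = 0 := by
  refine exteriorAlgebra_derivation_eq_zero (E := fun u =>
    T.actExt x (T.actExt y u) - T.actExt y (T.actExt x u) - T.actExt (T.brH x y) u)
    (fun u v => ?_) (fun u v => ?_) (fun a => ?_) (fun ξ => ?_) u
  · simp only [AlmostPreLieRinehartTriple.actExt, extDerivation_add]
    abel
  · simp only [AlmostPreLieRinehartTriple.actExt, extDerivation_add, extDerivation_mul, sub_mul,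
      mul_sub]
    abel
  · simp only [AlmostPreLieRinehartTriple.actExt, extDerivation_algebraMap]
    rw [T.anchorH_brH, map_sub, sub_self]
  · simp only [AlmostPreLieRinehartTriple.actExt, extDerivation_ι]
    rw [T.actHQ_brH, map_sub, sub_self]

theorem lieH_brH (x y : H) (w : ExtForms A H Q) :
    T.lieH (T.brH x y) w = T.lieH x (T.lieH y w) - T.lieH y (T.lieH x w) := by
  have h := ((T.isLieOp_lieH x).comm (T.isLieOp_lieH y)).sub (T.isLieOp_lieH (T.brH x y))
  refine (sub_eq_zero.1 (h.eq_zero (fun z => ?_) (S := Set.univ) (fun _ _ _ => trivial)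
    (fun w _ => T.actExt_brH x y _) (Set.mem_univ w))).symm
  have h1 := T.brH_brH x y z
  rw [T.brH_swap z x, T.brH_swap z (T.brH x y), map_neg] at h1
  rw [← h1]
  abel

theorem dOp_lieH (x : H) (w : ExtForms A H Q) : T.dOp (T.lieH x w) = T.lieH x (T.dOp w) := by
  refine sub_eq_zero.1 (eq_zero_of_insertFirst_mem (fun w => T.dOp (T.lieH x w) -
    T.lieH x (T.dOp w)) (fun w => ?_) (fun w y => ?_) w)
  · rw [map_sub, T.constTerm_lieH, T.constTerm_dOp, T.constTerm_dOp, sub_eq_zero]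
    exact (extDerivation_zero _ _ _).symm
  · have : insertFirst y (T.dOp (T.lieH x w) - T.lieH x (T.dOp w)) =
        T.dOp (T.lieH x (insertFirst y w)) - T.lieH x (T.dOp (insertFirst y w)) := by
      simp only [map_sub, T.insertFirst_dOp, T.insertFirst_lieH, ← T.lieH_parity, T.lieH_brH]
      abel
    rw [this]
    exact AddSubgroup.subset_closure ⟨_, rfl⟩

theorem dOp_dOp (w : ExtForms A H Q) : T.dOp (T.dOp w) = 0 := by
  refine eq_zero_of_insertFirst_mem (fun w => T.dOp (T.dOp w)) (fun w => T.constTerm_dOp _)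
    (fun w x => AddSubgroup.subset_closure ⟨insertFirst x w, ?_⟩) w
  simp only [T.insertFirst_dOp, map_sub, T.parity_dOp, map_neg, T.dOp_lieH]
  abel

end LieRinehartTriple

/-! ### Generators of the algebra of forms -/

section Spanning

variable {A H Q : Type*} [CommRing A] [AddCommGroup H] [Module A H] [AddCommGroup Q] [Module A Q]

/-- A finite dual basis of a finitely generated projective module. -/
theorem exists_dual_basis (A Q : Type*) [CommRing A] [AddCommGroup Q] [Module A Q]
    [Module.Finite A Q] [Module.Projective A Q] : ∃ (n : ℕ) (e : Fin n → Q) (θ : Fin n → Q →ₗ[A] A),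
      ∀ ξ, ∑ i, θ i ξ • e i = ξ := by
  obtain ⟨n, f, g, -, -, hfg⟩ := Module.Finite.exists_comp_eq_id_of_projective A Q
  refine ⟨n, fun i => f (Pi.single i 1), fun i => LinearMap.proj i ∘ₗ g, fun ξ => ?_⟩
  have h : f (g ξ) = ξ := LinearMap.congr_fun hfg ξ
  conv_rhs => rw [← h, ← (Pi.basisFun A (Fin n)).sum_repr (g ξ), map_sum]
  exact Finset.sum_congr rfl fun i _ => by
    rw [map_smul, Pi.basisFun_apply, Pi.basisFun_repr]
    rfl

/-- If `Q` is finitely generated projective, the exterior algebra has finite coordinates with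
respect to monomials. -/
theorem exists_monomial_coordinates (A Q : Type*) [CommRing A] [AddCommGroup Q] [Module A Q]
    [Module.Finite A Q] [Module.Projective A Q] :
    ∃ (n : ℕ) (c : Finset (Fin n) → ExteriorAlgebra A Q →ₗ[A] A)
      (ξ : ∀ I : Finset (Fin n), Fin I.card → Q),
      ∀ u, ∑ I, c I u • ExteriorAlgebra.ιMulti A I.card (ξ I) = u := by
  obtain ⟨n, f, g, -, -, hfg⟩ := Module.Finite.exists_comp_eq_id_of_projective A Q
  let b := (Pi.basisFun A (Fin n)).ExteriorAlgebra
  refine ⟨n, fun I => b.coord I ∘ₗ (ExteriorAlgebra.map g).toLinearMap,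
    fun I => f ∘ Pi.basisFun A (Fin n) ∘
      Set.powersetCard.ofFinEmbEquiv.symm (Set.powersetCard.prodEquiv.symm I).2, fun u => ?_⟩
  have h : ExteriorAlgebra.map f (ExteriorAlgebra.map g u) = u := by
    rw [← AlgHom.comp_apply, ExteriorAlgebra.map_comp_map, hfg, ExteriorAlgebra.map_id]
    rfl
  conv_rhs => rw [← h, ← b.sum_repr (ExteriorAlgebra.map g u), map_sum]
  refine Finset.sum_congr rfl fun I _ => ?_
  rw [map_smul, ExteriorAlgebra.basis_apply]
  exact congrArg _ (ExteriorAlgebra.map_apply_ιMulti f _).symm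

theorem ofExt_mul_eq_mapValues (u : ExteriorAlgebra A Q) (w : ExtForms A H Q) :
    formMulₗ A H Q (ofExt H u) w = mapValues (LinearMap.mulLeft A u) w := by
  refine sub_eq_zero.1 (eq_zero_of_insertFirst_mem (fun w : ExtForms A H Q =>
    formMulₗ A H Q (ofExt H u) w - mapValues (LinearMap.mulLeft A u) w) (fun w => ?_)
    (fun w x => AddSubgroup.subset_closure ⟨insertFirst x w, ?_⟩) w)
  · rw [map_sub, constTerm_formMulₗ, toForm_apply_constTerm, constTerm_mapValues, sub_eq_zero]
    rfl
  · simp only [map_sub, insertFirst_formMulₗ, insertFirst_ofExt, insertFirst_mapValues, map_zero,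
      LinearMap.zero_apply, zero_add]

attribute [local instance] formRing

/-- Products of an element of the exterior algebra and a scalar form. -/
def pureForms (A H Q : Type*) [CommRing A] [AddCommGroup H] [Module A H] [AddCommGroup Q]
    [Module A Q] : Set (ExtForms A H Q) :=
  {w | ∃ (p : ℕ) (ξ : Fin p → Q) (q : ℕ) (β : H [⋀^Fin q]→ₗ[A] A),
    w = ofExt H (ExteriorAlgebra.ιMulti A p ξ) * ofScalarForm Q β}

/-- If `Q` is finitely generated projective, every form is a sum of products of monomials in `Q` and
scalar forms. -/
theorem mem_closure_pureForms [Module.Finite A Q] [Module.Projective A Q] (w : ExtForms A H Q) :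
    w ∈ AddSubgroup.closure (pureForms A H Q) := by
  obtain ⟨n, c, ξ, h⟩ := exists_monomial_coordinates A Q
  induction w using forms_induction with
  | zero => exact zero_mem _
  | form q f =>
    have : toForm f = ∑ I, ofExt H (ExteriorAlgebra.ιMulti A I.card (ξ I)) *
        ofScalarForm Q ((c I).compAlternatingMap f) := by
      refine forms_ext fun m v => ?_
      have h1 : ∀ I, (ofExt H (ExteriorAlgebra.ιMulti A I.card (ξ I)) *
          ofScalarForm Q ((c I).compAlternatingMap f)) m v =
          c I (toForm f m v) • ExteriorAlgebra.ιMulti A I.card (ξ I) := fun I => by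
        rw [← formMulₗ_eq_mul, ofExt_mul_eq_mapValues, mapValues_apply, ofScalarForm]
        by_cases hm : q = m
        · subst hm
          rw [toForm_apply_self, toForm_apply_self, Algebra.smul_def, Algebra.commutes]
          rfl
        · rw [toForm_apply_ne hm, toForm_apply_ne hm]
          simp
      have h2 : ∀ (s : Finset (Finset (Fin n))) (F : Finset (Fin n) → ExtForms A H Q),
          (∑ I ∈ s, F I) m v = ∑ I ∈ s, F I m v := fun s F =>
        map_sum (AddMonoidHom.mk' (fun w : ExtForms A H Q => w m v) fun _ _ => rfl) F s
      rw [h2, Finset.sum_congr rfl fun I _ => h1 I, h]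
    rw [this]
    exact sum_mem fun I _ => AddSubgroup.subset_closure ⟨_, _, _, _, rfl⟩
  | add w w' hw hw' => exact add_mem hw hw'

theorem ofExt_one : ofExt H (1 : ExteriorAlgebra A Q) = 1 :=
  rfl

theorem ofExt_ιMulti_mem_closure {p : ℕ} (ξ : Fin p → Q) :
    ofExt H (ExteriorAlgebra.ιMulti A p ξ) ∈
      Submonoid.closure (Set.range fun ξ : Q => ofExt H (ExteriorAlgebra.ι A ξ)) := by
  induction p with
  | zero =>
    rw [ExteriorAlgebra.ιMulti_zero_apply, ofExt_one]
    exact one_mem _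
  | succ p ih =>
    rw [ExteriorAlgebra.ιMulti_succ_apply, ofExt_mul]
    exact mul_mem (Submonoid.subset_closure ⟨_, rfl⟩) (ih _)

theorem ιMulti_mem_extPower {p : ℕ} (ξ : Fin p → Q) :
    ExteriorAlgebra.ιMulti A p ξ ∈ extPower A Q p := by
  rw [extPower_natCast]
  exact ExteriorAlgebra.ιMulti_range A p ⟨ξ, rfl⟩

end Spanning

section Grading

variable {R A H Q : Type*} [CommRing R] [CommRing A] [Algebra R A] [AddCommGroup H] [Module A H]
  [AddCommGroup Q] [Module R Q] [Module A Q] [IsScalarTower R A Q]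

attribute [local instance] formRing

theorem pureForms_subset_gr {w : ExtForms A H Q} (hw : w ∈ pureForms A H Q) :
    ∃ q p : ℕ, w ∈ (formsAlgebra R A H Q).gr q p := by
  obtain ⟨p, ξ, q, β, rfl⟩ := hw
  refine ⟨q, p, ?_⟩
  have := mul_mem_gr (R := R) (ofExt_mem (H := H) (ιMulti_mem_extPower (A := A) ξ))
    (ofScalarForm_mem (Q := Q) β)
  rwa [zero_add, add_zero] at this

theorem isInternal_gr [Module.Finite A Q] [Module.Projective A Q] :
    DirectSum.IsInternal (fun i : ℤ × ℤ => (formsAlgebra R A H Q).gr i.1 i.2) := by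
  refine DirectSum.isInternal_submodule_of_iSupIndep_of_iSup_eq_top ?_ ?_
  · rintro ⟨q, p⟩
    rw [Submodule.disjoint_def]
    intro w hw hw'
    refine forms_ext fun m v => ?_
    by_cases hq : (m : ℤ) = q
    · subst hq
      obtain ⟨p, rfl⟩ | hp : (∃ n : ℕ, p = n) ∨ p < 0 := by
        rcases lt_or_ge p 0 with h | h
        · exact Or.inr h
        · exact Or.inl ⟨p.toNat, (Int.toNat_of_nonneg h).symm⟩
      -- Independence is tested on a single value, by projecting it to its component of degree `p`.
      · let N : ExtForms A H Q →ₗ[R] ExteriorAlgebra A Q :=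
          { toFun := fun w => GradedRing.proj (fun i : ℕ => ⋀[A]^i Q) p (w m v)
            map_add' := fun w w' => map_add (GradedRing.proj (fun i : ℕ => ⋀[A]^i Q) p) _ _
            map_smul' := fun r w => by
              change GradedRing.proj (fun i : ℕ => ⋀[A]^i Q) p (r • w m v) =
                r • GradedRing.proj (fun i : ℕ => ⋀[A]^i Q) p (w m v)
              rw [← algebraMap_smul A r (w m v), ← algebraMap_smul A r]
              exact map_smul (GradedAlgebra.proj (fun i : ℕ => ⋀[A]^i Q) p) _ _ }
        have h1 : (⨆ j : ℤ × ℤ, ⨆ _ : j ≠ ((m : ℤ), (p : ℤ)), (formsAlgebra R A H Q).gr j.1 j.2) ≤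
            LinearMap.ker N := by
          refine iSup₂_le fun j hj w hw => ?_
          obtain ⟨q', p'⟩ := j
          have hw := mem_gr_iff.1 hw m v
          change GradedRing.proj (fun i : ℕ => ⋀[A]^i Q) p (w m v) = 0
          by_cases hq' : (m : ℤ) = q'
          · obtain ⟨p', rfl⟩ | hp' : (∃ n : ℕ, p' = n) ∨ p' < 0 := by
              rcases lt_or_ge p' 0 with h | h
              · exact Or.inr h
              · exact Or.inl ⟨p'.toNat, (Int.toNat_of_nonneg h).symm⟩
            · have h2 : p' ≠ p := fun h => hj (by rw [← hq', h])
              rw [GradedRing.proj_apply]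
              exact DirectSum.decompose_of_mem_ne _ (by simpa only [extPower_natCast] using hw.1) h2
            · rw [extPower_neg _ hp', Submodule.mem_bot] at hw
              rw [hw.1, map_zero]
          · rw [hw.2 hq', map_zero]
        have h2 : N w = 0 := h1 hw'
        have h3 : GradedRing.proj (fun i : ℕ => ⋀[A]^i Q) p (w m v) = w m v := by
          rw [GradedRing.proj_apply]
          exact DirectSum.decompose_of_mem_same _
            (by simpa only [extPower_natCast] using (mem_gr_iff.1 hw m v).1)
        exact h3.symm.trans h2
      · rw [gr_eq_zero (Or.inr hp) hw]
    · exact (mem_gr_iff.1 hw m v).2 hq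
  · refine eq_top_iff.2 fun w _ => ?_
    induction mem_closure_pureForms w using AddSubgroup.closure_induction with
    | mem w hw =>
      obtain ⟨q, p, h⟩ := pureForms_subset_gr (R := R) hw
      exact Submodule.mem_iSup_of_mem ((q : ℤ), (p : ℤ)) h
    | zero => exact zero_mem _
    | add w w' _ _ hw hw' => exact add_mem (hw trivial) (hw' trivial)
    | neg w _ hw => exact neg_mem (hw trivial)

theorem isBigradedCommutative_formsAlgebra [Module.Finite A Q] [Module.Projective A Q] :
    (formsAlgebra R A H Q).IsBigradedCommutative where
  isInternal := isInternal_gr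
  gr_eq_bot _ _ h := (Submodule.eq_bot_iff _).2 fun _ hw => gr_eq_zero h hw
  one_mem := one_mem_gr
  mul_mem := mul_mem_gr
  one_mul := one_mul
  mul_one := mul_one
  mul_assoc := mul_assoc
  mul_comm := mul_comm_gr

/-- The elements of total degree `e`: the sums of elements of bidegrees `(q, p)` with `p - q = e`. -/
def totalDegree (R A H Q : Type*) [CommRing R] [CommRing A] [Algebra R A] [AddCommGroup H]
    [Module A H] [AddCommGroup Q] [Module R Q] [Module A Q] [IsScalarTower R A Q] (e : ℤ) :
    AddSubgroup (ExtForms A H Q) :=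
  AddSubgroup.closure {w | ∃ q p : ℤ, p - q = e ∧ w ∈ (formsAlgebra R A H Q).gr q p}

theorem mem_totalDegree {q p : ℤ} {w : ExtForms A H Q} (hw : w ∈ (formsAlgebra R A H Q).gr q p) :
    w ∈ totalDegree R A H Q (p - q) :=
  AddSubgroup.subset_closure ⟨q, p, rfl, hw⟩

theorem parity_of_mem_totalDegree {e : ℤ} {w : ExtForms A H Q} (hw : w ∈ totalDegree R A H Q e) :
    parity w = e.negOnePow • w := by
  induction hw using AddSubgroup.closure_induction with
  | mem w hw =>
    obtain ⟨q, p, rfl, hw⟩ := hw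
    exact parity_of_mem hw
  | zero => rw [map_zero, smul_zero]
  | add w w' _ _ hw hw' => rw [map_add, hw, hw', smul_add]
  | neg w _ hw => rw [map_neg, hw, smul_neg]

/-- An additive operator of bidegree `(s, t)` has total degree `t - s`. -/
theorem map_mem_totalDegree {X : ExtForms A H Q → ExtForms A H Q} {s t n : ℤ} (hn : t - s = n)
    (hadd : ∀ a b, X (a + b) = X a + X b)
    (hmem : ∀ {q p : ℤ} {a : ExtForms A H Q}, a ∈ (formsAlgebra R A H Q).gr q p →
      X a ∈ (formsAlgebra R A H Q).gr (q + s) (p + t)) {e : ℤ} {a : ExtForms A H Q}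
    (ha : a ∈ totalDegree R A H Q e) : X a ∈ totalDegree R A H Q (n + e) := by
  induction ha using AddSubgroup.closure_induction with
  | mem w hw =>
    obtain ⟨q, p, rfl, hw⟩ := hw
    exact AddSubgroup.subset_closure ⟨_, _, by rw [← hn]; ring, hmem hw⟩
  | zero =>
    rw [show X 0 = 0 from map_zero (AddMonoidHom.mk' X hadd)]
    exact zero_mem _
  | add w w' _ _ hw hw' => rw [hadd]; exact add_mem hw hw'
  | neg w _ hw =>
    rw [show X (-w) = -X w from map_neg (AddMonoidHom.mk' X hadd) w]
    exact neg_mem hw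

theorem isGradedComm_totalDegree [Module.Finite A Q] [Module.Projective A Q] :
    IsGradedComm (totalDegree R A H Q) where
  one_mem := AddSubgroup.subset_closure ⟨0, 0, sub_zero 0, one_mem_gr⟩
  mul_mem {i j a b} ha hb := by
    induction ha using AddSubgroup.closure_induction with
    | mem a ha =>
      obtain ⟨q, p, rfl, ha⟩ := ha
      induction hb using AddSubgroup.closure_induction with
      | mem b hb =>
        obtain ⟨q', p', rfl, hb⟩ := hb
        exact AddSubgroup.subset_closure ⟨q + q', p + p', by ring, mul_mem_gr ha hb⟩
      | zero => rw [mul_zero]; exact zero_mem _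
      | add b b' _ _ hb hb' => rw [mul_add]; exact add_mem hb hb'
      | neg b _ hb => rw [mul_neg]; exact neg_mem hb
    | zero => rw [zero_mul]; exact zero_mem _
    | add a a' _ _ ha ha' => rw [add_mul]; exact add_mem ha ha'
    | neg a _ ha => rw [neg_mul]; exact neg_mem ha
  mul_comm {i j a b} ha hb := by
    induction ha using AddSubgroup.closure_induction with
    | mem a ha =>
      obtain ⟨q, p, rfl, ha⟩ := ha
      induction hb using AddSubgroup.closure_induction with
      | mem b hb =>
        obtain ⟨q', p', rfl, hb⟩ := hb
        exact mul_comm_gr ha hb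
      | zero => rw [mul_zero, zero_mul, smul_zero]
      | add b b' _ _ hb hb' => rw [mul_add, hb, hb', add_mul, smul_add]
      | neg b _ hb => rw [mul_neg, hb, neg_mul, smul_neg]
    | zero => rw [mul_zero, zero_mul, smul_zero]
    | add a a' _ _ ha ha' => rw [add_mul, ha, ha', mul_add, smul_add]
    | neg a _ ha => rw [neg_mul, ha, mul_neg, smul_neg]
  mem_closure a := by
    refine AddSubgroup.closure_mono (fun w hw => ?_) (mem_closure_pureForms a)
    obtain ⟨q, p, h⟩ := pureForms_subset_gr (R := R) hw
    exact ⟨_, mem_totalDegree h⟩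

/-- The generators of the algebra of forms: scalar forms and elements of `Q`. -/
inductive IsFormGenerator (A H Q : Type*) [CommRing A] [AddCommGroup H] [Module A H]
    [AddCommGroup Q] [Module A Q] : ℤ → ExtForms A H Q → Prop
  | scalar {q : ℕ} (α : H [⋀^Fin q]→ₗ[A] A) : IsFormGenerator A H Q (-q) (ofScalarForm Q α)
  | ext (ξ : Q) : IsFormGenerator A H Q 1 (ofExt H (ExteriorAlgebra.ι A ξ))

theorem isGeneratedBy_isFormGenerator [Module.Finite A Q] [Module.Projective A Q] :
    IsGeneratedBy (totalDegree R A H Q) (IsFormGenerator A H Q) where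
  mem h := by
    cases h with
    | scalar α => simpa using mem_totalDegree (R := R) (ofScalarForm_mem (Q := Q) α)
    | ext ξ => simpa using mem_totalDegree (R := R) (ofExt_mem (H := H) (ι_mem_extPower (A := A) ξ))
  generates a := by
    refine AddSubgroup.closure_mono (fun w hw => ?_) (mem_closure_pureForms a)
    obtain ⟨p, ξ, q, β, rfl⟩ := hw
    refine mul_mem (Submonoid.closure_mono ?_ (ofExt_ιMulti_mem_closure ξ))
      (Submonoid.subset_closure ⟨_, .scalar β⟩)
    rintro _ ⟨ξ, rfl⟩
    exact ⟨1, .ext ξ⟩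

/-- An operator of bidegree `(s, t)` with the Leibniz rule, `t - s` even. -/
theorem isDer_of_even {X : ExtForms A H Q → ExtForms A H Q} {s t n : ℤ} (hn : t - s = n)
    (hn' : Even n) (hadd : ∀ a b, X (a + b) = X a + X b)
    (hmem : ∀ {q p : ℤ} {a : ExtForms A H Q}, a ∈ (formsAlgebra R A H Q).gr q p →
      X a ∈ (formsAlgebra R A H Q).gr (q + s) (p + t))
    (hmul : ∀ a b, X (a * b) = X a * b + a * X b) : IsDer (totalDegree R A H Q) n X where
  map_add := hadd
  mem := map_mem_totalDegree hn hadd hmem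
  leibniz {i a} b _ := by
    rw [hmul, Int.negOnePow_even _ (hn'.mul_right i), one_smul]

/-- An operator of bidegree `(s, t)` with the signed Leibniz rule, `t - s` odd. -/
theorem isDer_of_odd {X : ExtForms A H Q → ExtForms A H Q} {s t n : ℤ} (hn : t - s = n)
    (hn' : Odd n) (hadd : ∀ a b, X (a + b) = X a + X b)
    (hmem : ∀ {q p : ℤ} {a : ExtForms A H Q}, a ∈ (formsAlgebra R A H Q).gr q p →
      X a ∈ (formsAlgebra R A H Q).gr (q + s) (p + t))
    (hmul : ∀ a b, X (a * b) = X a * b + parity a * X b) : IsDer (totalDegree R A H Q) n X where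
  map_add := hadd
  mem := map_mem_totalDegree hn hadd hmem
  leibniz {i a} b ha := by
    have : (n * i).negOnePow = i.negOnePow := by
      rw [Int.negOnePow_eq_iff]
      obtain ⟨k, rfl⟩ := hn'
      exact ⟨k * i, by ring⟩
    rw [hmul, parity_of_mem_totalDegree ha, this, smul_mul_assoc]

end Grading

namespace AlmostPreLieRinehartTriple

variable {R A H Q : Type*} [CommRing R] [CommRing A] [Algebra R A]
  [AddCommGroup H] [Module R H] [Module A H] [IsScalarTower R A H]
  [AddCommGroup Q] [Module R Q] [Module A Q] [IsScalarTower R A Q]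
  {T : AlmostPreLieRinehartTriple R A H Q}

theorem IsLieRinehartDifferential.unique [Module.Finite A Q] [Module.Projective A Q]
    {d d' : ExtForms A H Q →ₗ[R] ExtForms A H Q} (h : T.IsLieRinehartDifferential d)
    (h' : T.IsLieRinehartDifferential d') : d = d' := by
  refine LinearMap.ext fun w => ?_
  induction mem_closure_pureForms w using AddSubgroup.closure_induction with
  | mem w hw =>
    obtain ⟨q, p, hw⟩ := pureForms_subset_gr (R := R) hw
    have hw' := mem_gr_iff.1 hw
    have : w = toForm (w q) := forms_ext fun m v => by
      by_cases hm : q = m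
      · subst hm
        rw [toForm_apply_self]
      · rw [toForm_apply_ne hm, (hw' m v).2 fun h => hm (by exact_mod_cast h.symm)]
        rfl
    rw [this]
    refine forms_ext fun m v => ?_
    by_cases hm : m = q + 1
    · subst hm
      have hf : ∀ v, w q v ∈ ⋀[A]^p Q := fun v => by
        simpa only [extPower_natCast] using (hw' q v).1
      exact smul_left_cancel _ ((h.apply_eq (w q) hf v).trans (h'.apply_eq (w q) hf v).symm)
    · rw [h.apply_ne _ m hm, h'.apply_ne _ m hm]
  | zero => rw [map_zero, map_zero]
  | add w w' _ _ hw hw' => rw [map_add, map_add, hw, hw']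
  | neg w _ hw => rw [map_neg, map_neg, hw]

end AlmostPreLieRinehartTriple

/-! ### Contractions, Lie derivatives along `Q`, and the bracket -/

section Contractions

variable {A H Q : Type*} [CommRing A] [AddCommGroup H] [Module A H] [AddCommGroup Q] [Module A Q]

/-- The contraction of the exterior algebra with a linear form. -/
noncomputable def extContract (θ : Q →ₗ[A] A) : ExteriorAlgebra A Q →ₗ[A] ExteriorAlgebra A Q :=
  CliffordAlgebra.contractLeft (Q := (0 : QuadraticForm A Q)) θ

variable (θ θ' : Q →ₗ[A] A)

theorem extContract_algebraMap (a : A) : extContract θ (algebraMap A _ a) = 0 :=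
  CliffordAlgebra.contractLeft_algebraMap _ θ a

theorem extContract_ι (ξ : Q) : extContract θ (ExteriorAlgebra.ι A ξ) = algebraMap A _ (θ ξ) :=
  CliffordAlgebra.contractLeft_ι _ θ ξ

theorem extContract_ι_mul (ξ : Q) (u : ExteriorAlgebra A Q) :
    extContract θ (ExteriorAlgebra.ι A ξ * u) =
      θ ξ • u - ExteriorAlgebra.ι A ξ * extContract θ u :=
  CliffordAlgebra.contractLeft_ι_mul _ _ _

theorem extContract_comm (u : ExteriorAlgebra A Q) :
    extContract θ (extContract θ' u) = -extContract θ' (extContract θ u) :=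
  CliffordAlgebra.contractLeft_comm _ _ _

theorem involute_ext_ι (ξ : Q) :
    CliffordAlgebra.involute (ExteriorAlgebra.ι A ξ) = -ExteriorAlgebra.ι A ξ :=
  CliffordAlgebra.involute_ι ξ

theorem extContract_mul (u v : ExteriorAlgebra A Q) : extContract θ (u * v) =
    extContract θ u * v + CliffordAlgebra.involute u * extContract θ v := by
  induction u using ExteriorAlgebra.induction generalizing v with
  | algebraMap a =>
    rw [← Algebra.smul_def, map_smul, extContract_algebraMap, zero_mul, zero_add, AlgHom.commutes,
      Algebra.smul_def]
  | ι ξ =>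
    rw [extContract_ι_mul, extContract_ι, involute_ext_ι, Algebra.smul_def, neg_mul, sub_eq_add_neg]
  | mul u u' hu hu' =>
    rw [mul_assoc, hu, hu', hu, map_mul, add_mul, mul_add, mul_assoc, mul_assoc, mul_assoc]
    abel
  | add u u' hu hu' => rw [add_mul, map_add, hu, hu', map_add, map_add, add_mul, add_mul]; abel

theorem extContract_involute (u : ExteriorAlgebra A Q) :
    extContract θ (CliffordAlgebra.involute u) = -CliffordAlgebra.involute (extContract θ u) := by
  induction u using ExteriorAlgebra.induction with
  | algebraMap a => rw [AlgHom.commutes, extContract_algebraMap, map_zero, neg_zero]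
  | ι ξ => rw [involute_ext_ι, map_neg, extContract_ι, AlgHom.commutes]
  | mul u v hu hv =>
    rw [map_mul, extContract_mul, hu, hv, extContract_mul, map_add, map_mul, map_mul, neg_add,
      neg_mul, mul_neg]
  | add u v hu hv => simp only [map_add, hu, hv, neg_add]

theorem extContract_mem {p : ℤ} {u : ExteriorAlgebra A Q} (hu : u ∈ extPower A Q p) :
    extContract θ u ∈ extPower A Q (p - 1) := by
  refine extPower_induction (P := fun p u => extContract θ u ∈ extPower A Q (p - 1))
    ?_ ?_ ?_ ?_ hu
  · intro p
    rw [map_zero]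
    exact zero_mem _
  · intro p u v hu hv
    rw [map_add]
    exact add_mem hu hv
  · intro a
    rw [extContract_algebraMap]
    exact zero_mem _
  · intro p ξ u _ hu' hu
    rw [extContract_ι_mul, add_sub_cancel_right]
    refine sub_mem (Submodule.smul_mem _ _ hu') ?_
    have := mul_mem_extPower (ι_mem_extPower ξ) hu
    rwa [add_sub_cancel] at this

/-- The contraction of the values of forms with a linear form on `Q`. -/
noncomputable def contractQ : ExtForms A H Q →ₗ[A] ExtForms A H Q :=
  mapValues (extContract θ)

theorem constTerm_contractQ (w : ExtForms A H Q) :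
    constTerm (contractQ θ w) = extContract θ (constTerm w) :=
  constTerm_mapValues _ _

theorem insertFirst_contractQ (x : H) (w : ExtForms A H Q) :
    insertFirst x (contractQ θ w) = contractQ θ (insertFirst x w) :=
  insertFirst_mapValues _ _ _

theorem parity_contractQ (w : ExtForms A H Q) :
    parity (contractQ θ w) = -contractQ θ (parity w) := by
  rw [← add_eq_zero_iff_eq_neg]
  refine eq_zero_of_insertFirst_mem (fun w : ExtForms A H Q => parity (contractQ θ w) +
    contractQ θ (parity w)) (fun w => ?_) (fun w x => ?_) w
  · rw [map_add, constTerm_parity, constTerm_contractQ, constTerm_contractQ, constTerm_parity,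
      extContract_involute, add_neg_cancel]
  · have : insertFirst x (parity (contractQ θ w) + contractQ θ (parity w)) =
        -(parity (contractQ θ (insertFirst x w)) + contractQ θ (parity (insertFirst x w))) := by
      simp only [map_add, insertFirst_parity, insertFirst_contractQ, map_neg]
      abel
    rw [this]
    exact neg_mem (AddSubgroup.subset_closure ⟨_, rfl⟩)

theorem contractQ_comm (w : ExtForms A H Q) :
    contractQ θ (contractQ θ' w) = -contractQ θ' (contractQ θ w) :=
  forms_ext fun _ _ => extContract_comm θ θ' _

theorem contractQ_of_mem_scalarForms {w : ExtForms A H Q} (hw : w ∈ scalarForms A H Q) :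
    contractQ θ w = 0 := by
  refine forms_ext fun m v => ?_
  obtain ⟨a, ha⟩ := hw m v
  change extContract θ (w m v) = 0
  rw [← ha, extContract_algebraMap]

theorem contractQ_ofExt (u : ExteriorAlgebra A Q) :
    contractQ θ (ofExt H u) = ofExt H (extContract θ u) :=
  ofExt_eq (by rw [constTerm_contractQ, toForm_apply_constTerm])
    fun x => by rw [insertFirst_contractQ, insertFirst_ofExt, map_zero]

theorem insertFirst_comm (x y : H) (w : ExtForms A H Q) :
    insertFirst x (insertFirst y w) = -insertFirst y (insertFirst x w) := by
  have := insertFirst_self (x + y) w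
  simp only [insertFirst_add, map_add, insertFirst_self, zero_add, add_zero] at this
  exact eq_neg_of_add_eq_zero_right this

/-- The insertion of an argument, with the sign that turns it into a derivation. -/
noncomputable def contractH (x : H) : ExtForms A H Q →ₗ[A] ExtForms A H Q :=
  insertFirst x ∘ₗ parity

theorem contractH_apply (x : H) (w : ExtForms A H Q) :
    contractH x w = insertFirst x (parity w) :=
  rfl

theorem contractH_comm (x y : H) (w : ExtForms A H Q) :
    contractH x (contractH y w) = -contractH y (contractH x w) := by
  simp only [contractH_apply, insertFirst_parity, map_neg, parity_parity]
  rw [insertFirst_comm]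

theorem contractH_self (x : H) (w : ExtForms A H Q) : contractH x (contractH x w) = 0 := by
  simp only [contractH_apply, insertFirst_parity, map_neg, parity_parity, insertFirst_self,
    neg_zero]

theorem contractH_contractQ (x : H) (w : ExtForms A H Q) :
    contractH x (contractQ θ w) = -contractQ θ (contractH x w) := by
  simp only [contractH_apply, parity_contractQ, map_neg, insertFirst_contractQ]

theorem contractH_ofExt (x : H) (u : ExteriorAlgebra A Q) : contractH x (ofExt H u) = 0 := by
  rw [contractH_apply, parity_ofExt, insertFirst_ofExt]

theorem contractH_add (x y : H) (w : ExtForms A H Q) :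
    contractH (x + y) w = contractH x w + contractH y w :=
  insertFirst_add _ _ _

theorem contractH_smul (a : A) (x : H) (w : ExtForms A H Q) :
    contractH (a • x) w = a • contractH x w :=
  insertFirst_smul _ _ _

attribute [local instance] formRing

theorem contractQ_mul (a b : ExtForms A H Q) :
    contractQ θ (a * b) = contractQ θ a * b + parity a * contractQ θ b := by
  refine sub_eq_zero.1 (eq_zero_of_insertFirst_mem (fun ab : ExtForms A H Q × ExtForms A H Q =>
    contractQ θ (ab.1 * ab.2) - (contractQ θ ab.1 * ab.2 + parity ab.1 * contractQ θ ab.2))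
    ?_ ?_ (a, b))
  · rintro ⟨a, b⟩
    simp only [map_sub, map_add, constTerm_mul, constTerm_contractQ, extContract_mul,
      constTerm_parity, sub_self]
  · rintro ⟨a, b⟩ x
    have : insertFirst x (contractQ θ (a * b) - (contractQ θ a * b + parity a * contractQ θ b)) =
        (contractQ θ (insertFirst x a * parity b) - (contractQ θ (insertFirst x a) * parity b +
          parity (insertFirst x a) * contractQ θ (parity b))) +
        (contractQ θ (a * insertFirst x b) - (contractQ θ a * insertFirst x b +
            parity a * contractQ θ (insertFirst x b))) := by
      simp only [map_sub, map_add, insertFirst_mul, insertFirst_contractQ, insertFirst_parity,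
        parity_contractQ, neg_mul, mul_neg]
      abel
    rw [this]
    exact add_mem (AddSubgroup.subset_closure ⟨(_, _), rfl⟩)
      (AddSubgroup.subset_closure ⟨(_, _), rfl⟩)

theorem contractH_mul (x : H) (a b : ExtForms A H Q) :
    contractH x (a * b) = contractH x a * b + parity a * contractH x b := by
  simp only [contractH_apply, parity_mul, insertFirst_mul, parity_parity]

section

variable {R : Type*} [CommRing R] [Algebra R A] [Module R Q] [IsScalarTower R A Q]

theorem contractQ_mem {q p : ℤ} {w : ExtForms A H Q} (hw : w ∈ (formsAlgebra R A H Q).gr q p) :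
    contractQ θ w ∈ (formsAlgebra R A H Q).gr q (p - 1) := by
  rw [mem_gr_iff] at hw ⊢
  intro m v
  refine ⟨extContract_mem θ (hw m v).1, fun hm => ?_⟩
  change extContract θ (w m v) = 0
  rw [(hw m v).2 hm, map_zero]

theorem contractH_mem (x : H) {q p : ℤ} {w : ExtForms A H Q}
    (hw : w ∈ (formsAlgebra R A H Q).gr q p) :
    contractH x w ∈ (formsAlgebra R A H Q).gr (q - 1) p :=
  insertFirst_mem (parity_mem hw) x

theorem isDer_contractQ : IsDer (totalDegree R A H Q) (-1) (contractQ (H := H) θ) :=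
  isDer_of_odd (s := 0) (t := -1) rfl odd_neg_one (map_add _) (fun {q p a} ha => by
    rw [add_zero]
    exact contractQ_mem θ ha) (contractQ_mul θ)

theorem isDer_contractH (x : H) : IsDer (totalDegree R A H Q) 1 (contractH (Q := Q) x) :=
  isDer_of_odd (s := -1) (t := 0) rfl odd_one (map_add _) (fun {q p a} ha => by
    rw [add_zero]
    exact contractH_mem x ha) (contractH_mul x)

end

end Contractions

section LieOperatorDerivations

variable {R A H Q : Type*} [CommRing R] [CommRing A] [Algebra R A] [AddCommGroup H] [Module R H]
  [Module A H] [AddCommGroup Q] [Module R Q] [Module A Q] [IsScalarTower R A Q]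

attribute [local instance] formRing

theorem isDer_lieOp (D : Derivation R A A) (φ : H →ₗ[R] H) (ψ : Q →ₗ[R] Q)
    (hφ : ∀ (a : A) (x : H), φ (a • x) = D a • x + a • φ x)
    (hψ : ∀ (a : A) (ξ : Q), ψ (a • ξ) = D a • ξ + a • ψ ξ) :
    IsDer (totalDegree R A H Q) 0 (lieOp D φ ψ hφ hψ) :=
  isDer_of_even (s := 0) (t := 0) rfl Even.zero (map_add _) (fun {q p a} ha => by
    rw [add_zero, add_zero]
    exact lieOp_mem _ _ _ _ _ ha) (lieOp_mul _ _ _ _ _)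

end LieOperatorDerivations

namespace AlmostPreLieRinehartTriple

variable {R A H Q : Type*} [CommRing R] [CommRing A] [Algebra R A]
  [AddCommGroup H] [Module R H] [Module A H] [IsScalarTower R A H]
  [AddCommGroup Q] [Module R Q] [Module A Q] [IsScalarTower R A Q]
  (T : AlmostPreLieRinehartTriple R A H Q)

attribute [local instance] formRing

theorem isDer_dOp : IsDer (totalDegree R A H Q) (-1) T.dOp :=
  isDer_of_odd (s := 1) (t := 0) rfl odd_neg_one (map_add _) (fun {q p a} ha => by
    rw [add_zero]
    exact T.dOp_mem ha) T.dOp_mul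

/-- The derivation `[ξ, ·]` of the algebra of forms. -/
def lieQ (ξ : Q) : ExtForms A H Q →ₗ[R] ExtForms A H Q :=
  lieOp (T.anchorQ ξ) (T.actQH ξ) (T.brQ ξ) (T.actQH_smul ξ) (T.brQ_smul ξ)

theorem isLieOp_lieQ (ξ : Q) : IsLieOp (T.actQH ξ)
    (extDerivation (T.anchorQ ξ) (T.brQ ξ) (T.brQ_smul ξ)) (T.lieQ ξ) :=
  isLieOp_lieOp _ _ _ _ _

theorem isDer_lieQ (ξ : Q) : IsDer (totalDegree R A H Q) 0 (T.lieQ ξ) :=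
  isDer_lieOp _ _ _ _ _

theorem brQ_swap (ξ η : Q) : T.brQ ξ η = -T.brQ η ξ := by
  have := T.brQ_self (ξ + η)
  simp only [map_add, LinearMap.add_apply, T.brQ_self, zero_add, add_zero] at this
  exact eq_neg_of_add_eq_zero_right this

theorem δ_swap (ξ η : Q) : T.δ ξ η = -T.δ η ξ := by
  have := T.δ_self (ξ + η)
  simp only [map_add, LinearMap.add_apply, T.δ_self, zero_add, add_zero] at this
  exact eq_neg_of_add_eq_zero_right this

variable {n : ℕ} (e : Fin n → Q) (θ : Fin n → Q →ₗ[A] A)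

/-- The covariant derivative on `Q` along `η` whose Christoffel symbols with respect to a dual basis
vanish. -/
def flatConnection (η : Q) : Q →ₗ[R] Q where
  toFun ξ := ∑ i, T.anchorQ η (θ i ξ) • e i
  map_add' ξ ξ' := by simp only [map_add, add_smul, Finset.sum_add_distrib]
  map_smul' r ξ := by
    simp only [RingHom.id_apply, Finset.smul_sum]
    refine Finset.sum_congr rfl fun i _ => ?_
    rw [← algebraMap_smul A r ξ, map_smul, algebraMap_smul, Derivation.map_smul, smul_assoc]

theorem flatConnection_apply (η ξ : Q) :
    T.flatConnection e θ η ξ = ∑ i, T.anchorQ η (θ i ξ) • e i :=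
  rfl

variable {e θ} (he : ∀ ξ, ∑ i, θ i ξ • e i = ξ)

theorem flatConnection_smul (he : ∀ ξ, ∑ i, θ i ξ • e i = ξ) (η : Q) (a : A) (ξ : Q) :
    T.flatConnection e θ η (a • ξ) = T.anchorQ η a • ξ + a • T.flatConnection e θ η ξ := by
  have : T.anchorQ η a • ξ = ∑ i, (T.anchorQ η a * θ i ξ) • e i := by
    conv_lhs => rw [← he ξ, Finset.smul_sum]
    simp only [smul_smul]
  rw [this, flatConnection_apply, flatConnection_apply, Finset.smul_sum, ← Finset.sum_add_distrib]
  refine Finset.sum_congr rfl fun i _ => ?_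
  rw [map_smul, smul_eq_mul, Derivation.leibniz, smul_smul, ← add_smul, smul_eq_mul, smul_eq_mul,
    mul_comm (θ i ξ), add_comm]

/-- The derivation of the algebra of forms along `η` given by the action of `Q` on `H` and the
flat connection on `Q`. -/
def lieFlat (η : Q) : ExtForms A H Q →ₗ[R] ExtForms A H Q :=
  lieOp (T.anchorQ η) (T.actQH η) (T.flatConnection e θ η) (T.actQH_smul η)
    (T.flatConnection_smul he η)

theorem isLieOp_lieFlat (η : Q) : IsLieOp (T.actQH η)
    (extDerivation (T.anchorQ η) (T.flatConnection e θ η) (T.flatConnection_smul he η))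
    (T.lieFlat he η) :=
  isLieOp_lieOp _ _ _ _ _

theorem isDer_lieFlat (η : Q) : IsDer (totalDegree R A H Q) 0 (T.lieFlat he η) :=
  isDer_lieOp _ _ _ _ _

/-- The bracket on forms, in terms of a dual basis `e`, `θ` of `Q`:
`[a, b] = ∑ i, (-1) ^ |∂_i a| (∂_i a) (L_i b) - (∇_i a) (∂_i b)`, where `∂_i` is the contraction with
`θ i`, and `L_i` and `∇_i` are the derivations along `e i` given on `Q` by the bracket and by the flat
connection. The second term compensates for the failure of `[ξ, η]` to be `A`-linear in `ξ`. -/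
noncomputable def brOp : ExtForms A H Q →ₗ[R] ExtForms A H Q →ₗ[R] ExtForms A H Q :=
  ∑ i, ((formsAlgebra R A H Q).mul.compl₁₂
      ((parity ∘ₗ contractQ (θ i)).restrictScalars R) (T.lieQ (e i))
    - (formsAlgebra R A H Q).mul.compl₁₂ (T.lieFlat he (e i))
      ((contractQ (θ i)).restrictScalars R))

theorem brOp_apply (a b : ExtForms A H Q) : T.brOp he a b =
    ∑ i, (parity (contractQ (θ i) a) * T.lieQ (e i) b
      - T.lieFlat he (e i) a * contractQ (θ i) b) := by
  rw [brOp]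
  simp only [LinearMap.sum_apply]
  rfl

theorem brOp_mem {q p q' p' : ℤ} {a b : ExtForms A H Q} (ha : a ∈ (formsAlgebra R A H Q).gr q p)
    (hb : b ∈ (formsAlgebra R A H Q).gr q' p') :
    T.brOp he a b ∈ (formsAlgebra R A H Q).gr (q + q') (p + p' - 1) := by
  rw [brOp_apply]
  refine sum_mem fun i _ => sub_mem_gr ?_ ?_
  · have := mul_mem_gr (parity_mem (contractQ_mem (θ i) ha))
      (lieOp_mem (T.anchorQ (e i)) (T.actQH (e i)) (T.brQ (e i)) (T.actQH_smul _) (T.brQ_smul _) hb)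
    rwa [show p - 1 + p' = p + p' - 1 by ring] at this
  · have := mul_mem_gr (lieOp_mem (T.anchorQ (e i)) (T.actQH (e i)) (T.flatConnection e θ (e i))
      (T.actQH_smul _) (T.flatConnection_smul he _) ha) (contractQ_mem (θ i) hb)
    rwa [show p + (p' - 1) = p + p' - 1 by ring] at this

theorem isBiderivation_brOp [Module.Finite A Q] [Module.Projective A Q] :
    IsBiderivation (totalDegree R A H Q) fun a b => T.brOp he a b where
  der {n a} ha := by
    have hg := isGradedComm_totalDegree (R := R) (A := A) (H := H) (Q := Q)
    refine (IsDer.sum Finset.univ fun i =>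
      ((((T.isDer_lieQ (e i)).mul_left hg (c := parity (contractQ (θ i) a)) (m := n - 1) ?_).congr
          (add_zero _) fun _ => rfl).sub
        (((isDer_contractQ (θ i)).mul_left hg (c := T.lieFlat he (e i) a) (m := n) ?_).congr
          (sub_eq_add_neg n 1).symm fun _ => rfl))).congr rfl fun b => T.brOp_apply he a b
    · have h := (isDer_contractQ (R := R) (θ i)).mem ha
      rw [parity_of_mem_totalDegree h]
      refine units_smul_mem_addSubgroup _ ?_
      rwa [show n - 1 = -1 + n by ring]
    · have h := (T.isDer_lieFlat he (e i)).mem ha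
      rwa [zero_add] at h
  add_left a b c := by rw [map_add, LinearMap.add_apply]
  mul_left {i j a b} c ha hb := by
    have hg := isGradedComm_totalDegree (R := R) (A := A) (H := H) (Q := Q)
    simp only [brOp_apply, Finset.mul_sum, Finset.smul_sum, ← Finset.sum_add_distrib]
    refine Finset.sum_congr rfl fun k _ => ?_
    have h1 := (isDer_contractQ (R := R) (θ k)).mem ha
    have h2 := (T.isDer_lieFlat he (e k)).mem ha
    have h3 := hg.mul_comm hb h1
    have h4 := hg.mul_comm hb h2
    simp only [mul_sub, smul_sub, ← mul_assoc, contractQ_mul, map_add, parity_mul, parity_parity,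
      (T.isDer_lieFlat he (e k)).leibniz b ha, add_mul, parity_of_mem_totalDegree h1, h4,
      mul_smul_comm, h3, zero_add, zero_mul, Int.negOnePow_zero, one_smul, smul_mul_assoc,
      parity_of_mem_totalDegree hb, smul_smul]
    rw [← Int.negOnePow_add, ← Int.negOnePow_add, ← Int.negOnePow_add, ← Int.negOnePow_add,
      (Int.negOnePow_eq_iff (i * j + (-1 + i) + j * (-1 + i)) (j + (-1 + i))).2
        ⟨i * j - j, by ring⟩, Int.negOnePow_even (i * j + j * i) ⟨i * j, by ring⟩, one_smul]
    abel

end AlmostPreLieRinehartTriple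

/-! ### The bracket on generators -/

section ConstantForms

variable {A H Q : Type*} [CommRing A] [AddCommGroup H] [Module A H] [AddCommGroup Q] [Module A Q]

variable (A H Q) in
/-- The inclusion of the exterior algebra as forms of degree zero, as a linear map. -/
def ofExtₗ : ExteriorAlgebra A Q →ₗ[A] ExtForms A H Q where
  toFun u := ofExt H u
  map_add' u v := (ofExt_eq
    (by rw [map_add, toForm_apply_constTerm, toForm_apply_constTerm])
    fun x => by rw [map_add, insertFirst_ofExt, insertFirst_ofExt, add_zero]).symm
  map_smul' a u := (ofExt_eq (by rw [map_smul, toForm_apply_constTerm]; rfl)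
    fun x => by rw [map_smul, insertFirst_ofExt]; exact smul_zero _).symm

theorem ofExtₗ_apply (u : ExteriorAlgebra A Q) : ofExtₗ A H Q u = ofExt H u :=
  rfl

theorem parity_ofExt_ι (ξ : Q) :
    parity (ofExt H (ExteriorAlgebra.ι A ξ)) = -ofExt H (ExteriorAlgebra.ι A ξ) := by
  rw [parity_ofExt, involute_ext_ι, ← ofExtₗ_apply, map_neg]
  rfl

theorem contractQ_ofExt_ι (θ : Q →ₗ[A] A) (ξ : Q) :
    contractQ θ (ofExt H (ExteriorAlgebra.ι A ξ)) = ofExt H (algebraMap A _ (θ ξ)) := by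
  rw [contractQ_ofExt, extContract_ι]

theorem lieOp_ofExt {R : Type*} [CommRing R] [Algebra R A] [Module R H] [Module R Q]
    [IsScalarTower R A Q] (D : Derivation R A A) (φ : H →ₗ[R] H) (ψ : Q →ₗ[R] Q)
    (hφ : ∀ (a : A) (x : H), φ (a • x) = D a • x + a • φ x)
    (hψ : ∀ (a : A) (ξ : Q), ψ (a • ξ) = D a • ξ + a • ψ ξ) (u : ExteriorAlgebra A Q) :
    lieOp D φ ψ hφ hψ (ofExt H u) = ofExt H (extDerivation D ψ hψ u) :=
  ofExt_eq (by rw [constTerm_lieOp, toForm_apply_constTerm]) fun x => by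
    rw [insertFirst_lieOp, insertFirst_ofExt, insertFirst_ofExt, map_zero, sub_zero]

end ConstantForms

namespace AlmostPreLieRinehartTriple

variable {R A H Q : Type*} [CommRing R] [CommRing A] [Algebra R A]
  [AddCommGroup H] [Module R H] [Module A H] [IsScalarTower R A H]
  [AddCommGroup Q] [Module R Q] [Module A Q] [IsScalarTower R A Q]
  (T : AlmostPreLieRinehartTriple R A H Q)

attribute [local instance] formRing

theorem lieQ_ofExt_ι (ξ η : Q) : T.lieQ ξ (ofExt H (ExteriorAlgebra.ι A η)) =
    ofExt H (ExteriorAlgebra.ι A (T.brQ ξ η)) := by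
  rw [lieQ, lieOp_ofExt, extDerivation_ι]

theorem lieH_ofExt_ι (x : H) (η : Q) : T.lieH x (ofExt H (ExteriorAlgebra.ι A η)) =
    ofExt H (ExteriorAlgebra.ι A (T.actHQ x η)) := by
  rw [lieH, lieOp_ofExt, extDerivation_ι]

variable {n : ℕ} {e : Fin n → Q} {θ : Fin n → Q →ₗ[A] A} (he : ∀ ξ, ∑ i, θ i ξ • e i = ξ)

theorem sum_mul_anchorQ (he : ∀ ξ, ∑ i, θ i ξ • e i = ξ) (ξ : Q) (a : A) :
    ∑ i, θ i ξ * T.anchorQ (e i) a = T.anchorQ ξ a := by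
  let N : Q →ₗ[A] A :=
    { toFun := fun ξ => T.anchorQ ξ a
      map_add' := fun ξ η => by rw [map_add, Derivation.add_apply]
      map_smul' := fun c ξ => by rw [map_smul, Derivation.smul_apply, RingHom.id_apply] }
  have h := congrArg N (he ξ)
  rw [map_sum] at h
  rw [← show N ξ = T.anchorQ ξ a from rfl, ← h]
  exact Finset.sum_congr rfl fun i _ => (map_smul N _ _).symm

theorem sum_smul_flatConnection (he : ∀ ξ, ∑ i, θ i ξ • e i = ξ) (ξ η : Q) :
    ∑ i, θ i η • T.flatConnection e θ (e i) ξ = T.flatConnection e θ η ξ := by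
  simp only [flatConnection_apply, Finset.smul_sum]
  rw [Finset.sum_comm]
  refine Finset.sum_congr rfl fun j _ => ?_
  rw [← T.sum_mul_anchorQ he, Finset.sum_smul]
  exact Finset.sum_congr rfl fun i _ => smul_smul _ _ _

theorem sum_smul_brQ (he : ∀ ξ, ∑ i, θ i ξ • e i = ξ) (ξ η : Q) :
    ∑ i, θ i ξ • T.brQ (e i) η = T.brQ ξ η + T.flatConnection e θ η ξ := by
  have h : T.brQ η ξ = ∑ i, (T.anchorQ η (θ i ξ) • e i + θ i ξ • T.brQ η (e i)) := by
    conv_lhs => rw [← he ξ, map_sum]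
    simp only [T.brQ_smul]
  rw [T.brQ_swap ξ η, h, Finset.sum_add_distrib, ← flatConnection_apply, neg_add_rev, neg_add_cancel_right,
    ← Finset.sum_neg_distrib]
  exact Finset.sum_congr rfl fun i _ => by rw [← smul_neg, ← T.brQ_swap]

theorem sum_smul_lieQ_of_mem_scalarForms (he : ∀ ξ, ∑ i, θ i ξ • e i = ξ) (ξ : Q)
    {w : ExtForms A H Q} (hw : w ∈ scalarForms A H Q) :
    ∑ i, θ i ξ • T.lieQ (e i) w = T.lieQ ξ w := by
  have h := (IsLieOp.sum Finset.univ fun i => (T.isLieOp_lieQ (e i)).smul (θ i ξ)).sub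
    (T.isLieOp_lieQ ξ)
  refine sub_eq_zero.1 (h.eq_zero_of_scalar (fun x => ?_) (fun a => ?_) hw)
  · rw [sub_eq_zero]
    conv_rhs => rw [← he ξ]
    simp only [map_sum, map_smul, LinearMap.sum_apply, LinearMap.smul_apply]
  · rw [sub_eq_zero]
    simp only [extDerivation_algebraMap, Algebra.smul_def, ← map_mul, ← map_sum]
    rw [T.sum_mul_anchorQ he]

theorem lieFlat_of_mem_scalarForms (η : Q) {w : ExtForms A H Q} (hw : w ∈ scalarForms A H Q) :
    T.lieFlat he η w = T.lieQ η w := by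
  refine sub_eq_zero.1 (((T.isLieOp_lieFlat he η).sub (T.isLieOp_lieQ η)).eq_zero_of_scalar
    (fun x => sub_self _) (fun a => ?_) hw)
  rw [extDerivation_algebraMap, extDerivation_algebraMap, sub_self]

theorem brOp_scalar_scalar {a b : ExtForms A H Q} (ha : a ∈ scalarForms A H Q)
    (hb : b ∈ scalarForms A H Q) : T.brOp he a b = 0 := by
  simp only [brOp_apply, contractQ_of_mem_scalarForms _ ha, contractQ_of_mem_scalarForms _ hb,
    map_zero, zero_mul, mul_zero, sub_zero, Finset.sum_const_zero]

theorem mul_ofExt_algebraMap (a : A) (w : ExtForms A H Q) :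
    w * ofExt H (algebraMap A _ a) = a • w := by
  rw [← mul_one w, ← formMul_smul, mul_one, ← ofExt_algebraMap_mul, mul_one]

theorem brOp_scalar_ι {a : ExtForms A H Q} (ha : a ∈ scalarForms A H Q) (ξ : Q) :
    T.brOp he a (ofExt H (ExteriorAlgebra.ι A ξ)) = -T.lieQ ξ a := by
  simp only [brOp_apply, contractQ_of_mem_scalarForms _ ha, map_zero, zero_mul, zero_sub,
    contractQ_ofExt_ι, mul_ofExt_algebraMap, lieFlat_of_mem_scalarForms T he _ ha,
    Finset.sum_neg_distrib]
  rw [T.sum_smul_lieQ_of_mem_scalarForms he ξ ha]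

variable [Module.Finite A Q] [Module.Projective A Q]

/-- Both sides are derivations in `b`, so that it suffices to compare them on generators. -/
theorem brOp_ι (ξ : Q) (b : ExtForms A H Q) :
    T.brOp he (ofExt H (ExteriorAlgebra.ι A ξ)) b = T.lieQ ξ b := by
  have hg := isGradedComm_totalDegree (R := R) (A := A) (H := H) (Q := Q)
  have hG := isGeneratedBy_isFormGenerator (R := R) (A := A) (H := H) (Q := Q)
  have h := ((T.isBiderivation_brOp he).der (hG.mem (.ext ξ))).sub
    ((T.isDer_lieQ ξ).congr (sub_self 1).symm fun _ => rfl)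
  refine sub_eq_zero.1 (h.eq_zero_of_isGeneratedBy hg hG (fun i b hb => ?_) b)
  have h1 : ∀ i, parity (ofExt H (algebraMap A (ExteriorAlgebra A Q) (θ i ξ))) =
      ofExt H (algebraMap A _ (θ i ξ)) := fun i => by
    rw [parity_ofExt, AlgHom.commutes]
  cases hb with
  | scalar α =>
    have hα := ofScalarForm_mem_scalarForms (Q := Q) α
    simp only [brOp_apply, contractQ_ofExt_ι, h1, ofExt_algebraMap_mul,
      contractQ_of_mem_scalarForms _ hα, mul_zero, sub_zero]
    rw [T.sum_smul_lieQ_of_mem_scalarForms he ξ hα, sub_self]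
  | ext η =>
    have h2 : ∀ i, T.lieFlat he (e i) (ofExt H (ExteriorAlgebra.ι A ξ)) *
        ofExt H (algebraMap A _ (θ i η)) =
        θ i η • ofExt H (ExteriorAlgebra.ι A (T.flatConnection e θ (e i) ξ)) := fun i => by
      rw [lieFlat, lieOp_ofExt, extDerivation_ι, ← ofExt_mul, ← Algebra.commutes, ofExt_mul,
        ofExt_algebraMap_mul]
    simp only [brOp_apply, contractQ_ofExt_ι, h1, ofExt_algebraMap_mul, lieQ_ofExt_ι, h2]
    simp only [← ofExtₗ_apply, ← map_smul, ← map_sub, ← map_sum]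
    rw [Finset.sum_sub_distrib, T.sum_smul_brQ he, T.sum_smul_flatConnection he,
      add_sub_cancel_right, sub_self, map_zero, map_zero]

theorem isSkewBracket_brOp : IsSkewBracket (totalDegree R A H Q) fun a b => T.brOp he a b where
  der := (T.isBiderivation_brOp he).der
  skew ha hb := by
    refine (T.isBiderivation_brOp he).skew isGradedComm_totalDegree isGeneratedBy_isFormGenerator
      (σ := parity) (map_add _) parity_of_mem_totalDegree (fun i j a b ha hb => ?_) ha hb
    cases ha with
    | scalar α =>
      have hα := ofScalarForm_mem_scalarForms (Q := Q) α
      cases hb with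
      | scalar β =>
        have hβ := ofScalarForm_mem_scalarForms (Q := Q) β
        rw [T.brOp_scalar_scalar he hα hβ, T.brOp_scalar_scalar he hβ hα, smul_zero]
      | ext η =>
        rw [T.brOp_scalar_ι he hα, T.brOp_ι he, sub_self, mul_zero, Int.negOnePow_zero,
          Units.neg_smul, one_smul]
    | ext ξ =>
      rw [sub_self, zero_mul, Int.negOnePow_zero, Units.neg_smul, one_smul]
      cases hb with
      | scalar β =>
        have hβ := ofScalarForm_mem_scalarForms (Q := Q) β
        rw [T.brOp_scalar_ι he hβ, T.brOp_ι he, neg_neg]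
      | ext η =>
        rw [T.brOp_ι he, T.brOp_ι he, lieQ_ofExt_ι, lieQ_ofExt_ι, T.brQ_swap ξ η, map_neg,
          ← ofExtₗ_apply, map_neg]
        rfl

theorem isFormBracket_brOp : T.IsFormBracket (T.brOp he) where
  mem := T.brOp_mem he
  mul_left c ha hb :=
    (T.isBiderivation_brOp he).mul_left c (mem_totalDegree ha) (mem_totalDegree hb)
  skew ha hb := (T.isSkewBracket_brOp he).skew (mem_totalDegree ha) (mem_totalDegree hb)
  scalar ξ {q} α x := by
    rw [T.brOp_ι he, lieQ, lieOp_apply, ofScalarForm, toForm_apply_self, map_sub, map_sum]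
    exact congrArg₂ _ (extDerivation_algebraMap _ _ _ _) rfl
  ext ξ η := by rw [T.brOp_ι he, lieQ_ofExt_ι]

end AlmostPreLieRinehartTriple

/-! ### Uniqueness of the bracket, and the Jacobiator -/

section Generators

variable {R A H Q : Type*} [CommRing R] [CommRing A] [Algebra R A] [AddCommGroup H] [Module A H]
  [AddCommGroup Q] [Module R Q] [Module A Q] [IsScalarTower R A Q]

theorem IsFormGenerator.mem_gr {i : ℤ} {a : ExtForms A H Q} (h : IsFormGenerator A H Q i a) :
    ∃ q p : ℤ, a ∈ (formsAlgebra R A H Q).gr q p := by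
  cases h with
  | scalar α => exact ⟨_, _, ofScalarForm_mem α⟩
  | ext ξ => exact ⟨_, _, ofExt_mem (ι_mem_extPower ξ)⟩

end Generators

namespace AlmostPreLieRinehartTriple

variable {R A H Q : Type*} [CommRing R] [CommRing A] [Algebra R A]
  [AddCommGroup H] [Module R H] [Module A H] [IsScalarTower R A H]
  [AddCommGroup Q] [Module R Q] [Module A Q] [IsScalarTower R A Q]
  {T : AlmostPreLieRinehartTriple R A H Q}

attribute [local instance] formRing

section BracketUniqueness

variable {br br' : ExtForms A H Q →ₗ[R] ExtForms A H Q →ₗ[R] ExtForms A H Q}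

theorem IsFormBracket.one_left (h : T.IsFormBracket br) (c : ExtForms A H Q) : br 1 c = 0 := by
  have h1 := h.mul_left c one_mem_gr one_mem_gr
  rw [formsAlgebra_mul, formsAlgebra_mul, mul_one, one_mul, sub_self, mul_zero,
    Int.negOnePow_zero, one_smul] at h1
  exact left_eq_add.1 h1

theorem IsFormBracket.congr_left [Module.Finite A Q] [Module.Projective A Q]
    (h : T.IsFormBracket br) (h' : T.IsFormBracket br') {c : ExtForms A H Q}
    (hc : ∀ i a, IsFormGenerator A H Q i a → br a c = br' a c) (a : ExtForms A H Q) :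
    br a c = br' a c := by
  have hG := isGeneratedBy_isFormGenerator (R := R) (A := A) (H := H) (Q := Q)
  induction hG.generates a using AddSubgroup.closure_induction with
  | mem b hb =>
    have key : (∃ q p, b ∈ (formsAlgebra R A H Q).gr q p) ∧ br b c = br' b c := by
      induction hb using Submonoid.closure_induction_left with
      | one => exact ⟨⟨0, 0, one_mem_gr⟩, by rw [h.one_left, h'.one_left]⟩
      | mul_left a ha b _ hb =>
        obtain ⟨i, ha⟩ := ha
        obtain ⟨q, p, ha'⟩ := ha.mem_gr (R := R)
        obtain ⟨⟨q', p', hb'⟩, hb⟩ := hb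
        refine ⟨⟨_, _, mul_mem_gr ha' hb'⟩, ?_⟩
        rw [← formsAlgebra_mul (R := R), h.mul_left c ha' hb', h'.mul_left c ha' hb', hb,
          hc i a ha]
    exact key.2
  | zero => simp only [map_zero, LinearMap.zero_apply]
  | add a b _ _ ha hb => simp only [map_add, LinearMap.add_apply, ha, hb]
  | neg a _ ha => simp only [map_neg, LinearMap.neg_apply, ha]

theorem IsFormBracket.ext_scalar (h : T.IsFormBracket br) (h' : T.IsFormBracket br') (ξ : Q)
    {q : ℕ} (α : H [⋀^Fin q]→ₗ[A] A) :
    br (ofExt H (ExteriorAlgebra.ι A ξ)) (ofScalarForm Q α) =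
      br' (ofExt H (ExteriorAlgebra.ι A ξ)) (ofScalarForm Q α) := by
  have hξ := ofExt_mem (R := R) (H := H) (ι_mem_extPower (A := A) ξ)
  have hα := ofScalarForm_mem (R := R) (Q := Q) α
  refine forms_ext fun m v => ?_
  by_cases hm : m = q
  · subst hm
    rw [h.scalar, h'.scalar]
  · have hm' : (m : ℤ) ≠ 0 + q := by rw [zero_add]; exact_mod_cast hm
    rw [(mem_gr_iff.1 (h.mem hξ hα) m v).2 hm', (mem_gr_iff.1 (h'.mem hξ hα) m v).2 hm']

theorem IsFormBracket.unique [Module.Finite A Q] [Module.Projective A Q]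
    (h : T.IsFormBracket br) (h' : T.IsFormBracket br') : br = br' := by
  have h1 : ∀ i a j b, IsFormGenerator A H Q i a → IsFormGenerator A H Q j b →
      br a b = br' a b := by
    intro i a j b ha hb
    cases ha with
    | scalar α =>
      have hα := ofScalarForm_mem (R := R) (Q := Q) α
      cases hb with
      | scalar β =>
        have hβ := ofScalarForm_mem (R := R) (Q := Q) β
        rw [gr_eq_zero (Or.inr (by norm_num)) (h.mem hα hβ),
          gr_eq_zero (Or.inr (by norm_num)) (h'.mem hα hβ)]
      | ext η =>
        have hη := ofExt_mem (R := R) (H := H) (ι_mem_extPower (A := A) η)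
        rw [h.skew hα hη, h'.skew hα hη, h.ext_scalar h']
    | ext ξ =>
      cases hb with
      | scalar β => exact h.ext_scalar h' ξ β
      | ext η => rw [h.ext, h'.ext]
  have h2 : ∀ {q p : ℤ} {c : ExtForms A H Q}, c ∈ (formsAlgebra R A H Q).gr q p →
      ∀ a, br a c = br' a c := by
    intro q p c hc a
    refine h.congr_left h' (fun i a ha => ?_) a
    obtain ⟨q', p', ha'⟩ := ha.mem_gr (R := R)
    rw [h.skew ha' hc, h'.skew ha' hc, h.congr_left h' (fun j b hb => h1 j b i a hb ha) c]
  refine LinearMap.ext fun a => LinearMap.ext fun c => ?_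
  induction mem_closure_pureForms c using AddSubgroup.closure_induction with
  | mem c hc =>
    obtain ⟨q, p, hc⟩ := pureForms_subset_gr (R := R) hc
    exact h2 hc a
  | zero => simp only [map_zero]
  | add b c _ _ hb hc => simp only [map_add, hb, hc]
  | neg c _ hc => simp only [map_neg, hc]

end BracketUniqueness

variable (T)

variable {n : ℕ} (e : Fin n → Q) (θ : Fin n → Q →ₗ[A] A)

/-- The Jacobiator, in terms of a dual basis `e`, `θ` of `Q`: the sum over `i < j` of the composite of
the contractions with `θ j`, `θ i` and `δ (e j) (e i)`. -/
noncomputable def psiOp : ExtForms A H Q →ₗ[A] ExtForms A H Q :=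
  ∑ ij : Fin n × Fin n with ij.1 < ij.2,
    contractH (T.δ (e ij.2) (e ij.1)) ∘ₗ contractQ (θ ij.1) ∘ₗ contractQ (θ ij.2)

theorem psiOp_apply (w : ExtForms A H Q) : T.psiOp e θ w =
    ∑ ij : Fin n × Fin n with ij.1 < ij.2,
      contractH (T.δ (e ij.2) (e ij.1)) (contractQ (θ ij.1) (contractQ (θ ij.2) w)) := by
  simp only [psiOp, LinearMap.sum_apply, LinearMap.comp_apply]

theorem psiOp_mem {q p : ℤ} {w : ExtForms A H Q} (hw : w ∈ (formsAlgebra R A H Q).gr q p) :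
    T.psiOp e θ w ∈ (formsAlgebra R A H Q).gr (q - 1) (p - 2) := by
  rw [psiOp_apply]
  refine sum_mem fun ij _ => contractH_mem _ ?_
  have := contractQ_mem (θ ij.1) (contractQ_mem (θ ij.2) hw)
  rwa [sub_sub] at this

theorem psiOp_one : T.psiOp e θ 1 = 0 := by
  rw [psiOp_apply]
  refine Finset.sum_eq_zero fun ij _ => ?_
  rw [← ofExt_one, ← map_one (algebraMap A (ExteriorAlgebra A Q)), contractQ_ofExt,
    extContract_algebraMap, ← ofExtₗ_apply, map_zero, map_zero, map_zero]

theorem psiOp_mul {a : ExtForms A H Q} (b : ExtForms A H Q)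
    (ha : a ∈ (formsAlgebra R A H Q).gr 0 0) : T.psiOp e θ (a * b) = a * T.psiOp e θ b := by
  have h1 : ∀ i, contractQ (θ i) a = 0 := fun i =>
    gr_eq_zero (Or.inr (by norm_num)) (contractQ_mem (θ i) ha)
  have h2 : ∀ x, contractH x a = 0 := fun x =>
    gr_eq_zero (Or.inl (by norm_num)) (contractH_mem x ha)
  have h3 : parity a = a := by
    rw [parity_of_mem ha, sub_self, Int.negOnePow_zero, one_smul]
  simp only [psiOp_apply, contractQ_mul, contractH_mul, h1, h2, h3, zero_mul, zero_add,
    Finset.mul_sum]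

theorem psiOp_psiOp (w : ExtForms A H Q) : T.psiOp e θ (T.psiOp e θ w) = 0 := by
  simp only [psiOp_apply, map_sum]
  rw [← Finset.sum_product']
  have h : ∀ (x y : H) (i j k l : Fin n),
      contractH x (contractQ (θ i) (contractQ (θ j)
        (contractH y (contractQ (θ k) (contractQ (θ l) w))))) =
      contractH x (contractH y (contractQ (θ i) (contractQ (θ j)
        (contractQ (θ k) (contractQ (θ l) w))))) := fun x y i j k l => by
    have h1 : ∀ (η : Q →ₗ[A] A) (v : ExtForms A H Q),
        contractQ η (contractH y v) = -contractH y (contractQ η v) := fun η v => by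
      rw [contractH_contractQ, neg_neg]
    rw [h1, map_neg, h1, neg_neg]
  simp only [h]
  -- In a product of six anticommuting contractions, exchanging the two triples changes the sign.
  refine Finset.sum_involution (fun P _ => P.swap) ?_ ?_ ?_ ?_
  · rintro ⟨⟨i, j⟩, ⟨k, l⟩⟩ _
    dsimp only [Prod.swap]
    rw [contractH_comm, contractQ_comm (θ j) (θ k), map_neg, contractQ_comm (θ i) (θ k), neg_neg,
      contractQ_comm (θ j) (θ l), map_neg, map_neg, contractQ_comm (θ i) (θ l)]
    simp only [map_neg, neg_neg]
    exact neg_add_cancel _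
  · rintro ⟨⟨i, j⟩, ⟨k, l⟩⟩ _ hP h'
    obtain ⟨rfl, rfl⟩ := Prod.mk.inj (Prod.mk.inj h').1
    exact hP (contractH_self _ _)
  · rintro ⟨P, P'⟩ hP
    rw [Finset.mem_product] at hP ⊢
    exact ⟨hP.2, hP.1⟩
  · exact fun P _ => Prod.swap_swap P

/-- The Jacobiator is a sum of composites of three derivations, and so has order at most `3`. -/
theorem isDiffOp_psiOp [Module.Finite A Q] [Module.Projective A Q] :
    IsDiffOp (totalDegree R A H Q) 4 (-1) (T.psiOp e θ) := by
  have hg := isGradedComm_totalDegree (R := R) (A := A) (H := H) (Q := Q)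
  have h : ∀ ij : Fin n × Fin n, IsDiffOp (totalDegree R A H Q) 4 (-1) fun w =>
      contractH (T.δ (e ij.2) (e ij.1)) (contractQ (θ ij.1) (contractQ (θ ij.2) w)) := fun ij => by
    have h1 := ((isDer_contractQ (R := R) (H := H) (θ ij.1)).isDiffOp hg).comp (k := 1) (l := 1)
      ((isDer_contractQ (R := R) (H := H) (θ ij.2)).isDiffOp hg)
    have h2 := ((isDer_contractH (R := R) (Q := Q) (T.δ (e ij.2) (e ij.1))).isDiffOp hg).comp
      (k := 1) (l := 2) h1
    exact h2.congr (by norm_num) fun _ => rfl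
  exact (IsDiffOp.sum _ h).congr rfl fun w => T.psiOp_apply e θ w

end AlmostPreLieRinehartTriple

/-! ### The Jacobiator on decomposable forms -/

section MonomialContractions

theorem sum_prod_eq_sum_lt {M : Type*} [AddCommMonoid M] {n : ℕ} (G : Fin n × Fin n → M)
    (h : ∀ i, G (i, i) = 0) :
    ∑ P, G P = ∑ P : Fin n × Fin n with P.1 < P.2, (G P + G P.swap) := by
  rw [Finset.sum_add_distrib, Finset.sum_filter, Finset.sum_filter,
    ← (Equiv.prodComm (Fin n) (Fin n)).sum_comp fun P => if P.1 < P.2 then G P.swap else 0,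
    ← Finset.sum_add_distrib]
  refine Finset.sum_congr rfl fun P _ => ?_
  obtain ⟨i, j⟩ := P
  change _ = _ + if j < i then G (i, j) else 0
  rcases lt_trichotomy i j with hij | rfl | hij
  · rw [if_pos hij, if_neg hij.asymm, add_zero]
  · rw [if_neg (lt_irrefl i), add_zero, h]
  · rw [if_neg hij.asymm, if_pos hij, zero_add]

variable {A Q V : Type*} [CommRing A] [AddCommGroup Q] [Module A Q] [AddCommGroup V] [Module A V]
  {n : ℕ} {e : Fin n → Q} {θ : Fin n → Q →ₗ[A] A}

theorem ιMulti_succ {m : ℕ} (ξ : Fin (m + 1) → Q) : ExteriorAlgebra.ιMulti A (m + 1) ξ =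
    ExteriorAlgebra.ι A (ξ 0) * ExteriorAlgebra.ιMulti A m fun i => ξ i.succ :=
  ExteriorAlgebra.ιMulti_succ_apply ξ

theorem ιMulti_removeNth_succ {m : ℕ} (j : Fin (m + 1)) (ξ : Fin (m + 2) → Q) :
    ExteriorAlgebra.ιMulti A (m + 1) (j.succ.removeNth ξ) =
      ExteriorAlgebra.ι A (ξ 0) * ExteriorAlgebra.ιMulti A m (j.removeNth fun i => ξ i.succ) := by
  rw [ιMulti_succ]
  congr 2
  funext i
  simp only [Fin.removeNth, Fin.succ_succAbove_succ]

theorem sum_extContract_ι_mul (he : ∀ ξ, ∑ i, θ i ξ • e i = ξ)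
    (F : Q →ₗ[A] ExteriorAlgebra A Q →ₗ[A] V) (ξ : Q) (u : ExteriorAlgebra A Q) :
    ∑ k, F (e k) (extContract (θ k) (ExteriorAlgebra.ι A ξ * u)) =
      F ξ u - ∑ k, F (e k) (ExteriorAlgebra.ι A ξ * extContract (θ k) u) := by
  have h1 : F ξ u = ∑ k, θ k ξ • F (e k) u := by
    conv_lhs => rw [← he ξ]
    simp only [map_smul, map_sum, LinearMap.sum_apply, LinearMap.smul_apply]
  rw [h1]
  simp only [extContract_ι_mul, map_sub, map_smul, Finset.sum_sub_distrib]

/-- The contractions with a dual basis remove the factors of a decomposable element one at a time. -/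
theorem sum_extContract_ιMulti (he : ∀ ξ, ∑ i, θ i ξ • e i = ξ) {m : ℕ}
    (F : Q →ₗ[A] ExteriorAlgebra A Q →ₗ[A] V) (ξ : Fin (m + 1) → Q) :
    ∑ k, F (e k) (extContract (θ k) (ExteriorAlgebra.ιMulti A (m + 1) ξ)) =
      ∑ j : Fin (m + 1), (-1 : ℤˣ) ^ (j : ℕ) •
        F (ξ j) (ExteriorAlgebra.ιMulti A m (j.removeNth ξ)) := by
  induction m generalizing F with
  | zero =>
    rw [ιMulti_succ, sum_extContract_ι_mul he, Fin.sum_univ_succ,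
      Finset.univ_eq_empty (α := Fin 0), Finset.sum_empty, Finset.sum_eq_zero fun k _ => ?_,
      sub_zero, add_zero, Fin.val_zero, pow_zero, one_smul]
    · rfl
    · rw [ExteriorAlgebra.ιMulti_zero_apply, ← map_one (algebraMap A (ExteriorAlgebra A Q)),
        extContract_algebraMap, mul_zero, map_zero]
  | succ m ih =>
    have h := ih (F.compl₂ (LinearMap.mulLeft A (ExteriorAlgebra.ι A (ξ 0)))) fun i => ξ i.succ
    simp only [LinearMap.compl₂_apply, LinearMap.mulLeft_apply] at h
    rw [ιMulti_succ, sum_extContract_ι_mul he, h, Fin.sum_univ_succ (n := m + 1), sub_eq_add_neg,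
      ← Finset.sum_neg_distrib]
    congr 1
    · rw [Fin.val_zero, pow_zero, one_smul]
      rfl
    · refine Finset.sum_congr rfl fun j _ => ?_
      rw [ιMulti_removeNth_succ, Fin.val_succ, pow_succ, mul_neg_one, Units.neg_smul]

theorem sum_lt_extContract_ι_mul {H : Type*} [AddCommGroup H] [Module A H]
    (he : ∀ ξ, ∑ i, θ i ξ • e i = ξ) (δ : Q →ₗ[A] Q →ₗ[A] H)
    (hδ : ∀ ξ, δ ξ ξ = 0) (B : H →ₗ[A] ExteriorAlgebra A Q →ₗ[A] V) (ξ : Q)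
    (u : ExteriorAlgebra A Q) :
    ∑ ij : Fin n × Fin n with ij.1 < ij.2, B (δ (e ij.1) (e ij.2))
        (extContract (θ ij.1) (extContract (θ ij.2) (ExteriorAlgebra.ι A ξ * u))) =
      ∑ ij : Fin n × Fin n with ij.1 < ij.2, B (δ (e ij.1) (e ij.2))
          (ExteriorAlgebra.ι A ξ * extContract (θ ij.1) (extContract (θ ij.2) u))
        - ∑ k, B (δ ξ (e k)) (extContract (θ k) u) := by
  have hswap : ∀ η ζ, δ η ζ = -δ ζ η := fun η ζ => by
    have := hδ (η + ζ)
    simp only [map_add, LinearMap.add_apply, hδ, zero_add, add_zero] at this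
    exact eq_neg_of_add_eq_zero_right this
  have h1 : ∑ k, B (δ ξ (e k)) (extContract (θ k) u) =
      ∑ P : Fin n × Fin n, θ P.1 ξ • B (δ (e P.1) (e P.2)) (extContract (θ P.2) u) := by
    rw [Fintype.sum_prod_type, Finset.sum_comm]
    refine Finset.sum_congr rfl fun k _ => ?_
    conv_lhs => rw [← he ξ]
    simp only [map_sum, map_smul, LinearMap.sum_apply, LinearMap.smul_apply]
  rw [h1, sum_prod_eq_sum_lt _ fun i => by rw [hδ, map_zero, LinearMap.zero_apply, smul_zero],
    ← Finset.sum_sub_distrib]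
  refine Finset.sum_congr rfl fun ij _ => ?_
  simp only [extContract_ι_mul, map_sub, map_smul, Prod.fst_swap, Prod.snd_swap]
  rw [hswap (e ij.2) (e ij.1), map_neg, LinearMap.neg_apply, smul_neg]
  abel

theorem sum_pairs_succ {M : Type*} [AddCommMonoid M] {p : ℕ} (G : Fin (p + 1) × Fin (p + 2) → M) :
    ∑ jk : Fin (p + 1) × Fin (p + 2) with jk.1.castSucc < jk.2, G jk =
      ∑ k : Fin (p + 1), G (0, k.succ)
        + ∑ j : Fin p, ∑ k : Fin (p + 1), if j.castSucc < k then G (j.succ, k.succ) else 0 := by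
  rw [Finset.sum_filter, Fintype.sum_prod_type, Fin.sum_univ_succ]
  dsimp only
  congr 1
  · rw [Fin.sum_univ_succ, if_neg (by simp), zero_add]
    exact Finset.sum_congr rfl fun k _ => if_pos (Fin.succ_pos k)
  · refine Finset.sum_congr rfl fun j _ => ?_
    rw [Fin.sum_univ_succ, if_neg (by simp), zero_add]
    refine Finset.sum_congr rfl fun k _ => ?_
    rw [← Fin.succ_castSucc]
    simp only [Fin.succ_lt_succ_iff]

/-- The induction step of `sum_lt_extContract_ιMulti`: the pairs of factors that contain the first one
are given by `sum_extContract_ιMulti`. -/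
theorem sum_lt_extContract_ιMulti_of_tail {H : Type*} [AddCommGroup H] [Module A H]
    (he : ∀ ξ, ∑ i, θ i ξ • e i = ξ) (δ : Q →ₗ[A] Q →ₗ[A] H)
    (hδ : ∀ ξ, δ ξ ξ = 0) {p : ℕ} (B : H →ₗ[A] ExteriorAlgebra A Q →ₗ[A] V) (ξ : Fin (p + 2) → Q)
    (htail : ∑ ij : Fin n × Fin n with ij.1 < ij.2, B (δ (e ij.1) (e ij.2))
        (ExteriorAlgebra.ι A (ξ 0) * extContract (θ ij.1) (extContract (θ ij.2)
          (ExteriorAlgebra.ιMulti A (p + 1) fun i => ξ i.succ))) =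
      ∑ j : Fin p, ∑ k : Fin (p + 1), if j.castSucc < k then
        (-1 : ℤˣ) ^ ((j.succ : ℕ) + (k.succ : ℕ)) • B (δ (ξ j.succ.castSucc) (ξ k.succ))
          (ExteriorAlgebra.ιMulti A p fun i => ξ (k.succ.succAbove (j.succ.succAbove i))) else 0) :
    ∑ ij : Fin n × Fin n with ij.1 < ij.2, B (δ (e ij.1) (e ij.2))
        (extContract (θ ij.1) (extContract (θ ij.2) (ExteriorAlgebra.ιMulti A (p + 2) ξ))) =
      ∑ jk : Fin (p + 1) × Fin (p + 2) with jk.1.castSucc < jk.2,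
        (-1 : ℤˣ) ^ ((jk.1 : ℕ) + (jk.2 : ℕ)) • B (δ (ξ jk.1.castSucc) (ξ jk.2))
          (ExteriorAlgebra.ιMulti A p fun i => ξ (jk.2.succAbove (jk.1.succAbove i))) := by
  have h1 := sum_extContract_ιMulti he (B ∘ₗ δ (ξ 0)) fun i : Fin (p + 1) => ξ i.succ
  simp only [LinearMap.comp_apply] at h1
  have h2 : ∀ k : Fin (p + 1), (-1 : ℤˣ) ^ (((0 : Fin (p + 1)) : ℕ) + (k.succ : ℕ)) •
      B (δ (ξ (Fin.castSucc (0 : Fin (p + 1)))) (ξ k.succ)) (ExteriorAlgebra.ιMulti A p fun i =>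
        ξ (k.succ.succAbove ((0 : Fin (p + 1)).succAbove i))) =
      -((-1 : ℤˣ) ^ (k : ℕ) • B (δ (ξ 0) (ξ k.succ))
        (ExteriorAlgebra.ιMulti A p (k.removeNth fun i => ξ i.succ))) := fun k => by
    rw [Fin.val_zero, zero_add, Fin.val_succ, pow_succ, mul_neg_one, Units.neg_smul]
    simp only [Fin.zero_succAbove, Fin.succ_succAbove_succ, Fin.castSucc_zero]
    rfl
  rw [sum_pairs_succ, Finset.sum_congr rfl fun k _ => h2 k, Finset.sum_neg_distrib, ← h1,
    ιMulti_succ, sum_lt_extContract_ι_mul he δ hδ, sub_eq_add_neg, add_comm]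
  rw [htail]

/-- The double contractions with a dual basis remove the factors of a decomposable element two at a
time. -/
theorem sum_lt_extContract_ιMulti {H : Type*} [AddCommGroup H] [Module A H]
    (he : ∀ ξ, ∑ i, θ i ξ • e i = ξ) (δ : Q →ₗ[A] Q →ₗ[A] H)
    (hδ : ∀ ξ, δ ξ ξ = 0) {p : ℕ} (B : H →ₗ[A] ExteriorAlgebra A Q →ₗ[A] V) (ξ : Fin (p + 2) → Q) :
    ∑ ij : Fin n × Fin n with ij.1 < ij.2, B (δ (e ij.1) (e ij.2))
        (extContract (θ ij.1) (extContract (θ ij.2) (ExteriorAlgebra.ιMulti A (p + 2) ξ))) =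
      ∑ jk : Fin (p + 1) × Fin (p + 2) with jk.1.castSucc < jk.2,
        (-1 : ℤˣ) ^ ((jk.1 : ℕ) + (jk.2 : ℕ)) • B (δ (ξ jk.1.castSucc) (ξ jk.2))
          (ExteriorAlgebra.ιMulti A p fun i => ξ (jk.2.succAbove (jk.1.succAbove i))) := by
  induction p generalizing B with
  | zero =>
    refine sum_lt_extContract_ιMulti_of_tail he δ hδ B ξ ?_
    rw [Finset.univ_eq_empty (α := Fin 0), Finset.sum_empty]
    refine Finset.sum_eq_zero fun ij _ => ?_
    rw [ιMulti_succ, ExteriorAlgebra.ιMulti_zero_apply, mul_one, extContract_ι,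
      extContract_algebraMap, mul_zero, map_zero]
  | succ p ih =>
    refine sum_lt_extContract_ιMulti_of_tail he δ hδ B ξ ?_
    have h := ih (B.compl₂ (LinearMap.mulLeft A (ExteriorAlgebra.ι A (ξ 0)))) fun i => ξ i.succ
    simp only [LinearMap.compl₂_apply, LinearMap.mulLeft_apply] at h
    rw [h, Finset.sum_filter, Fintype.sum_prod_type]
    refine Finset.sum_congr rfl fun j _ => Finset.sum_congr rfl fun k _ => if_congr Iff.rfl ?_ rfl
    have h2 : ((-1 : ℤˣ) ^ ((j.succ : ℕ) + (k.succ : ℕ))) = (-1) ^ ((j : ℕ) + (k : ℕ)) := by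
      rw [Fin.val_succ, Fin.val_succ, add_add_add_comm, pow_add, one_add_one_eq_two, neg_one_sq,
        mul_one]
    have h3 : (ExteriorAlgebra.ιMulti A (p + 1) fun i => ξ (k.succ.succAbove (j.succ.succAbove i))) =
        ExteriorAlgebra.ι A (ξ 0) *
          ExteriorAlgebra.ιMulti A p fun i => ξ (k.succAbove (j.succAbove i)).succ := by
      rw [ιMulti_succ]
      simp only [Fin.succ_succAbove_succ, Fin.succ_succAbove_zero]
    rw [h2, h3, ← Fin.succ_castSucc]

end MonomialContractions

namespace AlmostPreLieRinehartTriple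

variable {R A H Q : Type*} [CommRing R] [CommRing A] [Algebra R A]
  [AddCommGroup H] [Module R H] [Module A H] [IsScalarTower R A H]
  [AddCommGroup Q] [Module R Q] [Module A Q] [IsScalarTower R A Q]
  (T : AlmostPreLieRinehartTriple R A H Q)

attribute [local instance] formRing

theorem parity_ofScalarForm {q : ℕ} (β : H [⋀^Fin q]→ₗ[A] A) :
    parity (ofScalarForm Q β) = (-1 : ℤˣ) ^ q • ofScalarForm Q β := by
  rw [parity_of_mem (R := A) (ofScalarForm_mem β), zero_sub, Int.negOnePow_neg]
  rfl

theorem ofScalarForm_contractLast {q : ℕ} (y : H) (β : H [⋀^Fin (q + 1)]→ₗ[A] A) :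
    ofScalarForm Q (contractLast y β) = -contractH y (ofScalarForm Q β) := by
  have h : ∀ u : ℤˣ, ofScalarForm Q (u • β.curryLeft y) = u • insertFirst y (ofScalarForm Q β) := by
    intro u
    rw [ofScalarForm, ofScalarForm, insertFirst_toForm_succ]
    rcases Int.units_eq_one_or u with rfl | rfl
    · rw [one_smul, one_smul]
      rfl
    · rw [Units.neg_smul, one_smul, Units.neg_smul, one_smul, ← toForm_neg]
      congr 1
      ext v
      simp
  rw [contractLast, h, contractH_apply, parity_ofScalarForm, pow_succ, mul_neg_one, Units.neg_smul,
    map_neg, neg_neg]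
  rcases Int.units_eq_one_or ((-1 : ℤˣ) ^ q) with h | h
  · rw [h, one_smul, one_smul]
  · rw [h, Units.neg_smul, one_smul, Units.neg_smul, one_smul, map_neg]

variable {n : ℕ} {e : Fin n → Q} {θ : Fin n → Q →ₗ[A] A} (he : ∀ ξ, ∑ i, θ i ξ • e i = ξ)

theorem isJacobiator_psiOp (he : ∀ ξ, ∑ i, θ i ξ • e i = ξ) :
    T.IsJacobiator ((T.psiOp e θ).restrictScalars R) where
  mem := T.psiOp_mem e θ
  apply_eq {q p} β ξ := by
    let B : H →ₗ[A] ExteriorAlgebra A Q →ₗ[A] ExtForms A H Q := LinearMap.mk₂ A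
      (fun y u => contractH y (ofScalarForm Q β) * ofExt H u)
      (fun y z u => by rw [contractH_add, add_mul])
      (fun a y u => by rw [contractH_smul, smul_formMul])
      (fun y u v => by rw [← ofExtₗ_apply, map_add, mul_add]; rfl)
      (fun a y u => by rw [← ofExtₗ_apply, map_smul, formMul_smul]; rfl)
    have hβ := ofScalarForm_mem_scalarForms (Q := Q) β
    have h1 : ∀ η, contractQ η (ofScalarForm Q β) = 0 := fun η =>
      contractQ_of_mem_scalarForms η (ofScalarForm_mem_scalarForms β)
    have h2 : ∀ (y : H) (η ζ : Q →ₗ[A] A) (u : ExteriorAlgebra A Q),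
        contractH y (contractQ η (contractQ ζ (ofScalarForm Q β * ofExt H u))) =
          B y (extContract η (extContract ζ u)) := fun y η ζ u => by
      have h3 : contractQ η (parity (ofScalarForm Q β)) = 0 := by
        rw [← neg_neg (contractQ η _), ← parity_contractQ, h1, map_zero, neg_zero]
      rw [contractQ_mul, h1, zero_mul, zero_add, contractQ_mul, h3, zero_mul, zero_add,
        parity_parity, contractH_mul, contractQ_ofExt, contractQ_ofExt, contractH_ofExt, mul_zero,
        add_zero]
      rfl
    change T.psiOp e θ (ofScalarForm Q β * _) = _
    rw [psiOp_apply]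
    simp only [h2, formsAlgebra_mul, ofScalarForm_contractLast, neg_mul, smul_neg]
    rw [Finset.sum_neg_distrib]
    refine Eq.trans ?_ (congrArg Neg.neg (sum_lt_extContract_ιMulti he T.δ T.δ_self B ξ))
    rw [← Finset.sum_neg_distrib]
    refine Finset.sum_congr rfl fun ij _ => ?_
    rw [T.δ_swap, map_neg, LinearMap.neg_apply]

theorem IsJacobiator.unique [Module.Finite A Q] [Module.Projective A Q]
    {T : AlmostPreLieRinehartTriple R A H Q} {Ψ Ψ' : ExtForms A H Q →ₗ[R] ExtForms A H Q}
    (h : T.IsJacobiator Ψ) (h' : T.IsJacobiator Ψ') : Ψ = Ψ' := by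
  refine LinearMap.ext fun w => ?_
  induction mem_closure_pureForms w using AddSubgroup.closure_induction with
  | mem w hw =>
    obtain ⟨p, ξ, q, β, rfl⟩ := hw
    have hξ := ofExt_mem (R := R) (H := H) (ιMulti_mem_extPower (A := A) ξ)
    have hβ := ofScalarForm_mem (R := R) (Q := Q) β
    rw [mul_comm_gr hξ hβ]
    have key : Ψ (ofScalarForm Q β * ofExt H (ExteriorAlgebra.ιMulti A p ξ)) =
        Ψ' (ofScalarForm Q β * ofExt H (ExteriorAlgebra.ιMulti A p ξ)) := by
      have hw := mul_mem_gr hβ hξ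
      by_cases hq : q = 0 ∨ p < 2
      · have : (q : ℤ) + 0 - 1 < 0 ∨ (0 : ℤ) + p - 2 < 0 := by omega
        rw [gr_eq_zero this (h.mem hw), gr_eq_zero this (h'.mem hw)]
      · obtain ⟨q, rfl⟩ : ∃ k, q = k + 1 := ⟨q - 1, by omega⟩
        obtain ⟨p, rfl⟩ : ∃ k, p = k + 2 := ⟨p - 2, by omega⟩
        exact (h.apply_eq β ξ).trans (h'.apply_eq β ξ).symm
    generalize (((p : ℤ) - 0) * (0 - (q : ℤ))).negOnePow = u
    rcases Int.units_eq_one_or u with rfl | rfl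
    · rw [one_smul, key]
    · rw [Units.neg_smul, one_smul, map_neg, map_neg, key]
  | zero => rw [map_zero, map_zero]
  | add w w' _ _ hw hw' => rw [map_add, map_add, hw, hw']
  | neg w _ hw => rw [map_neg, map_neg, hw]

end AlmostPreLieRinehartTriple

/-! ### Koszul's form of the Jacobiator -/

section BidegreeOfKoszulForms

variable {R A H Q : Type*} [CommRing R] [CommRing A] [Algebra R A] [AddCommGroup H] [Module A H]
  [AddCommGroup Q] [Module R Q] [Module A Q] [IsScalarTower R A Q]

attribute [local instance] formRing

theorem koszulForm₃_formsAlgebra (D : ExtForms A H Q →ₗ[R] ExtForms A H Q) (i j k : ℤ)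
    (x y z : ExtForms A H Q) :
    (formsAlgebra R A H Q).koszulForm₃ D i j k x y z = koszulThree D i j k x y z :=
  rfl

theorem koszulThree_mem_gr {D : ExtForms A H Q → ExtForms A H Q} {s t : ℤ}
    (hD : ∀ {q p : ℤ} {a : ExtForms A H Q}, a ∈ (formsAlgebra R A H Q).gr q p →
      D a ∈ (formsAlgebra R A H Q).gr (q + s) (p + t)) {q₁ p₁ q₂ p₂ q₃ p₃ q p : ℤ}
    {x y z : ExtForms A H Q} (hx : x ∈ (formsAlgebra R A H Q).gr q₁ p₁)
    (hy : y ∈ (formsAlgebra R A H Q).gr q₂ p₂) (hz : z ∈ (formsAlgebra R A H Q).gr q₃ p₃)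
    (i j k : ℤ) (hq : q₁ + q₂ + q₃ + s = q) (hp : p₁ + p₂ + p₃ + t = p) :
    koszulThree D i j k x y z ∈ (formsAlgebra R A H Q).gr q p := by
  have cast : ∀ {q' p' : ℤ} {a : ExtForms A H Q}, a ∈ (formsAlgebra R A H Q).gr q' p' → q' = q →
      p' = p → a ∈ (formsAlgebra R A H Q).gr q p := by
    rintro q' p' a ha rfl rfl
    exact ha
  have h1 := hD (one_mem_gr (R := R) (A := A) (H := H) (Q := Q))
  unfold koszulThree
  refine sub_mem (add_mem (add_mem (add_mem (sub_mem (sub_mem (sub_mem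
    (cast (hD (mul_mem_gr (mul_mem_gr hx hy) hz)) ?_ ?_)
    (cast (mul_mem_gr (hD (mul_mem_gr hx hy)) hz) ?_ ?_))
    (units_smul_mem (cast (mul_mem_gr (hD (mul_mem_gr hy hz)) hx) ?_ ?_) _))
    (units_smul_mem (cast (mul_mem_gr (hD (mul_mem_gr hz hx)) hy) ?_ ?_) _))
    (cast (mul_mem_gr (mul_mem_gr (hD hx) hy) hz) ?_ ?_))
    (units_smul_mem (cast (mul_mem_gr (mul_mem_gr (hD hy) hz) hx) ?_ ?_) _))
    (units_smul_mem (cast (mul_mem_gr (mul_mem_gr (hD hz) hx) hy) ?_ ?_) _))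
    (cast (mul_mem_gr (mul_mem_gr (mul_mem_gr h1 hx) hy) hz) ?_ ?_) <;> linarith

theorem ext_ι_mem (ξ : Q) :
    ofExt H (ExteriorAlgebra.ι A ξ) ∈ (formsAlgebra R A H Q).gr 0 1 :=
  ofExt_mem (ι_mem_extPower ξ)

theorem ext_ι_mem_totalDegree (ξ : Q) :
    ofExt H (ExteriorAlgebra.ι A ξ) ∈ totalDegree R A H Q 1 := by
  have := mem_totalDegree (ext_ι_mem (R := R) (A := A) (H := H) ξ)
  rwa [sub_zero] at this

theorem ofScalarForm_mem_totalDegree {q : ℕ} (α : H [⋀^Fin q]→ₗ[A] A) :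
    ofScalarForm Q α ∈ totalDegree R A H Q (-q) := by
  have := mem_totalDegree (ofScalarForm_mem (R := R) (Q := Q) α)
  rwa [zero_sub] at this

end BidegreeOfKoszulForms

section JacobiatorOnGenerators

open AlmostPreLieRinehartTriple

variable {R A H Q : Type*} [CommRing R] [CommRing A] [Algebra R A]
  [AddCommGroup H] [Module R H] [Module A H] [IsScalarTower R A H]
  [AddCommGroup Q] [Module R Q] [Module A Q] [IsScalarTower R A Q]
  (T : AlmostPreLieRinehartTriple R A H Q)
  {n : ℕ} {e : Fin n → Q} {θ : Fin n → Q →ₗ[A] A}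

attribute [local instance] formRing

theorem koszulThree_psiOp_mem {q₁ p₁ q₂ p₂ q₃ p₃ : ℤ}
    {x y z : ExtForms A H Q} (hx : x ∈ (formsAlgebra R A H Q).gr q₁ p₁)
    (hy : y ∈ (formsAlgebra R A H Q).gr q₂ p₂) (hz : z ∈ (formsAlgebra R A H Q).gr q₃ p₃)
    (i j k : ℤ) : koszulThree (T.psiOp e θ) i j k x y z ∈
      (formsAlgebra R A H Q).gr (q₁ + q₂ + q₃ - 1) (p₁ + p₂ + p₃ - 2) :=
  koszulThree_mem_gr (s := -1) (t := -2) (T.psiOp_mem e θ) hx hy hz i j k rfl rfl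

theorem ofExt_ιMulti_two (ξ η : Q) :
    ofExt H (ExteriorAlgebra.ιMulti A 2 ![ξ, η]) =
      ofExt H (ExteriorAlgebra.ι A ξ) * ofExt H (ExteriorAlgebra.ι A η) := by
  rw [← ofExt_mul, ExteriorAlgebra.ιMulti_apply]
  simp

theorem psiOp_ofScalarForm_mul (he : ∀ ξ, ∑ i, θ i ξ • e i = ξ) {q : ℕ}
    (α : H [⋀^Fin q]→ₗ[A] A) (ξ η : Q) :
    T.psiOp e θ (ofScalarForm Q α *
      (ofExt H (ExteriorAlgebra.ι A ξ) * ofExt H (ExteriorAlgebra.ι A η))) =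
      contractH (T.δ ξ η) (ofScalarForm Q α) := by
  have hα := ofScalarForm_mem (R := R) (Q := Q) α
  cases q with
  | zero =>
    rw [gr_eq_zero (Or.inl (by norm_num)) (contractH_mem (R := R) (T.δ ξ η) hα)]
    exact gr_eq_zero (Or.inl (by norm_num))
      (T.psiOp_mem e θ (mul_mem_gr hα (mul_mem_gr (ext_ι_mem ξ) (ext_ι_mem η))))
  | succ q =>
    have h := (T.isJacobiator_psiOp he).apply_eq (p := 0) α ![ξ, η]
    rw [Finset.sum_filter, Fintype.sum_prod_type, Fin.sum_univ_one, Fin.sum_univ_two] at h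
    simp only [formsAlgebra_mul, LinearMap.coe_restrictScalars] at h
    change T.psiOp e θ (_ * ofExt H (ExteriorAlgebra.ιMulti A 2 _)) = _ at h
    rw [ofExt_ιMulti_two] at h
    rw [h]
    simp [ofScalarForm_contractLast, ofExt_one]

variable [Module.Finite A Q] [Module.Projective A Q]

/-- The form `Φ³` of the Jacobiator is, in the presence of two elements of `Q`, the contraction with
the value of `δ` on them. -/
theorem koszulThree_psiOp_ι_ι (he : ∀ ξ, ∑ i, θ i ξ • e i = ξ) (ξ η : Q) {k : ℤ}
    {z : ExtForms A H Q} (hz : z ∈ totalDegree R A H Q k) :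
    koszulThree (T.psiOp e θ) 1 1 k (ofExt H (ExteriorAlgebra.ι A ξ))
      (ofExt H (ExteriorAlgebra.ι A η)) z = contractH (T.δ ξ η) z := by
  have h := isGradedComm_totalDegree (R := R) (A := A) (H := H) (Q := Q)
  have hG := isGeneratedBy_isFormGenerator (R := R) (A := A) (H := H) (Q := Q)
  have hΨ := T.isDiffOp_psiOp e θ
  have hξ := ext_ι_mem (R := R) (A := A) (H := H) ξ
  have hη := ext_ι_mem (R := R) (A := A) (H := H) η
  have hξ' := ext_ι_mem_totalDegree (R := R) (A := A) (H := H) ξ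
  have hη' := ext_ι_mem_totalDegree (R := R) (A := A) (H := H) η
  rw [koszulThree_eq_koszulOp h hΨ hξ' hη' hz (T.psiOp_one e θ)]
  refine sub_eq_zero.1 (((hΨ.koszulOp h hξ' hη').congr (by norm_num) fun _ => rfl).sub
    (isDer_contractH (T.δ ξ η)) |>.eq_zero_of_isGeneratedBy h hG (fun i a ha => ?_) z)
  rw [sub_eq_zero, ← koszulThree_eq_koszulOp h hΨ hξ' hη' (hG.mem ha) (T.psiOp_one e θ)]
  cases ha with
  | @scalar q α =>
    have hα := ofScalarForm_mem (R := R) (Q := Q) α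
    have hα' := ofScalarForm_mem_totalDegree (R := R) (Q := Q) α
    rw [koszulThree, h.mul_comm (h.mul_mem hξ' hη') hα', hΨ.map_units_smul,
      psiOp_ofScalarForm_mul T he, T.psiOp_one,
      gr_eq_zero (Or.inl (by norm_num)) (T.psiOp_mem e θ (mul_mem_gr hξ hη)),
      gr_eq_zero (Or.inr (by norm_num)) (T.psiOp_mem e θ (mul_mem_gr hη hα)),
      gr_eq_zero (Or.inr (by norm_num)) (T.psiOp_mem e θ (mul_mem_gr hα hξ)),
      gr_eq_zero (Or.inr (by norm_num)) (T.psiOp_mem e θ hξ),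
      gr_eq_zero (Or.inr (by norm_num)) (T.psiOp_mem e θ hη),
      gr_eq_zero (Or.inr (by norm_num)) (T.psiOp_mem e θ hα)]
    have h1 : (((1 : ℤ) + 1) * -(q : ℤ)).negOnePow = 1 := Int.negOnePow_even _ ⟨-q, by ring⟩
    rw [h1, one_smul]
    simp
  | ext ζ =>
    rw [contractH_ofExt]
    exact gr_eq_zero (Or.inl (by norm_num))
      (koszulThree_psiOp_mem T (R := R) hξ hη (ext_ι_mem ζ) _ _ _)

end JacobiatorOnGenerators

/-! ### The differential and the bracket -/

section ScalarForms

variable {R A H Q : Type*} [CommRing R] [CommRing A] [Algebra R A] [AddCommGroup H] [Module A H]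
  [AddCommGroup Q] [Module R Q] [Module A Q] [IsScalarTower R A Q]

theorem mem_scalarForms_of_mem {q : ℤ} {w : ExtForms A H Q}
    (hw : w ∈ (formsAlgebra R A H Q).gr q 0) : w ∈ scalarForms A H Q := fun m v => by
  have h : w m v ∈ (1 : Submodule A (ExteriorAlgebra A Q)) := (mem_gr_iff.1 hw m v).1
  exact Submodule.mem_one.1 h

theorem parity_mem_scalarForms {w : ExtForms A H Q} (hw : w ∈ scalarForms A H Q) :
    parity w ∈ scalarForms A H Q := fun m v => by
  obtain ⟨a, ha⟩ := hw m v
  refine ⟨(-1 : ℤˣ) ^ m • a, ?_⟩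
  rw [parity_apply, ← ha, AlgHom.commutes]
  rcases neg_one_pow_eq_or ℤˣ m with h | h <;> rw [h] <;> simp [Units.neg_smul]

attribute [local instance] formRing

/-- The product of a `1`-form `φ` and the contraction with `y` is the Lie operator of the endomorphism
`x ↦ φ x • y` of `H`, which allows it to be compared with commutators of Lie derivatives. -/
theorem isLieOp_mul_contractH {φ : ExtForms A H Q} {f : H → A} (h₀ : constTerm φ = 0)
    (h₁ : ∀ x, insertFirst x φ = ofExt H (algebraMap A _ (f x))) (y : H) :
    IsLieOp (fun x => f x • y) (fun _ => 0) fun w => φ * contractH y w where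
  map_add w w' := by rw [map_add, mul_add]
  insert x w := by
    simp only [insertFirst_mul, h₁, AlmostPreLieRinehartTriple.ofExt_algebraMap_mul,
      contractH_apply, insertFirst_comm x y, insertFirst_parity, map_neg, parity_parity,
      insertFirst_smul, smul_neg, neg_neg]
    abel
  const w := by rw [constTerm_mul, h₀, zero_mul]

end ScalarForms

namespace AlmostPreLieRinehartTriple

variable {R A H Q : Type*} [CommRing R] [CommRing A] [Algebra R A]
  [AddCommGroup H] [Module R H] [Module A H] [IsScalarTower R A H]
  [AddCommGroup Q] [Module R Q] [Module A Q] [IsScalarTower R A Q]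
  (T : AlmostPreLieRinehartTriple R A H Q)
  {n : ℕ} {e : Fin n → Q} {θ : Fin n → Q →ₗ[A] A} (he : ∀ ξ, ∑ i, θ i ξ • e i = ξ)

attribute [local instance] formRing

theorem lieQ_parity (ξ : Q) (w : ExtForms A H Q) : T.lieQ ξ (parity w) = parity (T.lieQ ξ w) :=
  lieOp_parity _ _ _ _ _ w

theorem insertFirst_lieQ (ξ : Q) (y : H) (w : ExtForms A H Q) :
    insertFirst y (T.lieQ ξ w) = T.lieQ ξ (insertFirst y w) - insertFirst (T.actQH ξ y) w :=
  (T.isLieOp_lieQ ξ).insert y w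

theorem insertFirst_dOp_ι (x : H) (ξ : Q) :
    insertFirst x (T.dOp (ofExt H (ExteriorAlgebra.ι A ξ))) =
      ofExt H (ExteriorAlgebra.ι A (T.actHQ x ξ)) := by
  rw [insertFirst_dOp, insertFirst_ofExt, map_zero, parity_ofExt_ι, map_neg, T.lieH_ofExt_ι,
    sub_neg_eq_add, zero_add]

theorem insertFirst_contractQ_dOp_ι (ϑ : Q →ₗ[A] A) (x : H) (ξ : Q) :
    insertFirst x (contractQ ϑ (T.dOp (ofExt H (ExteriorAlgebra.ι A ξ)))) =
      ofExt H (algebraMap A _ (ϑ (T.actHQ x ξ))) := by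
  rw [insertFirst_contractQ, insertFirst_dOp_ι, contractQ_ofExt_ι]

theorem constTerm_contractQ_dOp (ϑ : Q →ₗ[A] A) (w : ExtForms A H Q) :
    constTerm (contractQ ϑ (T.dOp w)) = 0 := by
  rw [constTerm_contractQ, constTerm_dOp, map_zero]

theorem parity_contractQ_dOp_ι (ϑ : Q →ₗ[A] A) (ξ : Q) :
    parity (contractQ ϑ (T.dOp (ofExt H (ExteriorAlgebra.ι A ξ)))) =
      -contractQ ϑ (T.dOp (ofExt H (ExteriorAlgebra.ι A ξ))) := by
  rw [parity_contractQ, parity_dOp, parity_ofExt_ι]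
  simp only [map_neg, neg_neg]

theorem brOp_of_mem_scalarForms (a : ExtForms A H Q) {b : ExtForms A H Q}
    (hb : b ∈ scalarForms A H Q) : T.brOp he a b =
      ∑ i, parity (contractQ (θ i) a) * T.lieQ (e i) b := by
  simp only [brOp_apply, contractQ_of_mem_scalarForms _ hb, mul_zero, sub_zero]

end AlmostPreLieRinehartTriple

namespace LieRinehartTriple

open AlmostPreLieRinehartTriple

variable {R A H Q : Type*} [CommRing R] [CommRing A] [Algebra R A]
  [AddCommGroup H] [Module R H] [Module A H] [IsScalarTower R A H]
  [AddCommGroup Q] [Module R Q] [Module A Q] [IsScalarTower R A Q]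
  (T : LieRinehartTriple R A H Q)
  {n : ℕ} {e : Fin n → Q} {θ : Fin n → Q →ₗ[A] A} (he : ∀ ξ, ∑ i, θ i ξ • e i = ξ)

attribute [local instance] formRing

/-- The operators `𝓛_x` and `L_ξ` on `A`-valued forms satisfy the mixed commutation relation of the
triple; the sum is the Lie operator of the endomorphism `y ↦ (y · ξ) · x` of `H`. -/
theorem lieH_lieQ_of_mem_scalarForms (he : ∀ ξ, ∑ i, θ i ξ • e i = ξ) (x : H) (ξ : Q)
    {w : ExtForms A H Q} (hw : w ∈ scalarForms A H Q) :
    T.lieH x (T.lieQ ξ w) - T.lieQ ξ (T.lieH x w) + T.lieH (T.actQH ξ x) w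
      - T.lieQ (T.actHQ x ξ) w
      + ∑ i, contractQ (θ i) (T.dOp (ofExt H (ExteriorAlgebra.ι A ξ))) *
          contractH (T.actQH (e i) x) w = 0 := by
  have h := ((((T.isLieOp_lieH x).comm (T.isLieOp_lieQ ξ)).add
    (T.isLieOp_lieH (T.actQH ξ x))).sub (T.isLieOp_lieQ (T.actHQ x ξ))).add
    (IsLieOp.sum Finset.univ fun i => isLieOp_mul_contractH
      (T.constTerm_contractQ_dOp (θ i) _) (fun y => T.insertFirst_contractQ_dOp_ι (θ i) y ξ)
      (T.actQH (e i) x))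
  refine h.eq_zero_of_scalar (fun y => ?_) (fun a => ?_) hw
  · have h1 : ∑ i, θ i (T.actHQ y ξ) • T.actQH (e i) x = T.actQH (T.actHQ y ξ) x := by
      conv_rhs => rw [← he (T.actHQ y ξ)]
      simp only [map_sum, map_smul, LinearMap.sum_apply, LinearMap.smul_apply]
    rw [h1, T.actQH_brH ξ x y, T.brH_swap (T.actQH ξ x) y]
    abel
  · simp only [actExt, extDerivation_algebraMap, T.anchorQ_actHQ, Finset.sum_const_zero, map_add,
      map_sub]
    abel

/-- The differential is compatible with the bracket of an element of `Q` and an `A`-valued form: on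
contractions this is the formula `actQH_brH` for the action of `Q` on brackets in `H`. -/
theorem dOp_lieQ_of_mem_scalarForms (he : ∀ ξ, ∑ i, θ i ξ • e i = ξ) (ξ : Q)
    {w : ExtForms A H Q} (hw : w ∈ scalarForms A H Q) :
    T.dOp (T.lieQ ξ w) - T.lieQ ξ (T.dOp w) =
      T.brOp he (T.dOp (ofExt H (ExteriorAlgebra.ι A ξ))) w := by
  rw [T.brOp_of_mem_scalarForms he _ hw]
  simp only [T.parity_contractQ_dOp_ι, neg_mul]
  refine sub_eq_zero.1 (eq_zero_of_insertFirst_mem (ι := scalarForms A H Q)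
    (fun w => T.dOp (T.lieQ ξ w) - T.lieQ ξ (T.dOp w) -
      ∑ i, -(contractQ (θ i) (T.dOp (ofExt H (ExteriorAlgebra.ι A ξ))) * T.lieQ (e i) (w : _)))
    (fun w => ?_) (fun w x => ?_) ⟨w, hw⟩)
  · simp only [map_sub, map_sum, map_neg, constTerm_mul, T.constTerm_contractQ_dOp,
      T.constTerm_dOp, (T.isLieOp_lieQ ξ).const, extDerivation_zero, zero_mul, neg_zero, sub_zero,
      Finset.sum_const_zero]
  · obtain ⟨w, hw⟩ := w
    have key := T.lieH_lieQ_of_mem_scalarForms he x ξ (parity_mem_scalarForms hw)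
    have h2 := T.sum_smul_lieQ_of_mem_scalarForms he (T.actHQ x ξ) (parity_mem_scalarForms hw)
    rw [← h2] at key
    refine AddSubgroup.subset_closure ⟨⟨_, insertFirst_mem_scalarForms hw x⟩, ?_⟩
    rw [← sub_eq_zero, ← key]
    simp only [map_sub, map_sum, map_neg, insertFirst_mul, T.insertFirst_dOp, T.insertFirst_lieQ,
      T.insertFirst_contractQ_dOp_ι, ofExt_algebraMap_mul, T.lieQ_parity, contractH_apply,
      parity_parity, mul_sub, neg_add, neg_sub, Finset.sum_add_distrib, Finset.sum_sub_distrib,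
      Finset.sum_neg_distrib]
    abel

/-- The differential is compatible with the bracket of two elements of `Q`: on contractions this is
the formula `actHQ_brQ` for the action of `H` on brackets in `Q`. -/
theorem dOp_ι_brQ (ξ η : Q) : T.dOp (ofExt H (ExteriorAlgebra.ι A (T.brQ ξ η))) =
    T.lieQ ξ (T.dOp (ofExt H (ExteriorAlgebra.ι A η)))
      - T.lieQ η (T.dOp (ofExt H (ExteriorAlgebra.ι A ξ))) := by
  refine sub_eq_zero.1 (eq_zero_of_insertFirst ?_ fun x => ?_)
  · simp only [map_sub, T.constTerm_dOp, (T.isLieOp_lieQ _).const, extDerivation_zero, sub_zero]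
  · simp only [map_sub, T.insertFirst_dOp_ι, T.insertFirst_lieQ, T.lieQ_ofExt_ι, T.actHQ_brQ x ξ η]
    simp only [← ofExtₗ_apply, map_sub, map_add]
    abel

variable [Module.Finite A Q] [Module.Projective A Q]

/-- The differential is a derivation of the bracket. -/
theorem dOp_brOp {i : ℤ} {a : ExtForms A H Q} (ha : a ∈ totalDegree R A H Q i)
    (b : ExtForms A H Q) :
    T.dOp (T.brOp he a b) = T.brOp he (T.dOp a) b - i.negOnePow • T.brOp he a (T.dOp b) := by
  have h := isGradedComm_totalDegree (R := R) (A := A) (H := H) (Q := Q)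
  have hG := isGeneratedBy_isFormGenerator (R := R) (A := A) (H := H) (Q := Q)
  have hbr := T.isSkewBracket_brOp he
  refine hbr.isDer_bracket h hG T.isDer_dOp (fun i j a b ha hb => ?_) ha b
  cases ha with
  | @scalar q α =>
    have hα := ofScalarForm_mem_scalarForms (Q := Q) α
    have hdα := mem_scalarForms_of_mem (T.dOp_mem (ofScalarForm_mem (R := R) (Q := Q) α))
    have hα' := ofScalarForm_mem_totalDegree (R := R) (Q := Q) α
    cases hb with
    | scalar β =>
      have hβ := ofScalarForm_mem_scalarForms (Q := Q) β
      have hdβ := mem_scalarForms_of_mem (T.dOp_mem (ofScalarForm_mem (R := R) (Q := Q) β))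
      simp only [T.brOp_scalar_scalar he hα hβ, T.brOp_scalar_scalar he hdα hβ,
        T.brOp_scalar_scalar he hα hdβ, map_zero, smul_zero, sub_zero]
    | ext η =>
      have h1 := hbr.skew hα' (T.isDer_dOp.mem (ext_ι_mem_totalDegree η))
      have h2 : ((-(q : ℤ)).negOnePow * ((-(q : ℤ) - 1) * (-1 + 1 - 1)).negOnePow) = -1 := by
        rw [← Int.negOnePow_add, ← Int.negOnePow_one, Int.negOnePow_eq_iff]
        exact ⟨0, by ring⟩
      rw [h1, T.brOp_scalar_ι he hα, T.brOp_scalar_ι he hdα, Units.neg_smul, smul_neg, smul_smul,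
        h2, ← T.dOp_lieQ_of_mem_scalarForms he η hα, map_neg, Units.neg_smul, one_smul]
      abel
  | ext ξ =>
    have hξ := T.isDer_dOp.mem (ext_ι_mem_totalDegree (R := R) (A := A) (H := H) ξ)
    rw [Int.negOnePow_one, Units.neg_smul, one_smul, sub_neg_eq_add]
    simp only [T.brOp_ι he]
    cases hb with
    | scalar β =>
      rw [← T.dOp_lieQ_of_mem_scalarForms he ξ (ofScalarForm_mem_scalarForms β)]
      abel
    | ext η =>
      have h1 := hbr.skew hξ (ext_ι_mem_totalDegree η)
      simp only [T.brOp_ι he] at h1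
      rw [h1, T.lieQ_ofExt_ι, T.dOp_ι_brQ]
      simp
      abel

end LieRinehartTriple

/-! ### The Jacobi identity on generators -/

section CyclicDefect

variable {V : Type*} [Ring V] {𝒱 : ℤ → AddSubgroup V}

/-- The difference of the two sides of the graded Jacobi identity that is controlled by Koszul's
form `Φ³` of an operator `D`. -/
def jacobiDefect (br : V → V → V) (D : V → V) (i j k : ℤ) (x y z : V) : V :=
  ((i - 1) * (k - 1)).negOnePow • br x (br y z) + ((j - 1) * (i - 1)).negOnePow • br y (br z x)
    + ((k - 1) * (j - 1)).negOnePow • br z (br x y)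
    - (i * k + i + j + k).negOnePow • koszulThree D i j k x y z

/-- The defect of the Jacobi identity is invariant under cyclic permutations. -/
theorem jacobiDefect_rotate (h : IsGradedComm 𝒱) {br : V → V → V} {D : V → V} {m : ℕ} {n : ℤ}
    (hD : IsDiffOp 𝒱 m n D) (h1 : D 1 = 0) {i j k : ℤ} {x y z : V} (hx : x ∈ 𝒱 i) (hy : y ∈ 𝒱 j)
    (hz : z ∈ 𝒱 k) : jacobiDefect br D j k i y z x = jacobiDefect br D i j k x y z := by
  have h2 : (j * i + j + k + i).negOnePow * (i * (j + k)).negOnePow =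
      (i * k + i + j + k).negOnePow := by
    rw [← Int.negOnePow_add, Int.negOnePow_eq_iff]
    exact ⟨i * j, by ring⟩
  rw [jacobiDefect, jacobiDefect, koszulThree_cyclic h hD hx hy hz h1, smul_smul, h2]
  abel

end CyclicDefect

namespace LieRinehartTriple

open AlmostPreLieRinehartTriple

variable {R A H Q : Type*} [CommRing R] [CommRing A] [Algebra R A]
  [AddCommGroup H] [Module R H] [Module A H] [IsScalarTower R A H]
  [AddCommGroup Q] [Module R Q] [Module A Q] [IsScalarTower R A Q]
  (T : LieRinehartTriple R A H Q)
  {n : ℕ} {e : Fin n → Q} {θ : Fin n → Q →ₗ[A] A} (he : ∀ ξ, ∑ i, θ i ξ • e i = ξ)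

attribute [local instance] formRing

/-- On `A`-valued forms, the curvature of `ξ ↦ L_ξ` is the Lie derivative along `δ(ξ, η)`, up to the
Lie operator of the endomorphism `y ↦ δ(y · ξ, η) - δ(y · η, ξ)` of `H`. -/
theorem lieQ_lieQ_of_mem_scalarForms (he : ∀ ξ, ∑ i, θ i ξ • e i = ξ) (ξ η : Q)
    {w : ExtForms A H Q} (hw : w ∈ scalarForms A H Q) :
    T.lieQ ξ (T.lieQ η w) - T.lieQ η (T.lieQ ξ w) - T.lieQ (T.brQ ξ η) w =
      T.lieH (T.δ ξ η) w
        + ∑ i, contractQ (θ i) (T.dOp (ofExt H (ExteriorAlgebra.ι A ξ))) *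
            contractH (T.δ (e i) η) w
        - ∑ i, contractQ (θ i) (T.dOp (ofExt H (ExteriorAlgebra.ι A η))) *
            contractH (T.δ (e i) ξ) w := by
  have h := (((T.isLieOp_lieQ ξ).comm (T.isLieOp_lieQ η)).sub (T.isLieOp_lieQ (T.brQ ξ η))).sub
    (((T.isLieOp_lieH (T.δ ξ η)).add
    (IsLieOp.sum Finset.univ fun i => isLieOp_mul_contractH
      (T.constTerm_contractQ_dOp (θ i) _) (fun y => T.insertFirst_contractQ_dOp_ι (θ i) y ξ)
      (T.δ (e i) η))).sub
    (IsLieOp.sum Finset.univ fun i => isLieOp_mul_contractH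
      (T.constTerm_contractQ_dOp (θ i) _) (fun y => T.insertFirst_contractQ_dOp_ι (θ i) y η)
      (T.δ (e i) ξ)))
  refine sub_eq_zero.1 (h.eq_zero_of_scalar (fun y => ?_) (fun a => ?_) hw)
  · have h1 : ∀ ζ ζ' : Q, ∑ i, θ i ζ • T.δ (e i) ζ' = T.δ ζ ζ' := fun ζ ζ' => by
      conv_rhs => rw [← he ζ]
      simp only [map_sum, map_smul, LinearMap.sum_apply, LinearMap.smul_apply]
    rw [h1, h1, T.brH_swap (T.δ ξ η) y, T.brH_δ y ξ η, T.δ_swap (T.actHQ y ξ) η,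
      T.δ_swap (T.actHQ y η) ξ]
    abel
  · simp only [actExt, extDerivation_algebraMap, T.anchorQ_brQ, Finset.sum_const_zero,
      map_sub, add_zero, sub_zero]
    abel

/-- Cartan's formula. -/
theorem dOp_contractH (x : H) (w : ExtForms A H Q) :
    T.dOp (contractH x w) + contractH x (T.dOp w) = T.lieH x w := by
  rw [contractH_apply, contractH_apply, T.parity_dOp, map_neg, T.insertFirst_dOp, parity_parity]
  abel

theorem contractH_dOp_ι (x : H) (ζ : Q) :
    contractH x (T.dOp (ofExt H (ExteriorAlgebra.ι A ζ))) =
      ofExt H (ExteriorAlgebra.ι A (T.actHQ x ζ)) := by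
  simp only [contractH_apply, T.parity_dOp, parity_ofExt_ι, map_neg, neg_neg, T.insertFirst_dOp_ι]

/-- The differential of an element of `Q`, expanded in a dual basis. -/
theorem dOp_ι_eq_sum (he : ∀ ξ, ∑ i, θ i ξ • e i = ξ) (ξ : Q) :
    T.dOp (ofExt H (ExteriorAlgebra.ι A ξ)) =
      -∑ i, contractQ (θ i) (T.dOp (ofExt H (ExteriorAlgebra.ι A ξ))) *
        ofExt H (ExteriorAlgebra.ι A (e i)) := by
  rw [← sub_eq_zero]
  refine eq_zero_of_insertFirst ?_ fun x => ?_
  · simp only [map_sub, map_neg, map_sum, constTerm_mul, T.constTerm_contractQ_dOp, T.constTerm_dOp,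
      zero_mul, Finset.sum_const_zero, neg_zero, sub_zero]
  · simp only [map_sub, map_neg, map_sum, insertFirst_mul, T.insertFirst_contractQ_dOp_ι,
      ofExt_algebraMap_mul, insertFirst_ofExt, mul_zero, add_zero, parity_ofExt_ι, smul_neg,
      Finset.sum_neg_distrib, neg_neg, T.insertFirst_dOp_ι]
    simp only [← ofExtₗ_apply, ← map_smul, ← map_sum, he, sub_self]

variable [Module.Finite A Q] [Module.Projective A Q]

theorem koszulThree_psiOp_dOp_ι (he : ∀ ξ, ∑ i, θ i ξ • e i = ξ) (ξ η : Q) {q : ℕ}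
    (α : H [⋀^Fin q]→ₗ[A] A) :
    koszulThree (T.psiOp e θ) 0 1 (-q) (T.dOp (ofExt H (ExteriorAlgebra.ι A ξ)))
      (ofExt H (ExteriorAlgebra.ι A η)) (ofScalarForm Q α) =
      ∑ i, contractQ (θ i) (T.dOp (ofExt H (ExteriorAlgebra.ι A ξ))) *
        contractH (T.δ (e i) η) (ofScalarForm Q α) := by
  have h := isGradedComm_totalDegree (R := R) (A := A) (H := H) (Q := Q)
  have hΨ := T.isDiffOp_psiOp e θ
  have hΨ1 := T.psiOp_one e θ
  have hη := ext_ι_mem (R := R) (A := A) (H := H) η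
  have hη' := ext_ι_mem_totalDegree (R := R) (A := A) (H := H) η
  have hα := ofScalarForm_mem (R := R) (Q := Q) α
  have hα' := ofScalarForm_mem_totalDegree (R := R) (Q := Q) α
  have hdξ : T.dOp (ofExt H (ExteriorAlgebra.ι A ξ)) ∈ totalDegree R A H Q 0 := by
    have := T.isDer_dOp.mem (ext_ι_mem_totalDegree (R := R) (A := A) (H := H) ξ)
    rwa [neg_add_cancel] at this
  -- the operator `Φ³(η, α, ·)` is a derivation, and `dξ` is a combination of products of one-forms
  -- and elements of `Q`
  have hX := hΨ.koszulOp h hη' hα'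
  have h1 : koszulThree (T.psiOp e θ) 0 1 (-q) (T.dOp (ofExt H (ExteriorAlgebra.ι A ξ)))
      (ofExt H (ExteriorAlgebra.ι A η)) (ofScalarForm Q α) =
      koszulOp (T.psiOp e θ) (-1) 1 (-q) (ofExt H (ExteriorAlgebra.ι A η)) (ofScalarForm Q α)
        (T.dOp (ofExt H (ExteriorAlgebra.ι A ξ))) := by
    rw [← koszulThree_eq_koszulOp h hΨ hη' hα' hdξ hΨ1, koszulThree_cyclic h hΨ hdξ hη' hα' hΨ1,
      zero_mul, Int.negOnePow_zero, one_smul]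
  have hsum : ∀ w : Fin n → ExtForms A H Q, koszulOp (T.psiOp e θ) (-1) 1 (-q)
      (ofExt H (ExteriorAlgebra.ι A η)) (ofScalarForm Q α) (-∑ i, w i) =
      ∑ i, -koszulOp (T.psiOp e θ) (-1) 1 (-q) (ofExt H (ExteriorAlgebra.ι A η))
        (ofScalarForm Q α) (w i) := fun w => by
    rw [hX.map_neg, Finset.sum_neg_distrib]
    exact congrArg _ (_root_.map_sum (AddMonoidHom.mk' _ hX.map_add) w _)
  rw [h1]
  conv_lhs => rw [T.dOp_ι_eq_sum he ξ]
  rw [hsum]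
  refine Finset.sum_congr rfl fun i _ => ?_
  have hφ := contractQ_mem (R := R) (θ i) (T.dOp_mem (ext_ι_mem (R := R) (A := A) (H := H) ξ))
  have hφ' : contractQ (θ i) (T.dOp (ofExt H (ExteriorAlgebra.ι A ξ))) ∈
      totalDegree R A H Q (-1) := by
    have := mem_totalDegree hφ
    rwa [show (1 : ℤ) - 1 - (0 + 1) = -1 by norm_num] at this
  have hei := ext_ι_mem_totalDegree (R := R) (A := A) (H := H) (e i)
  rw [hX.leibniz _ hφ', ← koszulThree_eq_koszulOp h hΨ hη' hα' hφ' hΨ1,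
    ← koszulThree_eq_koszulOp h hΨ hη' hα' hei hΨ1,
    gr_eq_zero (Or.inr (by norm_num)) (koszulThree_psiOp_mem _ hη hα hφ _ _ _),
    koszulThree_cyclic h hΨ hei hη' hα' hΨ1, koszulThree_psiOp_ι_ι _ he _ _ hα', zero_mul,
    zero_add, mul_smul_comm, smul_smul, ← Int.negOnePow_add]
  have h2 : ((-1 + 1 + -(q : ℤ)) * -1 + 1 * (1 + -(q : ℤ))).negOnePow = -1 := by
    rw [← Int.negOnePow_one, Int.negOnePow_eq_iff]
    exact ⟨0, by ring⟩
  rw [h2, Units.neg_smul, one_smul, neg_neg]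

/-- The Jacobi identity for two elements of `Q` and an `A`-valued form. -/
theorem jacobiDefect_ι_ι_scalar (ξ η : Q) {q : ℕ} (α : H [⋀^Fin q]→ₗ[A] A) :
    jacobiDefect (fun a b => T.brOp he a b)
      (fun a => T.dOp (T.psiOp e θ a) + T.psiOp e θ (T.dOp a)) 1 1 (-q)
      (ofExt H (ExteriorAlgebra.ι A ξ)) (ofExt H (ExteriorAlgebra.ι A η)) (ofScalarForm Q α) =
        0 := by
  have h := isGradedComm_totalDegree (R := R) (A := A) (H := H) (Q := Q)
  have hΨ := T.isDiffOp_psiOp e θ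
  have hΨ1 := T.psiOp_one e θ
  have hξ' := ext_ι_mem_totalDegree (R := R) (A := A) (H := H) ξ
  have hη' := ext_ι_mem_totalDegree (R := R) (A := A) (H := H) η
  have hα := ofScalarForm_mem_scalarForms (Q := Q) α
  have hα' := ofScalarForm_mem_totalDegree (R := R) (Q := Q) α
  have hdα := T.isDer_dOp.mem hα'
  have hdη := T.isDer_dOp.mem hη'
  rw [jacobiDefect, koszulThree_commutator h hΨ T.isDer_dOp hξ' hη' hα' hΨ1,
    koszulThree_psiOp_ι_ι _ he _ _ hα', koszulThree_psiOp_ι_ι _ he _ _ hdα]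
  have h3 := koszulThree_swap h hΨ hdη hξ' hα' hΨ1
  rw [neg_add_cancel] at h3 ⊢
  rw [h3, T.koszulThree_psiOp_dOp_ι he, T.koszulThree_psiOp_dOp_ι he]
  have e1 : (1 * -(q : ℤ) + 1 + 1 + -(q : ℤ)).negOnePow = 1 :=
    Int.negOnePow_even _ ⟨1 - q, by ring⟩
  have e2 : ((1 : ℤ) + 1).negOnePow = 1 := Int.negOnePow_even _ ⟨1, rfl⟩
  simp only [T.brOp_ι he, T.brOp_scalar_ι he hα, T.lieQ_ofExt_ι, sub_self, zero_mul, mul_zero,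
    Int.negOnePow_zero, one_smul, e1, e2, Int.negOnePow_one, Units.neg_smul, map_neg]
  rw [sub_eq_zero, ← sub_eq_add_neg, ← sub_eq_add_neg, T.lieQ_lieQ_of_mem_scalarForms he ξ η hα,
    ← T.dOp_contractH]
  abel

/-- The Jacobi identity for three elements of `Q`. -/
theorem jacobiDefect_ι_ι_ι (ξ η ζ : Q) :
    jacobiDefect (fun a b => T.brOp he a b)
      (fun a => T.dOp (T.psiOp e θ a) + T.psiOp e θ (T.dOp a)) 1 1 1
      (ofExt H (ExteriorAlgebra.ι A ξ)) (ofExt H (ExteriorAlgebra.ι A η))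
      (ofExt H (ExteriorAlgebra.ι A ζ)) = 0 := by
  have h := isGradedComm_totalDegree (R := R) (A := A) (H := H) (Q := Q)
  have hΨ := T.isDiffOp_psiOp e θ
  have hΨ1 := T.psiOp_one e θ
  have hξ' := ext_ι_mem_totalDegree (R := R) (A := A) (H := H) ξ
  have hη' := ext_ι_mem_totalDegree (R := R) (A := A) (H := H) η
  have hζ' := ext_ι_mem_totalDegree (R := R) (A := A) (H := H) ζ
  have hdξ := T.isDer_dOp.mem hξ'
  have hdη := T.isDer_dOp.mem hη'
  have hdζ := T.isDer_dOp.mem hζ'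
  have h2 := koszulThree_cyclic h hΨ hdξ hη' hζ' hΨ1
  have h3 := koszulThree_cyclic h hΨ hζ' hξ' hdη hΨ1
  rw [koszulThree_psiOp_ι_ι _ he _ _ hdξ] at h2
  rw [koszulThree_psiOp_ι_ι _ he _ _ hdη] at h3
  rw [neg_add_cancel, zero_mul, Int.negOnePow_zero, one_smul] at h2
  rw [neg_add_cancel] at h3
  have e1 : ((1 : ℤ) * 1 + 1 + 1 + 1).negOnePow = 1 := Int.negOnePow_even _ ⟨2, rfl⟩
  have e2 : ((1 : ℤ) + 1).negOnePow = 1 := Int.negOnePow_even _ ⟨1, rfl⟩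
  have e3 : ((1 : ℤ) * (1 + 0)).negOnePow = -1 := Int.negOnePow_one
  rw [jacobiDefect, koszulThree_commutator h hΨ T.isDer_dOp hξ' hη' hζ' hΨ1,
    koszulThree_psiOp_ι_ι _ he _ _ hζ', koszulThree_psiOp_ι_ι _ he _ _ hdζ, neg_add_cancel, ← h2,
    h3]
  simp only [T.brOp_ι he, T.lieQ_ofExt_ι, sub_self, mul_zero, contractH_ofExt, map_zero,
    Int.negOnePow_zero, one_smul, e1, e2, e3, Int.negOnePow_one, Units.neg_smul, T.contractH_dOp_ι]
  simp only [← ofExtₗ_apply, ← map_add, ← map_sub, ← map_neg, zero_add, neg_neg]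
  rw [T.brQ_brQ, sub_self, map_zero, map_zero]

end LieRinehartTriple

/-! ### The Jacobi identity and the four-term identity -/

namespace LieRinehartTriple

open AlmostPreLieRinehartTriple

variable {R A H Q : Type*} [CommRing R] [CommRing A] [Algebra R A]
  [AddCommGroup H] [Module R H] [Module A H] [IsScalarTower R A H]
  [AddCommGroup Q] [Module R Q] [Module A Q] [IsScalarTower R A Q]
  (T : LieRinehartTriple R A H Q)
  {n : ℕ} {e : Fin n → Q} {θ : Fin n → Q →ₗ[A] A} (he : ∀ ξ, ∑ i, θ i ξ • e i = ξ)

attribute [local instance] formRing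

theorem dOp_psiOp_add_mem {q p : ℤ} {w : ExtForms A H Q}
    (hw : w ∈ (formsAlgebra R A H Q).gr q p) :
    T.dOp (T.psiOp e θ w) + T.psiOp e θ (T.dOp w) ∈
      (formsAlgebra R A H Q).gr (q + 0) (p + -2) := by
  have h1 := T.dOp_mem (T.psiOp_mem e θ hw)
  have h2 := T.psiOp_mem e θ (T.dOp_mem hw)
  rw [sub_add_cancel] at h1
  rw [add_sub_cancel_right] at h2
  rw [add_zero]
  exact add_mem h1 h2

/-- Every term of the Jacobi identity lowers the second degree by `2`. -/
theorem jacobiDefect_eq_zero_of_bidegree {q₁ p₁ q₂ p₂ q₃ p₃ : ℤ} {x y z : ExtForms A H Q}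
    (hx : x ∈ (formsAlgebra R A H Q).gr q₁ p₁) (hy : y ∈ (formsAlgebra R A H Q).gr q₂ p₂)
    (hz : z ∈ (formsAlgebra R A H Q).gr q₃ p₃) (i j k : ℤ) (hp : p₁ + p₂ + p₃ < 2) :
    jacobiDefect (fun a b => T.brOp he a b)
      (fun a => T.dOp (T.psiOp e θ a) + T.psiOp e θ (T.dOp a)) i j k x y z = 0 := by
  have h1 := T.brOp_mem he hx (T.brOp_mem he hy hz)
  have h2 := T.brOp_mem he hy (T.brOp_mem he hz hx)
  have h3 := T.brOp_mem he hz (T.brOp_mem he hx hy)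
  have h4 := koszulThree_mem_gr (fun {q p a} h => T.dOp_psiOp_add_mem (e := e) (θ := θ) h)
    hx hy hz i j k rfl rfl
  rw [jacobiDefect, gr_eq_zero (Or.inr (by linarith)) h1, gr_eq_zero (Or.inr (by linarith)) h2,
    gr_eq_zero (Or.inr (by linarith)) h3, gr_eq_zero (Or.inr (by linarith)) h4]
  simp

/-- Every term of the identity lowers the first degree by `1` and the second degree by `3`. -/
theorem bracketKoszul_eq_zero_of_bidegree {q₁ p₁ q₂ p₂ q₃ p₃ q₄ p₄ : ℤ} {x y z w : ExtForms A H Q}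
    (hx : x ∈ (formsAlgebra R A H Q).gr q₁ p₁) (hy : y ∈ (formsAlgebra R A H Q).gr q₂ p₂)
    (hz : z ∈ (formsAlgebra R A H Q).gr q₃ p₃) (hw : w ∈ (formsAlgebra R A H Q).gr q₄ p₄)
    (i j k l : ℤ) (hqp : q₁ + q₂ + q₃ + q₄ < 1 ∨ p₁ + p₂ + p₃ + p₄ < 3) :
    bracketKoszul (fun a b => T.brOp he a b) (T.psiOp e θ) i j k l x y z w = 0 := by
  have h1 : ∀ {q₁ p₁ q₂ p₂ q₃ p₃ q₄ p₄ : ℤ} {x y z w : ExtForms A H Q},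
      x ∈ (formsAlgebra R A H Q).gr q₁ p₁ → y ∈ (formsAlgebra R A H Q).gr q₂ p₂ →
      z ∈ (formsAlgebra R A H Q).gr q₃ p₃ → w ∈ (formsAlgebra R A H Q).gr q₄ p₄ → ∀ i j k : ℤ,
      q₁ + q₂ + q₃ + q₄ < 1 ∨ p₁ + p₂ + p₃ + p₄ < 3 →
      T.brOp he (koszulThree (T.psiOp e θ) i j k x y z) w = 0 :=
    fun hx hy hz hw i j k h => gr_eq_zero (h.imp (fun h => by linarith) fun h => by linarith)
      (T.brOp_mem he (koszulThree_psiOp_mem _ hx hy hz i j k) hw)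
  have h2 : ∀ {q₁ p₁ q₂ p₂ q₃ p₃ q₄ p₄ : ℤ} {x y z w : ExtForms A H Q},
      x ∈ (formsAlgebra R A H Q).gr q₁ p₁ → y ∈ (formsAlgebra R A H Q).gr q₂ p₂ →
      z ∈ (formsAlgebra R A H Q).gr q₃ p₃ → w ∈ (formsAlgebra R A H Q).gr q₄ p₄ → ∀ i j k : ℤ,
      q₁ + q₂ + q₃ + q₄ < 1 ∨ p₁ + p₂ + p₃ + p₄ < 3 →
      koszulThree (T.psiOp e θ) i j k (T.brOp he x y) z w = 0 :=
    fun hx hy hz hw i j k h => gr_eq_zero (h.imp (fun h => by linarith) fun h => by linarith)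
      (koszulThree_psiOp_mem _ (T.brOp_mem he hx hy) hz hw i j k)
  have c1 : q₁ + q₂ + q₄ + q₃ < 1 ∨ p₁ + p₂ + p₄ + p₃ < 3 := by omega
  have c2 : q₁ + q₃ + q₄ + q₂ < 1 ∨ p₁ + p₃ + p₄ + p₂ < 3 := by omega
  have c3 : q₂ + q₃ + q₄ + q₁ < 1 ∨ p₂ + p₃ + p₄ + p₁ < 3 := by omega
  have c4 : q₁ + q₃ + q₂ + q₄ < 1 ∨ p₁ + p₃ + p₂ + p₄ < 3 := by omega
  have c5 : q₁ + q₄ + q₂ + q₃ < 1 ∨ p₁ + p₄ + p₂ + p₃ < 3 := by omega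
  have c6 : q₂ + q₃ + q₁ + q₄ < 1 ∨ p₂ + p₃ + p₁ + p₄ < 3 := by omega
  have c7 : q₂ + q₄ + q₁ + q₃ < 1 ∨ p₂ + p₄ + p₁ + p₃ < 3 := by omega
  have c8 : q₃ + q₄ + q₁ + q₂ < 1 ∨ p₃ + p₄ + p₁ + p₂ < 3 := by omega
  rw [bracketKoszul, h1 hx hy hz hw _ _ _ hqp, h1 hx hy hw hz _ _ _ c1, h1 hx hz hw hy _ _ _ c2,
    h1 hy hz hw hx _ _ _ c3, h2 hx hy hz hw _ _ _ hqp, h2 hx hz hy hw _ _ _ c4,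
    h2 hx hw hy hz _ _ _ c5, h2 hy hz hx hw _ _ _ c6, h2 hy hw hx hz _ _ _ c7,
    h2 hz hw hx hy _ _ _ c8]
  simp only [smul_zero, add_zero, sub_zero]

theorem lieQ_contractH (ζ : Q) (y : H) (w : ExtForms A H Q) :
    T.lieQ ζ (contractH y w) = contractH y (T.lieQ ζ w) + contractH (T.actQH ζ y) w := by
  simp only [contractH_apply, ← T.lieQ_parity, T.insertFirst_lieQ]
  abel

variable [Module.Finite A Q] [Module.Projective A Q]

/-- The Jacobi identity up to the homotopy given by the Jacobiator. -/
theorem jacobiDefect_eq_zero {i j k : ℤ} {x y z : ExtForms A H Q}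
    (hx : x ∈ totalDegree R A H Q i) (hy : y ∈ totalDegree R A H Q j)
    (hz : z ∈ totalDegree R A H Q k) :
    jacobiDefect (fun a b => T.brOp he a b)
      (fun a => T.dOp (T.psiOp e θ a) + T.psiOp e θ (T.dOp a)) i j k x y z = 0 := by
  have h := isGradedComm_totalDegree (R := R) (A := A) (H := H) (Q := Q)
  have hG := isGeneratedBy_isFormGenerator (R := R) (A := A) (H := H) (Q := Q)
  have hΨ := T.isDiffOp_psiOp e θ
  have hΨ1 := T.psiOp_one e θ
  have hd := T.isDer_dOp.isDiffOp h
  have hD : IsDiffOp (totalDegree R A H Q) 5 (-2)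
      fun a => T.dOp (T.psiOp e θ a) + T.psiOp e θ (T.dOp a) :=
    ((IsDiffOp.comp (k := 1) (l := 3) hd hΨ).congr (by norm_num) fun _ => rfl).add
      ((IsDiffOp.comp (k := 3) (l := 1) hΨ hd).congr (by norm_num) fun _ => rfl)
  have hD1 : T.dOp (T.psiOp e θ 1) + T.psiOp e θ (T.dOp 1) = 0 := by
    rw [hΨ1, T.isDer_dOp.map_one h, map_zero, map_zero, add_zero]
  refine sub_eq_zero.2 ((T.isSkewBracket_brOp he).jacobi h hG T.isDer_dOp hΨ hΨ1
    (fun i j k x y z hx hy hz => sub_eq_zero.1 ?_) hx hy hz)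
  have hx' := hG.mem hx
  have hy' := hG.mem hy
  have hz' := hG.mem hz
  have rot : ∀ {i j k : ℤ} {x y z : ExtForms A H Q}, x ∈ totalDegree R A H Q i →
      y ∈ totalDegree R A H Q j → z ∈ totalDegree R A H Q k → _ := fun hx hy hz =>
    jacobiDefect_rotate h (br := fun a b => T.brOp he a b) hD hD1 hx hy hz
  change jacobiDefect (fun a b => T.brOp he a b) _ i j k x y z = 0
  -- Up to a rotation, at least two of the three generators are in `Q`.
  cases hx with
  | scalar α =>
    have hα := ofScalarForm_mem (R := R) (Q := Q) α
    cases hy with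
    | scalar β =>
      have hβ := ofScalarForm_mem (R := R) (Q := Q) β
      cases hz with
      | scalar γ =>
        exact T.jacobiDefect_eq_zero_of_bidegree he hα hβ (ofScalarForm_mem γ) _ _ _ (by norm_num)
      | ext ζ => exact T.jacobiDefect_eq_zero_of_bidegree he hα hβ (ext_ι_mem ζ) _ _ _ (by norm_num)
    | ext η =>
      cases hz with
      | scalar γ =>
        exact T.jacobiDefect_eq_zero_of_bidegree he hα (ext_ι_mem η) (ofScalarForm_mem γ) _ _ _
          (by norm_num)
      | ext ζ =>
        rw [← rot hx' hy' hz']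
        exact T.jacobiDefect_ι_ι_scalar he η ζ α
  | ext ξ =>
    cases hy with
    | scalar β =>
      cases hz with
      | scalar γ =>
        exact T.jacobiDefect_eq_zero_of_bidegree he (ext_ι_mem ξ) (ofScalarForm_mem β)
          (ofScalarForm_mem γ) _ _ _ (by norm_num)
      | ext ζ =>
        rw [rot hz' hx' hy']
        exact T.jacobiDefect_ι_ι_scalar he ζ ξ β
    | ext η =>
      cases hz with
      | scalar γ => exact T.jacobiDefect_ι_ι_scalar he ξ η γ
      | ext ζ => exact T.jacobiDefect_ι_ι_ι he ξ η ζ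

/-- The compatibility of the bracket with the Jacobiator, for three elements of `Q` and an `A`-valued
form: the contraction of the form with the identity `δ_brQ`. -/
theorem bracketKoszul_ι_ι_ι_scalar (ξ η ζ : Q) {q : ℕ} (α : H [⋀^Fin q]→ₗ[A] A) :
    bracketKoszul (fun a b => T.brOp he a b) (T.psiOp e θ) 1 1 1 (-q)
      (ofExt H (ExteriorAlgebra.ι A ξ)) (ofExt H (ExteriorAlgebra.ι A η))
      (ofExt H (ExteriorAlgebra.ι A ζ)) (ofScalarForm Q α) = 0 := by
  have h := isGradedComm_totalDegree (R := R) (A := A) (H := H) (Q := Q)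
  have hΨ := T.isDiffOp_psiOp e θ
  have hΨ1 := T.psiOp_one e θ
  have hι := ext_ι_mem_totalDegree (R := R) (A := A) (H := H) (Q := Q)
  have hα := ofScalarForm_mem (R := R) (Q := Q) α
  have hα' := ofScalarForm_mem_totalDegree (R := R) (Q := Q) α
  have hL : ∀ ζ, T.lieQ ζ (ofScalarForm Q α) ∈ totalDegree R A H Q (-q) := fun ζ => by
    have := (T.isDer_lieQ ζ).mem hα'
    rwa [zero_add] at this
  have hc : ∀ y, contractH y (ofScalarForm Q α) ∈ scalarForms A H Q := fun y =>
    mem_scalarForms_of_mem (contractH_mem (R := R) y hα)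
  have h1 : ∀ ξ η ζ : Q, koszulThree (T.psiOp e θ) (1 + -(q : ℤ) - 1) 1 1
      (T.lieQ ζ (ofScalarForm Q α)) (ofExt H (ExteriorAlgebra.ι A ξ))
      (ofExt H (ExteriorAlgebra.ι A η)) =
      contractH (T.δ ξ η) (T.lieQ ζ (ofScalarForm Q α)) := fun ξ η ζ => by
    have h2 := koszulThree_cyclic h hΨ (hL ζ) (hι ξ) (hι η) hΨ1
    rw [koszulThree_psiOp_ι_ι _ he _ _ (hL ζ),
      Int.negOnePow_even _ ⟨-(q : ℤ), by ring⟩, one_smul] at h2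
    rw [show (1 : ℤ) + -q - 1 = -q by ring, h2]
  have e0 : (1 : ℤ) + 1 - 1 = 1 := rfl
  have e1 : ((1 : ℤ) + 1 + 1).negOnePow = -1 := Int.negOnePow_odd _ ⟨1, rfl⟩
  have e2 : ((1 : ℤ) * -q + (1 + 1 + -q)).negOnePow = 1 := Int.negOnePow_even _ ⟨1 - q, by ring⟩
  have e3 : ((1 : ℤ) * 1 + 1 * -q + (1 + 1 + -q)).negOnePow = -1 :=
    Int.negOnePow_odd _ ⟨1 - q, by ring⟩
  have e4 : ((1 : ℤ) * (1 + 1 + -q) + (1 + 1 + -q)).negOnePow = 1 :=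
    Int.negOnePow_even _ ⟨2 - q, by ring⟩
  have e5 : ((1 : ℤ) * 1 + 1).negOnePow = 1 := Int.negOnePow_even _ ⟨1, rfl⟩
  have e6 : ((1 : ℤ) * -q + 1 * -q + 1).negOnePow = -1 := Int.negOnePow_odd _ ⟨-q, by ring⟩
  have e7 : ((1 : ℤ) * 1 + 1 * 1 + 1).negOnePow = -1 := Int.negOnePow_odd _ ⟨1, rfl⟩
  have e8 : ((1 : ℤ) * 1 + 1 * -q + 1 * -q + 1).negOnePow = 1 :=
    Int.negOnePow_even _ ⟨1 - q, by ring⟩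
  have e9 : (((1 : ℤ) + 1) * (1 + -q) + 1).negOnePow = -1 :=
    Int.negOnePow_odd _ ⟨1 - q, by ring⟩
  rw [bracketKoszul]
  simp only [T.brOp_ι he, T.lieQ_ofExt_ι, h1, e0, koszulThree_psiOp_ι_ι _ he _ _ hα',
    koszulThree_psiOp_ι_ι _ he _ _ (hι ζ), contractH_ofExt, T.brOp_scalar_ι he (hc _), map_zero,
    LinearMap.zero_apply, e1, e2, e3, e4, e5, e6, e7, e8, e9, Int.negOnePow_one, Units.neg_smul,
    one_smul, smul_zero, T.lieQ_contractH]
  have h2 := congrArg (fun y => contractH y (ofScalarForm Q α)) (T.δ_brQ ξ η ζ)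
  rw [T.δ_swap (T.brQ ξ η) ζ, T.δ_swap (T.brQ ξ ζ) η, T.brQ_swap ξ ζ, T.δ_swap (T.brQ η ζ) ξ,
    T.δ_swap ξ ζ]
  have h3 : ∀ y : H, contractH (-y) (ofScalarForm Q α) = -contractH y (ofScalarForm Q α) :=
    fun y => by rw [← neg_one_smul A y, contractH_smul, neg_one_smul]
  have h4 : contractH (0 : H) (ofScalarForm Q α) = 0 := by
    rw [← zero_smul A (0 : H), contractH_smul, zero_smul]
  simp only [contractH_add, h4] at h2
  simp only [map_neg, h3, neg_neg]
  rw [← sub_eq_zero, ← neg_eq_zero, ← h2]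
  abel

/-- The compatibility of the bracket with the Jacobiator. -/
theorem bracketKoszul_psiOp_eq_zero {i j k l : ℤ} {x y z w : ExtForms A H Q}
    (hx : x ∈ totalDegree R A H Q i) (hy : y ∈ totalDegree R A H Q j)
    (hz : z ∈ totalDegree R A H Q k) (hw : w ∈ totalDegree R A H Q l) :
    bracketKoszul (fun a b => T.brOp he a b) (T.psiOp e θ) i j k l x y z w = 0 := by
  have h := isGradedComm_totalDegree (R := R) (A := A) (H := H) (Q := Q)
  have hG := isGeneratedBy_isFormGenerator (R := R) (A := A) (H := H) (Q := Q)
  have hΨ := T.isDiffOp_psiOp e θ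
  have hΨ1 := T.psiOp_one e θ
  have hsmul : ∀ (u : ℤˣ) (a b : ExtForms A H Q), T.brOp he (u • a) b = u • T.brOp he a b :=
    fun u a b => by rw [LinearMap.map_smul_of_tower, LinearMap.smul_apply]
  have rot : ∀ {i j k l : ℤ} {x y z w : ExtForms A H Q}, x ∈ totalDegree R A H Q i →
      y ∈ totalDegree R A H Q j → z ∈ totalDegree R A H Q k → w ∈ totalDegree R A H Q l →
      bracketKoszul (fun a b => T.brOp he a b) (T.psiOp e θ) i j k l x y z w = 0 →
      bracketKoszul (fun a b => T.brOp he a b) (T.psiOp e θ) j k l i y z w x = 0 :=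
    fun hx hy hz hw h0 => by
      rw [bracketKoszul_rotate h (T.isSkewBracket_brOp he) hΨ hΨ1 hx hy hz hw hsmul, h0, smul_zero]
  refine bracketKoszul_eq_zero h hG (T.isSkewBracket_brOp he) hΨ hΨ1 hsmul
    (fun i j k l x y z w hx hy hz hw => ?_) hx hy hz hw
  have hx' := hG.mem hx
  have hy' := hG.mem hy
  have hz' := hG.mem hz
  have hw' := hG.mem hw
  have base := @(T.bracketKoszul_ι_ι_ι_scalar he)
  have low : ∀ {q₁ p₁ q₂ p₂ q₃ p₃ q₄ p₄ : ℤ}, x ∈ (formsAlgebra R A H Q).gr q₁ p₁ →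
      y ∈ (formsAlgebra R A H Q).gr q₂ p₂ → z ∈ (formsAlgebra R A H Q).gr q₃ p₃ →
      w ∈ (formsAlgebra R A H Q).gr q₄ p₄ → q₁ + q₂ + q₃ + q₄ < 1 ∨ p₁ + p₂ + p₃ + p₄ < 3 →
      bracketKoszul (fun a b => T.brOp he a b) (T.psiOp e θ) i j k l x y z w = 0 :=
    fun hx hy hz hw h => T.bracketKoszul_eq_zero_of_bidegree he hx hy hz hw _ _ _ _ h
  -- only three elements of `Q` and one `A`-valued form give a possibly non-trivial bidegree
  cases hx with
  | scalar α =>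
    cases hy with
    | scalar β =>
      cases hz with
      | scalar γ =>
        cases hw with
        | scalar ν =>
          exact low (ofScalarForm_mem α) (ofScalarForm_mem β) (ofScalarForm_mem γ) (ofScalarForm_mem ν) (by omega)
        | ext ω =>
          exact low (ofScalarForm_mem α) (ofScalarForm_mem β) (ofScalarForm_mem γ) (ext_ι_mem ω) (by omega)
      | ext ζ =>
        cases hw with
        | scalar ν =>
          exact low (ofScalarForm_mem α) (ofScalarForm_mem β) (ext_ι_mem ζ) (ofScalarForm_mem ν) (by omega)
        | ext ω =>
          exact low (ofScalarForm_mem α) (ofScalarForm_mem β) (ext_ι_mem ζ) (ext_ι_mem ω) (by omega)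
    | ext η =>
      cases hz with
      | scalar γ =>
        cases hw with
        | scalar ν =>
          exact low (ofScalarForm_mem α) (ext_ι_mem η) (ofScalarForm_mem γ) (ofScalarForm_mem ν) (by omega)
        | ext ω =>
          exact low (ofScalarForm_mem α) (ext_ι_mem η) (ofScalarForm_mem γ) (ext_ι_mem ω) (by omega)
      | ext ζ =>
        cases hw with
        | scalar ν =>
          exact low (ofScalarForm_mem α) (ext_ι_mem η) (ext_ι_mem ζ) (ofScalarForm_mem ν) (by omega)
        | ext ω =>
          exact rot hw' hx' hy' hz' (rot hz' hw' hx' hy' (rot hy' hz' hw' hx' (base η ζ ω α)))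
  | ext ξ =>
    cases hy with
    | scalar β =>
      cases hz with
      | scalar γ =>
        cases hw with
        | scalar ν =>
          exact low (ext_ι_mem ξ) (ofScalarForm_mem β) (ofScalarForm_mem γ) (ofScalarForm_mem ν) (by omega)
        | ext ω =>
          exact low (ext_ι_mem ξ) (ofScalarForm_mem β) (ofScalarForm_mem γ) (ext_ι_mem ω) (by omega)
      | ext ζ =>
        cases hw with
        | scalar ν =>
          exact low (ext_ι_mem ξ) (ofScalarForm_mem β) (ext_ι_mem ζ) (ofScalarForm_mem ν) (by omega)
        | ext ω =>
          exact rot hw' hx' hy' hz' (rot hz' hw' hx' hy' (base ζ ω ξ β))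
    | ext η =>
      cases hz with
      | scalar γ =>
        cases hw with
        | scalar ν =>
          exact low (ext_ι_mem ξ) (ext_ι_mem η) (ofScalarForm_mem γ) (ofScalarForm_mem ν) (by omega)
        | ext ω =>
          exact rot hw' hx' hy' hz' (base ω ξ η γ)
      | ext ζ =>
        cases hw with
        | scalar ν =>
          exact base ξ η ζ ν
        | ext ω =>
          exact low (ext_ι_mem ξ) (ext_ι_mem η) (ext_ι_mem ζ) (ext_ι_mem ω) (by omega)

end LieRinehartTriple

/-! ### The quasi-Gerstenhaber algebra of a Lie-Rinehart triple -/

namespace LieRinehartTriple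

open AlmostPreLieRinehartTriple

variable {R A H Q : Type*} [CommRing R] [CommRing A] [Algebra R A]
  [AddCommGroup H] [Module R H] [Module A H] [IsScalarTower R A H]
  [AddCommGroup Q] [Module R Q] [Module A Q] [IsScalarTower R A Q]
  (T : LieRinehartTriple R A H Q)
  {n : ℕ} {e : Fin n → Q} {θ : Fin n → Q →ₗ[A] A} (he : ∀ ξ, ∑ i, θ i ξ • e i = ξ)
  [Module.Finite A Q] [Module.Projective A Q]

attribute [local instance] formRing

/-- The forms on `H` with values in the exterior algebra on `Q` are a quasi-Gerstenhaber algebra. -/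
theorem isQuasiGerstenhaber_formsAlgebra : (formsAlgebra R A H Q).IsQuasiGerstenhaber T.dOp
    (T.brOp he) ((T.psiOp e θ).restrictScalars R) where
  toIsBigradedCommutative := isBigradedCommutative_formsAlgebra
  br_mem ha hb := T.brOp_mem he ha hb
  d_mem ha := T.dOp_mem ha
  d_d := T.dOp_dOp
  d_mul b ha := by
    rw [formsAlgebra_mul, formsAlgebra_mul, formsAlgebra_mul, T.dOp_mul, parity_of_mem ha,
      smul_mul_assoc]
  psi_mem ha := T.psiOp_mem e θ ha
  psi_one := T.psiOp_one e θ
  psi_linear b ha := T.psiOp_mul e θ b ha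
  psi_order {q₁ p₁ q₂ p₂ q₃ p₃ q₄ p₄ x y z w} hx hy hz hw := by
    simp only [BigradedAlgebraData.koszulForm₄, koszulForm₃_formsAlgebra, formsAlgebra_mul,
      LinearMap.coe_restrictScalars]
    exact koszulThree_mul isGradedComm_totalDegree (T.isDiffOp_psiOp e θ)
      (mem_totalDegree (R := R) hx) (mem_totalDegree hy) (mem_totalDegree hz) (mem_totalDegree hw)
      (T.psiOp_one e θ)
  br_skew ha hb := (T.isSkewBracket_brOp he).skew (mem_totalDegree ha) (mem_totalDegree hb)
  br_mul c ha hb := ((T.isSkewBracket_brOp he).der (mem_totalDegree ha)).leibniz _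
    (mem_totalDegree hb)
  d_br b ha := T.dOp_brOp he (mem_totalDegree ha) b
  jacobi hx hy hz := by
    simp only [koszulForm₃_formsAlgebra]
    exact sub_eq_zero.1 (T.jacobiDefect_eq_zero he (mem_totalDegree hx) (mem_totalDegree hy)
      (mem_totalDegree hz))
  psi_psi := T.psiOp_psiOp e θ
  br_psi q p a ha := by
    simp only [koszulForm₃_formsAlgebra]
    exact sum_shuffles_eq_of_bracketKoszul (br := fun a b => T.brOp he a b) (fun i => p i - q i) a
      (T.bracketKoszul_psiOp_eq_zero he (mem_totalDegree (ha 0)) (mem_totalDegree (ha 1))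
        (mem_totalDegree (ha 2)) (mem_totalDegree (ha 3)))

end LieRinehartTriple

theorem corollary6p10p4 {R A H Q : Type*} [CommRing R] [CommRing A] [Algebra R A]
    [AddCommGroup H] [Module R H] [Module A H] [IsScalarTower R A H]
    [AddCommGroup Q] [Module R Q] [Module A Q] [IsScalarTower R A Q]
    (T : LieRinehartTriple R A H Q) (hT : T.IsOrientable) :
    ∃ (d : ExtForms A H Q →ₗ[R] ExtForms A H Q)
      (br : ExtForms A H Q →ₗ[R] ExtForms A H Q →ₗ[R] ExtForms A H Q)
      (Ψ : ExtForms A H Q →ₗ[R] ExtForms A H Q),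
      (∀ d', T.IsLieRinehartDifferential d' ↔ d' = d) ∧
      (∀ br', T.IsFormBracket br' ↔ br' = br) ∧
      (∀ Ψ', T.IsJacobiator Ψ' ↔ Ψ' = Ψ) ∧
      (formsAlgebra R A H Q).IsQuasiGerstenhaber d br Ψ := by
  obtain ⟨_, _, _, _⟩ := hT
  obtain ⟨n, e, θ, he⟩ := exists_dual_basis A Q
  have hd := T.isLieRinehartDifferential_dOp
  have hbr := T.isFormBracket_brOp he
  have hΨ := T.isJacobiator_psiOp he
  exact ⟨T.dOp, T.brOp he, (T.psiOp e θ).restrictScalars R,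
    fun _ => ⟨fun h => h.unique hd, fun h => h ▸ hd⟩,
    fun _ => ⟨fun h => h.unique hbr, fun h => h ▸ hbr⟩,
    fun _ => ⟨fun h => h.unique hΨ, fun h => h ▸ hΨ⟩, T.isQuasiGerstenhaber_formsAlgebra he⟩
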